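/- **Setting.** Let $\Omega\subset\mathbb R^3$ be a bounded domain with Lipschitz boundary, $T>0$, $n\ge 1$, and let $m_1,\dots,m_n,c_w,\varepsilon>0$. Consider a mixture of $n$ ideal gases with partial mass densities $\rho_i$ and temperature $\theta$, with free energy densities $$\rho_i\psi_i=\theta\frac{\rho_i}{m_i}\Big(\ln\frac{\rho_i}{m_i}-1\Big)-c_w\rho_i\theta(\ln\theta-1),$$ and put $\mu_i=\partial(\rho_i\psi_i)/\partial\rho_i$, $\rho_i\eta_i=-\partial(\rho_i\psi_i)/\partial\theta$, $\rho_ie_i=\rho_i\psi_i+\theta\rho_i\eta_i$, $p_i=-\rho_i\psi_i+\rho_i\mu_i$, $\rho=\sum_i\rho_i$, $\rho e=\sum_i\rho_ie_i$, $p=\sum_ip_i$. The zero-mean-flow system without boundary heat exchange ($\lambda=0$) is $$\partial_t\rho_i+\operatorname{div}J_i=0\ (i=1,\dots,n),\qquad \nabla p=0,\qquad \partial_t(\rho e)+\operatorname{div}J_e=0\quad\text{in }\Omega\times(0,T),$$ $$J_i=\rho_iu_i,\qquad J_e=-\kappa\nabla\theta+\sum_i(\rho_ie_i+p_i)u_i,\qquad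 J_i\cdot\nu=J_e\cdot\nu=0\ \text{on }\partial\Omega,\qquad \rho_i(\cdot,0)=\rho_i^0,\ \theta(\cdot,0)=\theta^0,$$ where the diffusional velocities $u_i$ solve $$-\theta\sum_{j\ne i}b_{ij}\rho_i\rho_j(u_i-u_j)=\varepsilon d_i,\quad \sum_i\rho_iu_i=0,\quad d_i=-\frac{\rho_i}{\rho}\nabla p+\rho_i\theta\nabla\frac{\mu_i}{\theta}-\theta(\rho_ie_i+p_i)\nabla\frac1\theta .$$ Here $b_{ij}=b_{ij}(\rho_i,\rho_j,\theta)$ ($i\neq j$) are symmetric ($b_{ij}(r,s,\vartheta)=b_{ji}(s,r,\vartheta)$), positive, and Lipschitz continuous on compact subsets of $[0,\infty)^2\times(0,\infty)$. The conductivity $\kappa=\kappa(\rho_1,\dots,\rho_n,\theta)$ is continuous on $(0,\infty)^{n+1}$, satisfies $c_\kappa(1+\theta^2)\le\kappa\le C_\kappa(1+\theta^2)$ there with constants $c_\kappa,C_\kappa>0$, and is Lipschitz continuous as a function of the temperature on bounded sets: for each $R>0$ there is $L$ such that $|\kappa(\rho_1,\dots,\rho_n,\theta_1)-\kappa(\rho_1,\dots,\rho_n,\theta_2)|\le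 L|\theta_1-\theta_2|$ if all arguments lie in $(0,R]$. A *weak solution* on $[0,T)$ is $U=(\rho_1,\dots,\rho_n,\theta)$ with $\rho_i,\theta>0$ a.e. and, for every $\tau<T$, $\rho_i\in L^\infty(\Omega\times(0,\tau))\cap L^2(0,\tau;H^1(\Omega))$, $\theta,\log\theta\in L^2(0,\tau;H^1(\Omega))$, $\rho_i^0,\theta^0\in L^\infty(\Omega)$, such that the relations for $u_i$ and $\nabla p=0$ hold a.e. in $\Omega\times(0,T)$ (the gradients of functions of $U$ being given by the chain rule), $J_i,J_e\in L^1(\Omega\times(0,\tau))$, and for each $t\in[0,T)$ and each smooth $\varphi$ on $\mathbb R\times\mathbb R^3$ (not required to vanish on $\partial\Omega$), $\rho_i(t),(\rho e)(t)\in L^1(\Omega)$ and $$\int_\Omega\rho_i(t)\varphi(t)\,dx-\int_\Omega\rho_i^0\varphi(0)\,dx=\int_0^t\!\!\int_\Omega(\rho_i\partial_t\varphi+J_i\cdot\nabla\varphi)\,dx\,ds,$$ and likewise with $\rho e,J_e$ in place of $\rho_i,J_i$ (so $U$ is the representative that is weakly continuous in time). A *strong solution* is a weak solution for which $\partial_t\rho_i,\operatorname{div}J_i,\partial_t(\rho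 e),\operatorname{div}J_e$ are locally integrable functions on $\Omega\times(0,T)$, so that the balance laws hold a.e., and $\nabla\rho_i,\nabla\theta\in L^2(0,\tau;L^\infty(\Omega))$ for every $\tau<T$. **Theorem.** Let $U=(\rho_1,\dots,\rho_n,\theta)$ be a weak solution with initial data $U^0$ and $\bar U=(\bar\rho_1,\dots,\bar\rho_n,\bar\theta)$ a strong solution with initial data $\bar U^0$ of this system on $[0,T)$. Assume that there are $\delta,M>0$ such that, a.e. in $\Omega\times(0,T)$ and for all $i$, $$0<\rho_i\le M,\quad 0<\theta\le M,\qquad \delta\le\bar\rho_i\le M,\quad \delta\le\bar\theta\le M,$$ and that $\nabla\sqrt{\bar\rho_i}\in L^\infty_{\rm loc}(\Omega\times(0,T))$ and $\nabla\log\bar\theta\in L^\infty_{\rm loc}(\Omega\times(0,T))$. If $U^0=\bar U^0$ a.e. in $\Omega$, then for all $0\le t<T$, $U(x,t)=\bar U(x,t)$ for a.e. $x\in\Omega$. -/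

import Mathlib

open MeasureTheory Set
open scoped ContDiff NNReal

noncomputable section

namespace MaxwellStefan

/-! ### Domains -/

/-- The physical space `ℝ³` with its Euclidean norm. -/
abbrev Space : Type := EuclideanSpace ℝ (Fin 3)

/-- Near each boundary point, and after an isometry of `ℝ³`, the set `Ω` is the strict epigraph of
a Lipschitz function of the first two coordinates. -/
def HasLipschitzBoundary (Ω : Set Space) : Prop :=
  ∀ x ∈ frontier Ω, ∃ (A : Space ≃ₗᵢ[ℝ] Space) (γ : EuclideanSpace ℝ (Fin 2) → ℝ) (K : ℝ≥0)
    (r : ℝ), 0 < r ∧ LipschitzWith K γ ∧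
      ∀ y ∈ Metric.ball x r, (y ∈ Ω ↔ γ !₂[(A y) 0, (A y) 1] < (A y) 2)

/-- A bounded domain (open, connected, nonempty) with Lipschitz boundary. -/
structure IsLipschitzDomain (Ω : Set Space) : Prop where
  isOpen : IsOpen Ω
  isConnected : IsConnected Ω
  isBounded : Bornology.IsBounded Ω
  lipschitzBoundary : HasLipschitzBoundary Ω

/-- The space-time cylinder `(0, τ) × Ω`; time is the first coordinate. -/
def cyl (Ω : Set Space) (τ : ℝ) : Set (ℝ × Space) := Ioo 0 τ ×ˢ Ω

/-- Lebesgue measure on the space-time cylinder. -/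
def cylMeasure (Ω : Set Space) (τ : ℝ) : Measure (ℝ × Space) := volume.restrict (cyl Ω τ)

/-! ### Weak derivatives on the cylinder -/

/-- Smooth functions with compact support in the open cylinder `(0, T) × Ω`. -/
def IsTestFunction (Ω : Set Space) (T : ℝ) (φ : ℝ × Space → ℝ) : Prop :=
  ContDiff ℝ ∞ φ ∧ HasCompactSupport φ ∧ tsupport φ ⊆ cyl Ω T

/-- `G = ∇f` (gradient in space) in the sense of distributions on `(0, T) × Ω`. -/
def HasWeakGrad (Ω : Set Space) (T : ℝ) (f : ℝ × Space → ℝ) (G : ℝ × Space → Space) : Prop :=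
  LocallyIntegrableOn f (cyl Ω T) ∧ LocallyIntegrableOn G (cyl Ω T) ∧
    ∀ φ, IsTestFunction Ω T φ → ∀ v : Space,
      ∫ z in cyl Ω T, f z * fderiv ℝ φ z (0, v) = -∫ z in cyl Ω T, inner ℝ (G z) v * φ z

/-- `h = ∂ₜ f` in the sense of distributions on `(0, T) × Ω`. -/
def HasWeakTimeDeriv (Ω : Set Space) (T : ℝ) (f h : ℝ × Space → ℝ) : Prop :=
  LocallyIntegrableOn f (cyl Ω T) ∧ LocallyIntegrableOn h (cyl Ω T) ∧
    ∀ φ, IsTestFunction Ω T φ →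
      ∫ z in cyl Ω T, f z * fderiv ℝ φ z (1, 0) = -∫ z in cyl Ω T, h z * φ z

/-- `h = div J` (divergence in space) in the sense of distributions on `(0, T) × Ω`. Note that
`fderiv ℝ φ z (0, J z)` is `J z · ∇φ z`. -/
def HasWeakDiv (Ω : Set Space) (T : ℝ) (J : ℝ × Space → Space) (h : ℝ × Space → ℝ) : Prop :=
  LocallyIntegrableOn J (cyl Ω T) ∧ LocallyIntegrableOn h (cyl Ω T) ∧
    ∀ φ, IsTestFunction Ω T φ →
      ∫ z in cyl Ω T, fderiv ℝ φ z (0, J z) = -∫ z in cyl Ω T, h z * φ z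

/-- `f ∈ L²(0, τ; H¹(Ω))` for every `τ < T`, with gradient `G`. -/
def IsL2H1 (Ω : Set Space) (T : ℝ) (f : ℝ × Space → ℝ) (G : ℝ × Space → Space) : Prop :=
  HasWeakGrad Ω T f G ∧
    ∀ τ ∈ Ioo 0 T, MemLp f 2 (cylMeasure Ω τ) ∧ MemLp G 2 (cylMeasure Ω τ)

/-- `∇f ∈ L^∞_loc(Ω × (0, T))`. -/
def HasLocBoundedGrad (Ω : Set Space) (T : ℝ) (f : ℝ × Space → ℝ) : Prop :=
  ∃ G : ℝ × Space → Space, HasWeakGrad Ω T f G ∧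
    ∀ K, IsCompact K → K ⊆ cyl Ω T → MemLp G ⊤ (volume.restrict K)

/-! ### Thermodynamics of a simple mixture of ideal gases -/

/-- A state `(ρ₁, …, ρₙ, θ)`. -/
abbrev State (n : ℕ) : Type := (Fin n → ℝ) × ℝ

/-- Gradients `(∇ρ₁, …, ∇ρₙ, ∇θ)` at a point. -/
abbrev StateGrad (n : ℕ) : Type := (Fin n → Space) × Space

/-- The data of a mixture: molar masses `m i`, heat capacity `cw`, interaction strength `ε`,
friction coefficients `b i j (ρ_i) (ρ_j) θ`, and thermal conductivity `κ (ρ₁, …, ρₙ, θ)`. -/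
structure Mixture (n : ℕ) where
  m : Fin n → ℝ
  cw : ℝ
  ε : ℝ
  b : Fin n → Fin n → ℝ → ℝ → ℝ → ℝ
  κ : State n → ℝ
  m_pos : ∀ i, 0 < m i
  cw_pos : 0 < cw
  ε_pos : 0 < ε
  b_pos : ∀ i j, i ≠ j → ∀ r s ϑ : ℝ, 0 ≤ r → 0 ≤ s → 0 < ϑ → 0 < b i j r s ϑ
  b_symm : ∀ i j, i ≠ j → ∀ r s ϑ : ℝ, 0 ≤ r → 0 ≤ s → 0 < ϑ → b i j r s ϑ = b j i s r ϑ

/-- States with positive densities and positive temperature. -/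
def positiveCone (n : ℕ) : Set (State n) := {s | (∀ i, 0 < s.1 i) ∧ 0 < s.2}

namespace Mixture

variable {n : ℕ} (D : Mixture n)

/-- Helmholtz free energy density `ρ_i ψ_i` as a function of `r = ρ_i` and `ϑ = θ`. -/
def freeEnergy (i : Fin n) (r ϑ : ℝ) : ℝ :=
  ϑ * (r / D.m i) * (Real.log (r / D.m i) - 1) - D.cw * r * ϑ * (Real.log ϑ - 1)

/-- Chemical potential `μ_i = ∂(ρ_i ψ_i)/∂ρ_i`. -/
def chemPot (i : Fin n) (s : State n) : ℝ :=
  deriv (fun r => D.freeEnergy i r s.2) (s.1 i)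

/-- Partial entropy density `ρ_i η_i = -∂(ρ_i ψ_i)/∂θ`. -/
def entropy (i : Fin n) (s : State n) : ℝ :=
  -deriv (fun ϑ => D.freeEnergy i (s.1 i) ϑ) s.2

/-- Partial internal energy density `ρ_i e_i = ρ_i ψ_i + ρ_i η_i θ`. -/
def internalEnergy (i : Fin n) (s : State n) : ℝ :=
  D.freeEnergy i (s.1 i) s.2 + D.entropy i s * s.2

/-- Partial pressure `p_i = -ρ_i ψ_i + ρ_i μ_i`. -/
def pressure (i : Fin n) (s : State n) : ℝ :=
  -D.freeEnergy i (s.1 i) s.2 + s.1 i * D.chemPot i s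

/-- Total internal energy density `ρe = ∑ ρ_i e_i`. -/
def totalEnergy (s : State n) : ℝ := ∑ i, D.internalEnergy i s

/-- Total pressure `p = ∑ p_i`. -/
def totalPressure (s : State n) : ℝ := ∑ i, D.pressure i s

end Mixture

/-- Total mass density `ρ = ∑ ρ_i`. -/
def totalMass {n : ℕ} (s : State n) : ℝ := ∑ i, s.1 i

/-- The gradient of `F(ρ₁, …, ρₙ, θ)` at a point where the state is `s` and the gradients of
`ρ₁, …, ρₙ, θ` are `g`, by the chain rule:
`∇F = ∑ i, ∂F/∂ρ_i ∇ρ_i + ∂F/∂θ ∇θ`, written coordinatewise. -/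
def chainGrad {n : ℕ} (F : State n → ℝ) (s : State n) (g : StateGrad n) : Space :=
  WithLp.toLp 2 fun a => fderiv ℝ F s (fun i => (g.1 i) a, g.2 a)

namespace Mixture

variable {n : ℕ} (D : Mixture n)

/-- Generalized force (no external fields)
`d_i = -(ρ_i/ρ) ∇p + ρ_i θ ∇(μ_i/θ) - θ (ρ_i e_i + p_i) ∇(1/θ)`. -/
def force (i : Fin n) (s : State n) (g : StateGrad n) : Space :=
  -((s.1 i / totalMass s) • chainGrad D.totalPressure s g)
    + (s.1 i * s.2) • chainGrad (fun s' => D.chemPot i s' / s'.2) s g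
    - (s.2 * (D.internalEnergy i s + D.pressure i s)) • chainGrad (fun s' => 1 / s'.2) s g

/-- The Maxwell–Stefan relations with the constraint `∑ ρ_i u_i = 0`, for the diffusional
velocities `u` at a point. -/
def MaxwellStefanRelations (s : State n) (g : StateGrad n) (u : Fin n → Space) : Prop :=
  (∀ i, -(s.2 • ∑ j ∈ Finset.univ.erase i,
      (D.b i j (s.1 i) (s.1 j) s.2 * s.1 i * s.1 j) • (u i - u j)) = D.ε • D.force i s g) ∧
    ∑ i, s.1 i • u i = 0

/-- Energy flux `J_e = -κ ∇θ + ∑ (ρ_i e_i + p_i) u_i`. -/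
def energyFlux (s : State n) (g : StateGrad n) (u : Fin n → Space) : Space :=
  -(D.κ s • g.2) + ∑ i, (D.internalEnergy i s + D.pressure i s) • u i

end Mixture

/-- Mass flux `J_i = ρ_i u_i`. -/
def massFlux {n : ℕ} (i : Fin n) (s : State n) (u : Fin n → Space) : Space := s.1 i • u i

/-! ### Weak and strong solutions -/

/-- `U = (ρ₁, …, ρₙ, θ)` is a weak solution on `[0, T)` with initial data `U0` of
`∂ₜρ_i + div J_i = 0`, `∇p = 0`, `∂ₜ(ρe) + div J_e = 0` in `Ω`, with
`J_i · ν = 0 = J_e · ν` on `∂Ω`; here `G = ∇U`, and `u` are the diffusional velocities.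
The balance laws are tested with smooth functions that need not vanish on `∂Ω`, which encodes the
boundary conditions; they hold at each time `t`, i.e. `U` is the representative which is weakly
continuous in time. -/
structure IsWeakSolutionWith {n : ℕ} (D : Mixture n) (Ω : Set Space) (T : ℝ)
    (U0 : Space → State n) (U : ℝ × Space → State n) (G : ℝ × Space → StateGrad n)
    (u : ℝ × Space → Fin n → Space) : Prop where
  init_density : ∀ i, MemLp (fun x => (U0 x).1 i) ⊤ (volume.restrict Ω)
  init_temperature : MemLp (fun x => (U0 x).2) ⊤ (volume.restrict Ω)
  pos : ∀ᵐ z ∂(cylMeasure Ω T), U z ∈ positiveCone n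
  density_bounded : ∀ i, ∀ τ ∈ Ioo 0 T, MemLp (fun z => (U z).1 i) ⊤ (cylMeasure Ω τ)
  density_L2H1 : ∀ i, IsL2H1 Ω T (fun z => (U z).1 i) (fun z => (G z).1 i)
  temperature_L2H1 : IsL2H1 Ω T (fun z => (U z).2) (fun z => (G z).2)
  log_temperature_L2H1 :
    ∃ H : ℝ × Space → Space, IsL2H1 Ω T (fun z => Real.log (U z).2) H
  relations : ∀ᵐ z ∂(cylMeasure Ω T), D.MaxwellStefanRelations (U z) (G z) (u z)
  momentum : ∀ᵐ z ∂(cylMeasure Ω T), chainGrad D.totalPressure (U z) (G z) = 0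
  massFlux_integrable : ∀ i, ∀ τ ∈ Ioo 0 T,
    Integrable (fun z => massFlux i (U z) (u z)) (cylMeasure Ω τ)
  energyFlux_integrable : ∀ τ ∈ Ioo 0 T,
    Integrable (fun z => D.energyFlux (U z) (G z) (u z)) (cylMeasure Ω τ)
  density_slice : ∀ i, ∀ t ∈ Ico 0 T, IntegrableOn (fun x => (U (t, x)).1 i) Ω
  energy_slice : ∀ t ∈ Ico 0 T, IntegrableOn (fun x => D.totalEnergy (U (t, x))) Ω
  mass_balance : ∀ i, ∀ φ : ℝ × Space → ℝ, ContDiff ℝ ∞ φ → ∀ t ∈ Ico 0 T,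
    ∫ x in Ω, (U (t, x)).1 i * φ (t, x) - ∫ x in Ω, (U0 x).1 i * φ (0, x)
      = ∫ z in cyl Ω t, ((U z).1 i * fderiv ℝ φ z (1, 0)
          + fderiv ℝ φ z (0, massFlux i (U z) (u z)))
  energy_balance : ∀ φ : ℝ × Space → ℝ, ContDiff ℝ ∞ φ → ∀ t ∈ Ico 0 T,
    ∫ x in Ω, D.totalEnergy (U (t, x)) * φ (t, x)
        - ∫ x in Ω, D.totalEnergy (U0 x) * φ (0, x)
      = ∫ z in cyl Ω t, (D.totalEnergy (U z) * fderiv ℝ φ z (1, 0)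
          + fderiv ℝ φ z (0, D.energyFlux (U z) (G z) (u z)))

/-- Weak solutions on `[0, T)` of the zero-mean-flow system without boundary heat exchange. -/
def IsWeakSolution {n : ℕ} (D : Mixture n) (Ω : Set Space) (T : ℝ) (U0 : Space → State n)
    (U : ℝ × Space → State n) : Prop :=
  ∃ (G : ℝ × Space → StateGrad n) (u : ℝ × Space → Fin n → Space),
    IsWeakSolutionWith D Ω T U0 U G u

/-- Strong solutions on `[0, T)`: weak solutions for which the time derivatives and the divergences
of the fluxes are functions, so that the balance laws hold almost everywhere, and whose gradients
are in `L²(0, τ; L^∞(Ω))` for each `τ < T` (with a common majorant `q(t)`). -/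
def IsStrongSolution {n : ℕ} (D : Mixture n) (Ω : Set Space) (T : ℝ) (U0 : Space → State n)
    (U : ℝ × Space → State n) : Prop :=
  ∃ (G : ℝ × Space → StateGrad n) (u : ℝ × Space → Fin n → Space),
    IsWeakSolutionWith D Ω T U0 U G u ∧
    (∀ i, ∃ r h : ℝ × Space → ℝ, HasWeakTimeDeriv Ω T (fun z => (U z).1 i) r ∧
      HasWeakDiv Ω T (fun z => massFlux i (U z) (u z)) h ∧
      ∀ᵐ z ∂(cylMeasure Ω T), r z + h z = 0) ∧
    (∃ r h : ℝ × Space → ℝ, HasWeakTimeDeriv Ω T (fun z => D.totalEnergy (U z)) r ∧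
      HasWeakDiv Ω T (fun z => D.energyFlux (U z) (G z) (u z)) h ∧
      ∀ᵐ z ∂(cylMeasure Ω T), r z + h z = 0) ∧
    ∃ q : ℝ → ℝ, (∀ τ ∈ Ioo 0 T, MemLp q 2 (volume.restrict (Ioo 0 τ))) ∧
      ∀ᵐ z ∂(cylMeasure Ω T), (∀ i, ‖(G z).1 i‖ ≤ q z.1) ∧ ‖(G z).2‖ ≤ q z.1

end MaxwellStefan

end

open MeasureTheory Set
open scoped ContDiff NNReal

noncomputable section

set_option linter.unusedSectionVars false

namespace MaxwellStefan

open Filter Topology ENNReal Convolution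

/-! ### Tools for `L²` functions -/

section L2Tools

variable {α : Type*} [MeasurableSpace α] {μ : Measure α}
  {H : Type*} [NormedAddCommGroup H] [InnerProductSpace ℝ H]

/-! The two solutions are compared through a relative entropy of the concentrations c_i = ρ_i / m_i
alone, because the temperature is slaved to the concentrations. Bars denote the strong solution, c =
∑ c_i, and x_i = c_i / c.

Conserved quantities. The fluxes ρ_i u_i sum to zero, so the total mass density is stationary and,
for equal data, common to both solutions (`IsWeakSolutionWith.totalMass_eq`). Since ∇p = 0 and Ω is
connected, the pressure p = θ c depends on time only (`exists_pressure_eq`), and the energy balance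
tested with constants gives ∫ ρθ = ∫ ρθ̄. Inserting θ = P(t) / c, one obtains a positive lower bound
for θ and, at almost every time, an estimate of θ - θ̄ in L²(Ω) by the differences of the densities
(`IsComparable.le_temperature`, `integral_sq_temperature_sub_le`).

Entropy. For ∇p = 0 the force is d_i = θ (∇c_i - (c_i / c) ∇c), so that the factor θ drops out of
the Maxwell–Stefan relations. The relative entropy of the mole fractions, ∑ c_i log (x_i / x̄_i),
dominates the squares of ρ_i - ρ̄_i because the total masses agree (`exists_coercivity`). Its
production is ∑ c_i (u_i - ū_i) · ∇log (x_i / x̄_i) up to an error containing ∇log (c / c̄)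
(`relative_flux_identity`). The relations turn the main term into minus a friction form in u - ū,
which controls ∑ ρ_i |u_i - ū_i|² up to the barycentric part; that part is small since both
barycentric velocities vanish. Young's inequality absorbs the errors, and the production is at most
K (q · distance)², where q in L² bounds the gradients of the strong solution
(`exists_relative_flux_bound`). Gronwall's lemma with the integrable coefficient q² concludes.

Justification. The densities of the weak solution have no positive lower bound, so log c_i is
replaced by log (c_i + η). The dissipative sign of the relations bounds (c_i + η)⁻¹ J_i · ∇c_i from
above by an integrable function independent of η (`inv_add_mul_inner_flux_le`), which is enough for
a one-sided limit (`integral_relEntropy_le`). The chain rule in time is needed only as an inequality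
and is derived from time increments (`TimeBalance.integral_comp_le`). It uses test functions in
L²(H¹) that do not vanish on ∂Ω, whence the approximation by functions smooth up to the boundary
(`IsL2H1.smoothApprox`). Equality almost everywhere on the cylinder passes to every time by weak
continuity. -/

theorem integrable_inner_of_memLp {a b : α → H} (ha : MemLp a 2 μ) (hb : MemLp b 2 μ) :
    Integrable (fun z => inner ℝ (a z) (b z)) μ := by
  refine (integrable_congr ?_).1 (L2.integrable_inner (𝕜 := ℝ) ha.toLp hb.toLp)
  filter_upwards [ha.coeFn_toLp, hb.coeFn_toLp] with z h1 h2
  rw [h1, h2]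

/-- Cauchy–Schwarz inequality in `L²`. -/
theorem abs_integral_inner_le {a b : α → H} (ha : MemLp a 2 μ) (hb : MemLp b 2 μ) :
    |∫ z, inner ℝ (a z) (b z) ∂μ| ≤ (eLpNorm a 2 μ).toReal * (eLpNorm b 2 μ).toReal := by
  have h : ∫ z, inner ℝ (a z) (b z) ∂μ = inner ℝ ha.toLp hb.toLp := by
    rw [L2.inner_def]
    refine integral_congr_ae ?_
    filter_upwards [ha.coeFn_toLp, hb.coeFn_toLp] with z h1 h2
    rw [h1, h2]
  rw [h]
  have := norm_inner_le_norm (𝕜 := ℝ) ha.toLp hb.toLp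
  rwa [Real.norm_eq_abs, Lp.norm_toLp, Lp.norm_toLp] at this

/-- The `L²` pairing with a fixed function is continuous. -/
theorem tendsto_integral_inner {ι : Type*} {l : Filter ι} {a b : α → H} {bk : ι → α → H}
    (ha : MemLp a 2 μ) (hb : MemLp b 2 μ) (hbk : ∀ k, MemLp (bk k) 2 μ)
    (h : Tendsto (fun k => eLpNorm (bk k - b) 2 μ) l (𝓝 0)) :
    Tendsto (fun k => ∫ z, inner ℝ (a z) (bk k z) ∂μ) l (𝓝 (∫ z, inner ℝ (a z) (b z) ∂μ)) := by
  rw [tendsto_iff_norm_sub_tendsto_zero]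
  have h0 : Tendsto (fun k => (eLpNorm a 2 μ).toReal * (eLpNorm (bk k - b) 2 μ).toReal) l
      (𝓝 0) := by
    have := ((ENNReal.tendsto_toReal zero_ne_top).comp h).const_mul (eLpNorm a 2 μ).toReal
    simpa using this
  refine squeeze_zero (fun _ => norm_nonneg _) (fun k => ?_) h0
  rw [← integral_sub (integrable_inner_of_memLp ha (hbk k)) (integrable_inner_of_memLp ha hb),
    Real.norm_eq_abs]
  have := abs_integral_inner_le ha ((hbk k).sub hb)
  simpa [inner_sub_right] using this

theorem tendsto_integral_mul {ι : Type*} {l : Filter ι} {a b : α → ℝ} {bk : ι → α → ℝ}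
    (ha : MemLp a 2 μ) (hb : MemLp b 2 μ) (hbk : ∀ k, MemLp (bk k) 2 μ)
    (h : Tendsto (fun k => eLpNorm (bk k - b) 2 μ) l (𝓝 0)) :
    Tendsto (fun k => ∫ z, a z * bk k z ∂μ) l (𝓝 (∫ z, a z * b z ∂μ)) := by
  simpa [mul_comm] using tendsto_integral_inner ha hb hbk h

/-- Dominated convergence in `L²`. -/
theorem tendsto_eLpNorm_two_of_dominated {F : Type*} [NormedAddCommGroup F]
    {f : ℕ → α → F} {b : α → ℝ} (hf : ∀ k, AEStronglyMeasurable (f k) μ) (hb : MemLp b 2 μ)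
    (hfb : ∀ k, ∀ᵐ z ∂μ, ‖f k z‖ ≤ b z) (hlim : ∀ᵐ z ∂μ, Tendsto (fun k => f k z) atTop (𝓝 0)) :
    Tendsto (fun k => eLpNorm (f k) 2 μ) atTop (𝓝 0) := by
  have key : Tendsto (fun k => ∫⁻ z, ‖f k z‖ₑ ^ (2 : ℝ) ∂μ) atTop (𝓝 (∫⁻ _, 0 ∂μ)) := by
    refine tendsto_lintegral_of_dominated_convergence' (fun z => ‖b z‖ₑ ^ (2 : ℝ))
      (fun k => (hf k).enorm.pow_const _) (fun k => ?_) ?_ ?_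
    · filter_upwards [hfb k] with z hz
      gcongr
      rw [enorm_le_iff_norm_le]
      exact hz.trans (le_abs_self _)
    · have := lintegral_rpow_enorm_lt_top_of_eLpNorm_lt_top (p := 2) (by simp) (by simp) hb.2
      simpa using this.ne
    · filter_upwards [hlim] with z hz
      have h1 : Tendsto (fun k => ‖f k z‖ₑ) atTop (𝓝 0) := by
        simpa using hz.enorm
      have := (ENNReal.continuous_rpow_const (y := 2)).tendsto 0 |>.comp h1
      simpa [Function.comp_def] using this
  have h2 := (ENNReal.continuous_rpow_const (y := 1 / 2)).tendsto _ |>.comp key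
  simp only [Function.comp_def, lintegral_zero] at h2
  rw [ENNReal.zero_rpow_of_pos (by norm_num)] at h2
  refine h2.congr fun k => ?_
  rw [eLpNorm_eq_lintegral_rpow_enorm_toReal (by simp) (by simp)]
  simp

end L2Tools

/-! ### Translations and mollification in L². -/

section Mollification

variable {E : Type*} [NormedAddCommGroup E] [NormedSpace ℝ E] [FiniteDimensional ℝ E]
  [MeasurableSpace E] [BorelSpace E] {μ : Measure E} [μ.IsAddHaarMeasure]
  {F : Type*} [NormedAddCommGroup F] [NormedSpace ℝ F]

theorem memLp_comp_add {f : E → F} {p : ℝ≥0∞} (hf : MemLp f p μ) (a : E) :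
    MemLp (fun z => f (z + a)) p μ :=
  hf.comp_measurePreserving (measurePreserving_add_right μ a)

/-- Translations are continuous in `L²`. -/
theorem tendsto_eLpNorm_translate {f : E → F} (hf : MemLp f 2 μ) :
    Tendsto (fun a => eLpNorm (fun z => f (z + a) - f z) 2 μ) (𝓝 0) (𝓝 0) := by
  let g : E → C(E, E) := fun a => ⟨fun z => z + a, by fun_prop⟩
  have hg : Continuous g :=
    (ContinuousMap.mk (fun p : E × E => p.2 + p.1) (by fun_prop)).curry.continuous
  have hgm : ∀ a, MeasurePreserving (g a) μ μ := fun a => measurePreserving_add_right μ a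
  have h := (Continuous.compMeasurePreservingLp (f := fun _ : E => hf.toLp) continuous_const hg
    hgm (by simp)).tendsto 0
  rw [tendsto_iff_edist_tendsto_0] at h
  refine h.congr fun a => ?_
  have h0 : (Lp.compMeasurePreserving (g 0) (hgm 0)) hf.toLp = hf.toLp := by
    rw [Lp.toLp_compMeasurePreserving]
    congr 1
    ext z
    simp [g]
  rw [h0, Lp.toLp_compMeasurePreserving, Lp.edist_toLp_toLp]
  rfl

theorem eLpNorm_translate (f : E → F) (hf : AEStronglyMeasurable f μ) (a : E) :
    eLpNorm (fun z => f (z + a)) 2 μ = eLpNorm f 2 μ :=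
  eLpNorm_comp_measurePreserving hf (measurePreserving_add_right μ a)

/-- Mollification error in terms of translations. -/
theorem eLpNorm_convolution_sub_le [CompleteSpace F] (k : ContDiffBump (0 : E)) {f : E → F}
    (hf : MemLp f 2 μ) {C : ℝ≥0∞}
    (hC : ∀ y ∈ Metric.ball (0 : E) k.rOut, eLpNorm (fun z => f (z - y) - f z) 2 μ ≤ C) :
    eLpNorm (fun z => (k.normed μ ⋆[ContinuousLinearMap.lsmul ℝ ℝ, μ] f) z - f z) 2 μ ≤ C := by
  set w : E → ℝ≥0∞ := fun y => ENNReal.ofReal (k.normed μ y) with hw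
  have hwc : Continuous w := ENNReal.continuous_ofReal.comp k.continuous_normed
  -- The mollifier is the density of a probability measure ν. The norm comparison L¹(ν) ≤ L²(ν)
  -- bounds the squared error pointwise, and Tonelli's theorem reduces it to translation errors for
  -- shifts in the support.
  set ν := μ.withDensity w with hν
  have hmass : ∫⁻ y, w y ∂μ = 1 := by
    rw [← ofReal_integral_eq_lintegral_ofReal k.integrable_normed
      (Eventually.of_forall k.nonneg_normed), k.integral_normed, ENNReal.ofReal_one]
  have : IsProbabilityMeasure ν := ⟨by rw [hν, withDensity_apply _ .univ, setLIntegral_univ, hmass]⟩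
  have hac : ν ≪ μ := withDensity_absolutelyContinuous _ _
  have hmp : ∀ z : E, MeasurePreserving (fun y => z - y) μ μ := fun z =>
    Measure.measurePreserving_sub_left μ z
  have hmeas : ∀ z : E, AEStronglyMeasurable (fun y => f (z - y)) μ := fun z =>
    hf.1.comp_measurePreserving (hmp z)
  have hpt : ∀ z, ‖(k.normed μ ⋆[ContinuousLinearMap.lsmul ℝ ℝ, μ] f) z - f z‖ₑ ^ (2 : ℝ)
      ≤ ∫⁻ y, ‖f (z - y) - f z‖ₑ ^ (2 : ℝ) ∂ν := by
    intro z
    have hint : Integrable (fun y => k.normed μ y • f (z - y)) μ :=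
      (k.hasCompactSupport_normed.convolutionExists_left (L := ContinuousLinearMap.lsmul ℝ ℝ)
        k.continuous_normed (hf.locallyIntegrable (by norm_num)) z)
    have h1 : (k.normed μ ⋆[ContinuousLinearMap.lsmul ℝ ℝ, μ] f) z - f z
        = ∫ y, k.normed μ y • (f (z - y) - f z) ∂μ := by
      simp only [smul_sub]
      rw [integral_sub hint (k.integrable_normed.smul_const _), integral_smul_const,
        k.integral_normed, one_smul]
      rfl
    have hm : AEStronglyMeasurable (fun y => f (z - y) - f z) μ :=
      (hmeas z).sub aestronglyMeasurable_const
    have h2 : ‖(k.normed μ ⋆[ContinuousLinearMap.lsmul ℝ ℝ, μ] f) z - f z‖ₑ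
        ≤ eLpNorm (fun y => f (z - y) - f z) 1 ν := by
      rw [h1, eLpNorm_one_eq_lintegral_enorm, hν,
        lintegral_withDensity_eq_lintegral_mul₀ hwc.aemeasurable
          hm.enorm]
      refine (enorm_integral_le_lintegral_enorm _).trans (lintegral_mono fun y => ?_)
      simp only [Pi.mul_apply, hw]
      rw [enorm_smul, Real.enorm_eq_ofReal (k.nonneg_normed y)]
    have h3 := h2.trans (eLpNorm_le_eLpNorm_of_exponent_le (p := 1) (q := 2) (by norm_num)
      (hm.mono_ac hac))
    rw [eLpNorm_eq_lintegral_rpow_enorm_toReal (by simp) (by simp)] at h3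
    have h4 := ENNReal.rpow_le_rpow h3 (z := 2) (by norm_num)
    rw [← ENNReal.rpow_mul] at h4
    simpa using h4
  have hjoint : AEMeasurable (fun p : E × E => ‖f (p.1 - p.2) - f p.1‖ₑ ^ (2 : ℝ)) (μ.prod ν) := by
    refine AEMeasurable.pow_const (AEStronglyMeasurable.enorm ?_) _
    refine AEStronglyMeasurable.sub ?_ ?_
    · have : AEStronglyMeasurable (fun p : E × E => f (p.1 - p.2)) (μ.prod μ) :=
        hf.1.comp_quasiMeasurePreserving (quasiMeasurePreserving_sub_of_right_invariant μ μ)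
      exact this.mono_ac (Measure.AbsolutelyContinuous.rfl.prod hac)
    · exact hf.1.comp_fst
  rw [eLpNorm_eq_lintegral_rpow_enorm_toReal (by simp) (by simp)]
  have hC2 : ∫⁻ z, ‖(k.normed μ ⋆[ContinuousLinearMap.lsmul ℝ ℝ, μ] f) z - f z‖ₑ ^ (2 : ℝ) ∂μ
      ≤ C ^ (2 : ℝ) := by
    calc _ ≤ ∫⁻ z, ∫⁻ y, ‖f (z - y) - f z‖ₑ ^ (2 : ℝ) ∂ν ∂μ := lintegral_mono hpt
      _ = ∫⁻ y, ∫⁻ z, ‖f (z - y) - f z‖ₑ ^ (2 : ℝ) ∂μ ∂ν := lintegral_lintegral_swap hjoint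
      _ ≤ ∫⁻ _, C ^ (2 : ℝ) ∂ν := by
        refine lintegral_mono_ae ?_
        have hsupp : ∀ᵐ y ∂ν, y ∈ Metric.ball (0 : E) k.rOut := by
          rw [hν, ae_withDensity_iff hwc.measurable]
          refine Eventually.of_forall fun y hy => ?_
          rw [← k.support_normed_eq (μ := μ)]
          intro h0
          exact hy (by simp [hw, h0])
        filter_upwards [hsupp] with y hy
        have h3 := hC y hy
        rw [eLpNorm_eq_lintegral_rpow_enorm_toReal (by simp) (by simp)] at h3
        have h4 := ENNReal.rpow_le_rpow h3 (z := 2) (by norm_num)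
        rw [← ENNReal.rpow_mul] at h4
        simpa using h4
      _ = C ^ (2 : ℝ) := by simp
  have h4 := ENNReal.rpow_le_rpow hC2 (z := 1 / 2) (by norm_num)
  rw [← ENNReal.rpow_mul] at h4
  simpa using h4

end Mollification

/-! ### Approximation by smooth functions up to the boundary -/

instance isAddHaarMeasure_spaceTime : (volume : Measure (ℝ × Space)).IsAddHaarMeasure :=
  inferInstanceAs ((volume : Measure ℝ).prod (volume : Measure Space)).IsAddHaarMeasure

/-- By translation invariance the error splits into the unshifted mollification error and f(· + a_k)
- f. The shift serves to evaluate mollifications at points pushed into the domain. -/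
theorem tendsto_eLpNorm_shifted_convolution {E : Type*} [NormedAddCommGroup E] [NormedSpace ℝ E]
    [FiniteDimensional ℝ E] [MeasurableSpace E] [BorelSpace E] {μ : Measure E}
    [μ.IsAddHaarMeasure] {F : Type*} [NormedAddCommGroup F] [NormedSpace ℝ F] [CompleteSpace F]
    {f : E → F} (hf : MemLp f 2 μ) {κ : ℕ → ContDiffBump (0 : E)} {a : ℕ → E}
    (hκ : Tendsto (fun k => (κ k).rOut) atTop (𝓝 0)) (ha : Tendsto a atTop (𝓝 0)) :
    Tendsto (fun k => eLpNorm (fun z =>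
      ((κ k).normed μ ⋆[ContinuousLinearMap.lsmul ℝ ℝ, μ] f) (z + a k) - f z) 2 μ) atTop (𝓝 0) := by
  have hcont : ∀ k, Continuous ((κ k).normed μ ⋆[ContinuousLinearMap.lsmul ℝ ℝ, μ] f) := fun k =>
    (κ k).hasCompactSupport_normed.continuous_convolution_left _ (κ k).continuous_normed
      (hf.locallyIntegrable (by norm_num))
  have h1 : Tendsto (fun k => eLpNorm (fun z =>
      ((κ k).normed μ ⋆[ContinuousLinearMap.lsmul ℝ ℝ, μ] f) z - f z) 2 μ) atTop (𝓝 0) := by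
    rw [ENNReal.tendsto_nhds_zero]
    intro ε hε
    obtain ⟨δ, hδ, hball⟩ := Metric.eventually_nhds_iff.1
      ((ENNReal.tendsto_nhds_zero.1 (tendsto_eLpNorm_translate hf)) ε hε)
    filter_upwards [hκ.eventually_lt_const hδ] with k hk
    refine eLpNorm_convolution_sub_le (κ k) hf fun y hy => ?_
    have := hball (y := -y) (by
      rw [dist_zero_right, norm_neg]; exact (mem_ball_zero_iff.1 hy).trans hk)
    simpa [sub_eq_add_neg] using this
  have h2 : Tendsto (fun k => eLpNorm (fun z => f (z + a k) - f z) 2 μ) atTop (𝓝 0) :=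
    (tendsto_eLpNorm_translate hf).comp ha
  have h3 := h1.add h2
  rw [add_zero] at h3
  refine tendsto_of_tendsto_of_tendsto_of_le_of_le tendsto_const_nhds h3 (fun _ => zero_le) fun k => ?_
  have hm1 : AEStronglyMeasurable (fun z =>
      ((κ k).normed μ ⋆[ContinuousLinearMap.lsmul ℝ ℝ, μ] f) z - f z) μ :=
    (hcont k).aestronglyMeasurable.sub hf.1
  have e1 := eLpNorm_translate _ hm1 (a k)
  have hm2 : AEStronglyMeasurable (fun z => f (z + a k)) μ := (memLp_comp_add hf (a k)).1
  dsimp only at e1 ⊢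
  rw [← e1]
  refine le_trans (le_of_eq ?_) (eLpNorm_add_le
    (hm1.comp_measurePreserving (measurePreserving_add_right μ (a k))) (hm2.sub hf.1) (by norm_num))
  congr 1
  ext z
  simp

/-- The gradient in space of a function on space-time. -/
def spaceGrad (φ : ℝ × Space → ℝ) (z : ℝ × Space) : Space :=
  (InnerProductSpace.toDual ℝ Space).symm
    ((fderiv ℝ φ z).comp (ContinuousLinearMap.inr ℝ ℝ Space))

theorem inner_spaceGrad (φ : ℝ × Space → ℝ) (z : ℝ × Space) (v : Space) :
    inner ℝ (spaceGrad φ z) v = fderiv ℝ φ z (0, v) := by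
  simp [spaceGrad]

theorem continuous_spaceGrad {φ : ℝ × Space → ℝ} (hφ : ContDiff ℝ ∞ φ) :
    Continuous (spaceGrad φ) := by
  refine (InnerProductSpace.toDual ℝ Space).symm.continuous.comp ?_
  exact (hφ.continuous_fderiv (by simp)).clm_comp continuous_const

/-- `w` and `W` are limits in `L²((0, τ) × Ω)` of smooth functions on `ℝ × ℝ³` and of their spatial
gradients. -/
def SmoothApprox (Ω : Set Space) (τ : ℝ) (w : ℝ × Space → ℝ) (W : ℝ × Space → Space) : Prop :=
  MemLp w 2 (cylMeasure Ω τ) ∧ MemLp W 2 (cylMeasure Ω τ) ∧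
    ∃ φ : ℕ → ℝ × Space → ℝ, (∀ k, ContDiff ℝ ∞ (φ k)) ∧
      Tendsto (fun k => eLpNorm (φ k - w) 2 (cylMeasure Ω τ)) atTop (𝓝 0) ∧
      Tendsto (fun k => eLpNorm (spaceGrad (φ k) - W) 2 (cylMeasure Ω τ)) atTop (𝓝 0)

theorem isBounded_cyl {Ω : Set Space} (hΩ : Bornology.IsBounded Ω) (τ : ℝ) :
    Bornology.IsBounded (cyl Ω τ) :=
  (Metric.isBounded_Ioo 0 τ).prod hΩ

theorem isOpen_cyl {Ω : Set Space} (hΩ : IsOpen Ω) (τ : ℝ) : IsOpen (cyl Ω τ) :=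
  isOpen_Ioo.prod hΩ

theorem cyl_subset_cyl {Ω : Set Space} {τ τ' : ℝ} (h : τ ≤ τ') : cyl Ω τ ⊆ cyl Ω τ' :=
  prod_mono (Ioo_subset_Ioo le_rfl h) subset_rfl

theorem cylMeasure_mono {Ω : Set Space} {τ τ' : ℝ} (h : τ ≤ τ') :
    cylMeasure Ω τ ≤ cylMeasure Ω τ' :=
  Measure.restrict_mono (cyl_subset_cyl h) le_rfl

theorem isFiniteMeasure_cylMeasure {Ω : Set Space} (hΩ : Bornology.IsBounded Ω) (τ : ℝ) :
    IsFiniteMeasure (cylMeasure Ω τ) :=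
  ⟨by rw [cylMeasure, Measure.restrict_apply_univ]; exact (isBounded_cyl hΩ τ).measure_lt_top⟩

theorem memLp_of_continuous {Ω : Set Space} (hΩ : Bornology.IsBounded Ω) (τ : ℝ)
    {F : Type*} [NormedAddCommGroup F] {f : ℝ × Space → F} (hf : Continuous f) (p : ℝ≥0∞) 
    (hΩo : IsOpen Ω) : MemLp f p (cylMeasure Ω τ) := by
  have := isFiniteMeasure_cylMeasure hΩ τ
  obtain ⟨C, hC⟩ := ((isBounded_cyl hΩ τ).isCompact_closure.exists_bound_of_continuousOn
    hf.continuousOn)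
  refine MemLp.of_bound (hf.aestronglyMeasurable) C ?_
  exact ae_restrict_of_forall_mem (isOpen_cyl hΩo τ).measurableSet
    fun z hz => hC z (subset_closure hz)

theorem SmoothApprox.sum {Ω : Set Space} {τ : ℝ} {ι : Type*} (s : Finset ι)
    {w : ι → ℝ × Space → ℝ} {W : ι → ℝ × Space → Space}
    (h : ∀ i ∈ s, SmoothApprox Ω τ (w i) (W i)) :
    SmoothApprox Ω τ (fun z => ∑ i ∈ s, w i z) (fun z => ∑ i ∈ s, W i z) := by
  classical
  induction s using Finset.induction_on with
  | empty =>
    refine ⟨by simp, by simp, fun _ _ => 0, fun _ => contDiff_const, ?_, ?_⟩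
    · simp
    · have : (spaceGrad (fun _ => 0) - fun z => ∑ i ∈ (∅ : Finset ι), W i z) = 0 := by
        ext; simp [spaceGrad]
      simp only [this, eLpNorm_zero]
      exact tendsto_const_nhds
  | insert a s has ih =>
    obtain ⟨m1, m2, φ, hφ, c1, c2⟩ := h a (Finset.mem_insert_self a s)
    obtain ⟨m1', m2', ψ, hψ, c1', c2'⟩ := ih fun i hi => h i (Finset.mem_insert_of_mem hi)
    simp only [Finset.sum_insert has]
    refine ⟨m1.add m1', m2.add m2', fun k z => φ k z + ψ k z, fun k => (hφ k).add (hψ k), ?_, ?_⟩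
    · have h3 := c1.add c1'
      rw [add_zero] at h3
      refine tendsto_of_tendsto_of_tendsto_of_le_of_le tendsto_const_nhds h3
        (fun _ => zero_le) fun k => ?_
      refine le_trans (le_of_eq ?_) (eLpNorm_add_le
        ((hφ k).continuous.aestronglyMeasurable.sub m1.1)
        ((hψ k).continuous.aestronglyMeasurable.sub m1'.1) (by norm_num))
      congr 1
      ext z
      simp only [Pi.sub_apply, Pi.add_apply]
      ring
    · have h3 := c2.add c2'
      rw [add_zero] at h3
      refine tendsto_of_tendsto_of_tendsto_of_le_of_le tendsto_const_nhds h3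
        (fun _ => zero_le) fun k => ?_
      refine le_trans (le_of_eq ?_) (eLpNorm_add_le
        ((continuous_spaceGrad (hφ k)).aestronglyMeasurable.sub m2.1)
        ((continuous_spaceGrad (hψ k)).aestronglyMeasurable.sub m2'.1) (by norm_num))
      congr 1
      ext1 z
      have : spaceGrad (fun z => φ k z + ψ k z) z = spaceGrad (φ k) z + spaceGrad (ψ k) z := by
        rw [spaceGrad, fderiv_fun_add ((hφ k).differentiable (by simp) z)
          ((hψ k).differentiable (by simp) z), ContinuousLinearMap.add_comp, map_add]
        rfl
      simp only [Pi.sub_apply, Pi.add_apply, this]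
      abel

theorem SmoothApprox.congr {Ω : Set Space} {τ : ℝ} {w w' : ℝ × Space → ℝ}
    {W W' : ℝ × Space → Space} (h : SmoothApprox Ω τ w W)
    (hw : w =ᵐ[cylMeasure Ω τ] w') (hW : W =ᵐ[cylMeasure Ω τ] W') :
    SmoothApprox Ω τ w' W' := by
  obtain ⟨m1, m2, φ, hφ, c1, c2⟩ := h
  refine ⟨(memLp_congr_ae hw).1 m1, (memLp_congr_ae hW).1 m2, φ, hφ, c1.congr fun k => ?_,
    c2.congr fun k => ?_⟩
  · exact eLpNorm_congr_ae (EventuallyEq.rfl.sub hw)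
  · exact eLpNorm_congr_ae (EventuallyEq.rfl.sub hW)

theorem memLp_indicator_cyl {Ω : Set Space} (ho : IsOpen Ω) {τ : ℝ} {F : Type*}
    [NormedAddCommGroup F] {f : ℝ × Space → F} {p : ℝ≥0∞} (hf : MemLp f p (cylMeasure Ω τ)) :
    MemLp ((cyl Ω τ).indicator f) p volume :=
  (memLp_indicator_iff_restrict (isOpen_cyl ho τ).measurableSet).2 hf

theorem memLp_smul_of_continuous {α : Type*} [MeasurableSpace α] [TopologicalSpace α]
    [OpensMeasurableSpace α] {μ : Measure α} {F : Type*} [NormedAddCommGroup F] [NormedSpace ℝ F]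
    [SecondCountableTopologyEither α ℝ] {p : ℝ≥0∞}
    {χ : α → ℝ} (hχ : Continuous χ) {C : ℝ} (hC : ∀ y, |χ y| ≤ C) {f : α → F}
    (hf : MemLp f p μ) : MemLp (fun y => χ y • f y) p μ := by
  refine hf.of_le_mul (c := C) (hχ.aestronglyMeasurable.smul hf.1) (Eventually.of_forall fun y => ?_)
  rw [norm_smul]
  exact mul_le_mul_of_nonneg_right (hC y) (norm_nonneg _)

theorem gradient_inner_apply {χ : Space → ℝ} (x v : Space) :
    inner ℝ (gradient χ x) v = fderiv ℝ χ x v := by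
  simp [gradient]

/-- Derivative of a shifted mollification, in terms of the weak gradient, where the points needed
lie in the domain or outside the support of the cutoff `χ`. -/
theorem spaceGrad_shifted_convolution {Ω : Set Space} {T τ' : ℝ} (ho : IsOpen Ω) (hτ' : τ' ≤ T)
    {w : ℝ × Space → ℝ} {W : ℝ × Space → Space} (hw : HasWeakGrad Ω T w W)
    (hw2 : MemLp w 2 (cylMeasure Ω τ')) (hW2 : MemLp W 2 (cylMeasure Ω τ'))
    {χ : Space → ℝ} (hχ : ContDiff ℝ ∞ χ) (hχc : HasCompactSupport χ)
    (κ : ContDiffBump (0 : ℝ × Space)) (a z : ℝ × Space)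
    (hsupp : ∀ y ∈ Metric.closedBall (z + a) κ.rOut, y.1 ∈ Ioo 0 τ' ∧ (y.2 ∈ tsupport χ → y.2 ∈ Ω)) :
    spaceGrad (fun y => (κ.normed volume ⋆[ContinuousLinearMap.lsmul ℝ ℝ, volume]
        (cyl Ω τ').indicator fun y => χ y.2 * w y) (y + a)) z
      = (κ.normed volume ⋆[ContinuousLinearMap.lsmul ℝ ℝ, volume]
        (cyl Ω τ').indicator fun y => χ y.2 • W y + w y • gradient χ y.2) (z + a) := by
  set k := κ.normed volume with hk
  have hkd : ContDiff ℝ ∞ k := κ.contDiff_normed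
  have hkc : HasCompactSupport k := κ.hasCompactSupport_normed
  set w' := (cyl Ω τ').indicator w with hw'
  set W' := (cyl Ω τ').indicator W with hW'
  have hw'2 : MemLp w' 2 volume := memLp_indicator_cyl ho hw2
  have hW'2 : MemLp W' 2 volume := memLp_indicator_cyl ho hW2
  have hf : ((cyl Ω τ').indicator fun y => χ y.2 * w y) = fun y => χ y.2 * w' y := by
    ext y; by_cases hy : y ∈ cyl Ω τ' <;> simp [w', hy]
  have hF : ((cyl Ω τ').indicator fun y => χ y.2 • W y + w y • gradient χ y.2)
      = fun y => χ y.2 • W' y + w' y • gradient χ y.2 := by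
    ext1 y; by_cases hy : y ∈ cyl Ω τ' <;> simp [w', W', hy]
  rw [hf, hF]
  obtain ⟨C, hC⟩ := hχc.exists_bound_of_continuous hχ.continuous
  have hgc : Continuous (gradient χ) :=
    (InnerProductSpace.toDual ℝ Space).symm.continuous.comp (hχ.continuous_fderiv (by simp))
  have hgs : HasCompactSupport (gradient χ) := by
    refine HasCompactSupport.comp_left (g := (InnerProductSpace.toDual ℝ Space).symm)
      (f := fderiv ℝ χ) (hχc.fderiv (𝕜 := ℝ)) (map_zero _)
  obtain ⟨C', hC'⟩ := hgs.exists_bound_of_continuous hgc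
  have hfl : MemLp (fun y => χ y.2 * w' y) 2 volume :=
    memLp_smul_of_continuous (hχ.continuous.comp continuous_snd) (fun y => hC y.2) hw'2
  have hFl : MemLp (fun y => χ y.2 • W' y + w' y • gradient χ y.2) 2 volume := by
    refine (memLp_smul_of_continuous (hχ.continuous.comp continuous_snd) (fun y => hC y.2)
      hW'2).add ?_
    refine hw'2.of_le_mul (c := C') (hw'2.1.smul (hgc.comp continuous_snd).aestronglyMeasurable)
      (Eventually.of_forall fun y => ?_)
    rw [norm_smul, mul_comm]
    exact mul_le_mul_of_nonneg_right (hC' y.2) (norm_nonneg _)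
  set c := z + a with hc
  -- The derivative of the convolution falls on the kernel k(c - ·). Up to a term with ∇χ it is
  -- minus the derivative of the product ζ, whose support lies in the cylinder by `hsupp`; hence the
  -- weak gradient may be tested with ζ.
  set ζ : ℝ × Space → ℝ := fun y => k (c - y) * χ y.2 with hζ
  have hζd : ContDiff ℝ ∞ ζ :=
    (hkd.comp (contDiff_const.sub contDiff_id)).mul (hχ.comp contDiff_snd)
  have hζs : tsupport ζ ⊆ Metric.closedBall c κ.rOut ∩ (Prod.snd ⁻¹' tsupport χ) := by
    refine closure_minimal (fun y hy => ?_)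
      (Metric.isClosed_closedBall.inter ((isClosed_tsupport χ).preimage continuous_snd))
    rw [Function.mem_support, hζ] at hy
    refine ⟨?_, subset_tsupport _ (right_ne_zero_of_mul hy)⟩
    have h1 : c - y ∈ Function.support k := left_ne_zero_of_mul hy
    rw [hk, κ.support_normed_eq] at h1
    rw [Metric.mem_closedBall, dist_comm, dist_eq_norm]
    exact (mem_ball_zero_iff.1 h1).le
  have hζcyl : tsupport ζ ⊆ cyl Ω τ' := fun y hy =>
    ⟨(hsupp y (hζs hy).1).1, (hsupp y (hζs hy).1).2 (hζs hy).2⟩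
  have hζc : HasCompactSupport ζ :=
    (isCompact_closedBall c κ.rOut).of_isClosed_subset (isClosed_tsupport ζ)
      (hζs.trans inter_subset_left)
  refine ext_inner_right ℝ fun v => ?_
  have hweak : ∫ y, w' y * fderiv ℝ ζ y (0, v) = -∫ y, inner ℝ (W' y) v * ζ y := by
    have h := hw.2.2 ζ ⟨hζd, hζc, hζcyl.trans (cyl_subset_cyl hτ')⟩ v
    rw [← integral_indicator (isOpen_cyl ho T).measurableSet,
      ← integral_indicator (isOpen_cyl ho T).measurableSet] at h
    have e1 : ∀ y, w' y * fderiv ℝ ζ y (0, v)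
        = (cyl Ω T).indicator (fun z => w z * fderiv ℝ ζ z (0, v)) y := fun y => by
      by_cases h1 : y ∈ cyl Ω τ'
      · simp [w', h1, cyl_subset_cyl hτ' h1]
      · have h2 : fderiv ℝ ζ y = 0 := image_eq_zero_of_notMem_tsupport
          (fun h3 => h1 (hζcyl (tsupport_fderiv_subset ℝ h3)))
        by_cases h3 : y ∈ cyl Ω T <;> simp [h2, h3]
    have e2 : ∀ y, inner ℝ (W' y) v * ζ y
        = (cyl Ω T).indicator (fun z => inner ℝ (W z) v * ζ z) y := fun y => by
      by_cases h1 : y ∈ cyl Ω τ'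
      · simp [W', h1, cyl_subset_cyl hτ' h1]
      · have h2 : ζ y = 0 := image_eq_zero_of_notMem_tsupport (fun h3 => h1 (hζcyl h3))
        by_cases h3 : y ∈ cyl Ω T <;> simp [h2, h3]
    simpa only [e1, e2] using h
  have hderiv : ∀ y, fderiv ℝ ζ y (0, v)
      = -(fderiv ℝ k (c - y) (0, v)) * χ y.2 + k (c - y) * fderiv ℝ χ y.2 v := by
    intro y
    have h1 : HasFDerivAt (fun y => k (c - y)) ((fderiv ℝ k (c - y)).comp
        (-(ContinuousLinearMap.id ℝ (ℝ × Space)))) y :=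
      ((hkd.differentiable (by simp) (c - y)).hasFDerivAt).comp y
        ((hasFDerivAt_id y).const_sub c)
    have h2 : HasFDerivAt (fun y : ℝ × Space => χ y.2)
        ((fderiv ℝ χ y.2).comp (ContinuousLinearMap.snd ℝ ℝ Space)) y :=
      ((hχ.differentiable (by simp) y.2).hasFDerivAt).comp y hasFDerivAt_snd
    have h3 : HasFDerivAt ζ _ y := h1.mul h2
    rw [h3.fderiv]
    simp
    ring
  have hL : inner ℝ (spaceGrad (fun y => (k ⋆[ContinuousLinearMap.lsmul ℝ ℝ, volume]
      fun y => χ y.2 * w' y) (y + a)) z) v = ∫ y, fderiv ℝ k (c - y) (0, v) * (χ y.2 * w' y) := by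
    have h1 := hkc.hasFDerivAt_convolution_left (ContinuousLinearMap.lsmul ℝ ℝ)
      (hkd.of_le (by simp)) (hfl.locallyIntegrable (μ := volume) (by norm_num)) c
    rw [inner_spaceGrad, fderiv_comp_add_right, ← hc, h1.fderiv]
    have hex := (hkc.fderiv (𝕜 := ℝ)).convolutionExists_left
      ((ContinuousLinearMap.lsmul ℝ ℝ).precompL (ℝ × Space)) (hkd.continuous_fderiv (by simp))
      (hfl.locallyIntegrable (μ := volume) (by norm_num)) c
    rw [convolution_def, ContinuousLinearMap.integral_apply hex]
    rw [← integral_sub_left_eq_self _ volume c]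
    simp [ContinuousLinearMap.precompL_apply]
  have hR : inner ℝ ((k ⋆[ContinuousLinearMap.lsmul ℝ ℝ, volume]
      fun y => χ y.2 • W' y + w' y • gradient χ y.2) c) v
      = ∫ y, k (c - y) * (χ y.2 * inner ℝ (W' y) v + w' y * fderiv ℝ χ y.2 v) := by
    have hex := hkc.convolutionExists_left (ContinuousLinearMap.lsmul ℝ ℝ) hkd.continuous
      (hFl.locallyIntegrable (μ := volume) (by norm_num)) c
    rw [convolution_def, real_inner_comm, ← integral_inner hex, ← integral_sub_left_eq_self _ volume c]
    refine integral_congr_ae (Eventually.of_forall fun y => ?_)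
    simp [inner_smul_right, inner_add_right, real_inner_comm v]
    ring
  rw [hL, hR]
  have hkL : MemLp (fun y => k (c - y)) 2 (volume : Measure (ℝ × Space)) :=
    (hkd.continuous.memLp_of_hasCompactSupport hkc).comp_measurePreserving
      (Measure.measurePreserving_sub_left volume c)
  have hζv : Continuous fun y => fderiv ℝ ζ y (0, v) :=
    (hζd.continuous_fderiv (by simp)).clm_apply continuous_const
  have i1 : Integrable (fun y => w' y * fderiv ℝ ζ y (0, v)) volume :=
    MemLp.integrable_mul (p := 2) (q := 2) hw'2 (hζv.memLp_of_hasCompactSupport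
      ((hζc.fderiv (𝕜 := ℝ)).comp_left (g := fun L : (ℝ × Space) →L[ℝ] ℝ => L (0, v)) (by simp)))
  have i2 : Integrable (fun y => inner ℝ (W' y) v * ζ y) volume :=
    MemLp.integrable_mul (p := 2) (q := 2) (hW'2.inner_const v) (hζd.continuous.memLp_of_hasCompactSupport hζc)
  have i3 : Integrable (fun y => k (c - y) * (w' y * fderiv ℝ χ y.2 v)) volume := by
    refine MemLp.integrable_mul (p := 2) (q := 2) hkL (hw'2.of_le_mul (c := C' * ‖v‖) ?_ (Eventually.of_forall fun y => ?_))
    · exact hw'2.1.mul (((hχ.continuous_fderiv (by simp)).comp continuous_snd).clm_apply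
        continuous_const).aestronglyMeasurable
    · rw [norm_mul, mul_comm, ← gradient_inner_apply]
      refine mul_le_mul_of_nonneg_right ((norm_inner_le_norm _ _).trans ?_) (norm_nonneg _)
      exact mul_le_mul_of_nonneg_right (hC' y.2) (norm_nonneg _)
  calc ∫ y, fderiv ℝ k (c - y) (0, v) * (χ y.2 * w' y)
      = ∫ y, (k (c - y) * (w' y * fderiv ℝ χ y.2 v) - w' y * fderiv ℝ ζ y (0, v)) := by
        refine integral_congr_ae (Eventually.of_forall fun y => ?_)
        simp only [hderiv]
        ring
    _ = (∫ y, k (c - y) * (w' y * fderiv ℝ χ y.2 v)) + ∫ y, inner ℝ (W' y) v * ζ y := by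
        rw [integral_sub i3 i1, hweak, sub_neg_eq_add]
    _ = _ := by
        rw [← integral_add i3 i2]
        refine integral_congr_ae (Eventually.of_forall fun y => ?_)
        simp only [hζ]
        ring

/-- Extend χw by zero, push it by s • e in space and by 2s in time, and mollify at radius s. Seen
from (0, τ) × Ω, the mollifier meets only points of the larger cylinder or points outside the
support of χ, where the extension has no jump. The gradient of the mollification is therefore the
mollified gradient up to the boundary. -/
theorem smoothApprox_cutoff_mul {Ω : Set Space} {T : ℝ} (ho : IsOpen Ω)
    {w : ℝ × Space → ℝ} {W : ℝ × Space → Space} (hw : IsL2H1 Ω T w W)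
    {χ : Space → ℝ} (hχ : ContDiff ℝ ∞ χ) (hχc : HasCompactSupport χ) {e : Space} {s₀ : ℝ}
    (hs₀ : 0 < s₀) (hshift : ∀ y ∈ Ω, ∀ s ∈ Ioo 0 s₀, ∀ x ∈ Metric.closedBall (y + s • e) s,
      x ∈ tsupport χ → x ∈ Ω) {τ : ℝ} (hτ : τ ∈ Ioo 0 T) :
    SmoothApprox Ω τ (fun z => χ z.2 * w z) (fun z => χ z.2 • W z + w z • gradient χ z.2) := by
  set τ' := (τ + T) / 2 with hτ'
  have hττ' : τ < τ' := by linarith [hτ.2]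
  have hτ'T : τ' < T := by linarith [hτ.2]
  obtain ⟨hw2, hW2⟩ := hw.2 τ' ⟨hτ.1.trans hττ', hτ'T⟩
  obtain ⟨C, hC⟩ := hχc.exists_bound_of_continuous hχ.continuous
  have hgc : Continuous (gradient χ) :=
    (InnerProductSpace.toDual ℝ Space).symm.continuous.comp (hχ.continuous_fderiv (by simp))
  have hgs : HasCompactSupport (gradient χ) :=
    HasCompactSupport.comp_left (g := (InnerProductSpace.toDual ℝ Space).symm)
      (f := fderiv ℝ χ) (hχc.fderiv (𝕜 := ℝ)) (map_zero _)
  obtain ⟨C', hC'⟩ := hgs.exists_bound_of_continuous hgc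
  have hfl : MemLp (fun y : ℝ × Space => χ y.2 * w y) 2 (cylMeasure Ω τ') :=
    memLp_smul_of_continuous (hχ.continuous.comp continuous_snd) (fun y => hC y.2) hw2
  have hFl : MemLp (fun y : ℝ × Space => χ y.2 • W y + w y • gradient χ y.2) 2
      (cylMeasure Ω τ') := by
    refine (memLp_smul_of_continuous (hχ.continuous.comp continuous_snd) (fun y => hC y.2)
      hW2).add ?_
    refine hw2.of_le_mul (c := C') (hw2.1.smul (hgc.comp continuous_snd).aestronglyMeasurable)
      (Eventually.of_forall fun y => ?_)
    rw [norm_smul, mul_comm]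
    exact mul_le_mul_of_nonneg_right (hC' y.2) (norm_nonneg _)
  refine ⟨hfl.mono_measure (cylMeasure_mono hττ'.le), hFl.mono_measure (cylMeasure_mono hττ'.le), ?_⟩
  set f := (cyl Ω τ').indicator fun y => χ y.2 * w y with hf
  set F := (cyl Ω τ').indicator fun y => χ y.2 • W y + w y • gradient χ y.2 with hF
  have hf2 : MemLp f 2 volume := memLp_indicator_cyl ho hfl
  have hF2 : MemLp F 2 volume := memLp_indicator_cyl ho hFl
  -- Mollification at radius s after a time shift by 2s uses the times from t + s to t + 3s. For t
  -- in (0, τ) these are positive, and s < (T - τ) / 6 keeps them below τ' = (τ + T) / 2.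
  set s₁ := min s₀ ((T - τ) / 6) with hs₁
  have hs₁pos : 0 < s₁ := lt_min hs₀ (by linarith [hτ.2])
  let s : ℕ → ℝ := fun k => s₁ / (k + 2)
  have hspos : ∀ k, 0 < s k := fun k => by positivity
  have hslt : ∀ k, s k < s₁ := fun k => by
    rw [div_lt_iff₀ (by positivity)]
    nlinarith [(Nat.cast_nonneg k : (0 : ℝ) ≤ k)]
  have hslim : Tendsto s atTop (𝓝 0) := by
    have : Tendsto (fun k : ℕ => (k : ℝ) + 2) atTop atTop :=
      tendsto_atTop_add_const_right _ _ tendsto_natCast_atTop_atTop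
    exact this.const_div_atTop s₁
  let κ : ℕ → ContDiffBump (0 : ℝ × Space) := fun k =>
    ⟨s k / 2, s k, half_pos (hspos k), half_lt_self (hspos k)⟩
  let a : ℕ → ℝ × Space := fun k => (2 * s k, s k • e)
  have halim : Tendsto a atTop (𝓝 0) := by
    have h1 : Tendsto (fun k => 2 * s k) atTop (𝓝 0) := by simpa using hslim.const_mul 2
    have h2 : Tendsto (fun k => s k • e) atTop (𝓝 0) := by simpa using hslim.smul_const e
    exact h1.prodMk_nhds h2
  refine ⟨fun k y => ((κ k).normed volume ⋆[ContinuousLinearMap.lsmul ℝ ℝ, volume] f) (y + a k),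
    fun k => ?_, ?_, ?_⟩
  · exact ((κ k).hasCompactSupport_normed.contDiff_convolution_left _ (κ k).contDiff_normed
      (hf2.locallyIntegrable (by norm_num))).comp (contDiff_id.add contDiff_const)
  · refine tendsto_of_tendsto_of_tendsto_of_le_of_le tendsto_const_nhds
      (tendsto_eLpNorm_shifted_convolution hf2 (κ := κ) hslim halim) (fun _ => zero_le) fun k => ?_
    refine le_trans (le_of_eq ?_) (eLpNorm_mono_measure _ (Measure.restrict_le_self (s := cyl Ω τ)))
    refine eLpNorm_congr_ae (ae_restrict_of_forall_mem (isOpen_cyl ho τ).measurableSet fun z hz => ?_)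
    simp [hf, cyl_subset_cyl hττ'.le hz]
  · refine tendsto_of_tendsto_of_tendsto_of_le_of_le tendsto_const_nhds
      (tendsto_eLpNorm_shifted_convolution hF2 (κ := κ) hslim halim) (fun _ => zero_le) fun k => ?_
    refine le_trans (le_of_eq ?_) (eLpNorm_mono_measure _ (Measure.restrict_le_self (s := cyl Ω τ)))
    refine eLpNorm_congr_ae (ae_restrict_of_forall_mem (isOpen_cyl ho τ).measurableSet fun z hz => ?_)
    have key := spaceGrad_shifted_convolution ho hτ'T.le hw.1 hw2 hW2 hχ hχc (κ k) (a k) z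
      (fun y hy => ?_)
    · simp only [Pi.sub_apply]
      rw [key]
      simp [hF, cyl_subset_cyl hττ'.le hz]
    · have hy' : dist y (z + a k) ≤ s k := hy
      rw [Prod.dist_eq, max_le_iff] at hy'
      have hd := abs_le.1 (by simpa [Real.dist_eq] using hy'.1 : |y.1 - (z.1 + (a k).1)| ≤ s k)
      have hb1 : s k < (T - τ) / 6 := (hslt k).trans_le (min_le_right _ _)
      have ha1 : (a k).1 = 2 * s k := rfl
      refine ⟨⟨?_, ?_⟩, fun hyχ => ?_⟩
      · linarith [hz.1.1, hspos k]
      · linarith [hz.1.2]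
      · exact hshift z.2 hz.2 (s k) ⟨hspos k, (hslt k).trans_le (min_le_left _ _)⟩ y.2 hy'.2 hyχ

/-- Near each point of the closure of a Lipschitz domain, there is a direction that points into the
domain, uniformly. -/
theorem IsLipschitzDomain.exists_inward_shift {Ω : Set Space} (hΩ : IsLipschitzDomain Ω) {x : Space}
    (hx : x ∈ closure Ω) : ∃ (e : Space) (r : ℝ), 0 < r ∧
      ∀ y ∈ Ω, y ∈ Metric.ball x r → ∀ s ∈ Ioo 0 r, Metric.closedBall (y + s • e) s ⊆ Ω := by
  by_cases hxΩ : x ∈ Ω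
  · obtain ⟨R, hR, hball⟩ := Metric.isOpen_iff.1 hΩ.isOpen x hxΩ
    refine ⟨0, R / 2, half_pos hR, fun y _ hy s hs p hp => hball ?_⟩
    rw [smul_zero, add_zero, Metric.mem_closedBall] at hp
    rw [Metric.mem_ball] at hy ⊢
    linarith [dist_triangle p y x, hs.2]
  · obtain ⟨A, γ, K, R, hR, hγ, hloc⟩ := hΩ.lipschitzBoundary x
      (by rw [frontier, hΩ.isOpen.interior_eq]; exact ⟨hx, hxΩ⟩)
    set e₃ : Space := EuclideanSpace.single 2 1 with he₃
    have hnorm : ‖e₃‖ = 1 := by simp [e₃]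
    have hK : (0 : ℝ) ≤ K := K.2
    -- In the direction of the graph the shift gains s (K + 2). A displacement of length at most s
    -- loses at most s in height, and the graph rises by at most K s. The radius R / (K + 4) keeps
    -- all points in the ball where the graph describes Ω.
    refine ⟨((K : ℝ) + 2) • A.symm e₃, R / (K + 4), by positivity, fun y hy hyx s hs p hp => ?_⟩
    have hRK : R / (K + 4) * (K + 4) = R := by field_simp
    have hyR : dist y x < R / (K + 4) := hyx
    set q := p - (y + s • ((K : ℝ) + 2) • A.symm e₃) with hq
    have hqs : ‖q‖ ≤ s := by rw [hq, ← dist_eq_norm]; exact hp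
    have hpy : p = y + s • ((K : ℝ) + 2) • A.symm e₃ + q := by rw [hq]; abel
    have hpyn : dist p y ≤ s * (K + 3) := by
      rw [dist_eq_norm, hpy]
      have : y + s • ((K : ℝ) + 2) • A.symm e₃ + q - y = s • ((K : ℝ) + 2) • A.symm e₃ + q := by abel
      rw [this]
      refine (norm_add_le _ _).trans ?_
      rw [norm_smul, norm_smul, LinearIsometryEquiv.norm_map, hnorm, Real.norm_of_nonneg hs.1.le,
        Real.norm_of_nonneg (by positivity)]
      linarith
    have hpR : p ∈ Metric.ball x R := by
      rw [Metric.mem_ball]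
      nlinarith [dist_triangle p y x, hs.1, hs.2]
    have hyR' : y ∈ Metric.ball x R := by
      rw [Metric.mem_ball]
      have : 0 ≤ R / (K + 4) * (K + 3) := by positivity
      linarith
    rw [hloc p hpR]
    have hyl := (hloc y hyR').1 hy
    have hAp : A p = A y + (s * (K + 2)) • e₃ + A q := by
      rw [hpy, map_add, map_add, map_smul, map_smul, LinearIsometryEquiv.apply_symm_apply, smul_smul]
    have hAq : ‖A q‖ ≤ s := by rwa [LinearIsometryEquiv.norm_map]
    have hc2 : |(A q) 2| ≤ s := (by simpa using PiLp.norm_apply_le (A q) 2 : |(A q) 2| ≤ ‖A q‖).trans hAq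
    have h2 : (A p) 2 = (A y) 2 + s * (K + 2) + (A q) 2 := by rw [hAp]; simp [e₃]
    have h0 : (A p) 0 = (A y) 0 + (A q) 0 := by rw [hAp]; simp [e₃]
    have h1 : (A p) 1 = (A y) 1 + (A q) 1 := by rw [hAp]; simp [e₃]
    have hd : dist (!₂[(A p) 0, (A p) 1] : EuclideanSpace ℝ (Fin 2)) !₂[(A y) 0, (A y) 1] ≤ s := by
      refine le_trans ?_ hAq
      rw [EuclideanSpace.dist_eq, EuclideanSpace.norm_eq]
      refine Real.sqrt_le_sqrt ?_
      simp only [Fin.sum_univ_two, Fin.sum_univ_three, h0, h1, Real.dist_eq, Real.norm_eq_abs, sq_abs]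
      simp
      nlinarith [sq_nonneg ((A q) 2)]
    have hγd := hγ.dist_le_mul (!₂[(A p) 0, (A p) 1]) (!₂[(A y) 0, (A y) 1])
    rw [Real.dist_eq] at hγd
    have := (abs_le.1 hγd).2
    have h3 : (K : ℝ) * dist (!₂[(A p) 0, (A p) 1] : EuclideanSpace ℝ (Fin 2)) !₂[(A y) 0, (A y) 1]
        ≤ K * s := mul_le_mul_of_nonneg_left hd hK
    rw [h2]
    nlinarith [(abs_le.1 hc2).1, hs.1]

/-- In a Lipschitz domain, functions in `L²(0, τ; H¹(Ω))` are limits of smooth functions. -/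
theorem IsL2H1.smoothApprox {Ω : Set Space} (hΩ : IsLipschitzDomain Ω) {T : ℝ}
    {w : ℝ × Space → ℝ} {W : ℝ × Space → Space} (hw : IsL2H1 Ω T w W) {τ : ℝ} (hτ : τ ∈ Ioo 0 T) :
    SmoothApprox Ω τ w W := by
  have hcomp : IsCompact (closure Ω) := hΩ.isBounded.isCompact_closure
  choose! e r hr hshift using fun (x : Space) (hx : x ∈ closure Ω) => hΩ.exists_inward_shift hx
  obtain ⟨t, htΩ, htc⟩ := hcomp.elim_nhds_subcover (fun x => Metric.ball x (r x / 2))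
    fun x hx => Metric.ball_mem_nhds x (half_pos (hr x hx))
  obtain ⟨f, hf⟩ := SmoothPartitionOfUnity.exists_isSubordinate (modelWithCornersSelf ℝ Space)
    (isClosed_closure (s := Ω)) (fun i : t => Metric.ball (i : Space) (r i / 2))
    (fun i => Metric.isOpen_ball) (fun x hx => by
      obtain ⟨i, hi, hxi⟩ := mem_iUnion₂.1 (htc hx)
      exact mem_iUnion.2 ⟨⟨i, hi⟩, hxi⟩)
  have hfd : ∀ i, ContDiff ℝ ∞ (f i) := fun i => (f i).contMDiff.contDiff
  have hfc : ∀ i, HasCompactSupport (f i) := fun i =>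
    (isCompact_closedBall (i : Space) (r i / 2)).of_isClosed_subset (isClosed_tsupport _)
      ((hf i).trans Metric.ball_subset_closedBall)
  have hsum : ∀ x ∈ closure Ω, ∑ i, f i x = 1 := fun x hx => by
    rw [← finsum_eq_sum_of_fintype]; exact f.sum_eq_one hx
  have happ := SmoothApprox.sum (Finset.univ : Finset t)
    (w := fun i z => f i z.2 * w z) (W := fun i z => f i z.2 • W z + w z • gradient (f i) z.2)
    fun i _ => by
      have hi := htΩ i i.2
      have hri := hr i hi
      -- Points in the support of f_i lie within r_i / 2 of the centre. The choice of s₀ makes s (1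
      -- + ‖e_i‖) < r_i / 2, so the unshifted point lies within r_i and the inward shift applies to
      -- it.
      refine smoothApprox_cutoff_mul hΩ.isOpen hw (hfd i) (hfc i) (e := e i)
        (s₀ := r i / (2 * (‖e i‖ + 2))) (by positivity) (fun y hy s hs x hx hxs => ?_) hτ
      have hxi : dist x i < r i / 2 := hf i hxs
      have hs2 : s * (2 * (‖e i‖ + 2)) < r i := (lt_div_iff₀ (by positivity)).1 hs.2
      have hxy : dist y x ≤ s + s * ‖e i‖ := by
        have h1 : dist x (y + s • e i) ≤ s := hx
        have h2 : dist (y + s • e i) y = s * ‖e i‖ := by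
          rw [dist_eq_norm, add_sub_cancel_left, norm_smul, Real.norm_of_nonneg hs.1.le]
        rw [dist_comm]
        linarith [dist_triangle x (y + s • e i) y]
      refine hshift i hi y hy ?_ s ⟨hs.1, ?_⟩ hx
      · rw [Metric.mem_ball]
        nlinarith [dist_triangle y x i, hs.1]
      · nlinarith [hs.1, norm_nonneg (e i)]
  refine happ.congr ?_ ?_
  · refine ae_restrict_of_forall_mem (isOpen_cyl hΩ.isOpen τ).measurableSet fun z hz => ?_
    simp only
    rw [← Finset.sum_mul, hsum z.2 (subset_closure hz.2), one_mul]
  · refine ae_restrict_of_forall_mem (isOpen_cyl hΩ.isOpen τ).measurableSet fun z hz => ?_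
    simp only
    rw [Finset.sum_add_distrib, ← Finset.sum_smul, hsum z.2 (subset_closure hz.2), one_smul,
      ← Finset.smul_sum]
    have hg : ∑ i, gradient (f i) z.2 = 0 := by
      refine ext_inner_right ℝ fun v => ?_
      rw [sum_inner, inner_zero_left]
      simp only [gradient_inner_apply]
      have h1 : HasFDerivAt (fun x => ∑ i, f i x) (∑ i, fderiv ℝ (f i) z.2) z.2 :=
        HasFDerivAt.fun_sum fun i _ => ((hfd i).differentiable (by simp) z.2).hasFDerivAt
      have h2 : HasFDerivAt (fun x => ∑ i, f i x) (0 : Space →L[ℝ] ℝ) z.2 :=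
        (hasFDerivAt_const (1 : ℝ) z.2).congr_of_eventuallyEq
          (Filter.eventuallyEq_of_mem (hΩ.isOpen.mem_nhds hz.2) fun x hx =>
            hsum x (subset_closure hx))
      have h3 := DFunLike.congr_fun (h1.unique h2) v
      simpa using h3
    rw [hg, smul_zero, add_zero]

/-! ### Chain rule -/

section ChainRule

variable {ι : Type*} [Fintype ι]

/-- `∑ b, L(e_b) G_b`: the gradient of a function with differential `L` of quantities with
gradients `G b`. -/
def liftGrad [DecidableEq ι] (L : (ι → ℝ) →L[ℝ] ℝ) (G : ι → Space) : Space :=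
  ∑ b, L (Pi.single b 1) • G b

variable [DecidableEq ι]

theorem clm_apply_eq_sum (L : (ι → ℝ) →L[ℝ] ℝ) (y : ι → ℝ) :
    L y = ∑ b, L (Pi.single b 1) * y b := by
  conv_lhs => rw [pi_eq_sum_univ' y]
  simp [mul_comm]

theorem inner_liftGrad (L : (ι → ℝ) →L[ℝ] ℝ) (G : ι → Space) (v : Space) :
    inner ℝ (liftGrad L G) v = L fun b => inner ℝ (G b) v := by
  rw [clm_apply_eq_sum L, liftGrad, sum_inner]
  simp [real_inner_smul_left]

theorem norm_liftGrad_le (L : (ι → ℝ) →L[ℝ] ℝ) (G : ι → Space) :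
    ‖liftGrad L G‖ ≤ ‖L‖ * ∑ b, ‖G b‖ := by
  rw [liftGrad, Finset.mul_sum]
  refine (norm_sum_le _ _).trans (Finset.sum_le_sum fun b _ => ?_)
  rw [norm_smul]
  refine mul_le_mul_of_nonneg_right ((L.le_opNorm _).trans ?_) (norm_nonneg _)
  rw [Pi.norm_single]
  simp

theorem liftGrad_sub_left (L L' : (ι → ℝ) →L[ℝ] ℝ) (G : ι → Space) :
    liftGrad (L - L') G = liftGrad L G - liftGrad L' G := by
  simp [liftGrad, sub_smul]

theorem liftGrad_sub_right (L : (ι → ℝ) →L[ℝ] ℝ) (G G' : ι → Space) :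
    liftGrad L (fun b => G b - G' b) = liftGrad L G - liftGrad L G' := by
  simp [liftGrad, smul_sub]

theorem spaceGrad_comp {g : (ι → ℝ) → ℝ} (hg : ContDiff ℝ ∞ g) {φ : ι → ℝ × Space → ℝ}
    (hφ : ∀ b, ContDiff ℝ ∞ (φ b)) (z : ℝ × Space) :
    spaceGrad (fun z => g fun b => φ b z) z
      = liftGrad (fderiv ℝ g fun b => φ b z) fun b => spaceGrad (φ b) z := by
  refine ext_inner_right ℝ fun v => ?_
  have h1 : HasFDerivAt (fun z b => φ b z) (ContinuousLinearMap.pi fun b => fderiv ℝ (φ b) z) z :=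
    hasFDerivAt_pi.2 fun b => ((hφ b).differentiable (by simp) z).hasFDerivAt
  have h2 := ((hg.differentiable (by simp) (fun b => φ b z)).hasFDerivAt).comp z h1
  rw [inner_spaceGrad, inner_liftGrad]
  change fderiv ℝ (g ∘ fun z b => φ b z) z (0, v) = _
  rw [h2.fderiv]
  simp only [ContinuousLinearMap.comp_apply, inner_spaceGrad]
  rfl

theorem aestronglyMeasurable_liftGrad {α : Type*} [MeasurableSpace α] {μ : Measure α}
    {L : α → (ι → ℝ) →L[ℝ] ℝ} (hL : AEStronglyMeasurable L μ) {G : ι → α → Space}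
    (hG : ∀ b, AEStronglyMeasurable (G b) μ) :
    AEStronglyMeasurable (fun z => liftGrad (L z) fun b => G b z) μ := by
  refine Finset.aestronglyMeasurable_fun_sum _ fun b _ => ?_
  have h1 : AEStronglyMeasurable (fun z => L z (Pi.single b 1)) μ :=
    ((ContinuousLinearMap.apply ℝ ℝ (Pi.single b (1 : ℝ) : ι → ℝ)).continuous
      ).comp_aestronglyMeasurable hL
  exact h1.smul (hG b)

theorem eLpNorm_sum_norm_le {α : Type*} [MeasurableSpace α] {μ : Measure α} {F : Type*}
    [NormedAddCommGroup F] {f : ι → α → F} (hf : ∀ b, AEStronglyMeasurable (f b) μ) :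
    eLpNorm (fun z => ∑ b, ‖f b z‖) 2 μ ≤ ∑ b, eLpNorm (f b) 2 μ := by
  have : (fun z => ∑ b, ‖f b z‖) = ∑ b, fun z => ‖f b z‖ := by ext z; simp
  rw [this]
  refine (eLpNorm_sum_le (fun b _ => (hf b).norm) (by norm_num)).trans ?_
  exact Finset.sum_le_sum fun b _ => (eLpNorm_norm _).le

/-- Along a subsequence the approximations φ_k converge almost everywhere. The gradient error splits
into g'(φ_k) (∇φ_k - G), small in L² because g' is bounded, and (g'(φ_k) - g'(f)) G, which tends to
zero by dominated convergence. -/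
theorem SmoothApprox.comp {Ω : Set Space} (hb : Bornology.IsBounded Ω) {τ : ℝ}
    {f : ι → ℝ × Space → ℝ} {G : ι → ℝ × Space → Space} (h : ∀ b, SmoothApprox Ω τ (f b) (G b))
    {g : (ι → ℝ) → ℝ} (hg : ContDiff ℝ ∞ g) (hgc : HasCompactSupport g) :
    SmoothApprox Ω τ (fun z => g fun b => f b z)
      (fun z => liftGrad (fderiv ℝ g fun b => f b z) fun b => G b z) := by
  have := isFiniteMeasure_cylMeasure hb τ
  set μ := cylMeasure Ω τ with hμ
  choose m1 m2 φ hφ c1 c2 using h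
  obtain ⟨C, hC⟩ := hgc.exists_bound_of_continuous hg.continuous
  have hg'c : Continuous (fderiv ℝ g) := hg.continuous_fderiv (by simp)
  obtain ⟨L, hL⟩ := (hgc.fderiv (𝕜 := ℝ)).exists_bound_of_continuous hg'c
  have hfm : AEStronglyMeasurable (fun z b => f b z) μ :=
    (aemeasurable_pi_lambda _ fun b => (m1 b).1.aemeasurable).aestronglyMeasurable
  have hΓm : AEStronglyMeasurable
      (fun z => liftGrad (fderiv ℝ g fun b => f b z) fun b => G b z) μ :=
    aestronglyMeasurable_liftGrad (hg'c.comp_aestronglyMeasurable hfm) fun b => (m2 b).1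
  have hGsum : MemLp (fun z => ∑ b, ‖G b z‖) 2 μ := memLp_finsetSum _ fun b _ => (m2 b).norm
  have hSm : ∀ k, ∀ b, AEStronglyMeasurable (φ b k - f b) μ := fun k b =>
    (hφ b k).continuous.aestronglyMeasurable.sub (m1 b).1
  have hS : Tendsto (fun k => eLpNorm (fun z => ∑ b, ‖(φ b k - f b) z‖) 2 μ) atTop (𝓝 0) := by
    have h1 : Tendsto (fun k => ∑ b, eLpNorm (φ b k - f b) 2 μ) atTop (𝓝 0) := by
      simpa using tendsto_finsetSum Finset.univ fun b _ => c1 b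
    exact tendsto_of_tendsto_of_tendsto_of_le_of_le tendsto_const_nhds h1 (fun _ => zero_le)
      fun k => eLpNorm_sum_norm_le (hSm k)
  have hSm' : ∀ k, AEStronglyMeasurable (fun z => ∑ b, ‖(φ b k - f b) z‖) μ := fun k =>
    Finset.aestronglyMeasurable_fun_sum _ fun b _ => (hSm k b).norm
  obtain ⟨ns, hns, hae⟩ := (tendstoInMeasure_of_tendsto_eLpNorm (p := 2) (by norm_num) hSm'
    (aestronglyMeasurable_const (b := (0 : ℝ))) (by
      refine hS.congr fun k => ?_
      congr 1
      ext z
      simp)).exists_seq_tendsto_ae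
  have hnst := hns.tendsto_atTop
  have hlim : ∀ᵐ z ∂μ, Tendsto (fun k b => φ b (ns k) z) atTop (𝓝 fun b => f b z) := by
    filter_upwards [hae] with z hz
    refine tendsto_pi_nhds.2 fun b => tendsto_iff_norm_sub_tendsto_zero.2 ?_
    refine squeeze_zero (fun _ => norm_nonneg _) (fun k => ?_) hz
    exact Finset.single_le_sum (f := fun b => ‖(φ b (ns k) - f b) z‖)
      (fun b _ => norm_nonneg _) (Finset.mem_univ b)
  refine ⟨MemLp.of_bound (hg.continuous.comp_aestronglyMeasurable hfm) C
    (Eventually.of_forall fun z => hC _), ?_, fun k z => g fun b => φ b (ns k) z,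
    fun k => hg.comp (contDiff_pi.2 fun b => hφ b _), ?_, ?_⟩
  · refine hGsum.of_le_mul (c := L) hΓm (Eventually.of_forall fun z => ?_)
    refine (norm_liftGrad_le _ _).trans (mul_le_mul (hL _) (le_abs_self _) ?_ ?_)
    · exact Finset.sum_nonneg fun b _ => norm_nonneg _
    · exact (norm_nonneg _).trans (hL 0)
  · refine tendsto_eLpNorm_two_of_dominated (b := fun _ => 2 * C) (fun k => ?_)
      (memLp_const _) (fun k => Eventually.of_forall fun z => ?_) ?_
    · exact ((hg.comp (contDiff_pi.2 fun b => hφ b _)).continuous.aestronglyMeasurable).sub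
        (hg.continuous.comp_aestronglyMeasurable hfm)
    · refine (norm_sub_le _ _).trans ?_
      linarith [hC (fun b => φ b (ns k) z), hC (fun b => f b z)]
    · filter_upwards [hlim] with z hz
      have := ((hg.continuous.tendsto _).comp hz).sub_const (g fun b => f b z)
      simpa using this
  · have hA : Tendsto (fun k => ENNReal.ofReal L *
        ∑ b, eLpNorm (spaceGrad (φ b (ns k)) - G b) 2 μ) atTop (𝓝 0) := by
      have h1 : Tendsto (fun k => ∑ b, eLpNorm (spaceGrad (φ b (ns k)) - G b) 2 μ) atTop (𝓝 0) := by
        simpa using tendsto_finsetSum Finset.univ fun b _ => (c2 b).comp hnst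
      simpa using ENNReal.Tendsto.const_mul h1 (Or.inr ENNReal.ofReal_ne_top)
    have hB : Tendsto (fun k => eLpNorm (fun z =>
        liftGrad (fderiv ℝ g (fun b => φ b (ns k) z) - fderiv ℝ g fun b => f b z)
          fun b => G b z) 2 μ) atTop (𝓝 0) := by
      refine tendsto_eLpNorm_two_of_dominated (b := fun z => (2 * L) * ∑ b, ‖G b z‖) (fun k => ?_)
        (hGsum.const_mul _) (fun k => Eventually.of_forall fun z => ?_) ?_
      · refine aestronglyMeasurable_liftGrad ?_ fun b => (m2 b).1
        exact (hg'c.comp_aestronglyMeasurable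
          (contDiff_pi.2 fun b => hφ b (ns k)).continuous.aestronglyMeasurable).sub
          (hg'c.comp_aestronglyMeasurable hfm)
      · refine (norm_liftGrad_le _ _).trans (mul_le_mul_of_nonneg_right ?_
          (Finset.sum_nonneg fun b _ => norm_nonneg _))
        refine (norm_sub_le _ _).trans ?_
        linarith [hL (fun b => φ b (ns k) z), hL (fun b => f b z)]
      · filter_upwards [hlim] with z hz
        have h1 : Tendsto (fun k => ‖fderiv ℝ g (fun b => φ b (ns k) z) - fderiv ℝ g fun b => f b z‖
            * ∑ b, ‖G b z‖) atTop (𝓝 0) := by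
          have := (tendsto_iff_norm_sub_tendsto_zero.1 ((hg'c.tendsto _).comp hz)).mul_const
            (∑ b, ‖G b z‖)
          simpa using this
        exact squeeze_zero_norm (fun k => norm_liftGrad_le _ _) h1
    have hAB := hA.add hB
    rw [add_zero] at hAB
    refine tendsto_of_tendsto_of_tendsto_of_le_of_le tendsto_const_nhds hAB
      (fun _ => zero_le) fun k => ?_
    have hdm : ∀ b, AEStronglyMeasurable (spaceGrad (φ b (ns k)) - G b) μ := fun b =>
      (continuous_spaceGrad (hφ b _)).aestronglyMeasurable.sub (m2 b).1
    have hm1 : AEStronglyMeasurable (fun z => liftGrad (fderiv ℝ g fun b => φ b (ns k) z)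
        fun b => (spaceGrad (φ b (ns k)) - G b) z) μ :=
      aestronglyMeasurable_liftGrad (hg'c.comp_aestronglyMeasurable
        (contDiff_pi.2 fun b => hφ b (ns k)).continuous.aestronglyMeasurable) hdm
    have hm2 : AEStronglyMeasurable (fun z =>
        liftGrad (fderiv ℝ g (fun b => φ b (ns k) z) - fderiv ℝ g fun b => f b z)
          fun b => G b z) μ :=
      aestronglyMeasurable_liftGrad ((hg'c.comp_aestronglyMeasurable
        (contDiff_pi.2 fun b => hφ b (ns k)).continuous.aestronglyMeasurable).sub
        (hg'c.comp_aestronglyMeasurable hfm)) fun b => (m2 b).1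
    refine le_trans (le_of_eq ?_) ((eLpNorm_add_le hm1 hm2 (by norm_num)).trans
      (add_le_add_left ?_ _))
    · congr 1
      ext1 z
      simp only [Pi.sub_apply, Pi.add_apply]
      rw [spaceGrad_comp hg fun b => hφ b _, liftGrad_sub_left, liftGrad_sub_right]
      abel
    · refine le_trans (eLpNorm_le_mul_eLpNorm_of_ae_le_mul (c := L)
        (g := fun z => ∑ b, ‖(spaceGrad (φ b (ns k)) - G b) z‖) (Eventually.of_forall fun z => ?_) 2) ?_
      · refine (norm_liftGrad_le _ _).trans (mul_le_mul (hL _) (le_abs_self _) ?_ ?_)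
        · exact Finset.sum_nonneg fun b _ => norm_nonneg _
        · exact (norm_nonneg _).trans (hL 0)
      · exact mul_le_mul_right (eLpNorm_sum_norm_le hdm) _

/-- A function that is smooth near a compact set agrees near this set with a smooth function of
compact support. -/
theorem exists_contDiff_hasCompactSupport_eventuallyEq {V : Type*} [NormedAddCommGroup V]
    [NormedSpace ℝ V] [FiniteDimensional ℝ V] {P O : Set V} (hP : IsCompact P) (hO : IsOpen O)
    (hPO : P ⊆ O) {g : V → ℝ} (hg : ContDiffOn ℝ ∞ g O) :
    ∃ g' : V → ℝ, ContDiff ℝ ∞ g' ∧ HasCompactSupport g' ∧ ∀ y ∈ P, g' =ᶠ[𝓝 y] g := by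
  obtain ⟨K, hK, hPK, hKO⟩ := exists_compact_between hP hO hPO
  obtain ⟨χ, h1, h0, -⟩ := exists_contMDiffMap_one_nhds_of_subset_interior
    (modelWithCornersSelf ℝ V) (n := ⊤) hP.isClosed hPK
  have hχd : ContDiff ℝ ∞ χ := χ.contMDiff.contDiff
  have hχs : tsupport χ ⊆ K := closure_minimal
    (fun x hx => by by_contra h; exact hx (h0 x h)) hK.isClosed
  have hχc : HasCompactSupport χ := hK.of_isClosed_subset (isClosed_tsupport _) hχs
  refine ⟨fun y => χ y * g y, contDiff_iff_contDiffAt.2 fun y => ?_, hχc.mul_right, fun y hy => ?_⟩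
  · by_cases hy : y ∈ O
    · exact hχd.contDiffAt.mul (hg.contDiffAt (hO.mem_nhds hy))
    · have : (fun y => χ y * g y) =ᶠ[𝓝 y] fun _ => 0 := by
        filter_upwards [(isClosed_tsupport χ).isOpen_compl.mem_nhds fun h => hy (hKO (hχs h))]
          with x hx
        rw [image_eq_zero_of_notMem_tsupport hx, zero_mul]
      exact contDiffAt_const.congr_of_eventuallyEq this
  · filter_upwards [h1.filter_mono (nhds_le_nhdsSet hy)] with x hx
    rw [hx, one_mul]

/-- Chain rule for functions with values in a compact set near which the outer function is
smooth. -/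
theorem SmoothApprox.comp_of_mem {Ω : Set Space} (hb : Bornology.IsBounded Ω) {τ : ℝ}
    {f : ι → ℝ × Space → ℝ} {G : ι → ℝ × Space → Space} (h : ∀ b, SmoothApprox Ω τ (f b) (G b))
    {P O : Set (ι → ℝ)} (hP : IsCompact P) (hO : IsOpen O) (hPO : P ⊆ O)
    (hf : ∀ᵐ z ∂cylMeasure Ω τ, (fun b => f b z) ∈ P)
    {g : (ι → ℝ) → ℝ} (hg : ContDiffOn ℝ ∞ g O) :
    SmoothApprox Ω τ (fun z => g fun b => f b z)
      (fun z => liftGrad (fderiv ℝ g fun b => f b z) fun b => G b z) := by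
  obtain ⟨g', hg', hgc, heq⟩ := exists_contDiff_hasCompactSupport_eventuallyEq hP hO hPO hg
  refine (SmoothApprox.comp hb h hg' hgc).congr ?_ ?_
  · filter_upwards [hf] with z hz using (heq _ hz).eq_of_nhds
  · filter_upwards [hf] with z hz
    rw [(heq _ hz).fderiv_eq]

end ChainRule

/-! ### Functions with vanishing spatial gradient -/

/-- Limits of smooth functions are weakly differentiable. -/
theorem SmoothApprox.hasWeakGrad {Ω : Set Space} (ho : IsOpen Ω) (hb : Bornology.IsBounded Ω)
    {τ : ℝ} {w : ℝ × Space → ℝ} {W : ℝ × Space → Space} (h : SmoothApprox Ω τ w W) :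
    HasWeakGrad Ω τ w W := by
  have := isFiniteMeasure_cylMeasure hb τ
  obtain ⟨m1, m2, φ, hφ, c1, c2⟩ := h
  have i1 : IntegrableOn w (cyl Ω τ) volume := m1.integrable (by norm_num)
  have i2 : IntegrableOn W (cyl Ω τ) volume := m2.integrable (by norm_num)
  refine ⟨i1.locallyIntegrableOn, i2.locallyIntegrableOn, fun ζ hζ v => ?_⟩
  obtain ⟨hζd, hζc, hζs⟩ := hζ
  have hζv : Continuous fun z => fderiv ℝ ζ z (0, v) :=
    (hζd.continuous_fderiv (by simp)).clm_apply continuous_const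
  have hζvs : HasCompactSupport fun z => fderiv ℝ ζ z (0, v) :=
    (hζc.fderiv (𝕜 := ℝ)).comp_left (g := fun L : (ℝ × Space) →L[ℝ] ℝ => L (0, v)) (by simp)
  have key : ∀ k, ∫ z in cyl Ω τ, fderiv ℝ ζ z (0, v) * φ k z
      = -∫ z in cyl Ω τ, inner ℝ (ζ z • v) (spaceGrad (φ k) z) := by
    intro k
    have hφv : Continuous fun z => fderiv ℝ (φ k) z (0, v) :=
      ((hφ k).continuous_fderiv (by simp)).clm_apply continuous_const
    rw [setIntegral_eq_integral_of_forall_compl_eq_zero fun z hz => ?_,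
      setIntegral_eq_integral_of_forall_compl_eq_zero fun z hz => ?_]
    · have := integral_mul_fderiv_eq_neg_fderiv_mul_of_integrable (μ := (volume : Measure (ℝ × Space)))
        (f := φ k) (g := ζ) (v := (0, v))
        ((hφv.mul hζd.continuous).integrable_of_hasCompactSupport hζc.mul_left)
        (((hφ k).continuous.mul hζv).integrable_of_hasCompactSupport hζvs.mul_left)
        (((hφ k).continuous.mul hζd.continuous).integrable_of_hasCompactSupport hζc.mul_left)
        (fun z _ => (hφ k).differentiable (by simp) z) (fun z _ => hζd.differentiable (by simp) z)
      simp only [real_inner_smul_left, real_inner_comm _ v, inner_spaceGrad]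
      simpa only [mul_comm] using this
    · rw [image_eq_zero_of_notMem_tsupport fun h => hz (hζs h), zero_smul, inner_zero_left]
    · rw [show fderiv ℝ ζ z = 0 from image_eq_zero_of_notMem_tsupport fun h =>
        hz (hζs (tsupport_fderiv_subset ℝ h))]
      simp
  have l1 := tendsto_integral_mul (memLp_of_continuous hb τ hζv 2 ho) m1
    (fun k => memLp_of_continuous hb τ (hφ k).continuous 2 ho) c1
  have l2 := (tendsto_integral_inner
    (memLp_of_continuous hb τ (hζd.continuous.smul (continuous_const (y := v))) 2 ho) m2
    (fun k => memLp_of_continuous hb τ (continuous_spaceGrad (hφ k)) 2 ho) c2).neg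
  have h3 := tendsto_nhds_unique l1 (l2.congr fun k => (key k).symm)
  simpa only [cylMeasure, Pi.smul_apply', real_inner_smul_left, real_inner_comm _ v, mul_comm] using h3

/-- A function with vanishing gradient in space on a connected domain depends on time only. -/
theorem exists_eq_of_weakGrad_eq_zero {Ω : Set Space} (ho : IsOpen Ω)
    (hb : Bornology.IsBounded Ω) (hc : IsConnected Ω) {τ : ℝ} {p : ℝ × Space → ℝ}
    (hp : SmoothApprox Ω τ p 0) :
    ∃ P : ℝ → ℝ, ∀ᵐ z ∂cylMeasure Ω τ, p z = P z.1 := by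
  obtain ⟨x₀, hx₀⟩ := hc.nonempty
  obtain ⟨R, hR⟩ := hb.subset_closedBall (0 : Space)
  -- The cutoff equals 1 on Ω; it only brings the situation into the form of
  -- `spaceGrad_shifted_convolution`.
  let χ : ContDiffBump (0 : Space) := ⟨|R| + 1, |R| + 2, by positivity, by linarith⟩
  have hχd : ContDiff ℝ ∞ χ := χ.contDiff
  have hχ1 : ∀ x ∈ Ω, χ x = 1 := fun x hx => χ.one_of_mem_closedBall
    (Metric.closedBall_subset_closedBall (by simp only [χ]; linarith [le_abs_self R]) (hR hx))
  have hf : ((cyl Ω τ).indicator fun y => χ y.2 * p y) = (cyl Ω τ).indicator p := by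
    ext y
    by_cases hy : y ∈ cyl Ω τ
    · simp [hy, hχ1 y.2 hy.2]
    · simp [hy]
  set f := (cyl Ω τ).indicator p with hfdef
  have hf2 : MemLp f 2 volume := memLp_indicator_cyl ho hp.1
  have hF : ((cyl Ω τ).indicator fun y => χ y.2 • (0 : ℝ × Space → Space) y
      + p y • gradient χ y.2) = 0 := by
    ext1 y
    by_cases hy : y ∈ cyl Ω τ
    · have : gradient χ y.2 = 0 := by
        have h1 : (χ : Space → ℝ) =ᶠ[𝓝 y.2] fun _ => 1 :=
          Filter.eventuallyEq_of_mem (ho.mem_nhds hy.2) fun x hx => hχ1 x hx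
        rw [gradient, h1.fderiv_eq]
        simp
      simp [hy, this]
    · simp [hy]
  let κ : ℕ → ContDiffBump (0 : ℝ × Space) := fun k =>
    ⟨1 / ((k : ℝ) + 1) / 2, 1 / ((k : ℝ) + 1), by positivity, half_lt_self (by positivity)⟩
  have hκ : Tendsto (fun k => (κ k).rOut) atTop (𝓝 0) := tendsto_one_div_add_atTop_nhds_zero_nat
  let q : ℕ → ℝ × Space → ℝ := fun k =>
    (κ k).normed volume ⋆[ContinuousLinearMap.lsmul ℝ ℝ, volume] f
  have hq : ∀ k, ContDiff ℝ ∞ (q k) := fun k =>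
    (κ k).hasCompactSupport_normed.contDiff_convolution_left _ (κ k).contDiff_normed
      (hf2.locallyIntegrable (by norm_num))
  have hgrad : ∀ k z, Metric.closedBall z (κ k).rOut ⊆ cyl Ω τ → ∀ v,
      fderiv ℝ (q k) z (0, v) = 0 := by
    intro k z hz v
    have key := spaceGrad_shifted_convolution ho le_rfl (hp.hasWeakGrad ho hb) hp.1 hp.2.1 hχd
      χ.hasCompactSupport (κ k) 0 z (fun y hy => by
        rw [add_zero] at hy
        exact ⟨(hz hy).1, fun _ => (hz hy).2⟩)
    rw [hf, hF, convolution_zero] at key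
    rw [← inner_spaceGrad]
    simp only [add_zero] at key
    change spaceGrad (q k) z = _ at key
    rw [key]
    simp
  have hloc : ∀ t ∈ Ioo 0 τ, ∀ x ∈ Ω, ∀ᶠ y in 𝓝[Ω] x, ∀ᶠ k in atTop, q k (t, x) = q k (t, y) := by
    intro t ht x hx
    obtain ⟨r, hr, hball⟩ := Metric.isOpen_iff.1 (isOpen_cyl ho τ) (t, x) ⟨ht, hx⟩
    filter_upwards [mem_nhdsWithin_of_mem_nhds (Metric.ball_mem_nhds x (half_pos hr))] with y hy
    filter_upwards [hκ.eventually_lt_const (half_pos hr)] with k hk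
    have hd : ∀ x' : Space, HasFDerivAt (fun x' => q k (t, x'))
        ((fderiv ℝ (q k) (t, x')).comp (ContinuousLinearMap.inr ℝ ℝ Space)) x' := fun x' =>
      ((hq k).differentiable (by simp) (t, x')).hasFDerivAt.comp x' (hasFDerivAt_prodMk_right t x')
    refine Metric.isOpen_ball.is_const_of_fderiv_eq_zero
      (convex_ball x (r / 2)).isPreconnected (fun x' _ => (hd x').differentiableAt.differentiableWithinAt)
      (fun x' hx' => ?_) (Metric.mem_ball_self (half_pos hr)) hy
    rw [(hd x').fderiv]
    ext v
    have := hgrad k (t, x') (fun y' hy' => hball ?_) v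
    · simpa using this
    · have h1 : dist (t, x') (t, x) < r / 2 := by
        rw [Prod.dist_eq]; simpa [hr] using hx'
      rw [Metric.mem_ball]
      rw [Metric.mem_closedBall] at hy'
      linarith [dist_triangle y' (t, x') (t, x)]
  -- Mollifications are constant in space near a point once the radius is small. How small depends
  -- on the point, but eventual equality along the sequence is an equivalence relation and spreads
  -- over the connected set Ω. At almost every point the limit is therefore the limit at x₀.
  have hconst : ∀ t ∈ Ioo 0 τ, ∀ x ∈ Ω, ∀ᶠ k in atTop, q k (t, x) = q k (t, x₀) := by
    intro t ht x hx
    refine hc.isPreconnected.induction₂ (fun x y => ∀ᶠ k in atTop, q k (t, x) = q k (t, y))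
      (hloc t ht) (fun x y z _ _ _ h1 h2 => ?_) (fun x y _ _ h1 => ?_) hx hx₀
    · filter_upwards [h1, h2] with k e1 e2 using e1.trans e2
    · filter_upwards [h1] with k e1 using e1.symm
  have hae := ContDiffBump.ae_convolution_tendsto_right_of_locallyIntegrable (K := 2) (φ := κ)
    (l := atTop) (μ := (volume : Measure (ℝ × Space))) hκ
    (Eventually.of_forall fun k => by simp only [κ]; linarith) (hf2.locallyIntegrable (by norm_num))
  refine ⟨fun t => limUnder atTop fun k => q k (t, x₀), ?_⟩
  rw [cylMeasure, ae_restrict_iff' (isOpen_cyl ho τ).measurableSet]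
  filter_upwards [hae] with z hz hzc
  have h1 : Tendsto (fun k => q k (z.1, x₀)) atTop (𝓝 (p z)) := by
    have h2 : f z = p z := by simp [hfdef, hzc]
    rw [← h2]
    exact hz.congr' (hconst z.1 hzc.1 z.2 hzc.2)
  exact h1.limUnder_eq.symm

/-! ### Chain rule in time -/

theorem setIntegral_cyl {Ω : Set Space} {τ : ℝ} (hτ : 0 ≤ τ) {F : Type*} [NormedAddCommGroup F]
    [NormedSpace ℝ F] {u : ℝ × Space → F} (hu : IntegrableOn u (cyl Ω τ)) :
    ∫ z in cyl Ω τ, u z = ∫ t in 0..τ, ∫ x in Ω, u (t, x) := by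
  rw [intervalIntegral.integral_of_le hτ, integral_Ioc_eq_integral_Ioo]
  exact setIntegral_prod u hu

/-- `f` solves `∂ₜ f + div F = 0` up to time `τ₁`, with vanishing flux through the boundary and
initial value `f₀`; for convenience `f` is extended by `f₀` to negative times and `F` by zero. -/
structure TimeBalance (Ω : Set Space) (τ₁ : ℝ) (f₀ : Space → ℝ) (f : ℝ × Space → ℝ)
    (F : ℝ × Space → Space) : Prop where
  measurable : Measurable f
  bounded : ∃ C, ∀ z, |f z| ≤ C
  flux_measurable : Measurable F
  flux_memLp : MemLp F 2 volume
  flux_zero : ∀ z, z ∉ cyl Ω τ₁ → F z = 0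
  init : ∀ t ≤ 0, ∀ x, f (t, x) = f₀ x
  balance : ∀ᵐ r : ℝ, r ≤ τ₁ → ∀ ψ : Space → ℝ, ContDiff ℝ ∞ ψ →
    (∫ x in Ω, f (r, x) * ψ x) - (∫ x in Ω, f₀ x * ψ x)
      = ∫ s in 0..r, ∫ x in Ω, inner ℝ (F (s, x)) (gradient ψ x)

/-- Continuity of translations in L². It makes averages over small time shifts converge to the
unshifted pairing of flux and gradient. -/
theorem continuous_integral_inner_translate {Ω : Set Space} {τ : ℝ} {F W : ℝ × Space → Space}
    (hF : MemLp F 2 volume) (hW : MemLp W 2 (cylMeasure Ω τ)) :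
    Continuous fun σ : ℝ => ∫ z in cyl Ω τ, inner ℝ (F (z + (σ, 0))) (W z) := by
  rw [continuous_iff_continuousAt]
  intro σ₀
  have hm : ∀ σ : ℝ, MemLp (fun z => F (z + (σ, 0))) 2 (cylMeasure Ω τ) := fun σ =>
    (memLp_comp_add hF ((σ, 0) : ℝ × Space)).mono_measure Measure.restrict_le_self
  have h := tendsto_integral_inner (l := 𝓝 σ₀) (bk := fun σ z => F (z + (σ, 0))) hW (hm σ₀) hm ?_
  · simpa only [real_inner_comm, ContinuousAt, cylMeasure] using h
  · have h1 : Tendsto (fun σ : ℝ => ((σ - σ₀, 0) : ℝ × Space)) (𝓝 σ₀) (𝓝 0) := by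
      have : Continuous fun σ : ℝ => ((σ - σ₀, 0) : ℝ × Space) := by fun_prop
      exact this.tendsto' σ₀ 0 (by simp)
    have h2 := (tendsto_eLpNorm_translate hF).comp h1
    refine tendsto_of_tendsto_of_tendsto_of_le_of_le tendsto_const_nhds h2 (fun _ => zero_le)
      fun σ => ?_
    refine (eLpNorm_mono_measure _ Measure.restrict_le_self).trans (le_of_eq ?_)
    have h3 := eLpNorm_translate (μ := (volume : Measure (ℝ × Space)))
      (fun z => F (z + (σ - σ₀, 0)) - F z) ((memLp_comp_add hF _).1.sub hF.1) (σ₀, 0)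
    rw [Function.comp_apply, ← h3]
    congr 1
    ext1 z
    simp only [Pi.sub_apply, add_assoc, Prod.mk_add_mk, add_zero]
    congr 4
    ring

theorem tendsto_average_of_continuous {K : ℝ → ℝ} (hK : Continuous K) :
    Tendsto (fun h => h⁻¹ * ∫ σ in 0..h, K σ) (𝓝[>] 0) (𝓝 (K 0)) := by
  have h1 := (intervalIntegral.integral_hasDerivAt_right (hK.intervalIntegrable 0 0)
    (hK.stronglyMeasurableAtFilter _ _) hK.continuousAt).tendsto_slope_zero_right
  simpa using h1

theorem tendsto_average_left_of_continuous {K : ℝ → ℝ} (hK : Continuous K) :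
    Tendsto (fun h => h⁻¹ * ∫ σ in (-h)..0, K σ) (𝓝[>] 0) (𝓝 (K 0)) := by
  have h1 := tendsto_average_of_continuous (K := fun σ => K (-σ)) (by fun_prop)
  simpa [intervalIntegral.integral_comp_neg] using h1

/-- Fubini in time and time shift is justified by the substitution t + σ, after which the integral
over t no longer depends on σ. -/
theorem integrable_inner_shift {Ω : Set Space} (ho : IsOpen Ω) (hb : Bornology.IsBounded Ω) {τ : ℝ}
    {F : ℝ × Space → Space} (hFm : Measurable F) (hF : Integrable F volume)
    {X : ℝ × Space → Space} (hX : Continuous X) (s₁ s₂ : ℝ) :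
    Integrable (fun p : (ℝ × ℝ) × Space => inner ℝ (F (p.1.1 + p.1.2, p.2)) (X (p.1.1, p.2)))
      (((volume.restrict (Ioc 0 τ)).prod (volume.restrict (Ioc s₁ s₂))).prod
        (volume.restrict Ω)) := by
  have hm : Measurable fun p : (ℝ × ℝ) × Space => F (p.1.1 + p.1.2, p.2) :=
    hFm.comp (by fun_prop)
  have h1 : Integrable (fun p : (ℝ × ℝ) × Space => F (p.1.1 + p.1.2, p.2))
      (((volume : Measure ℝ).prod (volume.restrict (Ioc s₁ s₂))).prod (volume : Measure Space)) := by
    refine ⟨hm.aestronglyMeasurable, ?_⟩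
    rw [HasFiniteIntegral, lintegral_prod _ hm.enorm.aemeasurable,
      lintegral_prod_symm _ hm.enorm.lintegral_prod_right'.aemeasurable]
    have h2 : ∀ σ : ℝ, ∫⁻ t : ℝ, ∫⁻ x : Space, ‖F (t + σ, x)‖ₑ = ∫⁻ z, ‖F z‖ₑ := fun σ => by
      rw [lintegral_add_right_eq_self (fun t => ∫⁻ x : Space, ‖F (t, x)‖ₑ) σ,
        Measure.volume_eq_prod, lintegral_prod _ hFm.enorm.aemeasurable]
    simp only [h2, lintegral_const, Measure.restrict_apply_univ, Real.volume_Ioc]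
    exact ENNReal.mul_lt_top hF.2 ENNReal.ofReal_lt_top
  have h3 := h1.mono_measure (Measure.prod_mono (Measure.prod_mono
    (Measure.restrict_le_self (s := Ioc 0 τ)) le_rfl) (Measure.restrict_le_self (s := Ω)))
  obtain ⟨C, hC⟩ := ((isCompact_Icc (a := (0 : ℝ)) (b := τ)).prod
    hb.isCompact_closure).exists_bound_of_continuousOn hX.continuousOn
  refine (h3.norm.const_mul C).mono ?_ ?_
  · exact hm.aestronglyMeasurable.inner (hX.comp (by fun_prop)).aestronglyMeasurable
  · have h4 : ∀ᵐ p ∂(((volume.restrict (Ioc 0 τ)).prod (volume.restrict (Ioc s₁ s₂))).prod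
        (volume.restrict Ω)), p ∈ (Ioc 0 τ ×ˢ Ioc s₁ s₂) ×ˢ Ω := by
      rw [Measure.prod_restrict, Measure.prod_restrict]
      exact ae_restrict_mem ((measurableSet_Ioc.prod measurableSet_Ioc).prod ho.measurableSet)
    filter_upwards [h4] with p hp
    have h5 := hC (p.1.1, p.2) ⟨Ioc_subset_Icc_self hp.1.1, subset_closure hp.2⟩
    refine (norm_inner_le_norm _ _).trans ?_
    rw [mul_comm, norm_mul, norm_norm]
    exact mul_le_mul_of_nonneg_right (h5.trans (le_abs_self C)) (norm_nonneg _)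

theorem TimeBalance.flux_integrable {Ω : Set Space} (hb : Bornology.IsBounded Ω)
    {τ₁ : ℝ} {f₀ : Space → ℝ} {f : ℝ × Space → ℝ} {F : ℝ × Space → Space}
    (h : TimeBalance Ω τ₁ f₀ f F) : Integrable F volume := by
  have : IsFiniteMeasure (volume.restrict (cyl Ω τ₁)) := isFiniteMeasure_cylMeasure hb τ₁
  have h1 : IntegrableOn F (cyl Ω τ₁) volume :=
    (h.flux_memLp.mono_measure (Measure.restrict_le_self (s := cyl Ω τ₁))).integrable (by norm_num)
  exact (integrableOn_iff_integrable_of_support_subset fun z hz => by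
    by_contra hc; exact hz (h.flux_zero z hc)).1 h1

/-- The increments of `f` over a time step, tested with a smooth function. -/
theorem TimeBalance.integral_increment_smooth {Ω : Set Space} (ho : IsOpen Ω)
    (hb : Bornology.IsBounded Ω) {τ₁ : ℝ} {f₀ : Space → ℝ} {f : ℝ × Space → ℝ}
    {F : ℝ × Space → Space} (h : TimeBalance Ω τ₁ f₀ f F) {τ s₁ s₂ : ℝ} (hτ : 0 ≤ τ)
    (hs : s₁ ≤ s₂) (hτs : τ + s₂ ≤ τ₁) {φ : ℝ × Space → ℝ} (hφ : ContDiff ℝ ∞ φ) :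
    ∫ z in cyl Ω τ, (f (z + (s₂, 0)) - f (z + (s₁, 0))) * φ z
      = ∫ σ in s₁..s₂, ∫ z in cyl Ω τ, inner ℝ (F (z + (σ, 0))) (spaceGrad φ z) := by
  have := isFiniteMeasure_cylMeasure hb τ
  have hFi := h.flux_integrable hb
  have hX := continuous_spaceGrad hφ
  obtain ⟨C, hC⟩ := h.bounded
  have hfm : ∀ s : ℝ, Measurable fun z : ℝ × Space => f (z + (s, 0)) := fun s =>
    h.measurable.comp (measurable_add_const _)
  have hL : IntegrableOn (fun z => (f (z + (s₂, 0)) - f (z + (s₁, 0))) * φ z) (cyl Ω τ) := by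
    refine ((memLp_of_continuous hb τ hφ.continuous 1 ho).integrable le_rfl).bdd_mul (c := 2 * C)
      ((hfm s₂).sub (hfm s₁)).aestronglyMeasurable (Eventually.of_forall fun z => ?_)
    refine (norm_sub_le _ _).trans ?_
    have h1 := hC (z + (s₂, 0))
    have h2 := hC (z + (s₁, 0))
    rw [Real.norm_eq_abs, Real.norm_eq_abs]
    linarith
  rw [setIntegral_cyl hτ hL]
  have hH := integrable_inner_shift ho hb (τ := τ) h.flux_measurable hFi hX s₁ s₂
  have hR : ∀ σ, ∫ z in cyl Ω τ, inner ℝ (F (z + (σ, 0))) (spaceGrad φ z)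
      = ∫ t in 0..τ, ∫ x in Ω, inner ℝ (F (t + σ, x)) (spaceGrad φ (t, x)) := fun σ => by
    rw [setIntegral_cyl hτ]
    · simp
    · exact integrable_inner_of_memLp
        ((memLp_comp_add h.flux_memLp ((σ, 0) : ℝ × Space)).mono_measure Measure.restrict_le_self)
        (memLp_of_continuous hb τ hX 2 ho)
  simp only [hR]
  simp only [intervalIntegral.integral_of_le hτ, intervalIntegral.integral_of_le hs]
  have hswap := integral_integral_swap (f := fun t σ => ∫ x in Ω, inner ℝ (F (t + σ, x))
    (spaceGrad φ (t, x))) hH.integral_prod_left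
  rw [← hswap]
  have hbal : ∀ s : ℝ, ∀ᵐ t : ℝ, t + s ≤ τ₁ → ∀ ψ : Space → ℝ, ContDiff ℝ ∞ ψ →
      (∫ x in Ω, f (t + s, x) * ψ x) - (∫ x in Ω, f₀ x * ψ x)
        = ∫ s in 0..(t + s), ∫ x in Ω, inner ℝ (F (s, x)) (gradient ψ x) := fun s =>
    (quasiMeasurePreserving_add_right volume s).ae h.balance
  refine setIntegral_congr_ae measurableSet_Ioc ?_
  filter_upwards [hbal s₁, hbal s₂] with t ht1 ht2 ht
  -- At fixed t the function φ(t, ·) tests the balance at both times t + s₁ and t + s₂, so no time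
  -- derivative of φ appears. This is what permits test functions without regularity in time.
  have hψ : ContDiff ℝ ∞ fun x => φ (t, x) := hφ.comp (contDiff_prodMk_right t)
  have hgrad : ∀ x, gradient (fun x => φ (t, x)) x = spaceGrad φ (t, x) := fun x => by
    refine ext_inner_right ℝ fun v => ?_
    have h1 : HasFDerivAt (fun x => φ (t, x))
        ((fderiv ℝ φ (t, x)).comp (ContinuousLinearMap.inr ℝ ℝ Space)) x :=
      (hφ.differentiable (by simp) (t, x)).hasFDerivAt.comp x (hasFDerivAt_prodMk_right t x)
    rw [gradient_inner_apply, inner_spaceGrad, h1.fderiv]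
    simp
  have e1 := ht1 (by linarith [ht.2]) _ hψ
  have e2 := ht2 (by linarith [ht.2]) _ hψ
  simp only [hgrad] at e1 e2
  have : IsFiniteMeasure ((volume : Measure Space).restrict Ω) := isFiniteMeasure_restrict.2
    hb.measure_lt_top.ne
  have hψb : MemLp (fun x => φ (t, x)) 1 ((volume : Measure Space).restrict Ω) := by
    obtain ⟨C', hC'⟩ := hb.isCompact_closure.exists_bound_of_continuousOn hψ.continuous.continuousOn
    exact MemLp.of_bound hψ.continuous.aestronglyMeasurable C'
      (ae_restrict_of_forall_mem ho.measurableSet fun x hx => hC' x (subset_closure hx))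
  have hsl : ∀ s : ℝ, Integrable (fun x => f (t + s, x) * φ (t, x)) (volume.restrict Ω) := fun s =>
    (hψb.integrable le_rfl).bdd_mul (c := C)
      (h.measurable.comp measurable_prodMk_left).aestronglyMeasurable
      (Eventually.of_forall fun x => hC _)
  have hJ : IntervalIntegrable (fun s => ∫ x in Ω, inner ℝ (F (s, x)) (spaceGrad φ (t, x)))
      volume 0 (t + s₂) ∧ IntervalIntegrable (fun s => ∫ x in Ω, inner ℝ (F (s, x))
        (spaceGrad φ (t, x))) volume 0 (t + s₁) := by
    have hint : Integrable (fun s => ∫ x in Ω, inner ℝ (F (s, x)) (spaceGrad φ (t, x))) volume := by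
      have h1 : Integrable F ((volume : Measure ℝ).prod (volume.restrict Ω)) :=
        hFi.mono_measure (Measure.prod_mono le_rfl Measure.restrict_le_self)
      obtain ⟨C', hC'⟩ := hb.isCompact_closure.exists_bound_of_continuousOn
        (hX.comp (Continuous.prodMk_right t)).continuousOn
      have h2 : Integrable (fun p : ℝ × Space => inner ℝ (F p) (spaceGrad φ (t, p.2)))
          ((volume : Measure ℝ).prod (volume.restrict Ω)) := by
        refine (h1.norm.const_mul C').mono (h1.1.inner
          (hX.comp (by fun_prop)).aestronglyMeasurable) ?_
        have h4 : ∀ᵐ p ∂((volume : Measure ℝ).prod (volume.restrict Ω)), p.2 ∈ Ω :=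
          Measure.quasiMeasurePreserving_snd.ae (ae_restrict_mem ho.measurableSet)
        filter_upwards [h4] with p hp
        have h5 := hC' p.2 (subset_closure hp)
        refine (norm_inner_le_norm _ _).trans ?_
        rw [mul_comm, norm_mul, norm_norm]
        exact mul_le_mul_of_nonneg_right (h5.trans (le_abs_self C')) (norm_nonneg _)
      exact h2.integral_prod_left
    exact ⟨hint.intervalIntegrable, hint.intervalIntegrable⟩
  have e3 : ∫ x in Ω, (f ((t, x) + (s₂, 0)) - f ((t, x) + (s₁, 0))) * φ (t, x)
      = (∫ x in Ω, f (t + s₂, x) * φ (t, x)) - (∫ x in Ω, f (t + s₁, x) * φ (t, x)) := by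
    rw [← integral_sub (hsl s₂) (hsl s₁)]
    simp [sub_mul]
  rw [e3]
  have e4 : (∫ x in Ω, f (t + s₂, x) * φ (t, x)) - (∫ x in Ω, f (t + s₁, x) * φ (t, x))
      = ∫ s in (t + s₁)..(t + s₂), ∫ x in Ω, inner ℝ (F (s, x)) (spaceGrad φ (t, x)) := by
    rw [← intervalIntegral.integral_interval_sub_left hJ.1 hJ.2, ← e1, ← e2]
    ring
  rw [e4, ← intervalIntegral.integral_comp_add_left
    (fun s => ∫ x in Ω, inner ℝ (F (s, x)) (spaceGrad φ (t, x))) t,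
    intervalIntegral.integral_of_le hs]

/-- The increments of `f` over a time step, tested with a function in `L²(0, τ; H¹(Ω))`. -/
theorem TimeBalance.integral_increment {Ω : Set Space} (ho : IsOpen Ω)
    (hb : Bornology.IsBounded Ω) {τ₁ : ℝ} {f₀ : Space → ℝ} {f : ℝ × Space → ℝ}
    {F : ℝ × Space → Space} (h : TimeBalance Ω τ₁ f₀ f F) {τ s₁ s₂ : ℝ} (hτ : 0 ≤ τ)
    (hs : s₁ ≤ s₂) (hτs : τ + s₂ ≤ τ₁) {w : ℝ × Space → ℝ} {W : ℝ × Space → Space}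
    (hw : SmoothApprox Ω τ w W) :
    ∫ z in cyl Ω τ, (f (z + (s₂, 0)) - f (z + (s₁, 0))) * w z
      = ∫ σ in s₁..s₂, ∫ z in cyl Ω τ, inner ℝ (F (z + (σ, 0))) (W z) := by
  have := isFiniteMeasure_cylMeasure hb τ
  obtain ⟨m1, m2, φ, hφ, c1, c2⟩ := hw
  obtain ⟨C, hC⟩ := h.bounded
  have hfm : ∀ s : ℝ, Measurable fun z : ℝ × Space => f (z + (s, 0)) := fun s =>
    h.measurable.comp (measurable_add_const _)
  have hfl : MemLp (fun z => f (z + (s₂, 0)) - f (z + (s₁, 0))) 2 (cylMeasure Ω τ) := by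
    refine MemLp.of_bound ((hfm s₂).sub (hfm s₁)).aestronglyMeasurable (2 * C)
      (Eventually.of_forall fun z => ?_)
    refine (norm_sub_le _ _).trans ?_
    have h1 := hC (z + (s₂, 0))
    have h2 := hC (z + (s₁, 0))
    rw [Real.norm_eq_abs, Real.norm_eq_abs]
    linarith
  have l1 := tendsto_integral_mul hfl m1
    (fun k => memLp_of_continuous hb τ (hφ k).continuous 2 ho) c1
  refine tendsto_nhds_unique l1 ?_
  have hgl : ∀ k, MemLp (spaceGrad (φ k)) 2 (cylMeasure Ω τ) := fun k =>
    memLp_of_continuous hb τ (continuous_spaceGrad (hφ k)) 2 ho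
  have hFl : ∀ σ : ℝ, MemLp (fun z => F (z + (σ, 0))) 2 (cylMeasure Ω τ) := fun σ =>
    (memLp_comp_add h.flux_memLp ((σ, 0) : ℝ × Space)).mono_measure Measure.restrict_le_self
  have e : ∀ k, ∫ z, (f (z + (s₂, 0)) - f (z + (s₁, 0))) * φ k z ∂cylMeasure Ω τ
      = ∫ σ in s₁..s₂, ∫ z in cyl Ω τ, inner ℝ (F (z + (σ, 0))) (spaceGrad (φ k) z) := fun k =>
    h.integral_increment_smooth ho hb hτ hs hτs (hφ k)
  simp only [e]
  rw [tendsto_iff_norm_sub_tendsto_zero]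
  -- Shifting F in time does not increase its L² norm on the cylinder beyond the norm on the whole
  -- space, so the error is uniform in σ.
  have h0 : Tendsto (fun k => (eLpNorm F 2 volume).toReal *
      (eLpNorm (spaceGrad (φ k) - W) 2 (cylMeasure Ω τ)).toReal * |s₂ - s₁|) atTop (𝓝 0) := by
    have := (((ENNReal.tendsto_toReal zero_ne_top).comp c2).const_mul
      (eLpNorm F 2 volume).toReal).mul_const |s₂ - s₁|
    simpa using this
  refine squeeze_zero (fun _ => norm_nonneg _) (fun k => ?_) h0
  rw [← intervalIntegral.integral_sub
    ((continuous_integral_inner_translate h.flux_memLp (hgl k)).intervalIntegrable _ _)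
    ((continuous_integral_inner_translate h.flux_memLp m2).intervalIntegrable _ _)]
  refine intervalIntegral.norm_integral_le_of_norm_le_const fun σ _ => ?_
  change ‖(∫ z, inner ℝ (F (z + (σ, 0))) (spaceGrad (φ k) z) ∂cylMeasure Ω τ)
    - ∫ z, inner ℝ (F (z + (σ, 0))) (W z) ∂cylMeasure Ω τ‖ ≤ _
  rw [← integral_sub (integrable_inner_of_memLp (hFl σ) (hgl k))
    (integrable_inner_of_memLp (hFl σ) m2)]
  have h1 := abs_integral_inner_le (hFl σ) ((hgl k).sub m2)
  simp only [Pi.sub_apply, inner_sub_right] at h1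
  refine h1.trans (mul_le_mul_of_nonneg_right ?_ ENNReal.toReal_nonneg)
  refine ENNReal.toReal_mono h.flux_memLp.2.ne ?_
  refine (eLpNorm_mono_measure _ Measure.restrict_le_self).trans (le_of_eq ?_)
  exact eLpNorm_translate F h.flux_memLp.1 _

theorem SmoothApprox.mono {Ω : Set Space} {τ τ' : ℝ} (hτ : τ' ≤ τ) {w : ℝ × Space → ℝ}
    {W : ℝ × Space → Space} (h : SmoothApprox Ω τ w W) : SmoothApprox Ω τ' w W := by
  obtain ⟨m1, m2, φ, hφ, c1, c2⟩ := h
  have hm := cylMeasure_mono (Ω := Ω) hτ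
  exact ⟨m1.mono_measure hm, m2.mono_measure hm, φ, hφ,
    tendsto_of_tendsto_of_tendsto_of_le_of_le tendsto_const_nhds c1 (fun _ => zero_le)
      fun _ => eLpNorm_mono_measure _ hm,
    tendsto_of_tendsto_of_tendsto_of_le_of_le tendsto_const_nhds c2 (fun _ => zero_le)
      fun _ => eLpNorm_mono_measure _ hm⟩

theorem measurable_integral_slice {Ω : Set Space} {u : ℝ × Space → ℝ} (hu : Measurable u) :
    Measurable fun t => ∫ x in Ω, u (t, x) :=
  (hu.stronglyMeasurable.integral_prod_right' (ν := volume.restrict Ω)).measurable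

theorem integrable_slice {Ω : Set Space} (hb : Bornology.IsBounded Ω) {u : ℝ × Space → ℝ}
    (hu : Measurable u) {C : ℝ} (hC : ∀ z, |u z| ≤ C) (t : ℝ) :
    IntegrableOn (fun x => u (t, x)) Ω := by
  have : IsFiniteMeasure ((volume : Measure Space).restrict Ω) := isFiniteMeasure_restrict.2
    hb.measure_lt_top.ne
  exact (MemLp.of_bound (hu.comp measurable_prodMk_left).aestronglyMeasurable C
    (Eventually.of_forall fun x => hC _)).integrable le_rfl

theorem abs_integral_slice_le {Ω : Set Space} (hb : Bornology.IsBounded Ω) {u : ℝ × Space → ℝ}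
    {C : ℝ} (hC : ∀ z, |u z| ≤ C) (t : ℝ) :
    |∫ x in Ω, u (t, x)| ≤ C * volume.real Ω := by
  rw [← Real.norm_eq_abs]
  exact norm_setIntegral_le_of_norm_le_const hb.measure_lt_top fun x _ => hC _

theorem locallyIntegrable_integral_slice {Ω : Set Space} (hb : Bornology.IsBounded Ω)
    {u : ℝ × Space → ℝ} (hu : Measurable u) {C : ℝ} (hC : ∀ z, |u z| ≤ C) :
    LocallyIntegrable (fun t => ∫ x in Ω, u (t, x)) volume :=
  (locallyIntegrable_const (C * volume.real Ω)).mono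
    (measurable_integral_slice hu).aestronglyMeasurable (Eventually.of_forall fun t =>
      (abs_integral_slice_le hb hC t).trans (le_abs_self _))

theorem integrableOn_cyl_shift {Ω : Set Space} (hb : Bornology.IsBounded Ω) {u : ℝ × Space → ℝ}
    (hu : Measurable u) {C : ℝ} (hC : ∀ z, |u z| ≤ C) (τ s : ℝ) :
    IntegrableOn (fun z => u (z + (s, 0))) (cyl Ω τ) := by
  have := isFiniteMeasure_cylMeasure hb τ
  exact (MemLp.of_bound (μ := cylMeasure Ω τ) (hu.comp (measurable_add_const _)).aestronglyMeasurable
    C (Eventually.of_forall fun x => hC _)).integrable le_rfl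

theorem setIntegral_cyl_shift {Ω : Set Space} (hb : Bornology.IsBounded Ω) {u : ℝ × Space → ℝ}
    (hu : Measurable u) {C : ℝ} (hC : ∀ z, |u z| ≤ C) {τ : ℝ} (hτ : 0 ≤ τ) (s : ℝ) :
    ∫ z in cyl Ω τ, u (z + (s, 0)) = ∫ t in s..(τ + s), ∫ x in Ω, u (t, x) := by
  rw [setIntegral_cyl hτ (integrableOn_cyl_shift hb hu hC τ s)]
  have := intervalIntegral.integral_comp_add_right (a := 0) (b := τ)
    (fun t => ∫ x in Ω, u (t, x)) s
  simpa using this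

/-- Lebesgue differentiation. Forward averages serve the energy inequality, backward averages the
chain rule. -/
theorem ae_tendsto_averages {U : ℝ → ℝ} (hU : LocallyIntegrable U volume) :
    ∀ᵐ τ : ℝ, Tendsto (fun h => h⁻¹ * ∫ t in τ..(τ + h), U t) (𝓝[>] 0) (𝓝 (U τ)) ∧
      Tendsto (fun h => h⁻¹ * ∫ t in (τ - h)..τ, U t) (𝓝[>] 0) (𝓝 (U τ)) := by
  filter_upwards [LocallyIntegrable.ae_hasDerivAt_integral hU] with τ hτ
  constructor
  · simpa using (hτ τ).tendsto_slope_zero_right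
  · have h1 : HasDerivAt (fun h => ∫ t in τ..(τ - h), U t) (-U τ) 0 := by
      have h2 : HasDerivAt (fun h => τ - h) (-1) (0 : ℝ) := by
        simpa using (hasDerivAt_id (0 : ℝ)).const_sub τ
      have h3 : HasDerivAt (fun x => ∫ t in τ..x, U t) (U τ) (τ - 0) := by
        simpa using hτ τ
      simpa [Function.comp_def] using h3.comp (0 : ℝ) h2
    have h4 := h1.tendsto_slope_zero_right.neg
    simp only [zero_add, sub_zero, intervalIntegral.integral_same, neg_neg, smul_eq_mul] at h4
    refine h4.congr fun h => ?_
    rw [intervalIntegral.integral_symm τ (τ - h)]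
    ring

/-! ### Quadratic remainders and the energy inequality for balance laws. -/

section TimeChain

variable {ι : Type*} [Fintype ι] [DecidableEq ι]

/-- Mean value inequality with a Lipschitz derivative. The expansion is about y, which will be the
later state, so that the linear term is an increment tested with ∂Φ at the current time. The
remainder is a sum of squares of increments, removable by the energy inequality. -/
theorem exists_quadratic_remainder_bound {Φ : (ι → ℝ) → ℝ} (hΦ : ContDiff ℝ ∞ Φ)
    (hc : HasCompactSupport Φ) :
    ∃ L : ℝ, 0 ≤ L ∧ ∀ y z, Φ y - Φ z ≤
      ∑ a, fderiv ℝ Φ y (Pi.single a 1) * (y a - z a) + L * ∑ a, (y a - z a) ^ 2 := by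
  obtain ⟨L, hL⟩ := ContDiff.lipschitzWith_of_hasCompactSupport (hc.fderiv (𝕜 := ℝ))
    (hΦ.fderiv_right (m := ∞) (by simp)) (by simp)
  refine ⟨L, L.2, fun y z => ?_⟩
  have h1 := (convex_closedBall y ‖z - y‖).norm_image_sub_le_of_norm_fderiv_le' (𝕜 := ℝ) (f := Φ)
    (φ := fderiv ℝ Φ y) (C := L * ‖z - y‖) (x := y) (y := z)
    (fun x _ => hΦ.differentiable (by simp) x) (fun x hx => by
      refine (hL.norm_sub_le x y).trans (mul_le_mul_of_nonneg_left ?_ L.2)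
      simpa [dist_eq_norm] using hx) (by simp) (by simp [dist_eq_norm])
  have h2 : ‖z - y‖ ^ 2 ≤ ∑ a, (y a - z a) ^ 2 := by
    have h0 : 0 ≤ ∑ a, (y a - z a) ^ 2 := Finset.sum_nonneg fun a _ => sq_nonneg _
    refine (Real.le_sqrt (norm_nonneg _) h0).1 ?_
    refine (pi_norm_le_iff_of_nonneg (Real.sqrt_nonneg _)).2 fun a => ?_
    refine Real.le_sqrt_of_sq_le ?_
    refine le_trans (le_of_eq ?_) (Finset.single_le_sum (f := fun a => (y a - z a) ^ 2)
      (fun a _ => sq_nonneg _) (Finset.mem_univ a))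
    rw [Real.norm_eq_abs, sq_abs, Pi.sub_apply]
    ring
  rw [Real.norm_eq_abs, mul_assoc, ← pow_two] at h1
  have h3 := (abs_le.1 h1).1
  rw [clm_apply_eq_sum] at h3
  have h4 : ∑ a, fderiv ℝ Φ y (Pi.single a 1) * (z - y) a
      = - ∑ a, fderiv ℝ Φ y (Pi.single a 1) * (y a - z a) := by
    rw [← Finset.sum_neg_distrib]
    exact Finset.sum_congr rfl fun a _ => by simp; ring
  rw [h4] at h3
  nlinarith [mul_le_mul_of_nonneg_left h2 L.2]

/-- Weak continuity at the initial time. -/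
theorem TimeBalance.integral_initial_increment {Ω : Set Space} (ho : IsOpen Ω)
    (hb : Bornology.IsBounded Ω) {τ₁ : ℝ} (hτ₁ : 0 < τ₁) {f₀ : Space → ℝ} {f : ℝ × Space → ℝ}
    {F : ℝ × Space → Space} (h : TimeBalance Ω τ₁ f₀ f F) {e : ℝ} (he : 0 < e) :
    ∃ d > 0, ∀ᵐ t : ℝ, t ∈ Ioo 0 d → -e ≤ ∫ x in Ω, f₀ x * (f (t, x) - f₀ x) := by
  obtain ⟨C₀, hC₀⟩ := h.bounded
  set C := max C₀ 1 with hCdef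
  have hC : ∀ z, |f z| ≤ C := fun z => (hC₀ z).trans (le_max_left _ _)
  have hCpos : 0 < C := lt_of_lt_of_le one_pos (le_max_right _ _)
  have hf₀ : ∀ x, f₀ x = f (0, x) := fun x => (h.init 0 le_rfl x).symm
  have hsl := fun t => integrable_slice hb h.measurable hC (Ω := Ω) t
  have hf0i : IntegrableOn f₀ Ω := by simpa only [← hf₀] using hsl 0
  -- The initial value is replaced by a smooth test function. As |f - f₀| ≤ 2C, the tolerance e /
  -- (4C) in L¹ costs at most e / 2; the flux over a short time costs the other half.
  obtain ⟨ψ, hψc, hψ, hψe⟩ := MemLp.exist_eLpNorm_sub_le (p := 1) (by simp) le_rfl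
    ((memLp_one_iff_integrable).2 hf0i) (ε := e / (4 * C)) (by positivity)
  have hψi : IntegrableOn ψ Ω := (hψ.continuous.integrable_of_hasCompactSupport hψc).integrableOn
  have hgc : Continuous (gradient ψ) := by
    unfold gradient
    exact (InnerProductSpace.toDual ℝ Space).symm.continuous.comp
      (hψ.continuous_fderiv (by simp))
  obtain ⟨D, hD⟩ := hb.isCompact_closure.exists_bound_of_continuousOn hgc.continuousOn
  have hint : Integrable (fun s => ∫ x in Ω, inner ℝ (F (s, x)) (gradient ψ x)) volume := by
    have h1 : Integrable F ((volume : Measure ℝ).prod (volume.restrict Ω)) :=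
      (h.flux_integrable hb).mono_measure (Measure.prod_mono le_rfl Measure.restrict_le_self)
    have h2 : Integrable (fun p : ℝ × Space => inner ℝ (F p) (gradient ψ p.2))
        ((volume : Measure ℝ).prod (volume.restrict Ω)) := by
      refine (h1.norm.const_mul D).mono (h1.1.inner
        (hgc.comp continuous_snd).aestronglyMeasurable) ?_
      have h4 : ∀ᵐ p ∂((volume : Measure ℝ).prod (volume.restrict Ω)), p.2 ∈ Ω :=
        Measure.quasiMeasurePreserving_snd.ae (ae_restrict_mem ho.measurableSet)
      filter_upwards [h4] with p hp
      have h5 := hD p.2 (subset_closure hp)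
      refine (norm_inner_le_norm _ _).trans ?_
      rw [mul_comm, norm_mul, norm_norm]
      exact mul_le_mul_of_nonneg_right (h5.trans (le_abs_self D)) (norm_nonneg _)
    exact h2.integral_prod_left
  have hcont := (intervalIntegral.continuous_primitive
    (fun a b => hint.intervalIntegrable (a := a) (b := b)) 0).tendsto 0
  rw [intervalIntegral.integral_same, Metric.tendsto_nhds_nhds] at hcont
  obtain ⟨d, hd, hdd⟩ := hcont (e / 2) (by positivity)
  refine ⟨min d τ₁, lt_min hd hτ₁, ?_⟩
  filter_upwards [h.balance] with t ht htd
  have e1 := ht (htd.2.le.trans (min_le_right _ _)) ψ hψ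
  have e2 : |∫ s in 0..t, ∫ x in Ω, inner ℝ (F (s, x)) (gradient ψ x)| < e / 2 := by
    have := hdd (x := t) (by
      rw [dist_zero_right, Real.norm_eq_abs, abs_of_pos htd.1]
      exact htd.2.trans_le (min_le_left _ _))
    rwa [dist_zero_right, Real.norm_eq_abs] at this
  rw [← e1] at e2
  have hψb : ∀ g : Space → ℝ, (∃ t, g = fun x => f (t, x)) →
      IntegrableOn (fun x => g x * ψ x) Ω := by
    rintro g ⟨t, rfl⟩
    exact hψi.bdd_mul (c := C) (hsl t).1 (Eventually.of_forall fun x => hC _)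
  have i1 := hψb _ ⟨t, rfl⟩
  have i2 : IntegrableOn (fun x => f₀ x * ψ x) Ω := by
    simpa only [← hf₀] using hψb _ ⟨0, rfl⟩
  have i3 : IntegrableOn (fun x => (f (t, x) - f₀ x) * (f₀ x - ψ x)) Ω := by
    refine (hf0i.sub hψi).bdd_mul (c := 2 * C) ((hsl t).1.sub hf0i.1)
      (Eventually.of_forall fun x => ?_)
    rw [hf₀]
    refine (norm_sub_le _ _).trans ?_
    have h1 := hC (t, x)
    have h2 := hC (0, x)
    rw [Real.norm_eq_abs, Real.norm_eq_abs]
    linarith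
  have e3 : ∫ x in Ω, f₀ x * (f (t, x) - f₀ x)
      = ((∫ x in Ω, f (t, x) * ψ x) - ∫ x in Ω, f₀ x * ψ x)
        + ∫ x in Ω, (f (t, x) - f₀ x) * (f₀ x - ψ x) := by
    rw [← integral_sub i1 i2]
    refine Eq.trans ?_ (integral_add (i1.sub i2) i3)
    refine integral_congr_ae (Eventually.of_forall fun x => ?_)
    dsimp only
    ring
  have e4 : |∫ x in Ω, (f (t, x) - f₀ x) * (f₀ x - ψ x)| ≤ e / 2 := by
    have h1 : ∫ x in Ω, |f₀ x - ψ x| ≤ e / (4 * C) := by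
      have h2 := hψe
      rw [eLpNorm_one_eq_lintegral_enorm] at h2
      have h3 := integral_norm_eq_lintegral_enorm (hf0i.sub hψi).1
      simp only [Pi.sub_apply, Real.norm_eq_abs] at h3
      rw [h3]
      exact ENNReal.toReal_le_of_le_ofReal (by positivity) h2
    calc _ ≤ ∫ x in Ω, |(f (t, x) - f₀ x) * (f₀ x - ψ x)| := abs_integral_le_integral_abs
      _ ≤ ∫ x in Ω, (2 * C) * |f₀ x - ψ x| := by
        refine integral_mono i3.abs ((hf0i.sub hψi).abs.const_mul _) fun x => ?_
        simp only [abs_mul]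
        refine mul_le_mul_of_nonneg_right ?_ (abs_nonneg _)
        rw [hf₀]
        have h1 := hC (t, x)
        have h2 := hC (0, x)
        exact (abs_sub _ _).trans (by linarith)
      _ = (2 * C) * ∫ x in Ω, |f₀ x - ψ x| := integral_const_mul _ _
      _ ≤ (2 * C) * (e / (4 * C)) := mul_le_mul_of_nonneg_left h1 (by positivity)
      _ = e / 2 := by field_simp; norm_num
  rw [e3]
  have := (abs_lt.1 e2).1
  have := (abs_le.1 e4).1
  linarith

/-- Energy inequality for balance laws with fluxes in `L²`. -/
theorem TimeBalance.energy_ge {Ω : Set Space} (ho : IsOpen Ω)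
    (hb : Bornology.IsBounded Ω) {τ₁ : ℝ} (hτ₁ : 0 < τ₁) {f₀ : Space → ℝ} {f : ℝ × Space → ℝ}
    {F G : ℝ × Space → Space} (h : TimeBalance Ω τ₁ f₀ f F) (hw : SmoothApprox Ω τ₁ f G) :
    ∀ᵐ τ : ℝ, τ ∈ Ioo 0 τ₁ → 2 * ∫ z in cyl Ω τ, inner ℝ (F z) (G z)
      ≤ (∫ x in Ω, f (τ, x) ^ 2) - ∫ x in Ω, f₀ x ^ 2 := by
  obtain ⟨C, hC⟩ := h.bounded
  have hqm : Measurable fun z => f z ^ 2 := h.measurable.pow_const 2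
  have hqC : ∀ z, |f z ^ 2| ≤ C ^ 2 := fun z => by
    rw [abs_pow]; exact pow_le_pow_left₀ (abs_nonneg _) (hC z) 2
  have hQl := locallyIntegrable_integral_slice hb hqm hqC
  have hQi : ∀ a b : ℝ, IntervalIntegrable (fun t => ∫ x in Ω, f (t, x) ^ 2) volume a b :=
    fun a b => intervalIntegrable_iff.2
      ((hQl.integrableOn_isCompact isCompact_uIcc).mono_set uIoc_subset_uIcc)
  filter_upwards [ae_tendsto_averages hQl] with τ hτl hτ
  have hwτ := hw.mono hτ.2.le
  have hK := continuous_integral_inner_translate h.flux_memLp hwτ.2.1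
  have l1 := tendsto_average_of_continuous hK
  simp only [Prod.mk_zero_zero, add_zero] at l1
  refine le_of_forall_pos_le_add fun e he => ?_
  obtain ⟨d, hd, hde⟩ := h.integral_initial_increment ho hb hτ₁ (half_pos he)
  set Q₀ := ∫ x in Ω, f₀ x ^ 2 with hQ₀
  -- From f² ≥ f₀² + 2 f₀ (f - f₀), weak continuity at time zero yields lower semicontinuity of ∫ f²
  -- there. This is the direction needed, since the average over (0, s) enters with a minus sign.
  have hlow : ∀ᵐ t : ℝ, t ∈ Ioo 0 d → Q₀ - e ≤ ∫ x in Ω, f (t, x) ^ 2 := by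
    filter_upwards [hde] with t ht htd
    have h1 := ht htd
    have hf₀ : ∀ x, f₀ x = f (0, x) := fun x => (h.init 0 le_rfl x).symm
    have i0 : IntegrableOn (fun x => f₀ x ^ 2) Ω := by
      simpa only [hf₀] using integrable_slice hb hqm hqC 0
    have i1 := integrable_slice (Ω := Ω) hb hqm hqC t
    have i2 : IntegrableOn (fun x => f₀ x * (f (t, x) - f₀ x)) Ω := by
      refine (((integrable_slice hb h.measurable hC t).sub
        (integrable_slice hb h.measurable hC 0)).bdd_mul (c := C)
        (integrable_slice (Ω := Ω) hb h.measurable hC 0).1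
        (Eventually.of_forall fun x => hC _)).congr (Eventually.of_forall fun x => ?_)
      simp [hf₀]
    have h2 : Q₀ + 2 * ∫ x in Ω, f₀ x * (f (t, x) - f₀ x) ≤ ∫ x in Ω, f (t, x) ^ 2 := by
      rw [hQ₀, ← integral_const_mul, ← integral_add i0 (i2.const_mul 2)]
      refine integral_mono (i0.add (i2.const_mul 2)) i1 fun x => ?_
      dsimp only
      nlinarith [sq_nonneg (f (t, x) - f₀ x)]
    linarith
  have l2 : Tendsto (fun s => (1 / 2) * ((s⁻¹ * ∫ t in τ..(τ + s), ∫ x in Ω, f (t, x) ^ 2)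
      - (Q₀ - e))) (𝓝[>] 0) (𝓝 ((1 / 2) * ((∫ x in Ω, f (τ, x) ^ 2) - (Q₀ - e)))) :=
    (hτl.1.sub_const _).const_mul _
  have l3 := le_of_tendsto_of_tendsto l1 l2 ?_
  · linarith
  · have hs : ∀ᶠ s : ℝ in 𝓝[>] 0, s ∈ Ioo 0 (min d (τ₁ - τ)) :=
      Ioo_mem_nhdsGT (lt_min hd (by linarith [hτ.2]))
    filter_upwards [hs] with s hs
    have hsd := hs.2.trans_le (min_le_left _ _)
    have hsτ := hs.2.trans_le (min_le_right _ _)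
    have e1 := h.integral_increment ho hb hτ.1.le hs.1.le (by linarith) hwτ
    rw [← e1]
    have i1 : IntegrableOn (fun z => f (z + (s, 0)) ^ 2) (cyl Ω τ) :=
      integrableOn_cyl_shift hb hqm hqC τ s
    have i2 : IntegrableOn (fun z => f (z + (0, 0)) ^ 2) (cyl Ω τ) :=
      integrableOn_cyl_shift hb hqm hqC τ 0
    have i3 : IntegrableOn (fun z => (f (z + (s, 0)) - f (z + (0, 0))) * f z) (cyl Ω τ) := by
      have hz := integrableOn_cyl_shift (Ω := Ω) hb h.measurable hC τ 0
      have := ((integrableOn_cyl_shift hb h.measurable hC τ s).sub hz).mul_bdd (c := C) hz.1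
        (Eventually.of_forall fun x => hC _)
      simpa only [IntegrableOn, Prod.mk_zero_zero, add_zero, Pi.sub_apply] using this
    -- The forward increment satisfies (b - a) a ≤ (b² - a²) / 2, which gives the inequality its
    -- sign; the integrals on the right then telescope.
    have h2 : ∫ z in cyl Ω τ, (f (z + (s, 0)) - f (z + (0, 0))) * f z
        ≤ (1 / 2) * ((∫ z in cyl Ω τ, f (z + (s, 0)) ^ 2) - ∫ z in cyl Ω τ, f (z + (0, 0)) ^ 2) := by
      rw [← integral_sub i1 i2, ← integral_const_mul]
      refine integral_mono i3 ((i1.sub i2).const_mul _) fun z => ?_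
      simp only [Prod.mk_zero_zero, add_zero]
      nlinarith [sq_nonneg (f (z + (s, 0)) - f z)]
    rw [setIntegral_cyl_shift hb hqm hqC hτ.1.le, setIntegral_cyl_shift hb hqm hqC hτ.1.le] at h2
    have h3 : (∫ t in s..(τ + s), ∫ x in Ω, f (t, x) ^ 2)
        - ∫ t in 0..(τ + 0), ∫ x in Ω, f (t, x) ^ 2
        = (∫ t in τ..(τ + s), ∫ x in Ω, f (t, x) ^ 2) - ∫ t in 0..s, ∫ x in Ω, f (t, x) ^ 2 := by
      rw [add_zero, intervalIntegral.integral_interval_sub_interval_comm (hQi _ _) (hQi _ _)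
        (hQi _ _)]
      rw [intervalIntegral.integral_symm τ (τ + s), intervalIntegral.integral_symm 0 s]
      ring
    rw [h3] at h2
    have h4 : s * (Q₀ - e) ≤ ∫ t in 0..s, ∫ x in Ω, f (t, x) ^ 2 := by
      have : ∫ _ in (0 : ℝ)..s, (Q₀ - e) ≤ ∫ t in 0..s, ∫ x in Ω, f (t, x) ^ 2 := by
        rw [intervalIntegral.integral_of_le hs.1.le, intervalIntegral.integral_of_le hs.1.le]
        refine setIntegral_mono_on_ae (by simp) (hQi 0 s).1 measurableSet_Ioc ?_
        filter_upwards [hlow] with t ht hts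
        exact ht ⟨hts.1, hts.2.trans_lt hsd⟩
      rwa [intervalIntegral.integral_const, sub_zero, smul_eq_mul] at this
    have hsi : 0 < s⁻¹ := inv_pos.2 hs.1
    have h5 : s⁻¹ * (s * (Q₀ - e)) = Q₀ - e := by
      rw [← mul_assoc, inv_mul_cancel₀ hs.1.ne', one_mul]
    have h6 := mul_le_mul_of_nonneg_left h2 hsi.le
    have h7 := mul_le_mul_of_nonneg_left h4 hsi.le
    nlinarith

end TimeChain

/-! ### Chain rule inequality for smooth functions of several balance laws. -/

section EntropyInequality

variable {ι : Type*} [Fintype ι] [DecidableEq ι]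

theorem TimeBalance.measurable_comp {Ω : Set Space} {τ₁ : ℝ} {f₀ : ι → Space → ℝ}
    {f : ι → ℝ × Space → ℝ} {F : ι → ℝ × Space → Space}
    (h : ∀ a, TimeBalance Ω τ₁ (f₀ a) (f a) (F a)) {Φ : (ι → ℝ) → ℝ} (hΦ : Continuous Φ) :
    Measurable fun z => Φ fun a => f a z :=
  hΦ.measurable.comp (measurable_pi_iff.2 fun a => (h a).measurable)

/-- Chain rule in time for balance laws with fluxes in `L²`, as an inequality. -/
theorem TimeBalance.integral_comp_le_of_hasCompactSupport {Ω : Set Space} (ho : IsOpen Ω)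
    (hb : Bornology.IsBounded Ω) {τ₁ : ℝ} (hτ₁ : 0 < τ₁) {f₀ : ι → Space → ℝ}
    {f : ι → ℝ × Space → ℝ} {F G : ι → ℝ × Space → Space}
    (h : ∀ a, TimeBalance Ω τ₁ (f₀ a) (f a) (F a)) (hw : ∀ a, SmoothApprox Ω τ₁ (f a) (G a))
    {Φ : (ι → ℝ) → ℝ} (hΦ : ContDiff ℝ ∞ Φ) (hΦc : HasCompactSupport Φ) :
    ∀ᵐ τ : ℝ, τ ∈ Ioo 0 τ₁ →
      (∫ x in Ω, Φ fun a => f a (τ, x)) - (∫ x in Ω, Φ fun a => f₀ a x)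
        ≤ ∑ a, ∫ z in cyl Ω τ, inner ℝ (F a z)
          (liftGrad (fderiv ℝ (fun y => fderiv ℝ Φ y (Pi.single a 1)) fun b => f b z)
            fun b => G b z) := by
  obtain ⟨L, hL, hrem⟩ := exists_quadratic_remainder_bound hΦ hΦc
  choose C hC using fun a => (h a).bounded
  obtain ⟨B, hB⟩ := hΦc.exists_bound_of_continuous hΦ.continuous
  have hΦm := TimeBalance.measurable_comp h hΦ.continuous
  have hΦB : ∀ z, |Φ fun a => f a z| ≤ B := fun z => hB _
  have hqm : ∀ a, Measurable fun z => f a z ^ 2 := fun a => (h a).measurable.pow_const 2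
  have hqC : ∀ a z, |f a z ^ 2| ≤ C a ^ 2 := fun a z => by
    rw [abs_pow]; exact pow_le_pow_left₀ (abs_nonneg _) (hC a z) 2
  have hYl := locallyIntegrable_integral_slice (Ω := Ω) hb hΦm hΦB
  have hQl := fun a => locallyIntegrable_integral_slice (Ω := Ω) hb (hqm a) (hqC a)
  have hYi : ∀ a b : ℝ, IntervalIntegrable (fun t => ∫ x in Ω, Φ fun a => f a (t, x)) volume a b :=
    fun a b => intervalIntegrable_iff.2
      ((hYl.integrableOn_isCompact isCompact_uIcc).mono_set uIoc_subset_uIcc)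
  have hQi : ∀ c, ∀ a b : ℝ, IntervalIntegrable (fun t => ∫ x in Ω, f c (t, x) ^ 2) volume a b :=
    fun c a b => intervalIntegrable_iff.2
      (((hQl c).integrableOn_isCompact isCompact_uIcc).mono_set uIoc_subset_uIcc)
  have hen := ae_all_iff.2 fun a => (h a).energy_ge ho hb hτ₁ (hw a)
  set g : ι → (ι → ℝ) → ℝ := fun a y => fderiv ℝ Φ y (Pi.single a 1) with hg
  have hgd : ∀ a, ContDiff ℝ ∞ (g a) := fun a =>
    (hΦ.fderiv_right (m := ∞) (by simp)).clm_apply contDiff_const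
  have hgc : ∀ a, HasCompactSupport (g a) := fun a => hΦc.fderiv_apply (𝕜 := ℝ) _
  have hgw : ∀ a, SmoothApprox Ω τ₁ (fun z => g a fun b => f b z)
      (fun z => liftGrad (fderiv ℝ (g a) fun b => f b z) fun b => G b z) := fun a =>
    SmoothApprox.comp hb hw (hgd a) (hgc a)
  filter_upwards [ae_tendsto_averages hYl, ae_all_iff.2 fun a => ae_tendsto_averages (hQl a), hen]
    with τ hY hQ henτ hτ
  have hgwτ := fun a => (hgw a).mono hτ.2.le
  have hwτ := fun a => (hw a).mono hτ.2.le
  have hK := fun a => tendsto_average_left_of_continuous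
    (continuous_integral_inner_translate (h a).flux_memLp (hgwτ a).2.1)
  have hKf := fun a => tendsto_average_left_of_continuous
    (continuous_integral_inner_translate (h a).flux_memLp (hwτ a).2.1)
  simp only [Prod.mk_zero_zero, add_zero] at hK hKf
  set Y₀ := ∫ x in Ω, Φ fun a => f₀ a x with hY₀
  have l1 : Tendsto (fun s : ℝ => (s⁻¹ * ∫ t in (τ - s)..τ, ∫ x in Ω, Φ fun a => f a (t, x)) - Y₀)
      (𝓝[>] 0) (𝓝 ((∫ x in Ω, Φ fun a => f a (τ, x)) - Y₀)) := hY.2.sub_const _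
  have l2 := (tendsto_finsetSum Finset.univ fun a _ => hK a).add
    ((tendsto_finsetSum Finset.univ fun a _ => ((hKf a).const_mul 2).sub
      ((hQ a).2.sub_const (∫ x in Ω, f₀ a x ^ 2))).const_mul L)
  have l3 := le_of_tendsto_of_tendsto l1 l2 ?_
  · refine l3.trans ?_
    -- The limit of the quadratic remainder is nonpositive by the energy inequality, so it
    -- disappears from the upper bound.
    have : L * ∑ a, (2 * (∫ z in cyl Ω τ, inner ℝ (F a z) (G a z))
        - ((∫ x in Ω, f a (τ, x) ^ 2) - ∫ x in Ω, f₀ a x ^ 2)) ≤ 0 := by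
      refine mul_nonpos_of_nonneg_of_nonpos hL (Finset.sum_nonpos fun a _ => ?_)
      linarith [henτ a hτ]
    linarith
  · have hs : ∀ᶠ s : ℝ in 𝓝[>] 0, s ∈ Ioi (0 : ℝ) := self_mem_nhdsWithin
    filter_upwards [hs] with s hs
    have hs : 0 < s := hs
    have hsi : 0 < s⁻¹ := inv_pos.2 hs
    have e1 := fun a => (h a).integral_increment ho hb hτ.1.le (s₁ := -s) (s₂ := 0) (by linarith)
      (by linarith [hτ.2]) (hgwτ a)
    have e2 := fun a => (h a).integral_increment ho hb hτ.1.le (s₁ := -s) (s₂ := 0) (by linarith)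
      (by linarith [hτ.2]) (hwτ a)
    have ish : ∀ {u : ℝ × Space → ℝ} {D : ℝ}, Measurable u → (∀ z, |u z| ≤ D) →
        IntegrableOn u (cyl Ω τ) ∧ IntegrableOn (fun z => u (z + (-s, 0))) (cyl Ω τ) := by
      intro u D hu hD
      refine ⟨?_, integrableOn_cyl_shift hb hu hD τ _⟩
      simpa only [Prod.mk_zero_zero, add_zero] using integrableOn_cyl_shift (Ω := Ω) hb hu hD τ 0
    have iΦ := ish hΦm hΦB
    have iq := fun a => ish (hqm a) (hqC a)
    have if' := fun a => ish (h a).measurable (hC a)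
    have ig : ∀ a, IntegrableOn (fun z => (f a (z + (0, 0)) - f a (z + (-s, 0)))
        * g a fun b => f b z) (cyl Ω τ) := fun a => by
      obtain ⟨D, hD⟩ := (hgc a).exists_bound_of_continuous (hgd a).continuous
      have := ((if' a).1.sub (if' a).2).mul_bdd (c := D)
        (TimeBalance.measurable_comp h (hgd a).continuous).aestronglyMeasurable
        (Eventually.of_forall fun z => hD _)
      simpa only [IntegrableOn, Prod.mk_zero_zero, add_zero, Pi.sub_apply] using this
    have iff' : ∀ a, IntegrableOn (fun z => (f a (z + (0, 0)) - f a (z + (-s, 0))) * f a z)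
        (cyl Ω τ) := fun a => by
      have := ((if' a).1.sub (if' a).2).mul_bdd (c := C a) (if' a).1.1
        (Eventually.of_forall fun z => hC a _)
      simpa only [IntegrableOn, Prod.mk_zero_zero, add_zero, Pi.sub_apply] using this
    -- The extension by the initial value to negative times makes the backward difference available
    -- from time zero: it telescopes to an integral over (τ - s, τ) minus s times the initial value.
    have hsplit : ∀ {u : ℝ → ℝ} {u₀ : ℝ}, (∀ a b : ℝ, IntervalIntegrable u volume a b) →
        (∀ t ≤ 0, u t = u₀) →
        (∫ t in 0..(τ + 0), u t) - (∫ t in (-s)..(τ + -s), u t)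
          = (∫ t in (τ - s)..τ, u t) - s * u₀ := by
      intro u u₀ hi h0
      have h2 : ∫ t in (-s)..0, u t = s * u₀ := by
        have : ∫ t in (-s)..0, u t = ∫ _ in (-s)..0, u₀ :=
          intervalIntegral.integral_congr fun t ht => by
            rw [uIcc_of_le (by linarith)] at ht
            exact h0 t ht.2
        rw [this]; simp
      rw [← h2, add_zero, ← sub_eq_add_neg, intervalIntegral.integral_interval_sub_interval_comm
        (hi _ _) (hi _ _) (hi _ _), intervalIntegral.integral_symm τ (τ - s),
        intervalIntegral.integral_symm 0 (-s)]
      ring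
    have sΦ : (∫ z in cyl Ω τ, Φ fun a => f a z) - (∫ z in cyl Ω τ, Φ fun a => f a (z + (-s, 0)))
        = (∫ t in (τ - s)..τ, ∫ x in Ω, Φ fun a => f a (t, x)) - s * Y₀ := by
      rw [← hsplit hYi (fun t ht => by simp only [(h _).init t ht, hY₀]),
        ← setIntegral_cyl_shift hb hΦm hΦB hτ.1.le, ← setIntegral_cyl_shift hb hΦm hΦB hτ.1.le]
      simp only [Prod.mk_zero_zero, add_zero]
    have sq : ∀ a, (∫ z in cyl Ω τ, f a z ^ 2) - (∫ z in cyl Ω τ, f a (z + (-s, 0)) ^ 2)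
        = (∫ t in (τ - s)..τ, ∫ x in Ω, f a (t, x) ^ 2) - s * ∫ x in Ω, f₀ a x ^ 2 := fun a => by
      rw [← hsplit (hQi a) (fun t ht => by simp only [(h _).init t ht]),
        ← setIntegral_cyl_shift hb (hqm a) (hqC a) hτ.1.le,
        ← setIntegral_cyl_shift hb (hqm a) (hqC a) hτ.1.le]
      simp only [Prod.mk_zero_zero, add_zero]
    -- Since (y - z)² = 2 (y - z) y - (y² - z²), the quadratic remainder consists of an increment
    -- tested with f itself and a difference of squares. Both have known limits after division by s.
    have main : (∫ z in cyl Ω τ, Φ fun a => f a z) - (∫ z in cyl Ω τ, Φ fun a => f a (z + (-s, 0)))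
        ≤ (∑ a, ∫ z in cyl Ω τ, (f a (z + (0, 0)) - f a (z + (-s, 0))) * g a fun b => f b z)
          + L * ∑ a, (2 * (∫ z in cyl Ω τ, (f a (z + (0, 0)) - f a (z + (-s, 0))) * f a z)
            - ((∫ z in cyl Ω τ, f a z ^ 2) - ∫ z in cyl Ω τ, f a (z + (-s, 0)) ^ 2)) := by
      have r1 : ∀ a, 2 * (∫ z in cyl Ω τ, (f a (z + (0, 0)) - f a (z + (-s, 0))) * f a z)
            - ((∫ z in cyl Ω τ, f a z ^ 2) - ∫ z in cyl Ω τ, f a (z + (-s, 0)) ^ 2)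
          = ∫ z in cyl Ω τ, (2 * ((f a (z + (0, 0)) - f a (z + (-s, 0))) * f a z)
            - (f a z ^ 2 - f a (z + (-s, 0)) ^ 2)) := fun a => by
        rw [← integral_const_mul, ← integral_sub (iq a).1 (iq a).2]
        exact (integral_sub ((iff' a).const_mul 2) ((iq a).1.sub (iq a).2)).symm
      have i2 : ∀ a, Integrable (fun z => 2 * ((f a (z + (0, 0)) - f a (z + (-s, 0))) * f a z)
            - (f a z ^ 2 - f a (z + (-s, 0)) ^ 2)) (volume.restrict (cyl Ω τ)) := fun a =>
        ((iff' a).const_mul 2).sub ((iq a).1.sub (iq a).2)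
      have i3 := integrable_finsetSum Finset.univ fun a _ => ig a
      have i4 := (integrable_finsetSum Finset.univ fun a _ => i2 a).const_mul L
      simp only [r1]
      rw [← integral_sub iΦ.1 iΦ.2, ← integral_finsetSum _ fun a _ => ig a,
        ← integral_finsetSum _ fun a _ => i2 a, ← integral_const_mul]
      refine le_trans (integral_mono (iΦ.1.sub iΦ.2) (i3.add i4) fun z => ?_)
        (integral_add i3 i4).le
      simp only [Pi.add_apply, Prod.mk_zero_zero, add_zero]
      refine (hrem (fun a => f a z) fun a => f a (z + (-s, 0))).trans (le_of_eq ?_)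
      congr 1
      · exact Finset.sum_congr rfl fun a _ => mul_comm _ _
      · congr 1
        exact Finset.sum_congr rfl fun a _ => by ring
    rw [sΦ] at main
    simp only [e1, e2, sq] at main
    have m2 := mul_le_mul_of_nonneg_left main hsi.le
    have hss : s⁻¹ * s = 1 := inv_mul_cancel₀ hs.ne'
    calc _ = s⁻¹ * ((∫ t in (τ - s)..τ, ∫ x in Ω, Φ fun a => f a (t, x)) - s * Y₀) := by
          rw [mul_sub, ← mul_assoc s⁻¹ s, hss, one_mul]
      _ ≤ _ := m2
      _ = _ := by
        rw [mul_add, Finset.mul_sum, ← mul_assoc, mul_comm s⁻¹ L, mul_assoc, Finset.mul_sum]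
        congr 2
        refine Finset.sum_congr rfl fun a _ => ?_
        rw [mul_sub, mul_sub, ← mul_assoc s⁻¹ s, hss, one_mul]
        ring

/-- Chain rule in time for states in a compact set near which `Φ` is smooth. -/
theorem TimeBalance.integral_comp_le {Ω : Set Space} (ho : IsOpen Ω)
    (hb : Bornology.IsBounded Ω) {τ₁ : ℝ} (hτ₁ : 0 < τ₁) {f₀ : ι → Space → ℝ}
    {f : ι → ℝ × Space → ℝ} {F G : ι → ℝ × Space → Space}
    (h : ∀ a, TimeBalance Ω τ₁ (f₀ a) (f a) (F a)) (hw : ∀ a, SmoothApprox Ω τ₁ (f a) (G a))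
    {P O : Set (ι → ℝ)} (hP : IsCompact P) (hO : IsOpen O) (hPO : P ⊆ O)
    (hf : ∀ z, (fun b => f b z) ∈ P) {Φ : (ι → ℝ) → ℝ} (hΦ : ContDiffOn ℝ ∞ Φ O) :
    ∀ᵐ τ : ℝ, τ ∈ Ioo 0 τ₁ →
      (∫ x in Ω, Φ fun a => f a (τ, x)) - (∫ x in Ω, Φ fun a => f₀ a x)
        ≤ ∑ a, ∫ z in cyl Ω τ, inner ℝ (F a z)
          (liftGrad (fderiv ℝ (fun y => fderiv ℝ Φ y (Pi.single a 1)) fun b => f b z)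
            fun b => G b z) := by
  obtain ⟨g', hg', hgc, heq⟩ := exists_contDiff_hasCompactSupport_eventuallyEq hP hO hPO hΦ
  have h0 : ∀ x, (fun b => f₀ b x) ∈ P := fun x => by
    simpa only [(h _).init 0 le_rfl] using hf (0, x)
  filter_upwards [TimeBalance.integral_comp_le_of_hasCompactSupport ho hb hτ₁ h hw hg' hgc]
    with τ hτ hτ'
  have e1 : ∀ z, Φ (fun a => f a z) = g' fun a => f a z := fun z => (heq _ (hf z)).eq_of_nhds.symm
  have e2 : ∀ x, Φ (fun a => f₀ a x) = g' fun a => f₀ a x := fun x =>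
    (heq _ (h0 x)).eq_of_nhds.symm
  -- Agreement of Φ and g' on a neighbourhood, not merely at the points of P, is what also
  -- identifies the second derivatives.
  have e3 : ∀ a z, fderiv ℝ (fun y => fderiv ℝ Φ y (Pi.single a 1)) (fun b => f b z)
      = fderiv ℝ (fun y => fderiv ℝ g' y (Pi.single a 1)) fun b => f b z := fun a z =>
    Filter.EventuallyEq.fderiv_eq (((heq _ (hf z)).fderiv (𝕜 := ℝ)).mono fun y hy =>
      congrArg (fun L : (ι → ℝ) →L[ℝ] ℝ => L (Pi.single a 1)) hy.symm)
  simp only [e1, e2, e3]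
  exact hτ hτ'

end EntropyInequality

/-! ### Gronwall's lemma with an integrable coefficient -/

/-- The primitive Z(t) = ∫ a Y is nondecreasing and satisfies Z(t) - Z(s) ≤ Z(t) ∫ a over (s, t).
Its zero set is closed, contains 0, and extends to the right of each of its points: as long as the
integral of a from t to r is below 1/2, Z(t) = 0 forces Z(r) ≤ Z(r) / 2. Hence Z vanishes
throughout. -/
theorem ae_eq_zero_of_le_integral {τ₁ C : ℝ} {a Y : ℝ → ℝ} (hτ₁ : 0 < τ₁)
    (ha : IntegrableOn a (Ioo 0 τ₁)) (ha0 : ∀ t, 0 ≤ a t) (hYm : Measurable Y)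
    (hY0 : ∀ t, 0 ≤ Y t) (hYC : ∀ t, Y t ≤ C)
    (h : ∀ᵐ τ : ℝ, τ ∈ Ioo 0 τ₁ → Y τ ≤ ∫ s in 0..τ, a s * Y s) :
    ∀ᵐ τ : ℝ, τ ∈ Ioo 0 τ₁ → Y τ = 0 := by
  have hai : IntervalIntegrable a volume 0 τ₁ :=
    (intervalIntegrable_iff_integrableOn_Ioo_of_le hτ₁.le).2 ha
  have hwi : IntervalIntegrable (fun s => a s * Y s) volume 0 τ₁ := by
    rw [intervalIntegrable_iff_integrableOn_Ioo_of_le hτ₁.le]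
    exact ha.mul_bdd (c := C) hYm.aestronglyMeasurable (Eventually.of_forall fun t => by
      rw [Real.norm_eq_abs, abs_of_nonneg (hY0 t)]; exact hYC t)
  have hsub : ∀ {g : ℝ → ℝ}, IntervalIntegrable g volume 0 τ₁ → ∀ {s t}, s ∈ Icc 0 τ₁ →
      t ∈ Icc 0 τ₁ → IntervalIntegrable g volume s t := fun hg s t hs ht =>
    hg.mono_set (by rw [uIcc_of_le hτ₁.le]; exact uIcc_subset_Icc hs ht)
  have hcont : ∀ {g : ℝ → ℝ}, IntervalIntegrable g volume 0 τ₁ →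
      ContinuousOn (fun t => ∫ s in 0..t, g s) (Icc 0 τ₁) := fun hg => by
    have := intervalIntegral.continuousOn_primitive_interval' hg left_mem_uIcc
    rwa [uIcc_of_le hτ₁.le] at this
  set Z : ℝ → ℝ := fun t => ∫ s in 0..t, a s * Y s with hZ
  have h0 : (0 : ℝ) ∈ Icc 0 τ₁ := ⟨le_rfl, hτ₁.le⟩
  have hmono : ∀ {s t}, s ∈ Icc 0 τ₁ → t ∈ Icc 0 τ₁ → s ≤ t → Z s ≤ Z t := by
    intro s t hs ht hst
    have h1 : Z t - Z s = ∫ r in s..t, a r * Y r :=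
      intervalIntegral.integral_interval_sub_left (hsub hwi h0 ht) (hsub hwi h0 hs)
    have h2 : 0 ≤ ∫ r in s..t, a r * Y r :=
      intervalIntegral.integral_nonneg hst fun r _ => mul_nonneg (ha0 r) (hY0 r)
    linarith
  have hZ0 : ∀ t ∈ Icc 0 τ₁, 0 ≤ Z t := fun t ht => by
    simpa [hZ] using hmono h0 ht ht.1
  have hstep : ∀ {s t}, s ∈ Icc 0 τ₁ → t ∈ Icc 0 τ₁ → s ≤ t → Z t - Z s ≤ Z t * ∫ r in s..t, a r := by
    intro s t hs ht hst
    have h1 : Z t - Z s = ∫ r in s..t, a r * Y r :=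
      intervalIntegral.integral_interval_sub_left (hsub hwi h0 ht) (hsub hwi h0 hs)
    rw [h1, ← intervalIntegral.integral_const_mul, intervalIntegral.integral_of_le hst,
      intervalIntegral.integral_of_le hst, integral_Ioc_eq_integral_Ioo,
      integral_Ioc_eq_integral_Ioo]
    refine setIntegral_mono_on_ae ?_ ?_ measurableSet_Ioo ?_
    · exact (hsub hwi hs ht).1.mono_set Ioo_subset_Ioc_self
    · exact ((hsub hai hs ht).1.mono_set Ioo_subset_Ioc_self).const_mul _
    · filter_upwards [h] with r hr hrs
      have h2 := hr ⟨hs.1.trans_lt hrs.1, hrs.2.trans_le ht.2⟩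
      rw [mul_comm]
      refine mul_le_mul_of_nonneg_right (h2.trans ?_) (ha0 r)
      exact hmono ⟨hs.1.trans hrs.1.le, hrs.2.le.trans ht.2⟩ ht hrs.2.le
  have hzero : Icc 0 τ₁ ⊆ {t | Z t = 0} := by
    have hcl : IsClosed ({t | Z t = 0} ∩ Icc 0 τ₁) := by
      rw [inter_comm]
      exact (hcont hwi).preimage_isClosed_of_isClosed isClosed_Icc isClosed_singleton
    refine hcl.Icc_subset_of_forall_exists_gt (by simp [hZ]) fun t ht y hy => ?_
    have htI : t ∈ Icc 0 τ₁ := ⟨ht.2.1, ht.2.2.le⟩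
    have hA := (hcont hai) t htI
    have hA' : ContinuousWithinAt (fun t => ∫ s in 0..t, a s) (Ioi t) t := by
      have : Icc 0 τ₁ ∈ 𝓝[>] t := mem_of_superset (Ioo_mem_nhdsGT ht.2.2)
        fun r hr => ⟨ht.2.1.trans hr.1.le, hr.2.le⟩
      exact hA.mono_of_mem_nhdsWithin this
    have hlt : ∀ᶠ r in 𝓝[>] t, (∫ s in 0..r, a s) < (∫ s in 0..t, a s) + 1 / 2 :=
      hA'.tendsto.eventually_lt_const (by linarith)
    have hy' : t < y := hy
    obtain ⟨r, hr, hrI⟩ := (hlt.and (Ioo_mem_nhdsGT (lt_min ht.2.2 hy'))).exists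
    have hrI' : r ∈ Icc 0 τ₁ := ⟨ht.2.1.trans hrI.1.le, (hrI.2.trans_le (min_le_left _ _)).le⟩
    refine ⟨r, ?_, hrI.1, (hrI.2.trans_le (min_le_right _ _)).le⟩
    have h1 := hstep htI hrI' hrI.1.le
    have h2 : Z t = 0 := ht.1
    have h3 : (∫ s in 0..r, a s) - ∫ s in 0..t, a s = ∫ s in t..r, a s :=
      intervalIntegral.integral_interval_sub_left (hsub hai h0 hrI') (hsub hai h0 htI)
    have h4 := hZ0 r hrI'
    have h5 : Z r * ∫ s in t..r, a s ≤ Z r * (1 / 2) :=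
      mul_le_mul_of_nonneg_left (by linarith) h4
    change Z r = 0
    linarith
  filter_upwards [h] with τ hτ hτI
  have h1 : Z τ = 0 := hzero ⟨hτI.1.le, hτI.2.le⟩
  exact le_antisymm ((hτ hτI).trans h1.le) (hY0 τ)

/-! ### Algebra of the Maxwell–Stefan relations -/

section Pointwise

variable {ι V : Type*} [Fintype ι] [NormedAddCommGroup V] [InnerProductSpace ℝ V]

/-- Lagrange's identity. Friction sees only velocity differences; this recovers the full weighted
norm minus the square of the barycentric momentum. -/
theorem sum_sum_mul_norm_sub_sq (r : ι → ℝ) (v : ι → V) :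
    ∑ i, ∑ j, r i * r j * ‖v i - v j‖ ^ 2
      = 2 * ((∑ i, r i) * ∑ i, r i * ‖v i‖ ^ 2 - ‖∑ i, r i • v i‖ ^ 2) := by
  have h1 : ‖∑ i, r i • v i‖ ^ 2 = ∑ i, ∑ j, r i * r j * inner ℝ (v i) (v j) := by
    rw [← real_inner_self_eq_norm_sq, sum_inner]
    refine Finset.sum_congr rfl fun i _ => ?_
    rw [inner_sum]
    refine Finset.sum_congr rfl fun j _ => ?_
    rw [real_inner_smul_left, real_inner_smul_right]
    ring
  have h2 : (∑ i, r i) * ∑ i, r i * ‖v i‖ ^ 2 = ∑ i, ∑ j, r i * r j * ‖v j‖ ^ 2 := by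
    rw [Finset.sum_mul_sum]
    exact Finset.sum_congr rfl fun i _ => Finset.sum_congr rfl fun j _ => by ring
  have h3 : (∑ i, r i) * ∑ i, r i * ‖v i‖ ^ 2 = ∑ i, ∑ j, r i * r j * ‖v i‖ ^ 2 := by
    rw [h2, Finset.sum_comm]
    exact Finset.sum_congr rfl fun i _ => Finset.sum_congr rfl fun j _ => by ring
  have h4 : ∑ i, ∑ j, r i * r j * ‖v i - v j‖ ^ 2
      = (∑ i, ∑ j, r i * r j * ‖v i‖ ^ 2) + (∑ i, ∑ j, r i * r j * ‖v j‖ ^ 2)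
        - 2 * ∑ i, ∑ j, r i * r j * inner ℝ (v i) (v j) := by
    simp only [Finset.mul_sum, ← Finset.sum_add_distrib, ← Finset.sum_sub_distrib]
    refine Finset.sum_congr rfl fun i _ => Finset.sum_congr rfl fun j _ => ?_
    rw [norm_sub_sq_real]
    ring
  rw [h4, ← h2, ← h3, ← h1]
  ring

/-- Exchanging i and j and using the symmetry of β pairs the terms with v i and -v j into a square.
-/
theorem sum_inner_friction {β : ι → ι → ℝ} (hβ : ∀ i j, β i j = β j i) (r : ι → ℝ) (v : ι → V) :
    2 * ∑ i, inner ℝ (r i • v i) (∑ j, (β i j * r j) • (v i - v j))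
      = ∑ i, ∑ j, β i j * (r i * r j * ‖v i - v j‖ ^ 2) := by
  have h1 : ∑ i, inner ℝ (r i • v i) (∑ j, (β i j * r j) • (v i - v j))
      = ∑ i, ∑ j, β i j * r i * r j * inner ℝ (v i) (v i - v j) := by
    refine Finset.sum_congr rfl fun i _ => ?_
    rw [inner_sum]
    refine Finset.sum_congr rfl fun j _ => ?_
    rw [real_inner_smul_left, real_inner_smul_right]
    ring
  have h2 : ∑ i, ∑ j, β i j * r i * r j * inner ℝ (v i) (v i - v j)
      = ∑ i, ∑ j, β i j * r i * r j * inner ℝ (v j) (v j - v i) := by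
    rw [Finset.sum_comm]
    exact Finset.sum_congr rfl fun i _ => Finset.sum_congr rfl fun j _ => by rw [hβ]; ring
  rw [two_mul]
  nth_rewrite 2 [h1]
  rw [h1, h2]
  nth_rewrite 1 [← h2]
  simp only [← Finset.sum_add_distrib]
  refine Finset.sum_congr rfl fun i _ => Finset.sum_congr rfl fun j _ => ?_
  rw [← real_inner_self_eq_norm_sq, inner_sub_left, ← neg_sub (v i) (v j), inner_neg_right]
  ring

/-- Inversion of the Maxwell–Stefan relations for the fluxes. -/
theorem sum_norm_flux_le {β : ι → ι → ℝ} (hβ : ∀ i j, β i j = β j i) {b₀ : ℝ}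
    (hb : ∀ i j, b₀ ≤ β i j) {r : ι → ℝ} (hr : ∀ i, 0 ≤ r i) {J R : ι → V} (hJ : ∑ i, J i = 0)
    (hR : ∀ i, ∑ j, β i j • (r j • J i - r i • J j) = R i) :
    b₀ * (∑ i, r i) * ∑ i, ‖J i‖ ≤ ∑ i, ‖R i‖ := by
  -- Testing with the directions of the fluxes, not the fluxes themselves, gives a bound for ∑ ‖J i‖
  -- that needs no lower bound on the individual r i. For J i = 0 the direction is 0.
  set e : ι → V := fun i => ‖J i‖⁻¹ • J i with he
  have he1 : ∀ i, ‖e i‖ ≤ 1 := fun i => by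
    rw [he, norm_smul, norm_inv, norm_norm]
    exact inv_mul_le_one
  have heJ : ∀ i, inner ℝ (e i) (J i) = ‖J i‖ := fun i => by
    rw [real_inner_smul_left, real_inner_self_eq_norm_sq]
    by_cases h : ‖J i‖ = 0
    · simp [h]
    · field_simp
  have hle : ∀ i j, inner ℝ (e j) (J i) ≤ ‖J i‖ := fun i j =>
    (real_inner_le_norm _ _).trans (mul_le_of_le_one_left (norm_nonneg _) (he1 j))
  have h1 : ∑ i, inner ℝ (e i) (R i) = ∑ i, ∑ j, β i j * (r j * (‖J i‖ - inner ℝ (e j) (J i))) := by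
    have h2 : ∑ i, inner ℝ (e i) (R i)
        = ∑ i, ∑ j, (β i j * (r j * ‖J i‖) - β i j * (r i * inner ℝ (e i) (J j))) := by
      refine Finset.sum_congr rfl fun i _ => ?_
      rw [← hR i, inner_sum]
      refine Finset.sum_congr rfl fun j _ => ?_
      rw [real_inner_smul_right, inner_sub_right, real_inner_smul_right, real_inner_smul_right,
        heJ]
      ring
    rw [h2]
    simp only [Finset.sum_sub_distrib, mul_sub]
    congr 1
    rw [Finset.sum_comm]
    exact Finset.sum_congr rfl fun i _ => Finset.sum_congr rfl fun j _ => by rw [hβ]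
  -- The inner products with e j sum to zero against the constant coefficient b₀ because ∑ J i = 0.
  -- The resulting summands are nonnegative, so b₀ may then be replaced by β i j.
  calc b₀ * (∑ i, r i) * ∑ i, ‖J i‖
      = ∑ i, ∑ j, b₀ * (r j * (‖J i‖ - inner ℝ (e j) (J i))) := by
        have h3 : ∑ i, ∑ j, b₀ * (r j * inner ℝ (e j) (J i)) = 0 := by
          rw [Finset.sum_comm]
          refine Finset.sum_eq_zero fun j _ => ?_
          simp only [← Finset.mul_sum]
          rw [← inner_sum, hJ, inner_zero_right, mul_zero, mul_zero]
        simp only [mul_sub, Finset.sum_sub_distrib]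
        rw [h3, sub_zero, mul_assoc, mul_comm (∑ i, r i), Finset.sum_mul_sum, Finset.mul_sum]
        refine Finset.sum_congr rfl fun i _ => ?_
        rw [Finset.mul_sum]
        exact Finset.sum_congr rfl fun j _ => by ring
    _ ≤ ∑ i, ∑ j, β i j * (r j * (‖J i‖ - inner ℝ (e j) (J i))) := by
        refine Finset.sum_le_sum fun i _ => Finset.sum_le_sum fun j _ => ?_
        exact mul_le_mul_of_nonneg_right (hb i j)
          (mul_nonneg (hr j) (sub_nonneg.2 (hle i j)))
    _ = ∑ i, inner ℝ (e i) (R i) := h1.symm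
    _ ≤ ∑ i, ‖R i‖ := Finset.sum_le_sum fun i _ =>
        (real_inner_le_norm _ _).trans (mul_le_of_le_one_left (norm_nonneg _) (he1 i))

/-- Put A = c⁻¹ g - c̄⁻¹ ḡ and D = C⁻¹ G - C̄⁻¹ Ḡ, the gradients of log (c / c̄) and log (C / C̄).
The first bracket is A - D, the second -(c / c̄) A + (C / C̄) D. Collecting terms leaves a product
of differences and an error weighted by c - c̄ C / C̄. -/
theorem relative_flux_identity {c cb C Cb : ℝ} (hc : c ≠ 0) (hcb : cb ≠ 0) (hC : C ≠ 0)
    (hCb : Cb ≠ 0) (u ub g gb G Gb : V) :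
    inner ℝ (c • u) (c⁻¹ • g - C⁻¹ • G - cb⁻¹ • gb + Cb⁻¹ • Gb)
      + inner ℝ (cb • ub) (-(cb⁻¹ • g) + (c / cb ^ 2) • gb + Cb⁻¹ • G - (C / Cb ^ 2) • Gb)
      = inner ℝ (c • (u - ub)) ((c⁻¹ • g - C⁻¹ • G) - (cb⁻¹ • gb - Cb⁻¹ • Gb))
        - (c - cb * (C / Cb)) * inner ℝ ub (C⁻¹ • G - Cb⁻¹ • Gb) := by
  simp only [inner_add_right, inner_sub_right, inner_neg_right, real_inner_smul_left,
    real_inner_smul_right, inner_sub_left]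
  field_simp
  ring

theorem friction_difference_bound {β βb : ι → ι → ℝ} {r rb : ι → ℝ} {ub : ι → V}
    {b₁ L M W q : ℝ} (hβb : ∀ i j, |βb i j| ≤ b₁) (hL : ∀ i j, |β i j - βb i j| ≤ L * W)
    (hr : ∀ i, 0 ≤ r i) (hrM : ∀ i, r i ≤ M) (hL0 : 0 ≤ L) (hM : 0 ≤ M) (hW0 : 0 ≤ W)
    (hW : ∑ i, |r i - rb i| ≤ W) (hq : ∀ i, ‖ub i‖ ≤ q) (hb₁ : 0 ≤ b₁) (i : ι) :
    ‖∑ j, (β i j * r j - βb i j * rb j) • (ub i - ub j)‖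
      ≤ 2 * Fintype.card ι * (L * M + b₁) * (q * W) := by
  have hq0 : 0 ≤ q := (norm_nonneg _).trans (hq i)
  have h1 : ∀ j ∈ Finset.univ, ‖(β i j * r j - βb i j * rb j) • (ub i - ub j)‖
      ≤ ((L * M + b₁) * W) * (2 * q) := fun j _ => by
    rw [norm_smul]
    refine mul_le_mul ?_ ?_ (norm_nonneg _) (by positivity)
    · rw [Real.norm_eq_abs]
      have e : β i j * r j - βb i j * rb j = (β i j - βb i j) * r j + βb i j * (r j - rb j) := by
        ring
      rw [e]
      refine (abs_add_le _ _).trans ?_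
      rw [abs_mul, abs_mul, abs_of_nonneg (hr j)]
      have h2 : |r j - rb j| ≤ W := (Finset.single_le_sum (f := fun i => |r i - rb i|)
        (fun i _ => abs_nonneg _) (Finset.mem_univ j)).trans hW
      have h3 := mul_le_mul (hL i j) (hrM j) (hr j) (by positivity)
      have h4 := mul_le_mul (hβb i j) h2 (abs_nonneg _) hb₁
      nlinarith
    · refine (norm_sub_le _ _).trans ?_
      linarith [hq i, hq j]
  refine (norm_sum_le_of_le _ h1).trans (le_of_eq ?_)
  rw [Finset.sum_const, Finset.card_univ, nsmul_eq_mul]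
  ring

end Pointwise

/-! ### Upper bound for the relative entropy production. -/

section RelativeFlux

variable {ι V : Type*} [Fintype ι] [NormedAddCommGroup V] [InnerProductSpace ℝ V]

/-- Division by c i cancels the same factor in the friction term, so the gradient of the logarithmic
mole fraction has no singular coefficient. -/
theorem smul_log_gradient_eq {m : ι → ℝ} {β : ι → ι → ℝ} {ε : ℝ} {c : ι → ℝ} {G u : ι → V}
    {C : ℝ} {Gs : V} (hc : ∀ i, 0 < c i)
    (hMS : ∀ i, ε • (G i - (c i / C) • Gs)
      = -∑ j, (β i j * (m i * c i) * (m j * c j)) • (u i - u j)) (i : ι) :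
    ε • ((c i)⁻¹ • G i - C⁻¹ • Gs) = -(m i • ∑ j, (β i j * (m j * c j)) • (u i - u j)) := by
  have h1 : (c i)⁻¹ • G i - C⁻¹ • Gs = (c i)⁻¹ • (G i - (c i / C) • Gs) := by
    rw [smul_sub, smul_smul]
    congr 2
    field_simp [(hc i).ne']
  rw [h1, smul_comm, hMS, smul_neg, Finset.smul_sum, Finset.smul_sum]
  congr 1
  refine Finset.sum_congr rfl fun j _ => ?_
  rw [smul_smul, smul_smul]
  congr 1
  field_simp [(hc i).ne']

/-- The difference of the friction terms splits into friction of the velocity differences with the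
coefficients of the first solution, and a coefficient error multiplying only the velocities of the
second. -/
theorem smul_log_gradient_sub_eq {ε : ℝ} {μ : ι → ℝ} {β βb : ι → ι → ℝ} {r rb : ι → ℝ}
    {u ub E Eb : ι → V} (hE : ∀ i, ε • E i = -(μ i • ∑ j, (β i j * r j) • (u i - u j)))
    (hEb : ∀ i, ε • Eb i = -(μ i • ∑ j, (βb i j * rb j) • (ub i - ub j))) (i : ι) :
    ε • (E i - Eb i) = -(μ i • (∑ j, (β i j * r j) • ((u i - ub i) - (u j - ub j))
      + ∑ j, (β i j * r j - βb i j * rb j) • (ub i - ub j))) := by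
  rw [smul_sub, hE, hEb, neg_sub_neg, ← smul_sub, ← smul_neg]
  congr 1
  rw [← Finset.sum_add_distrib, ← Finset.sum_sub_distrib, ← Finset.sum_neg_distrib]
  refine Finset.sum_congr rfl fun j _ => ?_
  module

/-- The relations determine only gradients of mole fractions. The missing gradient of log (C / C̄)
is recovered from the equality of the total mass densities and of their gradients, by writing m_i
∇c_i = ρ_i ∇log c_i and summing. -/
theorem total_log_gradient_eq {m c cb : ι → ℝ} {G Gb : ι → V} {C Cb ρ : ℝ} {Gs Gbs : V}
    (hc : ∀ i, 0 < c i) (hcb : ∀ i, 0 < cb i) (hρ : ∑ i, m i * c i = ρ)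
    (hρb : ∑ i, m i * cb i = ρ) (hG : ∑ i, m i • G i = ∑ i, m i • Gb i) :
    ρ • (C⁻¹ • Gs - Cb⁻¹ • Gbs)
      = -(∑ i, (m i * c i) • (((c i)⁻¹ • G i - C⁻¹ • Gs) - ((cb i)⁻¹ • Gb i - Cb⁻¹ • Gbs))
        + ∑ i, (m i * c i - m i * cb i) • ((cb i)⁻¹ • Gb i - Cb⁻¹ • Gbs)) := by
  have h1 : ∀ i, (m i * c i) • (((c i)⁻¹ • G i - C⁻¹ • Gs) - ((cb i)⁻¹ • Gb i - Cb⁻¹ • Gbs))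
        + (m i * c i - m i * cb i) • ((cb i)⁻¹ • Gb i - Cb⁻¹ • Gbs)
      = m i • G i - m i • Gb i - (m i * c i) • (C⁻¹ • Gs) + (m i * cb i) • (Cb⁻¹ • Gbs) := by
    intro i
    have e1 : m i • G i = (m i * c i) • ((c i)⁻¹ • G i) := by
      rw [smul_smul, mul_assoc, mul_inv_cancel₀ (hc i).ne', mul_one]
    have e2 : m i • Gb i = (m i * cb i) • ((cb i)⁻¹ • Gb i) := by
      rw [smul_smul, mul_assoc, mul_inv_cancel₀ (hcb i).ne', mul_one]
    rw [e1, e2]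
    module
  rw [← Finset.sum_add_distrib, Finset.sum_congr rfl fun i _ => h1 i]
  simp only [Finset.sum_add_distrib, Finset.sum_sub_distrib, ← Finset.sum_smul, hρ, hρb, hG]
  module

/-- Splitting off c̄_i (C̄ - C) / C̄, whose absolute values sum to |C̄ - C| ≤ ∑ |c_i - c̄_i|,
doubles the bound; hence the factor 2. -/
theorem sum_abs_concentration_sub_le {m c cb : ι → ℝ} {C Cb m₀ W : ℝ} (hcb : ∀ i, 0 < cb i)
    (hC : ∑ i, c i = C) (hCb : ∑ i, cb i = Cb) (hCb0 : 0 < Cb) (hm₀ : 0 < m₀) (hm : ∀ i, m₀ ≤ m i)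
    (hW : ∑ i, |m i * c i - m i * cb i| ≤ W) :
    ∑ i, |c i - cb i * (C / Cb)| ≤ 2 / m₀ * W := by
  have h1 : ∑ i, |c i - cb i| ≤ W / m₀ := by
    rw [le_div_iff₀ hm₀, Finset.sum_mul]
    refine (Finset.sum_le_sum fun i _ => ?_).trans hW
    rw [← mul_sub, abs_mul, mul_comm, abs_of_pos (hm₀.trans_le (hm i))]
    exact mul_le_mul_of_nonneg_right (hm i) (abs_nonneg _)
  have h2 : |Cb - C| ≤ ∑ i, |c i - cb i| := by
    rw [← hC, ← hCb, ← Finset.sum_sub_distrib]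
    refine (Finset.abs_sum_le_sum_abs _ _).trans (le_of_eq ?_)
    exact Finset.sum_congr rfl fun i _ => abs_sub_comm _ _
  have h3 : ∀ i, |c i - cb i * (C / Cb)| ≤ |c i - cb i| + cb i * (|Cb - C| / Cb) := fun i => by
    have e : c i - cb i * (C / Cb) = (c i - cb i) + cb i * ((Cb - C) / Cb) := by
      field_simp
      ring
    rw [e]
    refine (abs_add_le _ _).trans (add_le_add_right (le_of_eq ?_) _)
    rw [abs_mul, abs_div, abs_of_pos (hcb i), abs_of_pos hCb0]
  calc _ ≤ ∑ i, (|c i - cb i| + cb i * (|Cb - C| / Cb)) := Finset.sum_le_sum fun i _ => h3 i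
    _ = (∑ i, |c i - cb i|) + |Cb - C| := by
      rw [Finset.sum_add_distrib, ← Finset.sum_mul, hCb]
      field_simp
    _ ≤ W / m₀ + W / m₀ := add_le_add h1 (h2.trans h1)
    _ = _ := by ring

/-- Let s² = ∑ r_i ‖u_i - ū_i‖² and X = q W. The friction form contributes -α s², and every other
term is at most a multiple of s X or of X², so Young's inequality leaves a multiple of X². The
constant depends only on the bounds listed, and no lower bound on c i enters. -/
theorem exists_relative_flux_bound (ι V : Type*) [Fintype ι] [NormedAddCommGroup V]
    [InnerProductSpace ℝ V] {ε b₀ b₁ L M m₀ m₁ ρ₀ : ℝ} (hε : 0 < ε)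
    (hb₀ : 0 < b₀) (hL : 0 ≤ L) (hM : 0 ≤ M) (hm₀ : 0 < m₀) (hρ₀ : 0 < ρ₀) (hb₁ : 0 ≤ b₁) :
    ∃ K, 0 ≤ K ∧ ∀ (m c cb : ι → ℝ) (β βb : ι → ι → ℝ) (G Gb u ub : ι → V) (q W : ℝ),
      (∀ i, m₀ ≤ m i) → (∀ i, m i ≤ m₁) → (∀ i, 0 < c i) → (∀ i, m i * c i ≤ M) →
      (∀ i, 0 < cb i) → (∑ i, m i * c i = ∑ i, m i * cb i) → (ρ₀ ≤ ∑ i, m i * c i) →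
      (∑ i, m i • G i = ∑ i, m i • Gb i) →
      (∀ i j, β i j = β j i) → (∀ i j, b₀ ≤ β i j) → (∀ i j, β i j ≤ b₁) →
      (∀ i j, |βb i j| ≤ b₁) → (∀ i j, |β i j - βb i j| ≤ L * W) →
      (∀ i, ε • (G i - (c i / ∑ j, c j) • ∑ j, G j)
        = -∑ j, (β i j * (m i * c i) * (m j * c j)) • (u i - u j)) →
      (∀ i, ε • (Gb i - (cb i / ∑ j, cb j) • ∑ j, Gb j)
        = -∑ j, (βb i j * (m i * cb i) * (m j * cb j)) • (ub i - ub j)) →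
      ∑ i, (m i * c i) • u i = 0 → ∑ i, (m i * cb i) • ub i = 0 →
      (∀ i, ‖ub i‖ ≤ q) →
      (∀ i, ‖(cb i)⁻¹ • Gb i - (∑ j, cb j)⁻¹ • ∑ j, Gb j‖ ≤ q) →
      0 ≤ W → ∑ i, |m i * c i - m i * cb i| ≤ W →
      (∑ i, inner ℝ (c i • u i) ((c i)⁻¹ • G i - (∑ j, c j)⁻¹ • (∑ j, G j) - (cb i)⁻¹ • Gb i
          + (∑ j, cb j)⁻¹ • ∑ j, Gb j))
        + (∑ i, inner ℝ (cb i • ub i) (-((cb i)⁻¹ • G i) + (c i / cb i ^ 2) • Gb i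
          + (∑ j, cb j)⁻¹ • (∑ j, G j) - ((∑ j, c j) / (∑ j, cb j) ^ 2) • ∑ j, Gb j))
        ≤ K * (q * W) ^ 2 := by
  set N : ℝ := (Fintype.card ι : ℝ) with hN
  have hN0 : 0 ≤ N := Nat.cast_nonneg _
  set a := Real.sqrt M with ha
  have ha0 : 0 ≤ a := Real.sqrt_nonneg M
  set k₁ := 2 * N * (L * M + b₁) with hk₁
  have hk₁0 : 0 ≤ k₁ := by positivity
  set m₂ := max m₁ 0 with hm₂
  have hm₂0 : 0 ≤ m₂ := le_max_right _ _
  set k₃ := N * (m₂ / ε * (N * (b₁ * (2 * M * a)))) with hk₃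
  have hk₃0 : 0 ≤ k₃ := by positivity
  set k₄ := N * (m₂ / ε * (M * k₁)) + 1 with hk₄
  have hk₄0 : 0 ≤ k₄ := by positivity
  set α := b₀ * ρ₀ / ε with hα
  have hα0 : 0 < α := by positivity
  set A := b₀ / ε + 2 / m₀ * (k₄ / ρ₀) with hA
  have hA0 : 0 ≤ A := by positivity
  -- A and B collect the coefficients of X² and s X. In each, the first summand comes from the
  -- friction terms (barycentric defect, coefficient error) and the second from the gradient of log
  -- (C / C̄). Completing the square with -α s² costs B² / (4α).
  set B := N * a * k₁ / ε + 2 / m₀ * (k₃ / ρ₀) with hB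
  refine ⟨A + B ^ 2 / (4 * α), by positivity, ?_⟩
  intro m c cb β βb G Gb u ub q W hm hm' hc hcM hcb hρ hρρ hG hβ hβ0 hβ1 hβb hβL hMS hMSb hJ hJb
    hq hqE hW0 hW
  have hm0 : ∀ i, 0 < m i := fun i => hm₀.trans_le (hm i)
  have hne : Nonempty ι := by
    by_contra hn
    rw [not_nonempty_iff] at hn
    simp at hρρ
    linarith
  have hq0 : 0 ≤ q := (norm_nonneg _).trans (hq hne.some)
  set C := ∑ j, c j with hC
  set Cb := ∑ j, cb j with hCb
  have hC0 : 0 < C := Finset.sum_pos (fun i _ => hc i) Finset.univ_nonempty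
  have hCb0 : 0 < Cb := Finset.sum_pos (fun i _ => hcb i) Finset.univ_nonempty
  set Gs := ∑ j, G j with hGs
  set Gbs := ∑ j, Gb j with hGbs
  set r : ι → ℝ := fun i => m i * c i with hr
  set rb : ι → ℝ := fun i => m i * cb i with hrb
  have hr0 : ∀ i, 0 ≤ r i := fun i => (mul_pos (hm0 i) (hc i)).le
  set v : ι → V := fun i => u i - ub i with hv
  set E : ι → V := fun i => (c i)⁻¹ • G i - C⁻¹ • Gs with hE
  set Eb : ι → V := fun i => (cb i)⁻¹ • Gb i - Cb⁻¹ • Gbs with hEb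
  set D := C⁻¹ • Gs - Cb⁻¹ • Gbs with hD
  set Z : ι → V := fun i => ∑ j, (β i j * r j - βb i j * rb j) • (ub i - ub j) with hZ
  set F : ι → V := fun i => ∑ j, (β i j * r j) • (v i - v j) with hF
  have hEd : ∀ i, ε • (E i - Eb i) = -(m i • (F i + Z i)) :=
    smul_log_gradient_sub_eq (smul_log_gradient_eq hc hMS) (smul_log_gradient_eq hcb hMSb)
  have hX0 : 0 ≤ q * W := mul_nonneg hq0 hW0
  set X := q * W with hX
  have hZn : ∀ i, ‖Z i‖ ≤ k₁ * X := fun i =>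
    friction_difference_bound hβb hβL hr0 hcM hL hM hW0 hW hq hb₁ i
  set S := ∑ i, r i * ‖v i‖ ^ 2 with hS
  have hS0 : 0 ≤ S := Finset.sum_nonneg fun i _ => mul_nonneg (hr0 i) (sq_nonneg _)
  set s := Real.sqrt S with hs
  have hs0 : 0 ≤ s := Real.sqrt_nonneg S
  have hss : s ^ 2 = S := Real.sq_sqrt hS0
  -- The weighted norm controls r_i ‖v_i‖ through the upper bound r_i ≤ M, so vanishing densities do
  -- no harm.
  have hrv : ∀ i, r i * ‖v i‖ ≤ a * s := fun i => by
    rw [ha, hs, ← Real.sqrt_mul hM]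
    refine Real.le_sqrt_of_sq_le ?_
    have h1 : r i * ‖v i‖ ^ 2 ≤ S := Finset.single_le_sum (f := fun i => r i * ‖v i‖ ^ 2)
      (fun i _ => mul_nonneg (hr0 i) (sq_nonneg _)) (Finset.mem_univ i)
    calc (r i * ‖v i‖) ^ 2 = r i * (r i * ‖v i‖ ^ 2) := by ring
      _ ≤ M * S := mul_le_mul (hcM i) h1 (mul_nonneg (hr0 i) (sq_nonneg _)) hM
  -- the quadratic part
  have hw : ‖∑ i, r i • v i‖ ≤ X := by
    -- Both barycentric momenta vanish, so that of the velocity difference is only a density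
    -- difference times ū.
    have e : ∑ i, r i • v i = -∑ i, (r i - rb i) • ub i := by
      simp only [hv, smul_sub, sub_smul, Finset.sum_sub_distrib]
      rw [hJ, hJb]
      abel
    rw [e, norm_neg]
    calc _ ≤ ∑ i, |r i - rb i| * q := norm_sum_le_of_le _ fun i _ => by
          rw [norm_smul, Real.norm_eq_abs]
          exact mul_le_mul_of_nonneg_left (hq i) (abs_nonneg _)
      _ = q * ∑ i, |r i - rb i| := by rw [← Finset.sum_mul, mul_comm]
      _ ≤ X := mul_le_mul_of_nonneg_left hW hq0
  have hquad : b₀ * (ρ₀ * S - X ^ 2) ≤ ∑ i, inner ℝ (r i • v i) (F i) := by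
    have h1 := sum_inner_friction hβ r v
    have h2 : ∑ i, ∑ j, b₀ * (r i * r j * ‖v i - v j‖ ^ 2)
        ≤ ∑ i, ∑ j, β i j * (r i * r j * ‖v i - v j‖ ^ 2) :=
      Finset.sum_le_sum fun i _ => Finset.sum_le_sum fun j _ =>
        mul_le_mul_of_nonneg_right (hβ0 i j)
          (mul_nonneg (mul_nonneg (hr0 i) (hr0 j)) (sq_nonneg _))
    simp only [← Finset.mul_sum] at h2
    rw [sum_sum_mul_norm_sub_sq r v, ← h1] at h2
    have h3 : ‖∑ i, r i • v i‖ ^ 2 ≤ X ^ 2 := pow_le_pow_left₀ (norm_nonneg _) hw 2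
    have h4 : ρ₀ * S ≤ (∑ i, r i) * S := mul_le_mul_of_nonneg_right hρρ hS0
    have h5 : b₀ * (ρ₀ * S - X ^ 2) ≤ b₀ * ((∑ i, r i) * S - ‖∑ i, r i • v i‖ ^ 2) :=
      mul_le_mul_of_nonneg_left (by linarith) hb₀.le
    linarith
  have hT1 : ε * ∑ i, inner ℝ (c i • v i) (E i - Eb i)
      ≤ -(b₀ * (ρ₀ * S - X ^ 2)) + N * (a * s * (k₁ * X)) := by
    have e : ε * ∑ i, inner ℝ (c i • v i) (E i - Eb i)
        = -(∑ i, inner ℝ (r i • v i) (F i)) - ∑ i, inner ℝ (r i • v i) (Z i) := by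
      rw [Finset.mul_sum, ← Finset.sum_neg_distrib, ← Finset.sum_sub_distrib]
      refine Finset.sum_congr rfl fun i _ => ?_
      rw [← real_inner_smul_right, hEd, inner_neg_right, real_inner_smul_right, inner_add_right]
      simp only [real_inner_smul_left, hr]
      ring
    have h1 : |∑ i, inner ℝ (r i • v i) (Z i)| ≤ N * (a * s * (k₁ * X)) := by
      refine (Finset.abs_sum_le_sum_abs _ _).trans ?_
      refine (Finset.sum_le_card_nsmul _ _ (a * s * (k₁ * X)) fun i _ => ?_).trans (le_of_eq ?_)
      · refine (abs_real_inner_le_norm _ _).trans ?_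
        rw [norm_smul, Real.norm_eq_abs, abs_of_nonneg (hr0 i)]
        exact mul_le_mul (hrv i) (hZn i) (norm_nonneg _) (by positivity)
      · rw [nsmul_eq_mul, Finset.card_univ]
    rw [e]
    linarith [(abs_le.1 h1).1]
  -- the gradient of the logarithm of the quotient of total concentrations
  have hDn : ρ₀ * ‖D‖ ≤ k₃ * s + k₄ * X := by
    have h1 := total_log_gradient_eq (C := C) (Cb := Cb) (Gs := Gs) (Gbs := Gbs) hc hcb rfl hρ.symm
      hG
    have h2 : ‖(∑ i, m i * c i) • D‖ ≤ k₃ * s + k₄ * X := by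
      rw [hD, h1, norm_neg]
      refine (norm_add_le _ _).trans ?_
      have h3 : ∀ i, ‖r i • (E i - Eb i)‖
          ≤ m₂ / ε * (N * (b₁ * (2 * M * a))) * s + m₂ / ε * (M * k₁) * X := fun i => by
        have e : r i • (E i - Eb i)
            = -((m i / ε) • ((∑ j, (β i j * (r i * r j)) • (v i - v j)) + r i • Z i)) := by
          have e1 : E i - Eb i = ε⁻¹ • (ε • (E i - Eb i)) := by
            rw [smul_smul, inv_mul_cancel₀ hε.ne', one_smul]
          have e2 : ∑ j, (β i j * (r i * r j)) • (v i - v j) = r i • F i := by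
            rw [hF, Finset.smul_sum]
            refine Finset.sum_congr rfl fun j _ => ?_
            rw [smul_smul]
            congr 1
            ring
          rw [e1, hEd, e2]
          module
        have h4 : ∀ j ∈ Finset.univ, ‖(β i j * (r i * r j)) • (v i - v j)‖
            ≤ b₁ * (2 * M * a) * s := fun j _ => by
          rw [norm_smul, norm_mul, Real.norm_eq_abs, Real.norm_eq_abs,
            abs_of_nonneg (hb₀.le.trans (hβ0 i j)), abs_of_nonneg (mul_nonneg (hr0 i) (hr0 j)),
            mul_assoc]
          have h5 : r i * r j * ‖v i - v j‖ ≤ 2 * M * a * s := by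
            have h6 := norm_sub_le (v i) (v j)
            have h7 := mul_le_mul (hcM j) (hrv i) (mul_nonneg (hr0 i) (norm_nonneg _)) hM
            have h8 := mul_le_mul (hcM i) (hrv j) (mul_nonneg (hr0 j) (norm_nonneg _)) hM
            calc r i * r j * ‖v i - v j‖ ≤ r i * r j * (‖v i‖ + ‖v j‖) :=
                  mul_le_mul_of_nonneg_left h6 (mul_nonneg (hr0 i) (hr0 j))
              _ = r j * (r i * ‖v i‖) + r i * (r j * ‖v j‖) := by ring
              _ ≤ M * (a * s) + M * (a * s) := add_le_add h7 h8
              _ = 2 * M * a * s := by ring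
          calc β i j * (r i * r j * ‖v i - v j‖) ≤ b₁ * (2 * M * a * s) :=
                mul_le_mul (hβ1 i j) h5 (mul_nonneg (mul_nonneg (hr0 i) (hr0 j)) (norm_nonneg _))
                  hb₁
            _ = _ := by ring
        have h9 : ‖(∑ j, (β i j * (r i * r j)) • (v i - v j)) + r i • Z i‖
            ≤ N * (b₁ * (2 * M * a) * s) + M * (k₁ * X) := by
          refine (norm_add_le _ _).trans (add_le_add ?_ ?_)
          · refine (norm_sum_le_of_le _ h4).trans (le_of_eq ?_)
            rw [Finset.sum_const, Finset.card_univ, nsmul_eq_mul]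
          · rw [norm_smul, Real.norm_eq_abs, abs_of_nonneg (hr0 i)]
            exact mul_le_mul (hcM i) (hZn i) (norm_nonneg _) hM
        rw [e, norm_neg, norm_smul, Real.norm_eq_abs, abs_of_nonneg (div_nonneg (hm0 i).le hε.le)]
        calc _ ≤ m₂ / ε * (N * (b₁ * (2 * M * a) * s) + M * (k₁ * X)) :=
              mul_le_mul (div_le_div_of_nonneg_right ((hm' i).trans (le_max_left _ _)) hε.le) h9
                (norm_nonneg _) (by positivity)
          _ = _ := by ring
      have h10 : ‖∑ i, r i • (E i - Eb i)‖ ≤ k₃ * s + N * (m₂ / ε * (M * k₁)) * X := by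
        refine (norm_sum_le_of_le _ fun i _ => h3 i).trans (le_of_eq ?_)
        rw [Finset.sum_const, Finset.card_univ, nsmul_eq_mul, hk₃]
        ring
      have h11 : ‖∑ i, (r i - rb i) • Eb i‖ ≤ X := by
        calc _ ≤ ∑ i, |r i - rb i| * q := norm_sum_le_of_le _ fun i _ => by
              rw [norm_smul, Real.norm_eq_abs]
              exact mul_le_mul_of_nonneg_left (hqE i) (abs_nonneg _)
          _ = q * ∑ i, |r i - rb i| := by rw [← Finset.sum_mul, mul_comm]
          _ ≤ X := mul_le_mul_of_nonneg_left hW hq0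
      refine (add_le_add h10 h11).trans (le_of_eq ?_)
      rw [hk₄]
      ring
    rw [norm_smul, Real.norm_eq_abs, abs_of_pos (hρ₀.trans_le hρρ)] at h2
    exact (mul_le_mul_of_nonneg_right hρρ (norm_nonneg _)).trans h2
  have hT2 : |∑ i, (c i - cb i * (C / Cb)) * inner ℝ (ub i) D|
      ≤ 2 / m₀ * (k₃ / ρ₀ * s + k₄ / ρ₀ * X) * X := by
    have h1 : ‖D‖ ≤ k₃ / ρ₀ * s + k₄ / ρ₀ * X := by
      have : k₃ / ρ₀ * s + k₄ / ρ₀ * X = (k₃ * s + k₄ * X) / ρ₀ := by ring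
      rw [this, le_div_iff₀ hρ₀]
      linarith
    calc _ ≤ ∑ i, |c i - cb i * (C / Cb)| * (q * ‖D‖) := by
          refine (Finset.abs_sum_le_sum_abs _ _).trans (Finset.sum_le_sum fun i _ => ?_)
          rw [abs_mul]
          refine mul_le_mul_of_nonneg_left ((abs_real_inner_le_norm _ _).trans ?_) (abs_nonneg _)
          exact mul_le_mul_of_nonneg_right (hq i) (norm_nonneg _)
      _ = (∑ i, |c i - cb i * (C / Cb)|) * (q * ‖D‖) := by rw [Finset.sum_mul]
      _ ≤ (2 / m₀ * W) * (q * ‖D‖) := mul_le_mul_of_nonneg_right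
          (sum_abs_concentration_sub_le hcb rfl rfl hCb0 hm₀ hm hW)
          (mul_nonneg hq0 (norm_nonneg _))
      _ = 2 / m₀ * X * ‖D‖ := by rw [hX]; ring
      _ ≤ 2 / m₀ * X * (k₃ / ρ₀ * s + k₄ / ρ₀ * X) := mul_le_mul_of_nonneg_left h1 (by positivity)
      _ = _ := by ring
  have hid : (∑ i, inner ℝ (c i • u i) ((c i)⁻¹ • G i - C⁻¹ • Gs - (cb i)⁻¹ • Gb i + Cb⁻¹ • Gbs))
      + (∑ i, inner ℝ (cb i • ub i) (-((cb i)⁻¹ • G i) + (c i / cb i ^ 2) • Gb i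
          + Cb⁻¹ • Gs - (C / Cb ^ 2) • Gbs))
      = (∑ i, inner ℝ (c i • v i) (E i - Eb i))
        - ∑ i, (c i - cb i * (C / Cb)) * inner ℝ (ub i) D := by
    rw [← Finset.sum_add_distrib, ← Finset.sum_sub_distrib]
    exact Finset.sum_congr rfl fun i _ => relative_flux_identity (hc i).ne' (hcb i).ne' hC0.ne'
      hCb0.ne' _ _ _ _ _ _
  rw [hid]
  have hT1' : ∑ i, inner ℝ (c i • v i) (E i - Eb i)
      ≤ -α * s ^ 2 + b₀ / ε * X ^ 2 + N * a * k₁ / ε * (s * X) := by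
    have : -α * s ^ 2 + b₀ / ε * X ^ 2 + N * a * k₁ / ε * (s * X)
        = (-(b₀ * (ρ₀ * S - X ^ 2)) + N * (a * s * (k₁ * X))) / ε := by
      rw [hα, ← hss]
      field_simp
      ring
    rw [this, le_div_iff₀ hε]
    linarith
  have hT2' := (abs_le.1 hT2).1
  have hyoung : -α * s ^ 2 + B * (s * X) ≤ B ^ 2 / (4 * α) * X ^ 2 := by
    have : B ^ 2 / (4 * α) * X ^ 2 - (-α * s ^ 2 + B * (s * X))
        = (2 * α * s - B * X) ^ 2 / (4 * α) := by
      field_simp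
      ring
    have h2 : 0 ≤ (2 * α * s - B * X) ^ 2 / (4 * α) := by positivity
    linarith
  have hfin : 2 / m₀ * (k₃ / ρ₀ * s + k₄ / ρ₀ * X) * X
      = 2 / m₀ * (k₃ / ρ₀) * (s * X) + 2 / m₀ * (k₄ / ρ₀) * X ^ 2 := by ring
  have hAX : A * X ^ 2 = b₀ / ε * X ^ 2 + 2 / m₀ * (k₄ / ρ₀) * X ^ 2 := by rw [hA]; ring
  have hBX : B * (s * X) = N * a * k₁ / ε * (s * X) + 2 / m₀ * (k₃ / ρ₀) * (s * X) := by
    rw [hB]; ring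
  have : (A + B ^ 2 / (4 * α)) * X ^ 2 = A * X ^ 2 + B ^ 2 / (4 * α) * X ^ 2 := by ring
  linarith

end RelativeFlux

/-! ### The relative entropy -/

section Entropy

variable {ι : Type*} [Fintype ι] [DecidableEq ι]

/-- A coordinate as a continuous linear map. -/
abbrev coordCLM {κ : Type*} (a : κ) : (κ → ℝ) →L[ℝ] ℝ := ContinuousLinearMap.proj a

theorem liftGrad_proj (a : ι) (G : ι → Space) : liftGrad (coordCLM a) G = G a := by
  simp [liftGrad, Pi.single_apply, ite_smul]

theorem liftGrad_add_left (L L' : (ι → ℝ) →L[ℝ] ℝ) (G : ι → Space) :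
    liftGrad (L + L') G = liftGrad L G + liftGrad L' G := by
  simp [liftGrad, add_smul, Finset.sum_add_distrib]

theorem liftGrad_smul_left (r : ℝ) (L : (ι → ℝ) →L[ℝ] ℝ) (G : ι → Space) :
    liftGrad (r • L) G = r • liftGrad L G := by
  simp [liftGrad, Finset.smul_sum, smul_smul]

theorem liftGrad_sum_left {κ : Type*} (s : Finset κ) (L : κ → (ι → ℝ) →L[ℝ] ℝ) (G : ι → Space) :
    liftGrad (∑ k ∈ s, L k) G = ∑ k ∈ s, liftGrad (L k) G := by
  simp only [liftGrad, sum_apply, Finset.sum_smul]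
  exact Finset.sum_comm

/-- Relative entropy of the concentrations `y (inl ·)` with respect to `y (inr ·)`, regularized
by a parameter `η`. -/
def relEntropy (η : ℝ) (y : ι ⊕ ι → ℝ) : ℝ :=
  (∑ i, (y (.inl i) + η) * Real.log (y (.inl i) + η))
    - (∑ i, y (.inl i)) * Real.log (∑ i, y (.inl i))
    - ∑ i, y (.inl i) * (Real.log (y (.inr i)) - Real.log (∑ j, y (.inr j)))

/-- The domain where the regularized relative entropy is smooth. -/
def entropyDomain (ι : Type*) [Fintype ι] (η : ℝ) : Set (ι ⊕ ι → ℝ) :=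
  {y | (∀ i, 0 < y (.inl i) + η) ∧ (∀ i, 0 < y (.inr i)) ∧ 0 < ∑ i, y (.inl i) ∧
    0 < ∑ i, y (.inr i)}

/-- A compact set of pairs of concentration vectors. -/
def concentrationBox (ι : Type*) [Fintype ι] (d M c₀ : ℝ) : Set (ι ⊕ ι → ℝ) :=
  {y | (∀ i, y (.inl i) ∈ Icc 0 M) ∧ (∀ i, y (.inr i) ∈ Icc d M) ∧ c₀ ≤ ∑ i, y (.inl i) ∧
    c₀ ≤ ∑ i, y (.inr i)}

theorem isOpen_entropyDomain (η : ℝ) : IsOpen (entropyDomain ι η) := by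
  simp only [entropyDomain, ofPred_and, ofPred_forall]
  refine (isOpen_iInter_of_finite fun i => isOpen_lt (by fun_prop) (by fun_prop)).inter
    ((isOpen_iInter_of_finite fun i => isOpen_lt (by fun_prop) (by fun_prop)).inter
    ((isOpen_lt (by fun_prop) (by fun_prop)).inter (isOpen_lt (by fun_prop) (by fun_prop))))

theorem isCompact_concentrationBox {d M c₀ : ℝ} : IsCompact (concentrationBox ι d M c₀) := by
  have hcl : IsClosed (concentrationBox ι d M c₀) := by
    simp only [concentrationBox, ofPred_and, ofPred_forall]
    refine (isClosed_iInter fun i => isClosed_Icc.preimage (by fun_prop)).inter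
      ((isClosed_iInter fun i => isClosed_Icc.preimage (by fun_prop)).inter
      ((isClosed_le (by fun_prop) (by fun_prop)).inter (isClosed_le (by fun_prop) (by fun_prop))))
  refine (isCompact_univ_pi (s := fun _ : ι ⊕ ι => Icc (min 0 d) M) fun _ =>
    isCompact_Icc).of_isClosed_subset hcl fun y hy => ?_
  rintro (i | i) -
  · exact ⟨(min_le_left _ _).trans (hy.1 i).1, (hy.1 i).2⟩
  · exact ⟨(min_le_right _ _).trans (hy.2.1 i).1, (hy.2.1 i).2⟩

theorem concentrationBox_subset {d M c₀ η : ℝ} (hd : 0 < d) (hc₀ : 0 < c₀) (hη : 0 < η) :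
    concentrationBox ι d M c₀ ⊆ entropyDomain ι η := fun y hy =>
  ⟨fun i => by linarith [(hy.1 i).1], fun i => hd.trans_le (hy.2.1 i).1, hc₀.trans_le hy.2.2.1,
    hc₀.trans_le hy.2.2.2⟩

theorem contDiffOn_relEntropy (η : ℝ) : ContDiffOn ℝ ∞ (relEntropy η) (entropyDomain ι η) := by
  intro y hy
  refine ContDiffAt.contDiffWithinAt ?_
  have h1 : ∀ a : ι ⊕ ι, ContDiffAt ℝ ∞ (fun y : ι ⊕ ι → ℝ => y a) y := fun a =>
    (contDiff_apply ℝ ℝ a).contDiffAt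
  have h2 : ContDiffAt ℝ ∞ (fun y : ι ⊕ ι → ℝ => ∑ i, y (.inl i)) y :=
    ContDiffAt.sum fun i _ => h1 _
  have h3 : ContDiffAt ℝ ∞ (fun y : ι ⊕ ι → ℝ => ∑ i, y (.inr i)) y :=
    ContDiffAt.sum fun i _ => h1 _
  unfold relEntropy
  refine ((ContDiffAt.sum fun i _ => ?_).sub (h2.mul (h2.log hy.2.2.1.ne'))).sub
    (ContDiffAt.sum fun i _ => (h1 _).mul (((h1 _).log (hy.2.1 i).ne').sub (h3.log hy.2.2.2.ne')))
  exact ((h1 _).add contDiffAt_const).mul (((h1 _).add contDiffAt_const).log (hy.1 i).ne')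

theorem hasFDerivAt_relEntropy {η : ℝ} {y : ι ⊕ ι → ℝ} (hy : y ∈ entropyDomain ι η) :
    HasFDerivAt (relEntropy η)
      ((∑ i, (Real.log (y (.inl i) + η) + 1) •
          coordCLM (Sum.inl i))
        - (Real.log (∑ i, y (.inl i)) + 1) • (∑ i, coordCLM (Sum.inl i))
        - ∑ i, (y (.inl i) • ((y (.inr i))⁻¹ • coordCLM (Sum.inr i)
            - (∑ j, y (.inr j))⁻¹ • ∑ j, coordCLM (Sum.inr j))
          + (Real.log (y (.inr i)) - Real.log (∑ j, y (.inr j)))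
            • coordCLM (Sum.inl i))) y := by
  have h1 : ∀ a : ι ⊕ ι, HasFDerivAt (fun y : ι ⊕ ι → ℝ => y a)
      (coordCLM a) y := fun a =>
    (coordCLM a).hasFDerivAt
  have h2 : HasFDerivAt (fun y : ι ⊕ ι → ℝ => ∑ i, y (.inl i))
      (∑ i, coordCLM (Sum.inl i)) y := HasFDerivAt.fun_sum fun i _ => h1 _
  have h3 : HasFDerivAt (fun y : ι ⊕ ι → ℝ => ∑ i, y (.inr i))
      (∑ i, coordCLM (Sum.inr i)) y := HasFDerivAt.fun_sum fun i _ => h1 _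
  unfold relEntropy
  refine ((HasFDerivAt.fun_sum fun i _ => ?_).fun_sub ?_).fun_sub
    (HasFDerivAt.fun_sum fun i _ => ?_)
  · exact (Real.hasDerivAt_mul_log (hy.1 i).ne').comp_hasFDerivAt y ((h1 (.inl i)).add_const η)
  · exact (Real.hasDerivAt_mul_log hy.2.2.1.ne').comp_hasFDerivAt y h2
  · exact (h1 _).fun_mul (((h1 _).log (hy.2.1 i).ne').fun_sub (h3.log hy.2.2.2.ne'))

theorem fderiv_relEntropy_inl {η : ℝ} {y : ι ⊕ ι → ℝ} (hy : y ∈ entropyDomain ι η) (i : ι) :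
    fderiv ℝ (relEntropy η) y (Pi.single (.inl i) 1)
      = Real.log (y (.inl i) + η) - Real.log (∑ i, y (.inl i)) - Real.log (y (.inr i))
        + Real.log (∑ i, y (.inr i)) := by
  rw [(hasFDerivAt_relEntropy hy).fderiv]
  simp [Pi.single_apply, Finset.sum_add_distrib]
  ring

theorem fderiv_relEntropy_inr {η : ℝ} {y : ι ⊕ ι → ℝ} (hy : y ∈ entropyDomain ι η) (i : ι) :
    fderiv ℝ (relEntropy η) y (Pi.single (.inr i) 1)
      = (∑ i, y (.inl i)) * (∑ i, y (.inr i))⁻¹ - y (.inl i) * (y (.inr i))⁻¹ := by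
  rw [(hasFDerivAt_relEntropy hy).fderiv]
  simp [Pi.single_apply, Finset.sum_add_distrib, mul_sub, Finset.sum_mul]

theorem liftGrad_relEntropy_inl {η : ℝ} {y : ι ⊕ ι → ℝ} (hy : y ∈ entropyDomain ι η) (i : ι)
    (G : ι ⊕ ι → Space) :
    liftGrad (fderiv ℝ (fun y => fderiv ℝ (relEntropy η) y (Pi.single (.inl i) 1)) y) G
      = (y (.inl i) + η)⁻¹ • G (.inl i) - (∑ j, y (.inl j))⁻¹ • (∑ j, G (.inl j))
        - (y (.inr i))⁻¹ • G (.inr i) + (∑ j, y (.inr j))⁻¹ • ∑ j, G (.inr j) := by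
  have h1 : ∀ a : ι ⊕ ι, HasFDerivAt (fun y : ι ⊕ ι → ℝ => y a)
      (coordCLM a) y := fun a =>
    (coordCLM a).hasFDerivAt
  have h2 : HasFDerivAt (fun y : ι ⊕ ι → ℝ => ∑ i, y (.inl i))
      (∑ i, coordCLM (Sum.inl i)) y := HasFDerivAt.fun_sum fun i _ => h1 _
  have h3 : HasFDerivAt (fun y : ι ⊕ ι → ℝ => ∑ i, y (.inr i))
      (∑ i, coordCLM (Sum.inr i)) y := HasFDerivAt.fun_sum fun i _ => h1 _
  have h4 := (((((h1 (.inl i)).add_const η).log (hy.1 i).ne').fun_sub (h2.log hy.2.2.1.ne')).fun_sub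
    ((h1 _).log (hy.2.1 i).ne')).fun_add (h3.log hy.2.2.2.ne')
  have h5 : (fun y => fderiv ℝ (relEntropy η) y (Pi.single (.inl i) 1)) =ᶠ[𝓝 y] fun y =>
      Real.log (y (.inl i) + η) - Real.log (∑ i, y (.inl i)) - Real.log (y (.inr i))
        + Real.log (∑ i, y (.inr i)) := by
    filter_upwards [(isOpen_entropyDomain η).mem_nhds hy] with y hy
    exact fderiv_relEntropy_inl hy i
  rw [h5.fderiv_eq, h4.fderiv]
  simp only [liftGrad_add_left, liftGrad_sub_left, liftGrad_smul_left, liftGrad_sum_left,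
    liftGrad_proj]

theorem liftGrad_relEntropy_inr {η : ℝ} {y : ι ⊕ ι → ℝ} (hy : y ∈ entropyDomain ι η) (i : ι)
    (G : ι ⊕ ι → Space) :
    liftGrad (fderiv ℝ (fun y => fderiv ℝ (relEntropy η) y (Pi.single (.inr i) 1)) y) G
      = -((y (.inr i))⁻¹ • G (.inl i)) + (y (.inl i) / y (.inr i) ^ 2) • G (.inr i)
        + (∑ j, y (.inr j))⁻¹ • (∑ j, G (.inl j))
        - ((∑ j, y (.inl j)) / (∑ j, y (.inr j)) ^ 2) • ∑ j, G (.inr j) := by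
  have h1 : ∀ a : ι ⊕ ι, HasFDerivAt (fun y : ι ⊕ ι → ℝ => y a)
      (coordCLM a) y := fun a =>
    (coordCLM a).hasFDerivAt
  have h2 : HasFDerivAt (fun y : ι ⊕ ι → ℝ => ∑ i, y (.inl i))
      (∑ i, coordCLM (Sum.inl i)) y := HasFDerivAt.fun_sum fun i _ => h1 _
  have h3 : HasFDerivAt (fun y : ι ⊕ ι → ℝ => ∑ i, y (.inr i))
      (∑ i, coordCLM (Sum.inr i)) y := HasFDerivAt.fun_sum fun i _ => h1 _
  have h4 := (h2.fun_mul ((hasDerivAt_inv hy.2.2.2.ne').comp_hasFDerivAt y h3)).fun_sub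
    ((h1 (.inl i)).fun_mul ((hasDerivAt_inv (hy.2.1 i).ne').comp_hasFDerivAt y (h1 (.inr i))))
  have h5 : (fun y => fderiv ℝ (relEntropy η) y (Pi.single (.inr i) 1)) =ᶠ[𝓝 y] fun y =>
      (∑ i, y (.inl i)) * (∑ i, y (.inr i))⁻¹ - y (.inl i) * (y (.inr i))⁻¹ := by
    filter_upwards [(isOpen_entropyDomain η).mem_nhds hy] with y hy
    exact fderiv_relEntropy_inr hy i
  have h6 := h5.fderiv_eq.trans h4.fderiv
  rw [h6]
  simp only [liftGrad_add_left, liftGrad_sub_left, liftGrad_smul_left, liftGrad_sum_left,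
    liftGrad_proj, Function.comp_apply]
  simp only [div_eq_mul_inv]
  module

theorem relEntropy_self {y : ι ⊕ ι → ℝ} (h : ∀ i, y (.inl i) = y (.inr i)) :
    relEntropy 0 y = 0 := by
  simp only [relEntropy, add_zero, h, mul_sub, Finset.sum_sub_distrib, Finset.sum_mul]
  ring

/-- The function t log t is continuous at 0, so joint continuity includes η = 0 and vanishing first
arguments. This yields a uniform bound and the limit η → 0 of the integrated entropy. -/
theorem continuousOn_relEntropy {d M c₀ : ℝ} (hd : 0 < d) (hc₀ : 0 < c₀) :
    ContinuousOn (fun p : ℝ × (ι ⊕ ι → ℝ) => relEntropy p.1 p.2)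
      (univ ×ˢ concentrationBox ι d M c₀) := by
  have h1 : ∀ a : ι ⊕ ι, ContinuousOn (fun p : ℝ × (ι ⊕ ι → ℝ) => p.2 a)
      (univ ×ˢ concentrationBox ι d M c₀) := fun a => by fun_prop
  unfold relEntropy
  refine ((continuousOn_finsetSum _ fun i _ => ?_).sub ?_).sub
    (continuousOn_finsetSum _ fun i _ => (h1 _).mul (((h1 _).log ?_).sub (ContinuousOn.log ?_ ?_)))
  · exact (Real.continuous_mul_log.comp (by fun_prop :
      Continuous fun p : ℝ × (ι ⊕ ι → ℝ) => p.2 (.inl i) + p.1)).continuousOn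
  · exact (Real.continuous_mul_log.comp (by fun_prop :
      Continuous fun p : ℝ × (ι ⊕ ι → ℝ) => ∑ i, p.2 (.inl i))).continuousOn
  · exact fun p hp => (hd.trans_le (hp.2.2.1 i).1).ne'
  · fun_prop
  · exact fun p hp => (hc₀.trans_le hp.2.2.2.2).ne'

/-- The inequality log x ≤ x - 1 at x = √(s / t) bounds t log (t / s) - t + s below by (√t - √s)².
The remaining factor (√t + √s)² is at most 4M. -/
theorem sq_sub_le_mul_log {t s M : ℝ} (ht : 0 ≤ t) (hs : 0 < s) (htM : t ≤ M) (hsM : s ≤ M) :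
    (t - s) ^ 2 ≤ 4 * M * (t * Real.log t - t * Real.log s - t + s) := by
  have hM : 0 < M := hs.trans_le hsM
  set a := Real.sqrt t with ha
  set b := Real.sqrt s with hb
  have ha0 : 0 ≤ a := Real.sqrt_nonneg t
  have hb0 : 0 < b := Real.sqrt_pos.2 hs
  have ha2 : a ^ 2 = t := Real.sq_sqrt ht
  have hb2 : b ^ 2 = s := Real.sq_sqrt hs.le
  have h1 : (a - b) ^ 2 ≤ t * Real.log t - t * Real.log s - t + s := by
    rcases ht.eq_or_lt with h0 | h0
    · have : a = 0 := by rw [ha, ← h0, Real.sqrt_zero]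
      rw [this, ← h0]
      simp [hb2]
    · have ha' : 0 < a := Real.sqrt_pos.2 h0
      have h2 := Real.log_le_sub_one_of_pos (div_pos hb0 ha')
      rw [Real.log_div hb0.ne' ha'.ne'] at h2
      have h3 : Real.log t = 2 * Real.log a := by rw [← ha2, Real.log_pow]; norm_num
      have h4 : Real.log s = 2 * Real.log b := by rw [← hb2, Real.log_pow]; norm_num
      rw [h3, h4]
      have h5 := mul_le_mul_of_nonneg_left h2 (by positivity : 0 ≤ 2 * a ^ 2)
      have h6 : 2 * a ^ 2 * (b / a - 1) = 2 * a * b - 2 * a ^ 2 := by field_simp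
      rw [← ha2, ← hb2]
      nlinarith
  have h2 : (a + b) ^ 2 ≤ 4 * M := by nlinarith [sq_nonneg (a - b)]
  calc (t - s) ^ 2 = (a + b) ^ 2 * (a - b) ^ 2 := by rw [← ha2, ← hb2]; ring
    _ ≤ 4 * M * (t * Real.log t - t * Real.log s - t + s) :=
      mul_le_mul h2 h1 (sq_nonneg _) (by positivity)

/-- The vector with entries c̄_i C / C̄ has the same sum as c. Adding this zero difference makes the
entropy a sum of terms t log (t / s) - t + s, each bounding a square. Both arguments are at most
(card + 1) M. -/
theorem sum_sq_le_relEntropy {d M c₀ : ℝ} (hd : 0 < d) (hc₀ : 0 < c₀) (hM : 0 ≤ M)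
    {y : ι ⊕ ι → ℝ} (hy : y ∈ concentrationBox ι d M c₀) :
    ∑ i, (y (.inl i) - y (.inr i) * ((∑ j, y (.inl j)) / ∑ j, y (.inr j))) ^ 2
      ≤ 4 * ((Fintype.card ι + 1) * M) * relEntropy 0 y := by
  set C := ∑ j, y (.inl j) with hC
  set Cb := ∑ j, y (.inr j) with hCb
  have hC0 : 0 < C := hc₀.trans_le hy.2.2.1
  have hCb0 : 0 < Cb := hc₀.trans_le hy.2.2.2
  have hb : ∀ i, 0 < y (.inr i) := fun i => hd.trans_le (hy.2.1 i).1
  have hCM : C ≤ Fintype.card ι * M := by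
    refine (Finset.sum_le_card_nsmul _ _ M fun i _ => (hy.1 i).2).trans (le_of_eq ?_)
    rw [nsmul_eq_mul, Finset.card_univ]
  have h1 : relEntropy 0 y = ∑ i, (y (.inl i) * Real.log (y (.inl i))
      - y (.inl i) * Real.log (y (.inr i) * (C / Cb)) - y (.inl i) + y (.inr i) * (C / Cb)) := by
    have h2 : ∀ i, Real.log (y (.inr i) * (C / Cb))
        = Real.log (y (.inr i)) + (Real.log C - Real.log Cb) := fun i => by
      rw [Real.log_mul (hb i).ne' (div_pos hC0 hCb0).ne', Real.log_div hC0.ne' hCb0.ne']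
    have h3 : ∑ i, y (.inr i) * (C / Cb) = C := by
      rw [← Finset.sum_mul, ← hCb]
      field_simp
    simp only [h2, Finset.sum_add_distrib, Finset.sum_sub_distrib, h3, ← hC, mul_add, mul_sub,
      relEntropy, add_zero, ← Finset.sum_mul]
    rw [← hCb]
    ring
  rw [h1, Finset.mul_sum]
  refine Finset.sum_le_sum fun i _ => ?_
  refine sq_sub_le_mul_log (hy.1 i).1 (mul_pos (hb i) (div_pos hC0 hCb0)) ?_ ?_
  · have : 0 ≤ (Fintype.card ι : ℝ) * M := by positivity
    linarith [(hy.1 i).2]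
  · have h4 : y (.inr i) ≤ Cb := Finset.single_le_sum (f := fun j => y (.inr j))
      (fun j _ => (hb j).le) (Finset.mem_univ i)
    calc y (.inr i) * (C / Cb) ≤ Cb * (C / Cb) :=
          mul_le_mul_of_nonneg_right h4 (div_pos hC0 hCb0).le
      _ = C := by field_simp
      _ ≤ _ := by linarith

/-- Coercivity of the relative entropy for states with the same total mass density. -/
theorem exists_coercivity {d M c₀ m₁ ρ₀ : ℝ} (hd : 0 < d) (hc₀ : 0 < c₀) (hM : 0 ≤ M)
    (hρ₀ : 0 < ρ₀) :
    ∃ K, 0 ≤ K ∧ ∀ (m : ι → ℝ) (y : ι ⊕ ι → ℝ), (∀ i, 0 ≤ m i) → (∀ i, m i ≤ m₁) →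
      y ∈ concentrationBox ι d M c₀ → ∑ i, m i * y (.inl i) = ∑ i, m i * y (.inr i) →
      ρ₀ ≤ ∑ i, m i * y (.inr i) →
      (∑ i, |m i * y (.inl i) - m i * y (.inr i)|) ^ 2 ≤ K * relEntropy 0 y := by
  set N : ℝ := (Fintype.card ι : ℝ) with hN
  set m₂ := max m₁ 0 with hm₂
  have hm₂0 : 0 ≤ m₂ := le_max_right _ _
  set k := m₂ + N * (m₂ * M) * (m₂ / ρ₀) with hk
  have hk0 : 0 ≤ k := by positivity
  refine ⟨k ^ 2 * N * (4 * ((N + 1) * M)), by positivity, fun m y hm0 hm hy hρ hρρ => ?_⟩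
  set C := ∑ j, y (.inl j) with hC
  set Cb := ∑ j, y (.inr j) with hCb
  have hmm : ∀ i, m i ≤ m₂ := fun i => (hm i).trans (le_max_left _ _)
  have hb : ∀ i, 0 < y (.inr i) := fun i => hd.trans_le (hy.2.1 i).1
  set w : ι → ℝ := fun i => y (.inl i) - y (.inr i) * (C / Cb) with hw
  -- The entropy does not see a common factor of all concentrations. Equality of the total masses
  -- fixes it: the defect 1 - C / C̄ is expressed by the quantities w i that the entropy controls.
  have h1 : (∑ i, m i * y (.inr i)) * (1 - C / Cb) = ∑ i, m i * w i := by
    simp only [hw, mul_sub, Finset.sum_sub_distrib, hρ, mul_one]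
    rw [Finset.sum_mul]
    simp only [mul_assoc]
  have hws : ∑ i, m i * w i ≤ m₂ * ∑ i, |w i| ∧ -(m₂ * ∑ i, |w i|) ≤ ∑ i, m i * w i := by
    have : |∑ i, m i * w i| ≤ m₂ * ∑ i, |w i| := by
      rw [Finset.mul_sum]
      refine (Finset.abs_sum_le_sum_abs _ _).trans (Finset.sum_le_sum fun i _ => ?_)
      rw [abs_mul, abs_of_nonneg (hm0 i)]
      exact mul_le_mul_of_nonneg_right (hmm i) (abs_nonneg _)
    exact ⟨(abs_le.1 this).2, (abs_le.1 this).1⟩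
  have h2 : |1 - C / Cb| ≤ m₂ / ρ₀ * ∑ i, |w i| := by
    have h3 : ρ₀ * |1 - C / Cb| ≤ m₂ * ∑ i, |w i| := by
      calc ρ₀ * |1 - C / Cb| ≤ (∑ i, m i * y (.inr i)) * |1 - C / Cb| :=
            mul_le_mul_of_nonneg_right hρρ (abs_nonneg _)
        _ = |∑ i, m i * w i| := by
            rw [← h1, abs_mul, abs_of_pos (hρ₀.trans_le hρρ)]
        _ ≤ _ := abs_le.2 ⟨hws.2, hws.1⟩
    rw [div_mul_eq_mul_div, le_div_iff₀ hρ₀]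
    linarith
  have h3 : ∑ i, |m i * y (.inl i) - m i * y (.inr i)| ≤ k * ∑ i, |w i| := by
    have h4 : ∀ i, |m i * y (.inl i) - m i * y (.inr i)|
        ≤ m₂ * |w i| + m₂ * M * |1 - C / Cb| := fun i => by
      have e : m i * y (.inl i) - m i * y (.inr i) = m i * w i - m i * y (.inr i) * (1 - C / Cb) := by
        simp only [hw]; ring
      rw [e]
      refine (abs_sub _ _).trans (add_le_add ?_ ?_)
      · rw [abs_mul, abs_of_nonneg (hm0 i)]
        exact mul_le_mul_of_nonneg_right (hmm i) (abs_nonneg _)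
      · rw [abs_mul, abs_of_nonneg (mul_nonneg (hm0 i) (hb i).le)]
        exact mul_le_mul_of_nonneg_right (mul_le_mul (hmm i) (hy.2.1 i).2 (hb i).le hm₂0)
          (abs_nonneg _)
    refine (Finset.sum_le_sum fun i _ => h4 i).trans ?_
    rw [Finset.sum_add_distrib, ← Finset.mul_sum, Finset.sum_const, Finset.card_univ, nsmul_eq_mul]
    have h5 := mul_le_mul_of_nonneg_left h2 (by positivity : 0 ≤ N * (m₂ * M))
    rw [hk]
    linarith
  have h4 : (∑ i, |w i|) ^ 2 ≤ N * ∑ i, w i ^ 2 := by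
    have := sq_sum_le_card_mul_sum_sq (s := Finset.univ) (f := fun i => |w i|)
    simpa only [sq_abs, Finset.card_univ] using this
  have h5 := sum_sq_le_relEntropy hd hc₀ hM hy
  calc _ ≤ (k * ∑ i, |w i|) ^ 2 :=
        pow_le_pow_left₀ (Finset.sum_nonneg fun i _ => abs_nonneg _) h3 2
    _ = k ^ 2 * (∑ i, |w i|) ^ 2 := by ring
    _ ≤ k ^ 2 * (N * (4 * ((N + 1) * M) * relEntropy 0 y)) := by
        refine mul_le_mul_of_nonneg_left (h4.trans ?_) (by positivity)
        exact mul_le_mul_of_nonneg_left h5 (by positivity)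
    _ = _ := by ring

end Entropy

/-! ### The relative entropy inequality -/

section EntropyEstimate

variable {ι : Type*} [Fintype ι] [DecidableEq ι]

/-- The part of the entropy production that needs no regularization. -/
def regularProduction (y : ι ⊕ ι → ℝ) (F G : ι ⊕ ι → Space) : ℝ :=
  (∑ i, inner ℝ (F (.inl i)) (-((∑ j, y (.inl j))⁻¹ • (∑ j, G (.inl j)))
      - (y (.inr i))⁻¹ • G (.inr i) + (∑ j, y (.inr j))⁻¹ • ∑ j, G (.inr j)))
    + ∑ i, inner ℝ (F (.inr i)) (-((y (.inr i))⁻¹ • G (.inl i))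
      + (y (.inl i) / y (.inr i) ^ 2) • G (.inr i) + (∑ j, y (.inr j))⁻¹ • (∑ j, G (.inl j))
      - ((∑ j, y (.inl j)) / (∑ j, y (.inr j)) ^ 2) • ∑ j, G (.inr j))

/-- Only the terms (c_i + η)⁻¹ F_i · G_i depend on η; these are the ones that can degenerate as c_i
tends to zero. -/
theorem sum_inner_liftGrad_relEntropy {η : ℝ} {y : ι ⊕ ι → ℝ} (hy : y ∈ entropyDomain ι η)
    (F G : ι ⊕ ι → Space) :
    ∑ a, inner ℝ (F a)
        (liftGrad (fderiv ℝ (fun y => fderiv ℝ (relEntropy η) y (Pi.single a 1)) y) G)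
      = (∑ i, (y (.inl i) + η)⁻¹ * inner ℝ (F (.inl i)) (G (.inl i)))
        + regularProduction y F G := by
  rw [Fintype.sum_sum_type, regularProduction, ← add_assoc]
  simp only [liftGrad_relEntropy_inr hy]
  congr 1
  rw [← Finset.sum_add_distrib]
  refine Finset.sum_congr rfl fun i _ => ?_
  rw [liftGrad_relEntropy_inl hy, ← real_inner_smul_right, ← inner_add_right]
  congr 1
  abel

theorem integrable_inner_liftGrad_relEntropy {Ω : Set Space} (hb : Bornology.IsBounded Ω) {τ : ℝ}
    {f : ι ⊕ ι → ℝ × Space → ℝ} {F G : ι ⊕ ι → ℝ × Space → Space}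
    (hF : ∀ a, MemLp (F a) 2 (cylMeasure Ω τ)) (hw : ∀ a, SmoothApprox Ω τ (f a) (G a))
    {d M c₀ η : ℝ} (hd : 0 < d) (hc₀ : 0 < c₀) (hη : 0 < η)
    (hf : ∀ z, (fun b => f b z) ∈ concentrationBox ι d M c₀) (a : ι ⊕ ι) :
    Integrable (fun z => inner ℝ (F a z)
      (liftGrad (fderiv ℝ (fun y => fderiv ℝ (relEntropy η) y (Pi.single a 1)) fun b => f b z)
        fun b => G b z)) (cylMeasure Ω τ) := by
  have h1 : ContDiffOn ℝ ∞ (fun y => fderiv ℝ (relEntropy η) y (Pi.single a 1))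
      (entropyDomain ι η) :=
    ((contDiffOn_relEntropy η).fderiv_of_isOpen (m := ∞) (isOpen_entropyDomain η)
      (by simp)).clm_apply contDiffOn_const
  have h2 := SmoothApprox.comp_of_mem hb hw isCompact_concentrationBox (isOpen_entropyDomain η)
    (concentrationBox_subset hd hc₀ hη) (Eventually.of_forall hf) h1
  exact integrable_inner_of_memLp (hF a) h2.2.1

/-- For η > 0 the entropy is smooth near the compact box of values and the chain rule applies. The
singular part of the production I_η is dominated only from above, by H. Replacing I_η by max (I_η,
B) supplies the lower bound B, and this maximum converges to B because the limit of I_η is at most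
B. Dominated convergence then gives the inequality in the limit. -/
theorem integral_relEntropy_le {Ω : Set Space} (ho : IsOpen Ω) (hb : Bornology.IsBounded Ω)
    {τ₁ : ℝ} (hτ₁ : 0 < τ₁) {f₀ : ι ⊕ ι → Space → ℝ} {f : ι ⊕ ι → ℝ × Space → ℝ}
    {F G : ι ⊕ ι → ℝ × Space → Space} (h : ∀ a, TimeBalance Ω τ₁ (f₀ a) (f a) (F a))
    (hw : ∀ a, SmoothApprox Ω τ₁ (f a) (G a)) (h0 : ∀ i, f₀ (.inl i) = f₀ (.inr i))
    {d M c₀ : ℝ} (hd : 0 < d) (hc₀ : 0 < c₀)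
    (hf : ∀ z, (fun b => f b z) ∈ concentrationBox ι d M c₀)
    (hpos : ∀ᵐ z ∂cylMeasure Ω τ₁, ∀ i, 0 < f (.inl i) z)
    {H B : ℝ × Space → ℝ} (hH : Integrable H (cylMeasure Ω τ₁))
    (hdom : ∀ᵐ z ∂cylMeasure Ω τ₁, ∀ i, ∀ η : ℝ, 0 < η →
      (f (.inl i) z + η)⁻¹ * inner ℝ (F (.inl i) z) (G (.inl i) z) ≤ H z)
    (hB : Integrable B (cylMeasure Ω τ₁))
    (hI : ∀ᵐ z ∂cylMeasure Ω τ₁,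
      (∑ i, (f (.inl i) z)⁻¹ * inner ℝ (F (.inl i) z) (G (.inl i) z))
        + regularProduction (fun b => f b z) (fun b => F b z) (fun b => G b z) ≤ B z) :
    ∀ᵐ τ : ℝ, τ ∈ Ioo 0 τ₁ →
      ∫ x in Ω, relEntropy 0 (fun b => f b (τ, x)) ≤ ∫ z in cyl Ω τ, B z := by
  set η : ℕ → ℝ := fun k => 1 / ((k : ℝ) + 1) with hη
  have hη0 : ∀ k, 0 < η k := fun k => Nat.one_div_pos_of_nat
  have hη1 : ∀ k, η k ≤ 1 := fun k => by
    rw [hη]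
    exact (div_le_one (by positivity)).2 (by linarith [(Nat.cast_nonneg k : (0 : ℝ) ≤ k)])
  have hηl : Tendsto η atTop (𝓝 0) := tendsto_one_div_add_atTop_nhds_zero_nat
  have hmain := ae_all_iff.2 fun k => TimeBalance.integral_comp_le ho hb hτ₁ h hw
    isCompact_concentrationBox (isOpen_entropyDomain (η k))
    (concentrationBox_subset hd hc₀ (hη0 k)) hf (contDiffOn_relEntropy (η k))
  filter_upwards [hmain] with τ hτ hτI
  have hfin := isFiniteMeasure_cylMeasure hb τ
  have hmono := cylMeasure_mono (Ω := Ω) hτI.2.le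
  have hac : ∀ {p : ℝ × Space → Prop}, (∀ᵐ z ∂cylMeasure Ω τ₁, p z) →
      ∀ᵐ z ∂cylMeasure Ω τ, p z := fun hp => ae_mono hmono hp
  have hFτ : ∀ a, MemLp (F a) 2 (cylMeasure Ω τ) := fun a =>
    (h a).flux_memLp.mono_measure Measure.restrict_le_self
  have hwτ := fun a => (hw a).mono hτI.2.le
  have hBτ := hB.mono_measure hmono
  have hHτ := hH.mono_measure hmono
  set P : ι → ℝ × Space → ℝ := fun i z => inner ℝ (F (.inl i) z) (G (.inl i) z) with hP
  have hPi : ∀ i, Integrable (P i) (cylMeasure Ω τ) := fun i =>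
    integrable_inner_of_memLp (hFτ _) (hwτ _).2.1
  set rest : ℝ × Space → ℝ := fun z =>
    regularProduction (fun b => f b z) (fun b => F b z) (fun b => G b z) with hrest
  have hid : ∀ {e : ℝ}, 0 < e → ∀ z, ∑ a, inner ℝ (F a z)
      (liftGrad (fderiv ℝ (fun y => fderiv ℝ (relEntropy e) y (Pi.single a 1)) fun b => f b z)
        fun b => G b z) = (∑ i, (f (.inl i) z + e)⁻¹ * P i z) + rest z := fun he z =>
    sum_inner_liftGrad_relEntropy (concentrationBox_subset hd hc₀ he (hf z)) _ _
  have hQi : ∀ {e : ℝ}, 0 < e → ∀ i, Integrable (fun z => (f (.inl i) z + e)⁻¹ * P i z)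
      (cylMeasure Ω τ) := fun {e} he i => by
    refine (hPi i).bdd_mul (c := e⁻¹) ((h _).measurable.add_const e).inv.aestronglyMeasurable
      (Eventually.of_forall fun z => ?_)
    have h1 : 0 ≤ f (.inl i) z := ((hf z).1 i).1
    rw [norm_inv, Real.norm_eq_abs, abs_of_pos (by linarith)]
    exact inv_anti₀ he (by linarith)
  have hGi : ∀ {e : ℝ}, 0 < e → ∀ a, Integrable (fun z => inner ℝ (F a z)
      (liftGrad (fderiv ℝ (fun y => fderiv ℝ (relEntropy e) y (Pi.single a 1)) fun b => f b z)
        fun b => G b z)) (cylMeasure Ω τ) := fun he a =>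
    integrable_inner_liftGrad_relEntropy hb hFτ hwτ hd hc₀ he hf a
  -- The regular part does not depend on η, hence it is integrable as the difference of the full
  -- production and the singular part at η = 1.
  have hri : Integrable rest (cylMeasure Ω τ) := by
    have h1 := (integrable_finsetSum Finset.univ fun a _ => hGi one_pos a).sub
      (integrable_finsetSum Finset.univ fun i _ => hQi one_pos i)
    refine h1.congr (Eventually.of_forall fun z => ?_)
    simp only [Pi.sub_apply]
    rw [hid one_pos]
    ring
  set I : ℕ → ℝ × Space → ℝ := fun k z => (∑ i, (f (.inl i) z + η k)⁻¹ * P i z) + rest z with hIdef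
  have hIi : ∀ k, Integrable (I k) (cylMeasure Ω τ) := fun k =>
    (integrable_finsetSum Finset.univ fun i _ => hQi (hη0 k) i).add hri
  -- the left-hand side
  obtain ⟨D, hD⟩ := ((isCompact_Icc (a := (0 : ℝ)) (b := 1)).prod
    (isCompact_concentrationBox (ι := ι) (d := d) (M := M) (c₀ := c₀))).exists_bound_of_continuousOn
    ((continuousOn_relEntropy hd hc₀).mono (prod_mono_left (subset_univ _)))
  have hfinΩ : IsFiniteMeasure ((volume : Measure Space).restrict Ω) :=
    isFiniteMeasure_restrict.2 hb.measure_lt_top.ne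
  have hcont : ∀ e : ℝ, Continuous fun y : (concentrationBox ι d M c₀) => relEntropy e y.1 :=
    fun e => by
      have h1 := (continuousOn_relEntropy (ι := ι) (M := M) hd hc₀)
      exact h1.comp_continuous (f := fun y : (concentrationBox ι d M c₀) => ((e, y.1) : ℝ × _))
        (by fun_prop) fun y => ⟨mem_univ _, y.2⟩
  have hmeas : ∀ (e t : ℝ), AEStronglyMeasurable (fun x => relEntropy e fun b => f b (t, x))
      (volume.restrict Ω) := fun e t => by
    have h1 : Measurable fun x => (⟨fun b => f b (t, x), hf (t, x)⟩ : concentrationBox ι d M c₀) :=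
      (measurable_pi_iff.2 fun b => (h b).measurable.comp measurable_prodMk_left).subtype_mk
    exact ((hcont e).measurable.comp h1).aestronglyMeasurable
  have hlim : ∀ t : ℝ, Tendsto (fun k => ∫ x in Ω, relEntropy (η k) fun b => f b (t, x)) atTop
      (𝓝 (∫ x in Ω, relEntropy 0 fun b => f b (t, x))) := fun t => by
    refine tendsto_integral_of_dominated_convergence (fun _ => D) (fun k => hmeas _ _)
      (integrable_const _) (fun k => Eventually.of_forall fun x => ?_)
      (Eventually.of_forall fun x => ?_)
    · exact hD (η k, _) ⟨⟨(hη0 k).le, hη1 k⟩, hf _⟩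
    · have h1 : Continuous fun e : ℝ => relEntropy e fun b => f b (t, x) := by
        have h2 := (continuousOn_relEntropy (ι := ι) (M := M) hd hc₀)
        exact h2.comp_continuous (f := fun e : ℝ => (e, fun b => f b (t, x))) (by fun_prop)
          fun e => ⟨mem_univ _, hf _⟩
      exact (h1.tendsto 0).comp hηl
  -- For η > 0 the entropy of two equal arguments need not vanish; the initial term drops out only
  -- in the limit.
  have hinit : ∫ x in Ω, relEntropy 0 (fun b => f b ((0 : ℝ), x)) = 0 := by
    simp only [(h _).init 0 le_rfl]
    have : ∀ x, relEntropy 0 (fun b => f₀ b x) = 0 := fun x =>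
      relEntropy_self fun i => by rw [h0]
    simp [this]
  have l1 := (hlim τ).sub (hlim 0)
  rw [hinit, sub_zero] at l1
  -- the right-hand side
  have l2 : Tendsto (fun k => ∫ z, max (I k z) (B z) ∂cylMeasure Ω τ) atTop
      (𝓝 (∫ z, B z ∂cylMeasure Ω τ)) := by
    refine tendsto_integral_of_dominated_convergence
      (fun z => |(Fintype.card ι : ℝ) * H z + rest z| + |B z|)
      (fun k => (hIi k).1.sup hBτ.1) (((hHτ.const_mul _).add hri).abs.add hBτ.abs)
      (fun k => ?_) ?_
    · filter_upwards [hac hdom] with z hz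
      have h1 : I k z ≤ (Fintype.card ι : ℝ) * H z + rest z := by
        refine add_le_add_left ?_ _
        refine (Finset.sum_le_card_nsmul _ _ (H z) fun i _ => hz i _ (hη0 k)).trans (le_of_eq ?_)
        rw [nsmul_eq_mul, Finset.card_univ]
      rw [Real.norm_eq_abs, abs_le]
      constructor
      · have := le_max_right (I k z) (B z)
        have := neg_abs_le (B z)
        have := abs_nonneg ((Fintype.card ι : ℝ) * H z + rest z)
        linarith
      · refine max_le ?_ ?_
        · linarith [le_abs_self ((Fintype.card ι : ℝ) * H z + rest z), abs_nonneg (B z)]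
        · linarith [le_abs_self (B z), abs_nonneg ((Fintype.card ι : ℝ) * H z + rest z)]
    · filter_upwards [hac hpos, hac hI] with z hz hzI
      have h1 : Tendsto (fun k => I k z) atTop (𝓝 ((∑ i, (f (.inl i) z)⁻¹ * P i z) + rest z)) := by
        refine Tendsto.add_const _ (tendsto_finsetSum _ fun i _ => Tendsto.mul_const _ ?_)
        refine Tendsto.inv₀ ?_ (hz i).ne'
        simpa using hηl.const_add (f (.inl i) z)
      have h2 := h1.max (tendsto_const_nhds (x := B z))
      rwa [max_eq_right hzI] at h2
  refine le_of_tendsto_of_tendsto' l1 l2 fun k => ?_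
  refine (le_of_eq_of_le ?_ (hτ k hτI)).trans ?_
  · simp only [(h _).init 0 le_rfl]
  · change (∑ a, ∫ z, _ ∂cylMeasure Ω τ) ≤ _
    rw [← integral_finsetSum _ fun a _ => hGi (hη0 k) a]
    refine integral_mono_ae (integrable_finsetSum _ fun a _ => hGi (hη0 k) a)
      ((hIi k).sup hBτ) (Eventually.of_forall fun z => ?_)
    simp only [hid (hη0 k)]
    exact le_max_left _ _

end EntropyEstimate

/-! ### Thermodynamic identities -/

namespace Mixture

variable {n : ℕ} (D : Mixture n)

theorem hasDerivAt_freeEnergy_density (i : Fin n) {r : ℝ} (hr : 0 < r) (ϑ : ℝ) :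
    HasDerivAt (fun r => D.freeEnergy i r ϑ)
      (ϑ / D.m i * Real.log (r / D.m i) - D.cw * ϑ * (Real.log ϑ - 1)) r := by
  have hm := D.m_pos i
  have h1 : HasDerivAt (fun r => r / D.m i) (1 / D.m i) r := (hasDerivAt_id r).div_const _
  have h2 := (h1.const_mul ϑ).mul ((h1.log (div_pos hr hm).ne').sub_const 1)
  have h3 := (((hasDerivAt_id r).const_mul D.cw).mul_const ϑ).mul_const (Real.log ϑ - 1)
  refine (h2.sub h3).congr_deriv ?_
  field_simp
  simp

theorem hasDerivAt_freeEnergy_temperature (i : Fin n) (r : ℝ) {ϑ : ℝ} (hϑ : ϑ ≠ 0) :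
    HasDerivAt (fun ϑ => D.freeEnergy i r ϑ)
      (r / D.m i * (Real.log (r / D.m i) - 1) - D.cw * r * Real.log ϑ) ϑ := by
  have h1 := ((hasDerivAt_id ϑ).mul_const (r / D.m i)).mul_const (Real.log (r / D.m i) - 1)
  have h2 := ((hasDerivAt_id ϑ).const_mul (D.cw * r)).mul ((Real.hasDerivAt_log hϑ).sub_const 1)
  refine (h1.sub h2).congr_deriv ?_
  simp only [id]
  field_simp
  ring

theorem chemPot_eq (i : Fin n) {s : State n} (hs : 0 < s.1 i) :
    D.chemPot i s = s.2 / D.m i * Real.log (s.1 i / D.m i) - D.cw * s.2 * (Real.log s.2 - 1) :=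
  (D.hasDerivAt_freeEnergy_density i hs s.2).deriv

/-- The logarithms cancel. No sign condition is needed, as both sides vanish for θ = 0; so the
formula holds on time slices where positivity is not known. -/
theorem internalEnergy_eq (i : Fin n) (s : State n) :
    D.internalEnergy i s = D.cw * s.1 i * s.2 := by
  by_cases h : s.2 = 0
  · simp [internalEnergy, freeEnergy, h]
  · rw [internalEnergy, entropy, (D.hasDerivAt_freeEnergy_temperature i (s.1 i) h).deriv,
      freeEnergy]
    ring

theorem totalEnergy_eq (s : State n) : D.totalEnergy s = D.cw * (totalMass s * s.2) := by
  simp only [totalEnergy, internalEnergy_eq, totalMass, Finset.sum_mul, Finset.mul_sum]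
  exact Finset.sum_congr rfl fun i _ => by ring

theorem pressure_eq (i : Fin n) {s : State n} (hs : 0 < s.1 i) :
    D.pressure i s = s.2 * (s.1 i / D.m i) := by
  rw [pressure, D.chemPot_eq i hs, freeEnergy]
  ring

end Mixture

theorem isOpen_positiveCone (n : ℕ) : IsOpen (positiveCone n) := by
  simp only [positiveCone, ofPred_and, ofPred_forall]
  exact (isOpen_iInter_of_finite fun i => isOpen_lt (by fun_prop) (by fun_prop)).inter
    (isOpen_lt (by fun_prop) (by fun_prop))

theorem chainGrad_eq {n : ℕ} {F : State n → ℝ} {s : State n} {r : Fin n → ℝ} {t : ℝ}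
    (hF : HasFDerivAt F ((∑ i, r i • ((ContinuousLinearMap.proj i : (Fin n → ℝ) →L[ℝ] ℝ).comp
      (ContinuousLinearMap.fst ℝ (Fin n → ℝ) ℝ)))
      + t • ContinuousLinearMap.snd ℝ (Fin n → ℝ) ℝ) s) (g : StateGrad n) :
    chainGrad F s g = (∑ i, r i • g.1 i) + t • g.2 := by
  ext a
  simp [chainGrad, hF.fderiv]

namespace Mixture

variable {n : ℕ} (D : Mixture n)

theorem hasFDerivAt_density (i : Fin n) (s : State n) :
    HasFDerivAt (fun s : State n => s.1 i)
      ((ContinuousLinearMap.proj i : (Fin n → ℝ) →L[ℝ] ℝ).comp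
        (ContinuousLinearMap.fst ℝ (Fin n → ℝ) ℝ)) s :=
  ((ContinuousLinearMap.proj i : (Fin n → ℝ) →L[ℝ] ℝ).comp
        (ContinuousLinearMap.fst ℝ (Fin n → ℝ) ℝ)).hasFDerivAt

theorem hasFDerivAt_temperature (s : State n) :
    HasFDerivAt (fun s : State n => s.2) (ContinuousLinearMap.snd ℝ (Fin n → ℝ) ℝ) s :=
  (ContinuousLinearMap.snd ℝ (Fin n → ℝ) ℝ).hasFDerivAt

theorem chainGrad_totalPressure {s : State n} (hs : s ∈ positiveCone n) (g : StateGrad n) :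
    chainGrad D.totalPressure s g
      = s.2 • (∑ i, (D.m i)⁻¹ • g.1 i) + (∑ i, s.1 i / D.m i) • g.2 := by
  have h1 : D.totalPressure =ᶠ[𝓝 s] fun s => s.2 * ∑ i, (D.m i)⁻¹ * s.1 i := by
    filter_upwards [(isOpen_positiveCone n).mem_nhds hs] with s hs
    rw [totalPressure, Finset.mul_sum]
    exact Finset.sum_congr rfl fun i _ => by rw [D.pressure_eq i (hs.1 i)]; ring
  have h2 := ((hasFDerivAt_temperature s).mul (HasFDerivAt.fun_sum (u := Finset.univ) fun i _ =>
    (hasFDerivAt_density i s).const_mul (D.m i)⁻¹)).congr_of_eventuallyEq h1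
  have h3 := chainGrad_eq (r := fun i => s.2 * (D.m i)⁻¹) (t := ∑ i, (D.m i)⁻¹ * s.1 i)
    (h2.congr_fderiv (by simp only [Finset.smul_sum, smul_smul])) g
  rw [h3, Finset.smul_sum]
  simp only [smul_smul, div_eq_inv_mul]

theorem chainGrad_chemPot_div {s : State n} (hs : s ∈ positiveCone n) (g : StateGrad n)
    (i : Fin n) :
    chainGrad (fun s => D.chemPot i s / s.2) s g
      = (D.m i * s.1 i)⁻¹ • g.1 i - (D.cw / s.2) • g.2 := by
  have h1 : (fun s => D.chemPot i s / s.2) =ᶠ[𝓝 s] fun s =>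
      (D.m i)⁻¹ * (Real.log (s.1 i) - Real.log (D.m i)) - D.cw * (Real.log s.2 - 1) := by
    filter_upwards [(isOpen_positiveCone n).mem_nhds hs] with s hs
    rw [D.chemPot_eq i (hs.1 i), Real.log_div (hs.1 i).ne' (D.m_pos i).ne']
    field_simp [hs.2.ne']
  have h2 := (((((hasFDerivAt_density i s).log (hs.1 i).ne').sub_const
    (Real.log (D.m i))).const_mul (D.m i)⁻¹).sub ((((hasFDerivAt_temperature s).log
      hs.2.ne').sub_const 1).const_mul D.cw)).congr_of_eventuallyEq h1
  ext a
  simp only [chainGrad, h2.fderiv]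
  simp
  field_simp

theorem chainGrad_inv_temperature {s : State n} (hs : s ∈ positiveCone n) (g : StateGrad n) :
    chainGrad (fun s => 1 / s.2) s g = -((s.2 ^ 2)⁻¹ • g.2) := by
  have h2 := (hasDerivAt_inv hs.2.ne').comp_hasFDerivAt s (hasFDerivAt_temperature s)
  have h3 : (fun s : State n => 1 / s.2) = (fun x => x⁻¹) ∘ fun s : State n => s.2 := by
    ext s; simp
  ext a
  simp only [chainGrad, h3, h2.fderiv]
  simp

/-- For a vanishing pressure gradient the force is the gradient of the partial pressure. -/
theorem force_eq {s : State n} (hs : s ∈ positiveCone n) {g : StateGrad n}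
    (hp : chainGrad D.totalPressure s g = 0) (i : Fin n) :
    D.force i s g = s.2 • ((D.m i)⁻¹ • g.1 i
      - ((s.1 i / D.m i) / ∑ j, s.1 j / D.m j) • ∑ j, (D.m j)⁻¹ • g.1 j) := by
  have hc : 0 < ∑ j, s.1 j / D.m j := Finset.sum_pos (fun j _ => div_pos (hs.1 j) (D.m_pos j))
    ⟨i, Finset.mem_univ i⟩
  have hp' := hp
  rw [D.chainGrad_totalPressure hs] at hp'
  set c := ∑ j, s.1 j / D.m j
  set Gs := ∑ j, (D.m j)⁻¹ • g.1 j
  -- Solving ∇p = 0 for the temperature gradient gives ∇θ = -(θ / c) ∇c. Inserted below, it cancels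
  -- the terms with the heat capacity and leaves the gradient of total concentration.
  have hg : g.2 = -((s.2 / c) • Gs) := by
    have h1 : c • g.2 = -(s.2 • Gs) := by rw [eq_neg_iff_add_eq_zero, add_comm]; exact hp'
    have h2 : g.2 = c⁻¹ • (c • g.2) := by rw [smul_smul, inv_mul_cancel₀ hc.ne', one_smul]
    rw [h2, h1, smul_neg, smul_smul]
    congr 2
    field_simp
  have hm := (D.m_pos i).ne'
  have hr := (hs.1 i).ne'
  have hθ := hs.2.ne'
  rw [force, hp, smul_zero, neg_zero, zero_add, D.chainGrad_chemPot_div hs,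
    chainGrad_inv_temperature hs, D.internalEnergy_eq, D.pressure_eq i (hs.1 i), hg]
  simp only [smul_sub, smul_add, smul_neg, smul_smul, sub_neg_eq_add, neg_neg]
  have e1 : s.1 i * s.2 * (D.m i * s.1 i)⁻¹ = s.2 * (D.m i)⁻¹ := by field_simp
  have e2 : s.1 i * s.2 * (D.cw / s.2 * (s.2 / c))
      - s.2 * (D.cw * s.1 i * s.2 + s.2 * (s.1 i / D.m i)) * ((s.2 ^ 2)⁻¹ * (s.2 / c))
      = -(s.2 * (s.1 i / D.m i / c)) := by
    field_simp
    ring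
  rw [e1, sub_eq_add_neg (_ • g.1 i) ((s.2 * (s.1 i / D.m i / c)) • Gs), ← neg_smul, ← e2]
  module

/-- The temperature is a common factor of force and friction and cancels. The diagonal of β is free
because it multiplies u i - u i. -/
theorem relations_concentration {s : State n} (hs : s ∈ positiveCone n) {g : StateGrad n}
    (hp : chainGrad D.totalPressure s g = 0) {u : Fin n → Space}
    (h : D.MaxwellStefanRelations s g u) {β : Fin n → Fin n → ℝ}
    (hβ : ∀ i j, i ≠ j → β i j = D.b i j (s.1 i) (s.1 j) s.2) (i : Fin n) :
    D.ε • ((D.m i)⁻¹ • g.1 i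
      - ((s.1 i / D.m i) / ∑ j, s.1 j / D.m j) • ∑ j, (D.m j)⁻¹ • g.1 j)
      = -∑ j, (β i j * s.1 i * s.1 j) • (u i - u j) := by
  have h1 := h.1 i
  rw [D.force_eq hs hp, smul_comm] at h1
  have h2 : ∑ j, (β i j * s.1 i * s.1 j) • (u i - u j)
      = ∑ j ∈ Finset.univ.erase i, (D.b i j (s.1 i) (s.1 j) s.2 * s.1 i * s.1 j) • (u i - u j) := by
    refine (Finset.sum_erase Finset.univ (a := i) (by simp)).symm.trans ?_
    exact Finset.sum_congr rfl fun j hj => by rw [hβ i j (Finset.ne_of_mem_erase hj).symm]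
  rw [h2]
  refine smul_right_injective Space hs.2.ne' ?_
  simp only [smul_neg]
  exact h1.symm

end Mixture

/-! ### Slices of cylinders and weak balance laws -/

theorem cylMeasure_eq_prod (Ω : Set Space) (τ : ℝ) :
    cylMeasure Ω τ = (volume.restrict (Ioo 0 τ)).prod (volume.restrict Ω) := by
  rw [Measure.prod_restrict, cylMeasure, cyl, Measure.volume_eq_prod]

theorem ae_slices {Ω : Set Space} {τ : ℝ} {p : ℝ × Space → Prop}
    (h : ∀ᵐ z ∂cylMeasure Ω τ, p z) :
    ∀ᵐ t : ℝ, t ∈ Ioo 0 τ → ∀ᵐ x ∂volume.restrict Ω, p (t, x) := by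
  rw [cylMeasure_eq_prod] at h
  exact (ae_restrict_iff' measurableSet_Ioo).1 (Measure.ae_ae_of_ae_prod h)

/-- Null sections imply a null set only for measurable sets, so the comparison is made between
measurable representatives. -/
theorem ae_cyl_eq_of_slices {Ω : Set Space} {τ : ℝ} {f g : ℝ × Space → ℝ}
    (hf : AEStronglyMeasurable f (cylMeasure Ω τ)) (hg : AEStronglyMeasurable g (cylMeasure Ω τ))
    (h : ∀ᵐ t : ℝ, t ∈ Ioo 0 τ → ∀ᵐ x ∂volume.restrict Ω, f (t, x) = g (t, x)) :
    f =ᵐ[cylMeasure Ω τ] g := by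
  have h1 := ae_slices hf.ae_eq_mk
  have h2 := ae_slices hg.ae_eq_mk
  have hm : MeasurableSet {z | hf.mk f z = hg.mk g z} :=
    measurableSet_eq_fun hf.stronglyMeasurable_mk.measurable hg.stronglyMeasurable_mk.measurable
  have h4 : ∀ᵐ t : ℝ, t ∈ Ioo 0 τ → ∀ᵐ x ∂volume.restrict Ω,
      (t, x) ∈ {z | hf.mk f z = hg.mk g z} := by
    filter_upwards [h, h1, h2] with t ht ht1 ht2 htI
    filter_upwards [ht htI, ht1 htI, ht2 htI] with x e e1 e2
    exact e1.symm.trans (e.trans e2)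
  have h3 : ∀ᵐ z ∂cylMeasure Ω τ, z ∈ {z | hf.mk f z = hg.mk g z} := by
    generalize {z | hf.mk f z = hg.mk g z} = S at hm h4 ⊢
    rwa [cylMeasure_eq_prod, Measure.ae_prod_mem_iff_ae_ae_mem hm,
      ae_restrict_iff' measurableSet_Ioo]
  filter_upwards [hf.ae_eq_mk, hg.ae_eq_mk, h3] with z e1 e2 e3
  exact e1.trans (Eq.trans e3 e2.symm)

theorem ae_cyl_of_forall_lt {Ω : Set Space} (ho : IsOpen Ω) {T : ℝ} {p : ℝ × Space → Prop}
    (h : ∀ τ ∈ Ioo 0 T, ∀ᵐ z ∂cylMeasure Ω τ, p z) : ∀ᵐ z ∂cylMeasure Ω T, p z := by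
  have h1 : ∀ k : ℕ, ∀ᵐ z, z ∈ cyl Ω (T - 1 / ((k : ℝ) + 1)) → p z := fun k => by
    by_cases hk : 0 < T - 1 / ((k : ℝ) + 1)
    · exact (ae_restrict_iff' (isOpen_cyl ho _).measurableSet).1
        (h _ ⟨hk, by linarith [Nat.one_div_pos_of_nat (α := ℝ) (n := k)]⟩)
    · refine Eventually.of_forall fun z hz => absurd (hz.1.1.trans hz.1.2) hk
  rw [cylMeasure, ae_restrict_iff' (isOpen_cyl ho _).measurableSet]
  filter_upwards [ae_all_iff.2 h1] with z hz hzc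
  obtain ⟨k, hk⟩ := exists_nat_one_div_lt (sub_pos.2 hzc.1.2)
  exact hz k ⟨⟨hzc.1.1, by linarith⟩, hzc.2⟩

/-- `f` solves `∂ₜ f + div F = 0` on `[0, T)`, with vanishing flux through the boundary and initial
value `f₀`, tested with functions of the space variable. -/
structure WeakBalance (Ω : Set Space) (T : ℝ) (f₀ : Space → ℝ) (f : ℝ × Space → ℝ)
    (F : ℝ × Space → Space) : Prop where
  slice : ∀ t ∈ Ico 0 T, IntegrableOn (fun x => f (t, x)) Ω
  flux : ∀ τ ∈ Ioo 0 T, Integrable F (cylMeasure Ω τ)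
  balance : ∀ ψ : Space → ℝ, ContDiff ℝ ∞ ψ → ∀ t ∈ Ico 0 T,
    (∫ x in Ω, f (t, x) * ψ x) - (∫ x in Ω, f₀ x * ψ x)
      = ∫ z in cyl Ω t, inner ℝ (F z) (gradient ψ z.2)

theorem fderiv_comp_snd {ψ : Space → ℝ} (hψ : ContDiff ℝ ∞ ψ) (z v : ℝ × Space) :
    fderiv ℝ (fun z : ℝ × Space => ψ z.2) z v = inner ℝ v.2 (gradient ψ z.2) := by
  have h1 : HasFDerivAt (fun z : ℝ × Space => ψ z.2)
      ((fderiv ℝ ψ z.2).comp (ContinuousLinearMap.snd ℝ ℝ Space)) z :=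
    (hψ.differentiable (by simp) z.2).hasFDerivAt.comp z hasFDerivAt_snd
  rw [h1.fderiv, real_inner_comm, gradient_inner_apply]
  simp

theorem integrableOn_mul_contDiff {Ω : Set Space} (ho : IsOpen Ω) (hb : Bornology.IsBounded Ω)
    {g ψ : Space → ℝ} (hg : IntegrableOn g Ω) (hψ : Continuous ψ) :
    IntegrableOn (fun x => g x * ψ x) Ω := by
  obtain ⟨C, hC⟩ := hb.isCompact_closure.exists_bound_of_continuousOn hψ.continuousOn
  exact hg.mul_bdd (c := C) hψ.aestronglyMeasurable
    (ae_restrict_of_forall_mem ho.measurableSet fun x hx => hC x (subset_closure hx))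

theorem integrable_inner_gradient {Ω : Set Space} (ho : IsOpen Ω) (hb : Bornology.IsBounded Ω)
    {τ : ℝ} {F : ℝ × Space → Space} (hF : Integrable F (cylMeasure Ω τ)) {ψ : Space → ℝ}
    (hψ : ContDiff ℝ ∞ ψ) :
    Integrable (fun z => inner ℝ (F z) (gradient ψ z.2)) (cylMeasure Ω τ) := by
  have hgc : Continuous (gradient ψ) := by
    unfold gradient
    exact (InnerProductSpace.toDual ℝ Space).symm.continuous.comp
      (hψ.continuous_fderiv (by simp))
  obtain ⟨D, hD⟩ := hb.isCompact_closure.exists_bound_of_continuousOn hgc.continuousOn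
  refine (hF.norm.const_mul D).mono (hF.1.inner (hgc.comp continuous_snd).aestronglyMeasurable) ?_
  refine ae_restrict_of_forall_mem (isOpen_cyl ho τ).measurableSet fun z hz => ?_
  have h5 := hD z.2 (subset_closure hz.2)
  refine (norm_inner_le_norm _ _).trans ?_
  rw [mul_comm, norm_mul, norm_norm]
  exact mul_le_mul_of_nonneg_right (h5.trans (le_abs_self D)) (norm_nonneg _)

/-- In the hypothesis the outer integral extends over the whole difference. The initial term is thus
a constant integrated over Ω and acquires the factor |Ω|, which is moved into the initial value. The
factor is common to both solutions, so equal data still give equal initial values of the balances.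
-/
theorem WeakBalance.of_test {Ω : Set Space} (ho : IsOpen Ω) (hb : Bornology.IsBounded Ω)
    {T : ℝ} {f₀ : Space → ℝ} {f : ℝ × Space → ℝ} {F : ℝ × Space → Space}
    (hs : ∀ t ∈ Ico 0 T, IntegrableOn (fun x => f (t, x)) Ω)
    (hF : ∀ τ ∈ Ioo 0 T, Integrable F (cylMeasure Ω τ))
    (h : ∀ φ : ℝ × Space → ℝ, ContDiff ℝ ∞ φ → ∀ t ∈ Ico 0 T,
      ∫ x in Ω, (f (t, x) * φ (t, x) - ∫ x in Ω, f₀ x * φ (0, x))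
        = ∫ z in cyl Ω t, (f z * fderiv ℝ φ z (1, 0) + fderiv ℝ φ z (0, F z))) :
    WeakBalance Ω T (fun x => volume.real Ω * f₀ x) f F := by
  refine ⟨hs, hF, fun ψ hψ t ht => ?_⟩
  have hfin : IsFiniteMeasure ((volume : Measure Space).restrict Ω) :=
    isFiniteMeasure_restrict.2 hb.measure_lt_top.ne
  have h1 := h (fun z => ψ z.2) (hψ.comp contDiff_snd) t ht
  simp only [fderiv_comp_snd hψ, inner_zero_left, mul_zero, zero_add] at h1
  rw [← h1, integral_sub (integrableOn_mul_contDiff ho hb (hs t ht) hψ.continuous)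
    (integrable_const _), integral_const, measureReal_restrict_apply_univ, smul_eq_mul,
    ← integral_const_mul]
  simp only [mul_assoc]

namespace WeakBalance

variable {Ω : Set Space} {T : ℝ} {f₀ g₀ : Space → ℝ} {f g : ℝ × Space → ℝ}
  {F G : ℝ × Space → Space}

theorem const_mul (r : ℝ) (h : WeakBalance Ω T f₀ f F) :
    WeakBalance Ω T (fun x => r * f₀ x) (fun z => r * f z) (fun z => r • F z) := by
  refine ⟨fun t ht => (h.slice t ht).const_mul r, fun τ hτ => (h.flux τ hτ).smul r,
    fun ψ hψ t ht => ?_⟩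
  simp only [mul_assoc, real_inner_smul_left]
  rw [integral_const_mul, integral_const_mul, integral_const_mul, ← h.balance ψ hψ t ht, mul_sub]

theorem sum {ι : Type*} (s : Finset ι) (ho : IsOpen Ω) (hb : Bornology.IsBounded Ω)
    {f₀ : ι → Space → ℝ} {f : ι → ℝ × Space → ℝ}
    {F : ι → ℝ × Space → Space} (hf₀ : ∀ i ∈ s, IntegrableOn (f₀ i) Ω)
    (h : ∀ i ∈ s, WeakBalance Ω T (f₀ i) (f i) (F i)) :
    WeakBalance Ω T (fun x => ∑ i ∈ s, f₀ i x) (fun z => ∑ i ∈ s, f i z)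
      (fun z => ∑ i ∈ s, F i z) := by
  refine ⟨fun t ht => integrable_finsetSum _ fun i hi => (h i hi).slice t ht,
    fun τ hτ => integrable_finsetSum _ fun i hi => (h i hi).flux τ hτ, fun ψ hψ t ht => ?_⟩
  simp only [Finset.sum_mul, sum_inner]
  rw [integral_finsetSum _ fun i hi =>
      integrableOn_mul_contDiff ho hb ((h i hi).slice t ht) hψ.continuous,
    integral_finsetSum _ fun i hi => integrableOn_mul_contDiff ho hb (hf₀ i hi) hψ.continuous,
    ← Finset.sum_sub_distrib]
  rcases ht.1.eq_or_lt with h0 | h0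
  · rw [← h0]
    refine (Finset.sum_congr rfl fun i hi => (h i hi).balance ψ hψ 0 ⟨le_rfl, h0 ▸ ht.2⟩).trans ?_
    simp [cyl]
  · rw [integral_finsetSum]
    · exact Finset.sum_congr rfl fun i hi => (h i hi).balance ψ hψ t ht
    · exact fun i hi => integrable_inner_gradient ho hb ((h i hi).flux t ⟨h0, ht.2⟩) hψ

theorem ae_eq_slice (ho : IsOpen Ω) (h : WeakBalance Ω T f₀ f F) (h' : WeakBalance Ω T g₀ g G)
    (hb : Bornology.IsBounded Ω) {s t : ℝ} (ht : t ∈ Ico 0 T) (hs : s ∈ Ico 0 T)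
    (hfg : ∀ ψ : Space → ℝ, ContDiff ℝ ∞ ψ →
      ∫ x in Ω, f (t, x) * ψ x = ∫ x in Ω, g (s, x) * ψ x) :
    ∀ᵐ x ∂volume.restrict Ω, f (t, x) = g (s, x) := by
  have h1 : IntegrableOn (fun x => f (t, x) - g (s, x)) Ω := (h.slice t ht).sub (h'.slice s hs)
  have h2 := ho.ae_eq_zero_of_integral_contDiff_smul_eq_zero h1.locallyIntegrableOn
    fun ψ hψ _ hψs => ?_
  · rw [ae_restrict_iff' ho.measurableSet]
    filter_upwards [h2] with x hx hxΩ
    exact sub_eq_zero.1 (hx hxΩ)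
  · rw [← setIntegral_eq_integral_of_forall_compl_eq_zero (s := Ω) fun x hx => by
      rw [image_eq_zero_of_notMem_tsupport fun h => hx (hψs h), zero_smul]]
    have h3 : ∀ x, ψ x • (f (t, x) - g (s, x)) = f (t, x) * ψ x - g (s, x) * ψ x := fun x => by
      rw [smul_eq_mul]; ring
    simp only [h3]
    rw [integral_sub (integrableOn_mul_contDiff ho hb (h.slice t ht) hψ.continuous)
      (integrableOn_mul_contDiff ho hb (h'.slice s hs) hψ.continuous), hfg ψ hψ, sub_self]

theorem integral_init_eq (h0 : f₀ =ᵐ[volume.restrict Ω] g₀) (ψ : Space → ℝ) :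
    ∫ x in Ω, f₀ x * ψ x = ∫ x in Ω, g₀ x * ψ x :=
  integral_congr_ae (h0.mono fun x hx => by simp only [hx])

/-- Balance laws with vanishing fluxes determine the solution by its initial value at all times. -/
theorem integral_eq_of_flux_eq_zero
    (h : WeakBalance Ω T f₀ f F) (h' : WeakBalance Ω T g₀ g G)
    (h0 : f₀ =ᵐ[volume.restrict Ω] g₀) (hF : F =ᵐ[cylMeasure Ω T] 0) (hG : G =ᵐ[cylMeasure Ω T] 0)
    {s t : ℝ} (hs : s ∈ Ico 0 T) (ht : t ∈ Ico 0 T) :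
    ∀ ψ : Space → ℝ, ContDiff ℝ ∞ ψ →
      ∫ x in Ω, f (t, x) * ψ x = ∫ x in Ω, g (s, x) * ψ x := by
  intro ψ hψ
  have h1 := h.balance ψ hψ t ht
  have h2 := h'.balance ψ hψ s hs
  have e : ∀ {H : ℝ × Space → Space} {r : ℝ}, r ∈ Ico 0 T → H =ᵐ[cylMeasure Ω T] 0 →
      ∫ z in cyl Ω r, inner ℝ (H z) (gradient ψ z.2) = 0 := fun {H r} hr hH => by
    refine integral_eq_zero_of_ae ?_
    have hH' : H =ᵐ[cylMeasure Ω r] 0 := ae_mono (cylMeasure_mono hr.2.le) hH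
    exact hH'.mono fun z hz => by simp [hz]
  rw [e ht hF] at h1
  rw [e hs hG] at h2
  linarith [integral_init_eq h0 ψ]

theorem continuousOn_flux_integral (ho : IsOpen Ω) (hb : Bornology.IsBounded Ω)
    (h : WeakBalance Ω T f₀ f F) {ψ : Space → ℝ} (hψ : ContDiff ℝ ∞ ψ) {τ : ℝ}
    (hτ : τ ∈ Ioo 0 T) :
    ContinuousOn (fun t => ∫ z in cyl Ω t, inner ℝ (F z) (gradient ψ z.2)) (Icc 0 τ) := by
  have hi := integrable_inner_gradient ho hb (h.flux τ hτ) hψ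
  have h1 : IntegrableOn (fun t => ∫ x in Ω, inner ℝ (F (t, x)) (gradient ψ x)) (Ioo 0 τ) := by
    rw [cylMeasure_eq_prod] at hi
    exact hi.integral_prod_left
  have h2 := intervalIntegral.continuousOn_primitive_interval'
    ((intervalIntegrable_iff_integrableOn_Ioo_of_le hτ.1.le).2 h1) left_mem_uIcc
  rw [uIcc_of_le hτ.1.le] at h2
  refine h2.congr fun t ht => ?_
  exact setIntegral_cyl ht.1 (hi.mono_measure (cylMeasure_mono ht.2))

/-- Two solutions of balance laws that agree almost everywhere agree at each time. -/
theorem ae_eq_of_ae_eq_cyl (ho : IsOpen Ω) (hb : Bornology.IsBounded Ω)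
    (h : WeakBalance Ω T f₀ f F) (h' : WeakBalance Ω T g₀ g G)
    (h0 : f₀ =ᵐ[volume.restrict Ω] g₀) (hfg : ∀ᵐ z ∂cylMeasure Ω T, f z = g z)
    {t : ℝ} (ht : t ∈ Ico 0 T) : ∀ᵐ x ∂volume.restrict Ω, f (t, x) = g (t, x) := by
  refine h.ae_eq_slice ho h' hb ht ht fun ψ hψ => ?_
  obtain ⟨τ, hτ1, hτ2⟩ := exists_between ht.2
  have hτ : τ ∈ Ioo 0 T := ⟨ht.1.trans_lt hτ1, hτ2⟩
  -- For almost every time the slices agree, hence so do the flux integrals. These are continuous in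
  -- time, so they agree always, and the balance at time t identifies the remaining slices.
  have hae : (fun t => ∫ z in cyl Ω t, inner ℝ (F z) (gradient ψ z.2))
      =ᵐ[volume.restrict (Icc 0 τ)]
        fun t => ∫ z in cyl Ω t, inner ℝ (G z) (gradient ψ z.2) := by
    rw [← restrict_Ioo_eq_restrict_Icc, EventuallyEq, ae_restrict_iff' measurableSet_Ioo]
    filter_upwards [ae_slices hfg] with s hs hsI
    have hsT : s ∈ Ico 0 T := ⟨hsI.1.le, hsI.2.trans hτ2⟩
    have e1 := h.balance ψ hψ s hsT
    have e2 := h'.balance ψ hψ s hsT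
    have e3 : ∫ x in Ω, f (s, x) * ψ x = ∫ x in Ω, g (s, x) * ψ x :=
      integral_congr_ae ((hs ⟨hsI.1, hsI.2.trans hτ2⟩).mono fun x hx => by simp only [hx])
    rw [← e1, ← e2, e3, integral_init_eq h0 ψ]
  have h1 := Measure.eqOn_Icc_of_ae_eq volume hτ.1.ne hae (h.continuousOn_flux_integral ho hb hψ hτ)
    (h'.continuousOn_flux_integral ho hb hψ hτ) ⟨ht.1, hτ1.le⟩
  have e1 := h.balance ψ hψ t ht
  have e2 := h'.balance ψ hψ t ht
  simp only at h1
  linarith [integral_init_eq h0 ψ]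

end WeakBalance

/-- Almost everywhere g is a limit of its convolutions with nonnegative smooth kernels, and these
are integrals of the form tested in `h`. -/
theorem ae_nonneg_of_integral_contDiff_nonneg {Ω : Set Space} (ho : IsOpen Ω) {g : Space → ℝ}
    (hg : IntegrableOn g Ω)
    (h : ∀ ψ : Space → ℝ, ContDiff ℝ ∞ ψ → (∀ x, 0 ≤ ψ x) → 0 ≤ ∫ x in Ω, g x * ψ x) :
    ∀ᵐ x ∂volume.restrict Ω, 0 ≤ g x := by
  let κ : ℕ → ContDiffBump (0 : Space) := fun k =>
    ⟨1 / ((k : ℝ) + 1) / 2, 1 / ((k : ℝ) + 1), by positivity, half_lt_self (by positivity)⟩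
  have hκ : Tendsto (fun k => (κ k).rOut) atTop (𝓝 0) := tendsto_one_div_add_atTop_nhds_zero_nat
  have hgi : Integrable (Ω.indicator g) volume := hg.integrable_indicator ho.measurableSet
  have hae := ContDiffBump.ae_convolution_tendsto_right_of_locallyIntegrable (K := 2) (φ := κ)
    (l := atTop) (μ := (volume : Measure Space)) hκ
    (Eventually.of_forall fun k => by simp only [κ]; linarith) hgi.locallyIntegrable
  rw [ae_restrict_iff' ho.measurableSet]
  filter_upwards [hae] with x hx hxΩ
  rw [Set.indicator_of_mem hxΩ] at hx
  refine ge_of_tendsto' hx fun k => ?_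
  rw [convolution_eq_swap]
  have e : ∀ y, ContinuousLinearMap.lsmul ℝ ℝ ((κ k).normed volume (x - y)) (Ω.indicator g y)
      = Ω.indicator (fun y => g y * (κ k).normed volume (x - y)) y := fun y => by
    by_cases hy : y ∈ Ω
    · simp [hy, mul_comm]
    · simp [hy]
  simp only [e]
  rw [integral_indicator ho.measurableSet]
  exact h _ ((κ k).contDiff_normed.comp (contDiff_const.sub contDiff_id))
    fun y => (κ k).nonneg_normed _

/-- Lower bounds of weakly continuous functions hold at the initial time. -/
theorem WeakBalance.le_init {Ω : Set Space} (ho : IsOpen Ω) (hb : Bornology.IsBounded Ω)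
    {T : ℝ} {f₀ : Space → ℝ} {f : ℝ × Space → ℝ} {F : ℝ × Space → Space} (hT : 0 < T)
    (h : WeakBalance Ω T f₀ f F) (hf₀ : IntegrableOn f₀ Ω) {d : ℝ}
    (hd : ∀ᵐ z ∂cylMeasure Ω T, d ≤ f z) : ∀ᵐ x ∂volume.restrict Ω, d ≤ f₀ x := by
  have hfin : IsFiniteMeasure ((volume : Measure Space).restrict Ω) :=
    isFiniteMeasure_restrict.2 hb.measure_lt_top.ne
  have h1 := ae_nonneg_of_integral_contDiff_nonneg ho (g := fun x => f₀ x - d)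
    (hf₀.sub (integrable_const d)) fun ψ hψ hψ0 => ?_
  · exact h1.mono fun x hx => sub_nonneg.1 hx
  have hψi : IntegrableOn (fun x => d * ψ x) Ω :=
    integrableOn_mul_contDiff ho hb (integrable_const d) hψ.continuous
  have hτ : T / 2 ∈ Ioo 0 T := ⟨by linarith, by linarith⟩
  have hc := (h.continuousOn_flux_integral ho hb hψ hτ) 0 ⟨le_rfl, hτ.1.le⟩
  have hc' : Tendsto (fun t => ∫ z in cyl Ω t, inner ℝ (F z) (gradient ψ z.2)) (𝓝[>] 0) (𝓝 0) := by
    have h2 : Tendsto (fun t => ∫ z in cyl Ω t, inner ℝ (F z) (gradient ψ z.2)) (𝓝[Icc 0 (T / 2)] 0)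
        (𝓝 (∫ z in cyl Ω 0, inner ℝ (F z) (gradient ψ z.2))) := hc
    have h3 : ∫ z in cyl Ω 0, inner ℝ (F z) (gradient ψ z.2) = 0 := by simp [cyl]
    rw [h3] at h2
    refine h2.mono_left ?_
    rw [nhdsWithin_le_iff]
    exact mem_of_superset (Ioo_mem_nhdsGT hτ.1) Ioo_subset_Icc_self
  refine le_of_forall_pos_le_add fun e he => ?_
  have h4 : ∀ᶠ t in 𝓝[>] (0 : ℝ), ∫ z in cyl Ω t, inner ℝ (F z) (gradient ψ z.2) < e :=
    hc'.eventually_lt_const he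
  obtain ⟨s, hs, hsub⟩ := (mem_nhdsGT_iff_exists_Ioo_subset' hT).1
    (inter_mem h4 (Ioo_mem_nhdsGT hT))
  have hex : ∃ t ∈ Ioo 0 s, ∀ᵐ x ∂volume.restrict Ω, d ≤ f (t, x) := by
    by_contra hcon
    replace hcon : ∀ t ∈ Ioo 0 s, ¬∀ᵐ x ∂volume.restrict Ω, d ≤ f (t, x) := fun t ht hc =>
      hcon ⟨t, ht, hc⟩
    have h5 := ae_slices hd
    have h6 : volume (Ioo 0 s) = 0 := by
      refine measure_mono_null (fun t ht => ?_) h5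
      intro hcc
      exact hcon t ht (hcc (hsub ht).2)
    rw [Real.volume_Ioo, ENNReal.ofReal_eq_zero] at h6
    have : 0 < s := hs
    linarith
  obtain ⟨t, ht, htd⟩ := hex
  have htT : t ∈ Ico 0 T := ⟨ht.1.le, (hsub ht).2.2⟩
  have h7 := h.balance ψ hψ t htT
  have h8 : ∫ z in cyl Ω t, inner ℝ (F z) (gradient ψ z.2) < e := (hsub ht).1
  have h9 : ∫ x in Ω, d * ψ x ≤ ∫ x in Ω, f (t, x) * ψ x :=
    integral_mono_ae hψi (integrableOn_mul_contDiff ho hb (h.slice t htT) hψ.continuous)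
      (htd.mono fun x hx => mul_le_mul_of_nonneg_right hx (hψ0 x))
  have h10 : ∫ x in Ω, (f₀ x - d) * ψ x = (∫ x in Ω, f₀ x * ψ x) - ∫ x in Ω, d * ψ x := by
    simp only [sub_mul]
    exact integral_sub (integrableOn_mul_contDiff ho hb hf₀ hψ.continuous) hψi
  rw [h10]
  linarith

/-! ### Measurable representatives and uniqueness of weak gradients -/

/-- The entropy argument shifts functions in time and needs values in a fixed set at every point.
Outside the cylinder, and where a measurable representative leaves S, the function is redefined as
f₀. Inside the cylinder this is a null set, so the balance survives for almost every time. -/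
theorem WeakBalance.exists_timeBalance {ι : Type*} [Fintype ι] {Ω : Set Space} (ho : IsOpen Ω)
    (hb : Bornology.IsBounded Ω) {T τ : ℝ} (hτ : τ ∈ Ioo 0 T) {g₀ f₀ : ι → Space → ℝ}
    {f : ι → ℝ × Space → ℝ} {F : ι → ℝ × Space → Space}
    (h : ∀ i, WeakBalance Ω T (g₀ i) (f i) (F i)) (hf₀m : ∀ i, Measurable (f₀ i))
    (hf₀ : ∀ i, g₀ i =ᵐ[volume.restrict Ω] f₀ i) {S : Set (ι → ℝ)} (hS : MeasurableSet S)
    (hSb : ∃ C, ∀ y ∈ S, ∀ i, |y i| ≤ C) (hf₀S : ∀ x, (fun i => f₀ i x) ∈ S)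
    (hfm : ∀ i, AEStronglyMeasurable (f i) (cylMeasure Ω τ))
    (hfS : ∀ᵐ z ∂cylMeasure Ω τ, (fun i => f i z) ∈ S)
    (hF : ∀ i, MemLp (F i) 2 (cylMeasure Ω τ)) :
    ∃ (f' : ι → ℝ × Space → ℝ) (F' : ι → ℝ × Space → Space),
      (∀ i, TimeBalance Ω τ (f₀ i) (f' i) (F' i)) ∧ (∀ z, (fun i => f' i z) ∈ S) ∧
      (∀ i, f' i =ᵐ[cylMeasure Ω τ] f i) ∧ ∀ i, F' i =ᵐ[cylMeasure Ω τ] F i := by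
  classical
  have hcm := (isOpen_cyl ho τ).measurableSet
  set g : ι → ℝ × Space → ℝ := fun i => (hfm i).mk with hg
  have hgm : ∀ i, Measurable (g i) := fun i => (hfm i).stronglyMeasurable_mk.measurable
  set A : Set (ℝ × Space) := cyl Ω τ ∩ {z | (fun i => g i z) ∈ S} with hA
  have hAm : MeasurableSet A := hcm.inter (measurable_pi_iff.2 hgm hS)
  set f' : ι → ℝ × Space → ℝ := fun i z => if z ∈ A then g i z else f₀ i z.2 with hf'
  set F' : ι → ℝ × Space → Space := fun i => (cyl Ω τ).indicator (hF i).1.mk with hF'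
  have hmem : ∀ᵐ z ∂cylMeasure Ω τ, z ∈ cyl Ω τ := ae_restrict_mem hcm
  have hfe : ∀ i, f' i =ᵐ[cylMeasure Ω τ] f i := fun i => by
    filter_upwards [hmem, hfS, ae_all_iff.2 fun i => (hfm i).ae_eq_mk] with z hz hzS hze
    have : z ∈ A := ⟨hz, by
      change (fun i => g i z) ∈ S
      simpa only [hg, ← hze] using hzS⟩
    simp only [hf', this, if_true]
    exact (hze i).symm
  have hFe : ∀ i, F' i =ᵐ[cylMeasure Ω τ] F i := fun i => by
    filter_upwards [hmem, (hF i).1.ae_eq_mk] with z hz hze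
    simp only [hF', Set.indicator_of_mem hz]
    exact hze.symm
  have hall : ∀ z, (fun i => f' i z) ∈ S := fun z => by
    by_cases hz : z ∈ A
    · simp only [hf', hz, if_true]
      exact hz.2
    · simp only [hf', hz, if_false]
      exact hf₀S _
  obtain ⟨C, hC⟩ := hSb
  refine ⟨f', F', fun i => ?_, hall, hfe, hFe⟩
  have hFl : MemLp (F' i) 2 volume := memLp_indicator_cyl ho ((memLp_congr_ae (hF i).1.ae_eq_mk).1 (hF i))
  have hF0 : ∀ z, z ∉ cyl Ω τ → F' i z = 0 := fun z hz => Set.indicator_of_notMem hz _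
  refine ⟨Measurable.ite hAm (hgm i) ((hf₀m i).comp measurable_snd), ⟨C, fun z => hC _ (hall z) i⟩,
    (hF i).1.stronglyMeasurable_mk.measurable.indicator hcm, hFl, hF0, fun t ht x => ?_, ?_⟩
  · have : ((t, x) : ℝ × Space) ∉ A := fun hz => absurd hz.1.1.1 (not_lt.2 ht)
    simp only [hf', this, if_false]
  · have hne : ∀ᵐ r : ℝ, r ≠ τ := by simp [ae_iff, measure_singleton]
    filter_upwards [ae_slices (hfe i), hne] with r hr hrτ hrle ψ hψ
    have hinit := WeakBalance.integral_init_eq (hf₀ i) ψ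
    rcases le_or_gt r 0 with hr0 | hr0
    · have e1 : ∀ x, f' i (r, x) = f₀ i x := fun x => by
        have : ((r, x) : ℝ × Space) ∉ A := fun hz => absurd hz.1.1.1 (not_lt.2 hr0)
        simp only [hf', this, if_false]
      simp only [e1, sub_self]
      symm
      refine (intervalIntegral.integral_congr (g := fun _ => (0 : ℝ)) fun s hs => ?_).trans (by simp)
      rw [uIcc_of_ge hr0] at hs
      have e2 : ∀ x, F' i (s, x) = 0 := fun x => hF0 _ fun hz => absurd hz.1.1 (not_lt.2 hs.2)
      simp [e2]
    · have hrI : r ∈ Ioo 0 τ := ⟨hr0, lt_of_le_of_ne hrle hrτ⟩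
      have hrT : r ∈ Ioo 0 T := ⟨hr0, hrI.2.trans hτ.2⟩
      have hFr : F' i =ᵐ[cylMeasure Ω r] F i := ae_mono (cylMeasure_mono hrI.2.le) (hFe i)
      have hFint : Integrable (F' i) (cylMeasure Ω r) :=
        (integrable_congr hFr).2 ((h i).flux r hrT)
      have e1 := setIntegral_cyl hr0.le (integrable_inner_gradient ho hb hFint hψ)
      rw [← e1]
      have e2 : ∫ x in Ω, f' i (r, x) * ψ x = ∫ x in Ω, f i (r, x) * ψ x :=
        integral_congr_ae ((hr hrI).mono fun x hx => by simp only [hx])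
      rw [e2, ← hinit, (h i).balance ψ hψ r ⟨hr0.le, hrT.2⟩]
      exact integral_congr_ae (hFr.symm.mono fun z hz => by simp only [hz])

theorem HasWeakGrad.ae_eq {Ω : Set Space} (ho : IsOpen Ω) {T : ℝ} {f f' : ℝ × Space → ℝ}
    {G G' : ℝ × Space → Space} (h : HasWeakGrad Ω T f G) (h' : HasWeakGrad Ω T f' G')
    (hff : f =ᵐ[cylMeasure Ω T] f') : G =ᵐ[cylMeasure Ω T] G' := by
  have hc := isOpen_cyl ho T
  have key : ∀ a : Fin 3, ∀ᵐ z ∂(volume : Measure (ℝ × Space)), z ∈ cyl Ω T →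
      inner ℝ (G z - G' z) (EuclideanSpace.single a (1 : ℝ)) = 0 := fun a => by
    set v : Space := EuclideanSpace.single a (1 : ℝ) with hv
    have hin : ∀ {H : ℝ × Space → Space}, LocallyIntegrableOn H (cyl Ω T) →
        LocallyIntegrableOn (fun z => inner ℝ (H z) v) (cyl Ω T) := fun {H} hH x hx => by
      obtain ⟨s, hs, hi⟩ := hH x hx
      exact ⟨s, hs, Integrable.inner_const hi v⟩
    have hloc : LocallyIntegrableOn (fun z => inner ℝ (G z - G' z) v) (cyl Ω T) := by
      simp only [inner_sub_left]
      exact (hin h.2.1).sub (hin h'.2.1)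
    refine hc.ae_eq_zero_of_integral_contDiff_smul_eq_zero hloc fun φ hφ hφc hφs => ?_
    have hφT : IsTestFunction Ω T φ := ⟨hφ, hφc, hφs⟩
    have e1 := h.2.2 φ hφT v
    have e2 := h'.2.2 φ hφT v
    have e3 : ∫ z in cyl Ω T, f z * fderiv ℝ φ z (0, v) = ∫ z in cyl Ω T, f' z * fderiv ℝ φ z (0, v) :=
      integral_congr_ae (hff.mono fun z hz => by simp only [hz])
    have hint : ∀ {H : ℝ × Space → Space}, LocallyIntegrableOn H (cyl Ω T) →
        Integrable (fun z => inner ℝ (H z) v * φ z) (volume.restrict (cyl Ω T)) := fun {H} hH => by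
      have h1 : IntegrableOn (fun z => inner ℝ (H z) v) (tsupport φ) :=
        (hin hH).integrableOn_compact_subset hφs hφc
      obtain ⟨C, hC⟩ := hφc.exists_bound_of_continuous hφ.continuous
      have h2 : IntegrableOn (fun z => inner ℝ (H z) v * φ z) (tsupport φ) :=
        h1.mul_bdd (c := C) hφ.continuous.aestronglyMeasurable (Eventually.of_forall hC)
      have h3 : Integrable (fun z => inner ℝ (H z) v * φ z) volume :=
        (integrableOn_iff_integrable_of_support_subset fun z hz => by
          by_contra hcon
          exact hz (by simp [image_eq_zero_of_notMem_tsupport hcon])).1 h2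
      exact h3.integrableOn
    rw [← setIntegral_eq_integral_of_forall_compl_eq_zero (s := cyl Ω T) fun z hz => by
      rw [image_eq_zero_of_notMem_tsupport fun h => hz (hφs h), zero_smul]]
    have e4 : ∀ z, φ z • (inner ℝ (G z - G' z) v : ℝ)
        = inner ℝ (G z) v * φ z - inner ℝ (G' z) v * φ z := fun z => by
      rw [inner_sub_left, smul_eq_mul]; ring
    simp only [e4]
    rw [integral_sub (hint h.2.1) (hint h'.2.1)]
    linarith
  rw [EventuallyEq, cylMeasure, ae_restrict_iff' hc.measurableSet]
  filter_upwards [ae_all_iff.2 key] with z hz hzc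
  ext a
  have := hz a hzc
  rw [EuclideanSpace.inner_single_right] at this
  simpa [sub_eq_zero] using this

/-! ### Bounds for the friction coefficients -/

theorem Mixture.exists_b_bounds {n : ℕ} (D : Mixture n)
    (hb : ∀ i j, i ≠ j → ∀ R : ℝ, 0 < R → ∃ L : ℝ≥0,
      LipschitzOnWith L (fun y : ℝ × ℝ × ℝ => D.b i j y.1 y.2.1 y.2.2)
        (Set.Icc 0 R ×ˢ Set.Icc 0 R ×ˢ Set.Icc R⁻¹ R)) {R : ℝ} (hR : 1 ≤ R) :
    ∃ b₀ b₁ L : ℝ, 0 < b₀ ∧ b₀ ≤ b₁ ∧ 0 ≤ L ∧ ∀ i j, i ≠ j →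
      ∀ y ∈ Set.Icc 0 R ×ˢ Set.Icc 0 R ×ˢ Set.Icc R⁻¹ R,
        b₀ ≤ D.b i j y.1 y.2.1 y.2.2 ∧ D.b i j y.1 y.2.1 y.2.2 ≤ b₁ ∧
        ∀ y' ∈ Set.Icc 0 R ×ˢ Set.Icc 0 R ×ˢ Set.Icc R⁻¹ R,
          |D.b i j y.1 y.2.1 y.2.2 - D.b i j y'.1 y'.2.1 y'.2.2| ≤ L * dist y y' := by
  set K : Set (ℝ × ℝ × ℝ) := Set.Icc 0 R ×ˢ Set.Icc 0 R ×ˢ Set.Icc R⁻¹ R with hK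
  have hR0 : 0 < R := by linarith
  have hKc : IsCompact K := isCompact_Icc.prod (isCompact_Icc.prod isCompact_Icc)
  have hKn : K.Nonempty := ⟨(0, 0, R), ⟨le_rfl, hR0.le⟩, ⟨le_rfl, hR0.le⟩,
    (inv_le_one_of_one_le₀ hR).trans hR, le_rfl⟩
  have h1 : ∀ p : Fin n × Fin n, ∃ t : ℝ × ℝ × ℝ, 0 < t.1 ∧ 0 ≤ t.2.1 ∧ 0 ≤ t.2.2 ∧
      (p.1 ≠ p.2 → ∀ y ∈ K, t.1 ≤ D.b p.1 p.2 y.1 y.2.1 y.2.2 ∧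
        D.b p.1 p.2 y.1 y.2.1 y.2.2 ≤ t.2.1 ∧ ∀ y' ∈ K,
          |D.b p.1 p.2 y.1 y.2.1 y.2.2 - D.b p.1 p.2 y'.1 y'.2.1 y'.2.2| ≤ t.2.2 * dist y y') := by
    rintro ⟨i, j⟩
    by_cases hij : i = j
    · exact ⟨(1, 0, 0), one_pos, le_rfl, le_rfl, fun h => absurd hij h⟩
    obtain ⟨L, hL⟩ := hb i j hij R hR0
    obtain ⟨ym, hym, hmin⟩ := hKc.exists_isMinOn hKn hL.continuousOn
    obtain ⟨yM, hyM, hmax⟩ := hKc.exists_isMaxOn hKn hL.continuousOn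
    have hp : ∀ y ∈ K, 0 < D.b i j y.1 y.2.1 y.2.2 := fun y hy =>
      D.b_pos i j hij _ _ _ hy.1.1 hy.2.1.1 ((inv_pos.2 hR0).trans_le hy.2.2.1)
    refine ⟨(D.b i j ym.1 ym.2.1 ym.2.2, D.b i j yM.1 yM.2.1 yM.2.2, L), hp _ hym, (hp _ hyM).le,
      L.2, fun _ y hy => ⟨hmin hy, hmax hy, fun y' hy' => ?_⟩⟩
    have := hL.dist_le_mul y hy y' hy'
    rwa [Real.dist_eq] at this
  choose t ht1 ht2 ht3 ht using h1
  -- The number (1 + s)⁻¹ lies below every t.1 and is positive even when there are no pairs.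
  set s := ∑ p, (t p).1⁻¹ with hs
  have hs0 : 0 ≤ s := Finset.sum_nonneg fun p _ => (inv_pos.2 (ht1 p)).le
  have hb0 : ∀ p, (1 + s)⁻¹ ≤ (t p).1 := fun p => by
    have h2 : (t p).1⁻¹ ≤ s := Finset.single_le_sum (f := fun p => (t p).1⁻¹)
      (fun p _ => (inv_pos.2 (ht1 p)).le) (Finset.mem_univ p)
    rw [inv_le_comm₀ (by linarith) (ht1 p)]
    linarith
  have hb1 : 0 ≤ ∑ p, (t p).2.1 := Finset.sum_nonneg fun p _ => ht2 p
  refine ⟨(1 + s)⁻¹, 1 + ∑ p, (t p).2.1, ∑ p, (t p).2.2, by positivity, ?_,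
    Finset.sum_nonneg fun p _ => ht3 p, fun i j hij y hy => ?_⟩
  · have : (1 + s)⁻¹ ≤ 1 := inv_le_one_of_one_le₀ (by linarith)
    linarith
  · obtain ⟨e1, e2, e3⟩ := ht (i, j) hij y hy
    refine ⟨(hb0 _).trans e1, e2.trans ?_, fun y' hy' => (e3 y' hy').trans ?_⟩
    · have := Finset.single_le_sum (f := fun p => (t p).2.1) (fun p _ => ht2 p)
        (Finset.mem_univ (i, j))
      linarith
    · exact mul_le_mul_of_nonneg_right (Finset.single_le_sum (f := fun p => (t p).2.2)
        (fun p _ => ht3 p) (Finset.mem_univ (i, j))) dist_nonneg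

/-! ### The pressure -/

/-- The pressure is a polynomial in bounded functions that have smooth approximations, so its weak
gradient is the one prescribed to vanish; connectedness leaves a function of time. -/
theorem exists_pressure_eq {n : ℕ} {D : Mixture n} {Ω : Set Space} (hΩ : IsLipschitzDomain Ω)
    {T : ℝ} {U0 : Space → State n} {U : ℝ × Space → State n} {G : ℝ × Space → StateGrad n}
    {u : ℝ × Space → Fin n → Space} (h : IsWeakSolutionWith D Ω T U0 U G u) {M : ℝ}
    (hM : ∀ᵐ z ∂cylMeasure Ω T, (∀ i, (U z).1 i ≤ M) ∧ (U z).2 ≤ M) {τ : ℝ} (hτ : τ ∈ Ioo 0 T) :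
    ∃ P : ℝ → ℝ, ∀ᵐ z ∂cylMeasure Ω τ, (U z).2 * ∑ i, (U z).1 i / D.m i = P z.1 := by
  set f : Option (Fin n) → ℝ × Space → ℝ := fun a z => a.elim (U z).2 fun i => (U z).1 i with hf
  set Gf : Option (Fin n) → ℝ × Space → Space := fun a z => a.elim (G z).2 fun i => (G z).1 i
    with hGf
  have hap : ∀ a, SmoothApprox Ω τ (f a) (Gf a) := by
    rintro (_ | i)
    · exact h.temperature_L2H1.smoothApprox hΩ hτ
    · exact (h.density_L2H1 i).smoothApprox hΩ hτ
  have hac : ∀ {p : ℝ × Space → Prop}, (∀ᵐ z ∂cylMeasure Ω T, p z) →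
      ∀ᵐ z ∂cylMeasure Ω τ, p z := fun hp => ae_mono (cylMeasure_mono hτ.2.le) hp
  set g : (Option (Fin n) → ℝ) → ℝ := fun y => y none * ∑ i, (D.m i)⁻¹ * y (some i) with hg
  have hgd : ContDiff ℝ ∞ g := by
    have h1 : ∀ a, ContDiff ℝ ∞ fun y : Option (Fin n) → ℝ => y a := fun a => contDiff_apply ℝ ℝ a
    exact (h1 none).mul (ContDiff.sum fun i _ => contDiff_const.mul (h1 _))
  have hcomp := SmoothApprox.comp_of_mem hΩ.isBounded hap
    (isCompact_univ_pi (s := fun _ : Option (Fin n) => Icc 0 M) fun _ => isCompact_Icc) isOpen_univ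
    (subset_univ _) ?_ hgd.contDiffOn
  · have hz0 : ∀ᵐ z ∂cylMeasure Ω τ,
        liftGrad (fderiv ℝ g fun a => f a z) (fun a => Gf a z) = (0 : ℝ × Space → Space) z := by
      filter_upwards [hac h.pos, hac h.momentum] with z hz hp
      rw [D.chainGrad_totalPressure hz] at hp
      have h1 : ∀ a : Option (Fin n), HasFDerivAt (fun y : Option (Fin n) → ℝ => y a)
          (coordCLM a) (fun a => f a z) := fun a => (coordCLM a).hasFDerivAt
      have h2 : HasFDerivAt g _ (fun a => f a z) := (h1 none).mul
        (HasFDerivAt.fun_sum (u := Finset.univ) fun i _ => (h1 (some i)).const_mul (D.m i)⁻¹)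
      rw [h2.fderiv]
      simp only [liftGrad_add_left, liftGrad_smul_left, liftGrad_sum_left, liftGrad_proj]
      simpa only [hf, hGf, Option.elim, div_eq_inv_mul, Pi.zero_apply] using hp
    obtain ⟨P, hP⟩ := exists_eq_of_weakGrad_eq_zero hΩ.isOpen hΩ.isBounded hΩ.isConnected
      (hcomp.congr EventuallyEq.rfl hz0)
    refine ⟨P, hP.mono fun z hz => ?_⟩
    rw [← hz]
    simp only [hg, hf, Option.elim, div_eq_inv_mul]
  · filter_upwards [hac h.pos, hac hM] with z hz hzM
    rintro (_ | i) -
    · exact ⟨hz.2.le, hzM.2⟩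
    · exact ⟨(hz.1 i).le, hzM.1 i⟩

/-! ### Balance laws of the solutions -/

section Balance

variable {n : ℕ} {D : Mixture n} {Ω : Set Space} {T : ℝ} {U0 Ub0 : Space → State n}
  {U Ub : ℝ × Space → State n} {G Gb : ℝ × Space → StateGrad n} {u ub : ℝ × Space → Fin n → Space}

theorem IsWeakSolutionWith.weakBalance_density (hΩ : IsLipschitzDomain Ω)
    (h : IsWeakSolutionWith D Ω T U0 U G u) (i : Fin n) :
    WeakBalance Ω T (fun x => volume.real Ω * (U0 x).1 i) (fun z => (U z).1 i)
      (fun z => massFlux i (U z) (u z)) :=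
  WeakBalance.of_test hΩ.isOpen hΩ.isBounded (h.density_slice i) (h.massFlux_integrable i)
    (h.mass_balance i)

theorem IsWeakSolutionWith.weakBalance_energy (hΩ : IsLipschitzDomain Ω)
    (h : IsWeakSolutionWith D Ω T U0 U G u) :
    WeakBalance Ω T (fun x => volume.real Ω * D.totalEnergy (U0 x)) (fun z => D.totalEnergy (U z))
      (fun z => D.energyFlux (U z) (G z) (u z)) :=
  WeakBalance.of_test hΩ.isOpen hΩ.isBounded h.energy_slice h.energyFlux_integrable
    h.energy_balance

theorem IsWeakSolutionWith.integrableOn_init (hb : Bornology.IsBounded Ω)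
    (h : IsWeakSolutionWith D Ω T U0 U G u) (i : Fin n) :
    IntegrableOn (fun x => (U0 x).1 i) Ω := by
  have : IsFiniteMeasure (volume.restrict Ω) := ⟨by simpa using hb.measure_lt_top⟩
  exact (h.init_density i).integrable le_top

theorem IsWeakSolutionWith.weakBalance_totalMass (hΩ : IsLipschitzDomain Ω)
    (h : IsWeakSolutionWith D Ω T U0 U G u) :
    WeakBalance Ω T (fun x => ∑ i, volume.real Ω * (U0 x).1 i) (fun z => totalMass (U z))
      (fun z => ∑ i, massFlux i (U z) (u z)) :=
  WeakBalance.sum Finset.univ hΩ.isOpen hΩ.isBounded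
    (fun i _ => (h.integrableOn_init hΩ.isBounded i).const_mul _)
    fun i _ => h.weakBalance_density hΩ i

theorem IsWeakSolutionWith.sum_massFlux_eq_zero (h : IsWeakSolutionWith D Ω T U0 U G u) :
    (fun z => ∑ i, massFlux i (U z) (u z)) =ᵐ[cylMeasure Ω T] 0 :=
  h.relations.mono fun _ hz => hz.2

/-- The total mass density is stationary and determined by the initial data. -/
theorem IsWeakSolutionWith.totalMass_eq (hΩ : IsLipschitzDomain Ω)
    (h : IsWeakSolutionWith D Ω T U0 U G u) (h' : IsWeakSolutionWith D Ω T Ub0 Ub Gb ub)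
    (h0 : ∀ᵐ x ∂volume.restrict Ω, U0 x = Ub0 x) {s t : ℝ} (hs : s ∈ Ico 0 T) (ht : t ∈ Ico 0 T) :
    ∀ᵐ x ∂volume.restrict Ω, totalMass (U (t, x)) = totalMass (Ub (s, x)) := by
  have e := (h.weakBalance_totalMass hΩ).integral_eq_of_flux_eq_zero (h'.weakBalance_totalMass hΩ)
    (h0.mono fun x hx => by simp only [hx]) h.sum_massFlux_eq_zero h'.sum_massFlux_eq_zero hs ht
  exact (h.weakBalance_totalMass hΩ).ae_eq_slice hΩ.isOpen (h'.weakBalance_totalMass hΩ) hΩ.isBounded ht hs e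

theorem IsWeakSolutionWith.totalMass_eq_cyl (hΩ : IsLipschitzDomain Ω)
    (h : IsWeakSolutionWith D Ω T U0 U G u) (h' : IsWeakSolutionWith D Ω T Ub0 Ub Gb ub)
    (h0 : ∀ᵐ x ∂volume.restrict Ω, U0 x = Ub0 x) :
    ∀ᵐ z ∂cylMeasure Ω T, totalMass (U z) = totalMass (Ub z) := by
  refine ae_cyl_of_forall_lt hΩ.isOpen fun τ hτ => ?_
  have hm : ∀ {U0 : Space → State n} {U : ℝ × Space → State n} {G : ℝ × Space → StateGrad n}
      {u : ℝ × Space → Fin n → Space}, IsWeakSolutionWith D Ω T U0 U G u →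
      AEStronglyMeasurable (fun z => totalMass (U z)) (cylMeasure Ω τ) := fun h =>
    Finset.aestronglyMeasurable_fun_sum _ fun i _ => (h.density_bounded i τ hτ).1
  exact ae_cyl_eq_of_slices (hm h) (hm h') (Eventually.of_forall fun t ht =>
    h.totalMass_eq hΩ h' h0 ⟨ht.1.le, ht.2.trans hτ.2⟩ ⟨ht.1.le, ht.2.trans hτ.2⟩)

theorem volume_real_pos (hΩ : IsLipschitzDomain Ω) : 0 < volume.real Ω :=
  ENNReal.toReal_pos (hΩ.isOpen.measure_pos volume hΩ.isConnected.nonempty).ne'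
    hΩ.isBounded.measure_lt_top.ne

/-- The bound holds at some time s; stationarity of the total mass, from comparing the solution with
itself, carries it to every t. -/
theorem IsWeakSolutionWith.le_totalMass (hΩ : IsLipschitzDomain Ω) (hT : 0 < T)
    (h : IsWeakSolutionWith D Ω T U0 U G u) {ρ₀ : ℝ}
    (hρ : ∀ᵐ z ∂cylMeasure Ω T, ρ₀ ≤ totalMass (U z)) {t : ℝ} (ht : t ∈ Ico 0 T) :
    ∀ᵐ x ∂volume.restrict Ω, ρ₀ ≤ totalMass (U (t, x)) := by
  have h1 := ae_slices hρ
  obtain ⟨s, hs, hsI⟩ : ∃ s, (s ∈ Ioo 0 T → ∀ᵐ x ∂volume.restrict Ω, ρ₀ ≤ totalMass (U (s, x))) ∧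
      s ∈ Ioo 0 T := by
    by_contra! hcon
    have h2 : ∀ᵐ s : ℝ, s ∉ Ioo 0 T := h1.mono fun s hs => hcon s hs
    have h3 : volume (Ioo 0 T) = 0 := by
      rw [ae_iff] at h2
      simpa only [not_not, Set.ofPred_mem_eq] using h2
    simp [hT.not_ge] at h3
  filter_upwards [hs hsI, h.totalMass_eq hΩ h (Eventually.of_forall fun _ => rfl)
    ⟨hsI.1.le, hsI.2⟩ ht] with x hx hx'
  rwa [hx']

/-- The constant test function removes the energy flux, and the total energy is proportional to ρθ.
The two integrals start from the same value. -/
theorem IsWeakSolutionWith.integral_mass_mul_temperature_eq (hΩ : IsLipschitzDomain Ω)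
    (h : IsWeakSolutionWith D Ω T U0 U G u) (h' : IsWeakSolutionWith D Ω T Ub0 Ub Gb ub)
    (h0 : ∀ᵐ x ∂volume.restrict Ω, U0 x = Ub0 x) {t : ℝ} (ht : t ∈ Ico 0 T) :
    ∫ x in Ω, totalMass (U (t, x)) * (U (t, x)).2
      = ∫ x in Ω, totalMass (Ub (t, x)) * (Ub (t, x)).2 := by
  have hg : ∀ x : Space, gradient (fun _ : Space => (1 : ℝ)) x = 0 := fun x => gradient_fun_const x 1
  have e1 := (h.weakBalance_energy hΩ).balance (fun _ => 1) contDiff_const t ht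
  have e2 := (h'.weakBalance_energy hΩ).balance (fun _ => 1) contDiff_const t ht
  simp only [hg, inner_zero_right, integral_zero, mul_one] at e1 e2
  have e3 : ∫ x in Ω, volume.real Ω * D.totalEnergy (U0 x)
      = ∫ x in Ω, volume.real Ω * D.totalEnergy (Ub0 x) :=
    integral_congr_ae (h0.mono fun x hx => by simp only [hx])
  have e4 : ∫ x in Ω, D.totalEnergy (U (t, x)) = ∫ x in Ω, D.totalEnergy (Ub (t, x)) := by linarith
  simp only [D.totalEnergy_eq, integral_const_mul] at e4
  exact mul_left_cancel₀ D.cw_pos.ne' e4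

end Balance

/-! ### Control of the temperature -/

/-- Cauchy–Schwarz, obtained by integrating the square of V w - I; the case V = 0 is separate
because V is divided out. -/
theorem sq_integral_le {α : Type*} [MeasurableSpace α] {μ : Measure α} [IsFiniteMeasure μ]
    {w : α → ℝ} (hw : MemLp w 2 μ) : (∫ x, w x ∂μ) ^ 2 ≤ μ.real univ * ∫ x, w x ^ 2 ∂μ := by
  have h1 : Integrable w μ := hw.integrable (by norm_num)
  have h2 : Integrable (fun x => w x ^ 2) μ := hw.integrable_sq
  set V := μ.real univ with hV
  set I := ∫ x, w x ∂μ with hI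
  have hV0 : 0 ≤ V := measureReal_nonneg
  have h3 : ∫ x, (V * w x - I) ^ 2 ∂μ = V * (V * (∫ x, w x ^ 2 ∂μ) - I ^ 2) := by
    have : ∀ x, (V * w x - I) ^ 2 = V ^ 2 * w x ^ 2 - 2 * V * I * w x + I ^ 2 := fun x => by ring
    simp only [this]
    have h4 : Integrable (fun x => V ^ 2 * w x ^ 2 - 2 * V * I * w x) μ :=
      (h2.const_mul _).sub (h1.const_mul _)
    rw [integral_add h4 (integrable_const _),
      integral_sub (h2.const_mul _) (h1.const_mul _), integral_const_mul, integral_const_mul,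
      integral_const, smul_eq_mul, ← hV, ← hI]
    ring
  rcases hV0.eq_or_lt with h0 | h0
  · have : μ = 0 := by
      rw [← Measure.measure_univ_eq_zero]
      exact (measureReal_eq_zero_iff).1 (hV ▸ h0.symm)
    simp [hI, this]
  · have h4 : 0 ≤ ∫ x, (V * w x - I) ^ 2 ∂μ := integral_nonneg fun x => sq_nonneg _
    rw [h3] at h4
    linarith [nonneg_of_mul_nonneg_right h4 h0]

/-- Two temperatures `P / c`, `P' / c'` with constant pressures and the same energy differ by no
more than the concentrations. -/
theorem integral_sq_temperature_sub_le {α : Type*} [MeasurableSpace α] {μ : Measure α}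
    [IsFiniteMeasure μ] (hμ : 0 < μ.real univ) {r θ θ' c c' w : α → ℝ} {P P' ρ₀ R c₀ C M k : ℝ}
    (hρ₀ : 0 < ρ₀) (hc₀ : 0 < c₀) (hC : 0 < C)
    (hM : 0 ≤ M) (hk : 0 ≤ k) (hR : 0 ≤ R) (hw : MemLp w 2 μ)
    (hr : ∀ᵐ x ∂μ, ρ₀ ≤ r x ∧ r x ≤ R) (hθ : ∀ᵐ x ∂μ, θ x * c x = P ∧ θ' x * c' x = P')
    (hc : ∀ᵐ x ∂μ, c₀ ≤ c' x ∧ c' x ≤ C) (hθM : ∀ᵐ x ∂μ, 0 ≤ θ x ∧ θ x ≤ M)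
    (hcw : ∀ᵐ x ∂μ, |c x - c' x| ≤ k * w x)
    (hi : Integrable (fun x => r x * θ x) μ) (hi' : Integrable (fun x => r x * θ' x) μ)
    (he : ∫ x, r x * θ x ∂μ = ∫ x, r x * θ' x ∂μ) :
    ∫ x, (θ x - θ' x) ^ 2 ∂μ
      ≤ 2 / c₀ ^ 2 * ((R * M / c₀ * k * C / ρ₀) ^ 2 + (M * k) ^ 2) * ∫ x, w x ^ 2 ∂μ := by
  set V := μ.real univ with hV
  have hw1 : Integrable w μ := hw.integrable (by norm_num)
  set A := R * M / c₀ * k with hA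
  have hA0 : 0 ≤ A := by positivity
  have hkw : ∀ᵐ x ∂μ, 0 ≤ k * w x := hcw.mono fun x hx => (abs_nonneg _).trans hx
  have hkw0 : 0 ≤ k * ∫ x, w x ∂μ := by
    rw [← integral_const_mul]
    exact integral_nonneg_of_ae hkw
  have hI0 : 0 ≤ A * ∫ x, w x ∂μ := by
    rw [hA, mul_assoc]
    exact mul_nonneg (by positivity) hkw0
  have hid : ∀ᵐ x ∂μ, c' x * (θ x - θ' x) = (P - P') - θ x * (c x - c' x) :=
    hθ.mono fun x hx => by rw [← hx.1, ← hx.2]; ring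
  -- By the identity above, r (θ - θ') = (r / c') (P - P') - (r θ / c') (c - c'), and the left side
  -- has integral zero. The weight r / c' is at least ρ₀ / C, so the pressure difference is bounded
  -- by the difference of concentrations. The sign s = ±1 treats both bounds at once.
  have key : ∀ s : ℝ, |s| = 1 → s * (P - P') * (ρ₀ / C * V) ≤ A * ∫ x, w x ∂μ := fun s hs => by
    rcases le_or_gt (s * (P - P')) 0 with h0 | h0
    · exact (mul_nonpos_of_nonpos_of_nonneg h0 (by positivity)).trans hI0
    have h1 : ∀ᵐ x ∂μ, s * (P - P') * (ρ₀ / C)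
        ≤ s * (r x * θ x - r x * θ' x) + A * w x := by
      filter_upwards [hid, hr, hc, hθM, hcw] with x e1 e2 e3 e4 e5
      have hcp : 0 < c' x := hc₀.trans_le e3.1
      have e6 : s * (r x * θ x - r x * θ' x)
          = s * (P - P') * (r x / c' x) - r x * θ x / c' x * (s * (c x - c' x)) := by
        field_simp
        linear_combination s * r x * e1
      have e7 : ρ₀ / C ≤ r x / c' x := div_le_div₀ (hρ₀.le.trans e2.1) e2.1 hcp e3.2
      have e8 : s * (c x - c' x) ≤ k * w x := by
        refine (le_abs_self _).trans ?_
        rwa [abs_mul, hs, one_mul]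
      have e9 : r x * θ x / c' x ≤ R * M / c₀ :=
        div_le_div₀ (by positivity) (mul_le_mul e2.2 e4.2 e4.1 hR) hc₀ e3.1
      have e10 : 0 ≤ r x * θ x / c' x :=
        div_nonneg (mul_nonneg (hρ₀.le.trans e2.1) e4.1) hcp.le
      have e11 := mul_le_mul_of_nonneg_left e8 e10
      have e12 := mul_le_mul_of_nonneg_right e9 ((abs_nonneg _).trans e5)
      have e13 := mul_le_mul_of_nonneg_left e7 h0.le
      rw [e6, hA, mul_assoc _ k]
      linarith
    have hs1 : Integrable (fun x => s * (r x * θ x - r x * θ' x)) μ := (hi.sub hi').const_mul s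
    have h2 := integral_mono_ae (integrable_const _) (hs1.add (hw1.const_mul A)) h1
    have h3 : ∫ x, (s * (r x * θ x - r x * θ' x) + A * w x) ∂μ = A * ∫ x, w x ∂μ := by
      rw [integral_add hs1 (hw1.const_mul A), integral_const_mul,
        integral_const_mul, integral_sub hi hi', he, sub_self, mul_zero, zero_add]
    simp only [Pi.add_apply] at h2
    rw [h3, integral_const, smul_eq_mul, ← hV] at h2
    linarith
  have hΔ : |P - P'| * V ≤ A * C / ρ₀ * ∫ x, w x ∂μ := by
    have h1 : |P - P'| * (ρ₀ / C * V) ≤ A * ∫ x, w x ∂μ := by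
      rcases abs_choice (P - P') with h | h
      · simpa [h] using key 1 (by simp)
      · simpa [h] using key (-1) (by simp)
    have h2 : |P - P'| * V = C / ρ₀ * (|P - P'| * (ρ₀ / C * V)) := by field_simp
    rw [h2, show A * C / ρ₀ * ∫ x, w x ∂μ = C / ρ₀ * (A * ∫ x, w x ∂μ) by ring]
    exact mul_le_mul_of_nonneg_left h1 (by positivity)
  have hΔ2 : (P - P') ^ 2 * V ≤ (A * C / ρ₀) ^ 2 * ∫ x, w x ^ 2 ∂μ := by
    have h1 : (|P - P'| * V) ^ 2 ≤ (A * C / ρ₀) ^ 2 * (V * ∫ x, w x ^ 2 ∂μ) := by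
      refine (pow_le_pow_left₀ (by positivity) hΔ 2).trans ?_
      rw [mul_pow]
      exact mul_le_mul_of_nonneg_left (sq_integral_le hw) (sq_nonneg _)
    rw [mul_pow, sq_abs] at h1
    refine le_of_mul_le_mul_right ?_ hμ
    linarith
  have hpt : ∀ᵐ x ∂μ, (θ x - θ' x) ^ 2 ≤ 2 / c₀ ^ 2 * ((P - P') ^ 2 + (M * k) ^ 2 * w x ^ 2) := by
    filter_upwards [hid, hc, hθM, hcw] with x e1 e3 e4 e5
    have e2 : c₀ ^ 2 * (θ x - θ' x) ^ 2 ≤ (c' x * (θ x - θ' x)) ^ 2 := by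
      rw [mul_pow]
      exact mul_le_mul_of_nonneg_right (pow_le_pow_left₀ hc₀.le e3.1 2) (sq_nonneg _)
    have e6 : (θ x * (c x - c' x)) ^ 2 ≤ (M * k) ^ 2 * w x ^ 2 := by
      have : |θ x * (c x - c' x)| ≤ M * k * w x := by
        rw [abs_mul, abs_of_nonneg e4.1, mul_assoc]
        exact mul_le_mul e4.2 e5 (abs_nonneg _) hM
      rw [← sq_abs, ← mul_pow]
      exact pow_le_pow_left₀ (abs_nonneg _) this 2
    rw [e1] at e2
    rw [div_mul_eq_mul_div, le_div_iff₀ (by positivity)]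
    nlinarith [sq_nonneg ((P - P') + θ x * (c x - c' x))]
  refine (integral_mono_of_nonneg (Eventually.of_forall fun x => sq_nonneg _)
    (((integrable_const _).add (hw.integrable_sq.const_mul _)).const_mul _) hpt).trans ?_
  simp only [Pi.add_apply]
  rw [integral_const_mul, integral_add (integrable_const _) (hw.integrable_sq.const_mul _),
    integral_const, integral_const_mul, smul_eq_mul, ← hV, mul_assoc]
  refine mul_le_mul_of_nonneg_left ?_ (by positivity)
  linarith

/-! ### A weak and a strong solution with the same initial data -/

/-- A weak solution `U` and a weak solution `Ub` with the same initial data, uniform bounds, lower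
bounds for `Ub`, and gradients of `Ub` in `L²(0, τ; L^∞)`. -/
structure IsComparable {n : ℕ} (D : Mixture n) (Ω : Set Space) (T : ℝ)
    (U0 Ub0 : Space → State n) (U Ub : ℝ × Space → State n) (G Gb : ℝ × Space → StateGrad n)
    (u ub : ℝ × Space → Fin n → Space) (δ M : ℝ) (q : ℝ → ℝ) : Prop where
  card_pos : 0 < n
  domain : IsLipschitzDomain Ω
  time_pos : 0 < T
  δ_pos : 0 < δ
  M_pos : 0 < M
  weak : IsWeakSolutionWith D Ω T U0 U G u
  strong : IsWeakSolutionWith D Ω T Ub0 Ub Gb ub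
  init : ∀ᵐ x ∂volume.restrict Ω, U0 x = Ub0 x
  weak_le : ∀ᵐ z ∂cylMeasure Ω T, (∀ i, (U z).1 i ≤ M) ∧ (U z).2 ≤ M
  strong_le : ∀ᵐ z ∂cylMeasure Ω T, (∀ i, (Ub z).1 i ≤ M) ∧ (Ub z).2 ≤ M
  le_strong : ∀ᵐ z ∂cylMeasure Ω T, (∀ i, δ ≤ (Ub z).1 i) ∧ δ ≤ (Ub z).2
  memLp_majorant : ∀ τ ∈ Ioo 0 T, MemLp q 2 (volume.restrict (Ioo 0 τ))
  grad_le : ∀ᵐ z ∂cylMeasure Ω T, (∀ i, ‖(Gb z).1 i‖ ≤ q z.1) ∧ ‖(Gb z).2‖ ≤ q z.1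

/-- The total concentration `∑ ρ_i / m_i`. -/
def Mixture.concentration {n : ℕ} (D : Mixture n) (s : State n) : ℝ := ∑ i, s.1 i / D.m i

namespace Mixture

variable {n : ℕ} (D : Mixture n)

/-- The sum of the molar masses. -/
def massSum : ℝ := ∑ i, D.m i

theorem m_le_massSum (i : Fin n) : D.m i ≤ D.massSum :=
  Finset.single_le_sum (fun j _ => (D.m_pos j).le) (Finset.mem_univ i)

theorem massSum_pos (hn : 0 < n) : 0 < D.massSum :=
  (D.m_pos ⟨0, hn⟩).trans_le (D.m_le_massSum _)

theorem totalMass_le_concentration {s : State n} (hs : ∀ i, 0 ≤ s.1 i) :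
    totalMass s ≤ D.massSum * D.concentration s := by
  rw [totalMass, concentration, Finset.mul_sum]
  refine Finset.sum_le_sum fun i _ => ?_
  have := mul_le_mul_of_nonneg_right (D.m_le_massSum i) (div_nonneg (hs i) (D.m_pos i).le)
  rwa [mul_div_cancel₀ _ (D.m_pos i).ne'] at this

/-- An upper bound for the concentrations if all densities are at most `M`. -/
def concentrationBound (M : ℝ) : ℝ := ∑ i, M / D.m i

theorem concentrationBound_pos (hn : 0 < n) {M : ℝ} (hM : 0 < M) : 0 < D.concentrationBound M :=
  Finset.sum_pos (fun i _ => div_pos hM (D.m_pos i)) ⟨⟨0, hn⟩, Finset.mem_univ _⟩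

theorem concentration_le {s : State n} {M : ℝ} (hs : ∀ i, s.1 i ≤ M) :
    D.concentration s ≤ D.concentrationBound M :=
  Finset.sum_le_sum fun i _ => div_le_div_of_nonneg_right (hs i) (D.m_pos i).le

theorem div_le_concentrationBound (i : Fin n) {r M : ℝ} (hM : 0 < M) (hr : r ≤ M) :
    r / D.m i ≤ D.concentrationBound M :=
  (div_le_div_of_nonneg_right hr (D.m_pos i).le).trans
    (Finset.single_le_sum (f := fun i => M / D.m i) (fun j _ => (div_pos hM (D.m_pos j)).le)
      (Finset.mem_univ i))

end Mixture

namespace IsComparable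

variable {n : ℕ} {D : Mixture n} {Ω : Set Space} {T : ℝ} {U0 Ub0 : Space → State n}
  {U Ub : ℝ × Space → State n} {G Gb : ℝ × Space → StateGrad n} {u ub : ℝ × Space → Fin n → Space}
  {δ M : ℝ} {q : ℝ → ℝ}

theorem cyl_mono {p : ℝ × Space → Prop} (h : ∀ᵐ z ∂cylMeasure Ω T, p z) {τ : ℝ} (hτ : τ ∈ Ioo 0 T) :
    ∀ᵐ z ∂cylMeasure Ω τ, p z :=
  ae_mono (cylMeasure_mono hτ.2.le) h


theorem totalMass_eq_cyl (S : IsComparable D Ω T U0 Ub0 U Ub G Gb u ub δ M q) :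
    ∀ᵐ z ∂cylMeasure Ω T, totalMass (U z) = totalMass (Ub z) :=
  S.weak.totalMass_eq_cyl S.domain S.strong S.init

theorem le_totalMass_strong (S : IsComparable D Ω T U0 Ub0 U Ub G Gb u ub δ M q) :
    ∀ᵐ z ∂cylMeasure Ω T, n * δ ≤ totalMass (Ub z) :=
  S.le_strong.mono fun z hz => by
    simpa [totalMass] using Finset.card_nsmul_le_sum Finset.univ (fun i => (Ub z).1 i) δ
      fun i _ => hz.1 i

theorem card_mul_pos (S : IsComparable D Ω T U0 Ub0 U Ub G Gb u ub δ M q) :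
    0 < n * δ := mul_pos (Nat.cast_pos.2 S.card_pos) S.δ_pos

theorem le_totalMass_weak (S : IsComparable D Ω T U0 Ub0 U Ub G Gb u ub δ M q) :
    ∀ᵐ z ∂cylMeasure Ω T, n * δ ≤ totalMass (U z) := by
  filter_upwards [S.totalMass_eq_cyl, S.le_totalMass_strong] with z h1 h2
  rwa [h1]

theorem totalMass_le (S : IsComparable D Ω T U0 Ub0 U Ub G Gb u ub δ M q) :
    ∀ᵐ z ∂cylMeasure Ω T, totalMass (U z) ≤ n * M :=
  S.weak_le.mono fun z hz => by
    simpa [totalMass] using Finset.sum_le_card_nsmul Finset.univ (fun i => (U z).1 i) M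
      fun i _ => hz.1 i

theorem le_concentration_weak (S : IsComparable D Ω T U0 Ub0 U Ub G Gb u ub δ M q) :
    ∀ᵐ z ∂cylMeasure Ω T, n * δ / D.massSum ≤ D.concentration (U z) := by
  filter_upwards [S.le_totalMass_weak, S.weak.pos] with z h1 h2
  rw [div_le_iff₀' (D.massSum_pos S.card_pos)]
  exact h1.trans (D.totalMass_le_concentration fun i => (h2.1 i).le)

theorem le_concentration_strong (S : IsComparable D Ω T U0 Ub0 U Ub G Gb u ub δ M q) :
    ∀ᵐ z ∂cylMeasure Ω T, n * δ / D.massSum ≤ D.concentration (Ub z) := by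
  filter_upwards [S.le_totalMass_strong, S.strong.pos] with z h1 h2
  rw [div_le_iff₀' (D.massSum_pos S.card_pos)]
  exact h1.trans (D.totalMass_le_concentration fun i => (h2.1 i).le)

theorem integrableOn_mass_mul_temperature {U0 : Space → State n} {U : ℝ × Space → State n}
    {G : ℝ × Space → StateGrad n} {u : ℝ × Space → Fin n → Space}
    (h : IsWeakSolutionWith D Ω T U0 U G u) {t : ℝ} (ht : t ∈ Ico 0 T) :
    IntegrableOn (fun x => totalMass (U (t, x)) * (U (t, x)).2) Ω := by
  have h1 := h.energy_slice t ht
  simp only [D.totalEnergy_eq] at h1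
  have h2 := Integrable.const_mul h1 D.cw⁻¹
  simp only [inv_mul_cancel_left₀ D.cw_pos.ne'] at h2
  exact h2

theorem isFiniteMeasure (S : IsComparable D Ω T U0 Ub0 U Ub G Gb u ub δ M q) :
    IsFiniteMeasure ((volume : Measure Space).restrict Ω) :=
  isFiniteMeasure_restrict.2 S.domain.isBounded.measure_lt_top.ne

/-- The temperature of the weak solution is bounded below. -/
theorem le_temperature (S : IsComparable D Ω T U0 Ub0 U Ub G Gb u ub δ M q)
    {τ : ℝ} (hτ : τ ∈ Ioo 0 T) :
    ∀ᵐ z ∂cylMeasure Ω τ, n * δ * δ / D.massSum / D.concentrationBound M ≤ (U z).2 := by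
  obtain ⟨P, hP⟩ := exists_pressure_eq S.domain S.weak S.weak_le hτ
  have hfin := S.isFiniteMeasure
  have hm := D.massSum_pos S.card_pos
  have hC := D.concentrationBound_pos S.card_pos S.M_pos
  -- The energy ∫ ρθ equals that of the strong solution, hence is at least nδ · δ · |Ω|. It is at
  -- most `D.massSum` times P(t) |Ω|, because ρ ≤ `D.massSum` · c and θ c = P. Dividing P by the
  -- bound for c then bounds θ below.
  have hPt : ∀ᵐ t : ℝ, t ∈ Ioo 0 τ → n * δ * δ / D.massSum ≤ P t := by
    filter_upwards [ae_slices hP, ae_slices (cyl_mono S.weak.pos hτ),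
      ae_slices (cyl_mono S.le_totalMass_strong hτ), ae_slices (cyl_mono S.le_strong hτ)]
      with t h1 h2 h3 h4 ht
    have htT : t ∈ Ico 0 T := ⟨ht.1.le, ht.2.trans hτ.2⟩
    have e1 := S.weak.integral_mass_mul_temperature_eq S.domain S.strong S.init htT
    have e2 : n * δ * δ * volume.real Ω ≤ ∫ x in Ω, totalMass (Ub (t, x)) * (Ub (t, x)).2 := by
      have := integral_mono_ae (integrable_const (n * δ * δ))
        (integrableOn_mass_mul_temperature S.strong htT) (by
          filter_upwards [h3 ht, h4 ht] with x hx hx'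
          exact mul_le_mul hx hx'.2 S.δ_pos.le (S.card_mul_pos.le.trans hx))
      rwa [integral_const, measureReal_restrict_apply_univ, smul_eq_mul, mul_comm] at this
    have e3 : ∫ x in Ω, totalMass (U (t, x)) * (U (t, x)).2 ≤ D.massSum * P t * volume.real Ω := by
      have := integral_mono_ae (integrableOn_mass_mul_temperature S.weak htT)
        (integrable_const (D.massSum * P t)) (by
          filter_upwards [h1 ht, h2 ht] with x hx hx'
          rw [← hx]
          have := mul_le_mul_of_nonneg_right
            (D.totalMass_le_concentration fun i => (hx'.1 i).le) hx'.2.le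
          rw [Mixture.concentration] at this
          linarith)
      rwa [integral_const, measureReal_restrict_apply_univ, smul_eq_mul, mul_comm (volume.real Ω)]
        at this
    rw [e1] at e3
    rw [div_le_iff₀' hm]
    exact le_of_mul_le_mul_right (e2.trans e3) (volume_real_pos S.domain)
  have hmp : ∀ᵐ z ∂cylMeasure Ω τ, n * δ * δ / D.massSum ≤ P z.1 := by
    rw [cylMeasure_eq_prod]
    exact Measure.quasiMeasurePreserving_fst.ae
      ((ae_restrict_iff' measurableSet_Ioo).2 hPt)
  filter_upwards [hP, hmp, cyl_mono S.weak_le hτ, cyl_mono S.weak.pos hτ] with z h1 h2 h3 h4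
  rw [div_le_iff₀ hC]
  refine h2.trans ?_
  rw [← h1]
  exact mul_le_mul_of_nonneg_left (D.concentration_le h3.1) h4.2.le

/-- On almost every time slice both temperatures are P / c with constant P and have the same energy,
so the density differences control them with a constant independent of the time. -/
theorem exists_temperature_sub_le (S : IsComparable D Ω T U0 Ub0 U Ub G Gb u ub δ M q)
    {τ : ℝ} (hτ : τ ∈ Ioo 0 T) :
    ∃ K, 0 ≤ K ∧ ∀ᵐ t : ℝ, t ∈ Ioo 0 τ →
      ∫ x in Ω, ((U (t, x)).2 - (Ub (t, x)).2) ^ 2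
        ≤ K * ∫ x in Ω, (∑ i, |(U (t, x)).1 i - (Ub (t, x)).1 i|) ^ 2 := by
  obtain ⟨P, hP⟩ := exists_pressure_eq S.domain S.weak S.weak_le hτ
  obtain ⟨P', hP'⟩ := exists_pressure_eq S.domain S.strong S.strong_le hτ
  have hfin := S.isFiniteMeasure
  have hm := D.massSum_pos S.card_pos
  have hC := D.concentrationBound_pos S.card_pos S.M_pos
  have hnδ := S.card_mul_pos
  have hM := S.M_pos.le
  have hc₀ : 0 < n * δ / D.massSum := div_pos hnδ hm
  set k := ∑ i, (D.m i)⁻¹ with hk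
  have hk0 : 0 ≤ k := Finset.sum_nonneg fun i _ => (inv_pos.2 (D.m_pos i)).le
  refine ⟨2 / (n * δ / D.massSum) ^ 2 * ((n * M * M / (n * δ / D.massSum) * k
    * D.concentrationBound M / (n * δ)) ^ 2 + (M * k) ^ 2), by positivity, ?_⟩
  · filter_upwards [ae_slices hP, ae_slices hP', ae_slices (cyl_mono S.weak.pos hτ),
      ae_slices (cyl_mono S.le_totalMass_weak hτ), ae_slices (cyl_mono S.totalMass_le hτ),
      ae_slices (cyl_mono S.le_concentration_strong hτ), ae_slices (cyl_mono S.weak_le hτ),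
      ae_slices (cyl_mono S.strong_le hτ), ae_slices (cyl_mono S.strong.pos hτ)]
      with t h1 h2 h3 h4 h5 h6 h7 h8 h9 ht
    have htT : t ∈ Ico 0 T := ⟨ht.1.le, ht.2.trans hτ.2⟩
    have heq : ∀ᵐ x ∂volume.restrict Ω,
        totalMass (Ub (t, x)) * (Ub (t, x)).2 = totalMass (U (t, x)) * (Ub (t, x)).2 :=
      (S.weak.totalMass_eq S.domain S.strong S.init htT htT).mono fun x hx => by rw [hx]
    refine integral_sq_temperature_sub_le (r := fun x => totalMass (U (t, x)))
      (c := fun x => D.concentration (U (t, x))) (c' := fun x => D.concentration (Ub (t, x)))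
      (P := P t) (P' := P' t) (ρ₀ := n * δ) (R := n * M) (c₀ := n * δ / D.massSum)
      (C := D.concentrationBound M) (M := M) (k := k) ?_ hnδ hc₀ hC hM hk0 (by positivity) ?_
      (by filter_upwards [h4 ht, h5 ht] with x e1 e2 using ⟨e1, e2⟩)
      (by filter_upwards [h1 ht, h2 ht] with x e1 e2 using ⟨e1, e2⟩)
      (by filter_upwards [h6 ht, h8 ht] with x e1 e2 using ⟨e1, D.concentration_le e2.1⟩)
      (by filter_upwards [h3 ht, h7 ht] with x e1 e2 using ⟨e1.2.le, e2.2⟩) ?_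
      (integrableOn_mass_mul_temperature S.weak htT)
      ((integrableOn_mass_mul_temperature S.strong htT).congr heq)
      ((S.weak.integral_mass_mul_temperature_eq S.domain S.strong S.init htT).trans
        (integral_congr_ae heq))
    · rw [measureReal_restrict_apply_univ]
      exact volume_real_pos S.domain
    · refine memLp_finsetSum _ fun i _ => MemLp.of_bound
        (((S.weak.density_slice i t htT).1.sub (S.strong.density_slice i t htT).1).norm) M ?_
      filter_upwards [h3 ht, h7 ht, h8 ht, h9 ht] with x e1 e2 e3 e4
      rw [Real.norm_eq_abs, abs_abs, abs_le]
      constructor <;> linarith [e1.1 i, e2.1 i, e3.1 i, e4.1 i]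
    · refine Eventually.of_forall fun x => ?_
      rw [Mixture.concentration, Mixture.concentration, ← Finset.sum_sub_distrib, hk,
        Finset.sum_mul]
      refine (Finset.abs_sum_le_sum_abs _ _).trans (Finset.sum_le_sum fun i _ => ?_)
      rw [← sub_div, abs_div, abs_of_pos (D.m_pos i), div_eq_inv_mul]
      exact mul_le_mul_of_nonneg_left
        (Finset.single_le_sum (f := fun i => |(U (t, x)).1 i - (Ub (t, x)).1 i|)
          (fun j _ => abs_nonneg _) (Finset.mem_univ i)) (inv_pos.2 (D.m_pos i)).le

end IsComparable

/-! ### Pointwise bounds for the diffusive fluxes -/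

section FluxBounds

variable {ι V : Type*} [Fintype ι] [NormedAddCommGroup V] [InnerProductSpace ℝ V]

/-- The dissipative sign of the Maxwell–Stefan relations bounds the singular part of the entropy
production from above. -/
theorem inv_add_mul_inner_flux_le {ε b₁ m₁ c₀ η : ℝ} (hε : 0 < ε) (hc₀ : 0 < c₀) (hη : 0 < η)
    {m c : ι → ℝ} {β : ι → ι → ℝ} {G u : ι → V} (hm : ∀ i, 0 < m i) (hm₁ : ∀ i, m i ≤ m₁)
    (hc : ∀ i, 0 < c i) (hcs : c₀ ≤ ∑ i, c i) (hβ : ∀ i j, 0 ≤ β i j) (hβ₁ : ∀ i j, β i j ≤ b₁)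
    (hR : ∀ i, ε • (G i - (c i / ∑ j, c j) • ∑ j, G j)
      = -∑ j, (β i j * (m i * c i) * (m j * c j)) • (u i - u j)) (i : ι) :
    (c i + η)⁻¹ * inner ℝ (c i • u i) (G i)
      ≤ (∑ j, ‖c j • u j‖) * (c₀⁻¹ * (∑ j, ‖G j‖) + ε⁻¹ * (b₁ * m₁ ^ 2) * ∑ j, ‖c j • u j‖) := by
  have hs0 : 0 < ∑ j, c j := hc₀.trans_le hcs
  have hm₁0 : 0 < m₁ := (hm i).trans_le (hm₁ i)
  have hb₁ : 0 ≤ b₁ := (hβ i i).trans (hβ₁ i i)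
  have e1 : G i = (c i / ∑ j, c j) • (∑ j, G j)
      - ε⁻¹ • ∑ j, (β i j * (m i * c i) * (m j * c j)) • (u i - u j) := by
    rw [← neg_neg (∑ j, (β i j * (m i * c i) * (m j * c j)) • (u i - u j)), ← hR i, smul_neg,
      inv_smul_smul₀ hε.ne']
    abel
  set S := ∑ j, ‖c j • u j‖ with hS
  have hS0 : 0 ≤ S := Finset.sum_nonneg fun j _ => norm_nonneg _
  have hiS : ‖c i • u i‖ ≤ S :=
    Finset.single_le_sum (f := fun j => ‖c j • u j‖) (fun j _ => norm_nonneg _) (Finset.mem_univ i)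
  have e2 : inner ℝ (c i • u i) ((c i / ∑ j, c j) • (∑ j, G j)) ≤ c i * (S * (c₀⁻¹ * ∑ j, ‖G j‖)) := by
    rw [real_inner_smul_right, div_mul_eq_mul_div, mul_div_assoc]
    refine mul_le_mul_of_nonneg_left ?_ (hc i).le
    rw [div_eq_inv_mul]
    have h1 : inner ℝ (c i • u i) (∑ j, G j) ≤ S * ∑ j, ‖G j‖ :=
      (real_inner_le_norm _ _).trans (mul_le_mul hiS (norm_sum_le _ _) (norm_nonneg _) hS0)
    calc (∑ j, c j)⁻¹ * inner ℝ (c i • u i) (∑ j, G j) ≤ (∑ j, c j)⁻¹ * (S * ∑ j, ‖G j‖) :=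
          mul_le_mul_of_nonneg_left h1 (inv_pos.2 hs0).le
      _ ≤ c₀⁻¹ * (S * ∑ j, ‖G j‖) := mul_le_mul_of_nonneg_right
          (inv_anti₀ hc₀ hcs) (mul_nonneg hS0 (Finset.sum_nonneg fun j _ => norm_nonneg _))
      _ = _ := by ring
  -- The part quadratic in u i has the favourable sign and is dropped; the mixed part is a product
  -- of two fluxes.
  have e3 : -inner ℝ (c i • u i) (∑ j, (β i j * (m i * c i) * (m j * c j)) • (u i - u j))
      ≤ c i * (S * ((b₁ * m₁ ^ 2) * S)) := by
    rw [inner_sum, ← Finset.sum_neg_distrib]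
    have h1 : ∀ j, -inner ℝ (c i • u i) ((β i j * (m i * c i) * (m j * c j)) • (u i - u j))
        ≤ c i * (S * ((b₁ * m₁ ^ 2) * ‖c j • u j‖)) := fun j => by
      have h2 : -inner ℝ (c i • u i) ((β i j * (m i * c i) * (m j * c j)) • (u i - u j))
          = c i * (β i j * m i * m j * inner ℝ (c i • u i) (c j • u j))
            - c i * (β i j * m i * m j * c j * c i * inner ℝ (u i) (u i)) := by
        simp only [real_inner_smul_left, real_inner_smul_right, inner_sub_right]
        ring
      have h3 : 0 ≤ c i * (β i j * m i * m j * c j * c i * inner ℝ (u i) (u i)) := by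
        have := hβ i j
        have := hm i
        have := hm j
        have := hc i
        have := hc j
        have := real_inner_self_nonneg (x := u i)
        positivity
      have h4 : β i j * m i * m j ≤ b₁ * m₁ ^ 2 := by
        rw [pow_two, ← mul_assoc]
        exact mul_le_mul (mul_le_mul (hβ₁ i j) (hm₁ i) (hm i).le hb₁) (hm₁ j) (hm j).le
          (mul_nonneg hb₁ hm₁0.le)
      have h5 : inner ℝ (c i • u i) (c j • u j) ≤ S * ‖c j • u j‖ :=
        (real_inner_le_norm _ _).trans (mul_le_mul_of_nonneg_right hiS (norm_nonneg _))
      have h6 : β i j * m i * m j * inner ℝ (c i • u i) (c j • u j)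
          ≤ S * ((b₁ * m₁ ^ 2) * ‖c j • u j‖) := by
        calc _ ≤ β i j * m i * m j * (S * ‖c j • u j‖) := mul_le_mul_of_nonneg_left h5
              (mul_nonneg (mul_nonneg (hβ i j) (hm i).le) (hm j).le)
          _ ≤ b₁ * m₁ ^ 2 * (S * ‖c j • u j‖) :=
              mul_le_mul_of_nonneg_right h4 (mul_nonneg hS0 (norm_nonneg _))
          _ = _ := by ring
      have h7 := mul_le_mul_of_nonneg_left h6 (hc i).le
      linarith
    refine (Finset.sum_le_sum fun j _ => h1 j).trans (le_of_eq ?_)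
    rw [← Finset.mul_sum, ← Finset.mul_sum, ← Finset.mul_sum]
  -- Every remaining term carries a factor c i, which compensates (c i + η)⁻¹ uniformly in η.
  have e4 : inner ℝ (c i • u i) (G i)
      ≤ c i * (S * (c₀⁻¹ * (∑ j, ‖G j‖) + ε⁻¹ * (b₁ * m₁ ^ 2) * S)) := by
    rw [e1, inner_sub_right, real_inner_smul_right (c i • u i) _ ε⁻¹]
    have := mul_le_mul_of_nonneg_left e3 (inv_pos.2 hε).le
    calc _ ≤ c i * (S * (c₀⁻¹ * ∑ j, ‖G j‖)) + ε⁻¹ * (c i * (S * ((b₁ * m₁ ^ 2) * S))) := by linarith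
      _ = _ := by ring
  have hci := hc i
  have hX : 0 ≤ S * (c₀⁻¹ * (∑ j, ‖G j‖) + ε⁻¹ * (b₁ * m₁ ^ 2) * S) := by
    have : 0 ≤ ∑ j, ‖G j‖ := Finset.sum_nonneg fun j _ => norm_nonneg _
    positivity
  rw [inv_mul_le_iff₀ (by linarith)]
  exact e4.trans (mul_le_mul_of_nonneg_right (by linarith) hX)

/-- Written with the fluxes J_i = r_i u_i, the friction r_i r_j (u_i - u_j) becomes r_j J_i - r_i
J_j, and `sum_norm_flux_le` applies. The factor 2 arises because the terms (c_i / C) ∇C together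
cost as much as the ∇c_i. -/
theorem sum_norm_flux_le_of_relations {ε b₀ ρ₀ : ℝ} (hε : 0 < ε) (hb₀ : 0 < b₀) (hρ₀ : 0 < ρ₀)
    {m c : ι → ℝ} {β : ι → ι → ℝ} {G u : ι → V}
    (hm : ∀ i, 0 < m i) (hc : ∀ i, 0 < c i) (hs : ρ₀ ≤ ∑ i, m i * c i)
    (hβ : ∀ i j, β i j = β j i) (hβ₀ : ∀ i j, b₀ ≤ β i j)
    (hR : ∀ i, ε • (G i - (c i / ∑ j, c j) • ∑ j, G j)
      = -∑ j, (β i j * (m i * c i) * (m j * c j)) • (u i - u j))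
    (hu : ∑ i, (m i * c i) • u i = 0) :
    ∑ i, ‖(m i * c i) • u i‖ ≤ 2 * ε / (b₀ * ρ₀) * ∑ i, ‖G i‖ := by
  have hr : ∀ i, 0 < m i * c i := fun i => mul_pos (hm i) (hc i)
  have h1 := sum_norm_flux_le hβ hβ₀ (r := fun i => m i * c i) (fun i => (hr i).le)
    (J := fun i => (m i * c i) • u i) (R := fun i => -(ε • (G i - (c i / ∑ j, c j) • ∑ j, G j)))
    hu fun i => by
      rw [hR i, neg_neg]
      refine Finset.sum_congr rfl fun j _ => ?_
      module
  have hcs : 0 ≤ ∑ j, c j := Finset.sum_nonneg fun j _ => (hc j).le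
  have h2 : ∑ i, ‖-(ε • (G i - (c i / ∑ j, c j) • ∑ j, G j))‖ ≤ 2 * ε * ∑ i, ‖G i‖ := by
    have h3 : ∀ i, ‖-(ε • (G i - (c i / ∑ j, c j) • ∑ j, G j))‖
        ≤ ε * (‖G i‖ + (c i / ∑ j, c j) * ∑ j, ‖G j‖) := fun i => by
      rw [norm_neg, norm_smul, Real.norm_of_nonneg hε.le]
      refine mul_le_mul_of_nonneg_left ((norm_sub_le _ _).trans (add_le_add le_rfl ?_)) hε.le
      rw [norm_smul, Real.norm_of_nonneg (div_nonneg (hc i).le hcs)]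
      exact mul_le_mul_of_nonneg_left (norm_sum_le _ _) (div_nonneg (hc i).le hcs)
    refine (Finset.sum_le_sum fun i _ => h3 i).trans ?_
    rw [← Finset.mul_sum, Finset.sum_add_distrib, ← Finset.sum_mul, ← Finset.sum_div]
    have h4 : (∑ j, c j) / (∑ j, c j) ≤ 1 := div_self_le_one _
    have h5 : 0 ≤ ∑ j, ‖G j‖ := Finset.sum_nonneg fun j _ => norm_nonneg _
    have h6 := mul_le_mul_of_nonneg_right h4 h5
    have h7 := mul_le_mul_of_nonneg_left h6 hε.le
    linarith
  have h8 : b₀ * ρ₀ * ∑ i, ‖(m i * c i) • u i‖ ≤ b₀ * (∑ i, m i * c i) * ∑ i, ‖(m i * c i) • u i‖ :=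
    mul_le_mul_of_nonneg_right (mul_le_mul_of_nonneg_left hs hb₀.le)
      (Finset.sum_nonneg fun j _ => norm_nonneg _)
  rw [div_mul_eq_mul_div, le_div_iff₀' (by positivity)]
  exact h8.trans (h1.trans h2)

end FluxBounds

/-! ### The friction matrix -/

namespace Mixture

variable {n : ℕ} (D : Mixture n)

/-- The friction coefficients at a state, completed by the value `b₀` on the diagonal. -/
def friction (b₀ : ℝ) (s : State n) (i j : Fin n) : ℝ :=
  if i = j then b₀ else D.b i j (s.1 i) (s.1 j) s.2

theorem friction_of_ne (b₀ : ℝ) (s : State n) {i j : Fin n} (h : i ≠ j) :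
    D.friction b₀ s i j = D.b i j (s.1 i) (s.1 j) s.2 := if_neg h

theorem friction_symm (b₀ : ℝ) {s : State n} (hs : s ∈ positiveCone n) (i j : Fin n) :
    D.friction b₀ s i j = D.friction b₀ s j i := by
  by_cases h : i = j
  · rw [h]
  · rw [D.friction_of_ne b₀ s h, D.friction_of_ne b₀ s (Ne.symm h),
      D.b_symm i j h _ _ _ (hs.1 i).le (hs.1 j).le hs.2]

/-- The compact box of densities and temperatures in `[0, R]` with temperature at least `1/R`. -/
def stateBox (n : ℕ) (R : ℝ) : Set (State n) := {s | (∀ i, s.1 i ∈ Icc 0 R) ∧ s.2 ∈ Icc R⁻¹ R}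

theorem exists_friction_bounds (hb : ∀ i j, i ≠ j → ∀ R : ℝ, 0 < R → ∃ L : ℝ≥0,
      LipschitzOnWith L (fun y : ℝ × ℝ × ℝ => D.b i j y.1 y.2.1 y.2.2)
        (Set.Icc 0 R ×ˢ Set.Icc 0 R ×ˢ Set.Icc R⁻¹ R)) {R : ℝ} (hR : 1 ≤ R) :
    ∃ b₀ b₁ L : ℝ, 0 < b₀ ∧ b₀ ≤ b₁ ∧ 0 ≤ L ∧ ∀ s ∈ stateBox n R, ∀ i j,
      b₀ ≤ D.friction b₀ s i j ∧ D.friction b₀ s i j ≤ b₁ ∧ ∀ s' ∈ stateBox n R,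
        |D.friction b₀ s i j - D.friction b₀ s' i j|
          ≤ L * (∑ k, |s.1 k - s'.1 k| + |s.2 - s'.2|) := by
  obtain ⟨b₀, b₁, L, h0, h1, hL, h⟩ := D.exists_b_bounds hb hR
  refine ⟨b₀, b₁, L, h0, h1, hL, fun s hs i j => ?_⟩
  by_cases hij : i = j
  · simp only [friction, hij, if_true, sub_self, abs_zero]
    refine ⟨le_rfl, h1, fun s' _ => mul_nonneg hL ?_⟩
    exact add_nonneg (Finset.sum_nonneg fun k _ => abs_nonneg _) (abs_nonneg _)
  · have hmem : ∀ s ∈ stateBox n R, ((s.1 i, s.1 j, s.2) : ℝ × ℝ × ℝ) ∈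
        Set.Icc 0 R ×ˢ Set.Icc 0 R ×ˢ Set.Icc R⁻¹ R := fun s hs => ⟨hs.1 i, hs.1 j, hs.2⟩
    obtain ⟨e1, e2, e3⟩ := h i j hij _ (hmem s hs)
    simp only [D.friction_of_ne b₀ _ hij]
    refine ⟨e1, e2, fun s' hs' => (e3 _ (hmem s' hs')).trans (mul_le_mul_of_nonneg_left ?_ hL)⟩
    have hk : ∀ k, |s.1 k - s'.1 k| ≤ ∑ k, |s.1 k - s'.1 k| := fun k =>
      Finset.single_le_sum (f := fun k => |s.1 k - s'.1 k|) (fun k _ => abs_nonneg _)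
        (Finset.mem_univ k)
    rw [Prod.dist_eq, Prod.dist_eq, Real.dist_eq, Real.dist_eq, Real.dist_eq]
    refine max_le ?_ (max_le ?_ ?_)
    · linarith [hk i, abs_nonneg (s.2 - s'.2)]
    · linarith [hk j, abs_nonneg (s.2 - s'.2)]
    · linarith [(abs_nonneg _).trans (hk i)]

end Mixture

/-! ### Bounds along the solutions -/

section AlongSolutions

variable {n : ℕ} {D : Mixture n} {Ω : Set Space} {T : ℝ} {U0 Ub0 : Space → State n}
  {U Ub : ℝ × Space → State n} {G Gb : ℝ × Space → StateGrad n} {u ub : ℝ × Space → Fin n → Space}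
  {δ M : ℝ} {q : ℝ → ℝ}

theorem Mixture.friction_relations {b₀ : ℝ} {s : State n} (hs : s ∈ positiveCone n)
    {g : StateGrad n} {v : Fin n → Space}
    (hp : chainGrad D.totalPressure s g = 0) (h : D.MaxwellStefanRelations s g v) (i : Fin n) :
    D.ε • ((D.m i)⁻¹ • g.1 i
      - ((s.1 i / D.m i) / ∑ j, s.1 j / D.m j) • ∑ j, (D.m j)⁻¹ • g.1 j)
      = -∑ j, (D.friction b₀ s i j * (D.m i * (s.1 i / D.m i)) * (D.m j * (s.1 j / D.m j)))
        • (v i - v j) := by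
  rw [D.relations_concentration hs hp h (β := D.friction b₀ s)
    (fun i j hij => D.friction_of_ne b₀ s hij) i]
  simp only [mul_div_cancel₀ _ (D.m_pos _).ne']

theorem Mixture.sum_norm_massFlux_le {b₀ ρ₀ : ℝ} (hb₀ : 0 < b₀) (hρ₀ : 0 < ρ₀) {s : State n}
    (hs : s ∈ positiveCone n) (hρ : ρ₀ ≤ totalMass s) (hβ : ∀ i j, b₀ ≤ D.friction b₀ s i j)
    {g : StateGrad n} {v : Fin n → Space}
    (hp : chainGrad D.totalPressure s g = 0) (h : D.MaxwellStefanRelations s g v) :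
    ∑ i, ‖massFlux i s v‖ ≤ 2 * D.ε / (b₀ * ρ₀) * ∑ i, ‖(D.m i)⁻¹ • g.1 i‖ := by
  have := sum_norm_flux_le_of_relations D.ε_pos hb₀ hρ₀ D.m_pos
    (fun i => div_pos (hs.1 i) (D.m_pos i))
    (by simpa only [mul_div_cancel₀ _ (D.m_pos _).ne', totalMass] using hρ) (D.friction_symm b₀ hs) hβ
    (fun i => D.friction_relations hs hp h i)
    (by simpa only [mul_div_cancel₀ _ (D.m_pos _).ne'] using h.2)
  simpa only [mul_div_cancel₀ _ (D.m_pos _).ne', massFlux] using this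

/-- The definition provides fluxes in L¹ only. The pointwise inversion of the relations bounds them
by the density gradients, which are in L². -/
theorem IsWeakSolutionWith.memLp_massFlux (h : IsWeakSolutionWith D Ω T U0 U G u) {τ : ℝ}
    (hτ : τ ∈ Ioo 0 T) {b₀ ρ₀ R : ℝ} (hb₀ : 0 < b₀) (hρ₀ : 0 < ρ₀)
    (hβ : ∀ s ∈ Mixture.stateBox n R, ∀ i j, b₀ ≤ D.friction b₀ s i j)
    (hR : ∀ᵐ z ∂cylMeasure Ω τ, U z ∈ Mixture.stateBox n R)
    (hρ : ∀ᵐ z ∂cylMeasure Ω T, ρ₀ ≤ totalMass (U z)) (i : Fin n) :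
    MemLp (fun z => massFlux i (U z) (u z)) 2 (cylMeasure Ω τ) := by
  have h1 : MemLp (fun z => ∑ i, ‖(D.m i)⁻¹ • (G z).1 i‖) 2 (cylMeasure Ω τ) :=
    memLp_finsetSum _ fun j _ => (((h.density_L2H1 j).2 τ hτ).2.const_smul (D.m j)⁻¹).norm
  refine (h1.const_mul (2 * D.ε / (b₀ * ρ₀))).mono (h.massFlux_integrable i τ hτ).1 ?_
  filter_upwards [IsComparable.cyl_mono h.pos hτ, hR, IsComparable.cyl_mono hρ hτ,
    IsComparable.cyl_mono h.momentum hτ, IsComparable.cyl_mono h.relations hτ] with z e1 e2 e3 e4 e5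
  refine ((Finset.single_le_sum (f := fun i => ‖massFlux i (U z) (u z)‖)
    (fun j _ => norm_nonneg _) (Finset.mem_univ i)).trans
    (D.sum_norm_massFlux_le hb₀ hρ₀ e1 e3 (hβ _ e2) e4 e5)).trans (le_abs_self _)

namespace IsComparable

theorem exists_stateBox (S : IsComparable D Ω T U0 Ub0 U Ub G Gb u ub δ M q)
    {τ : ℝ} (hτ : τ ∈ Ioo 0 T) :
    ∃ R, 1 ≤ R ∧ ∀ᵐ z ∂cylMeasure Ω τ, U z ∈ Mixture.stateBox n R ∧ Ub z ∈ Mixture.stateBox n R := by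
  set ϑ := n * δ * δ / D.massSum / D.concentrationBound M with hϑ
  have hϑ0 : 0 < ϑ := div_pos (div_pos (mul_pos S.card_mul_pos S.δ_pos) (D.massSum_pos S.card_pos))
    (D.concentrationBound_pos S.card_pos S.M_pos)
  have hM := S.M_pos
  have hδ := S.δ_pos
  have h1 : 0 < ϑ⁻¹ := inv_pos.2 hϑ0
  have h2 : 0 < δ⁻¹ := inv_pos.2 hδ
  refine ⟨1 + M + ϑ⁻¹ + δ⁻¹, by linarith, ?_⟩
  have h3 : (1 + M + ϑ⁻¹ + δ⁻¹)⁻¹ ≤ ϑ := inv_le_of_inv_le₀ hϑ0 (by linarith)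
  have h4 : (1 + M + ϑ⁻¹ + δ⁻¹)⁻¹ ≤ δ := inv_le_of_inv_le₀ hδ (by linarith)
  filter_upwards [S.le_temperature hτ, cyl_mono S.weak_le hτ, cyl_mono S.strong_le hτ,
    cyl_mono S.weak.pos hτ, cyl_mono S.le_strong hτ] with z e1 e2 e3 e4 e5
  exact ⟨⟨fun i => ⟨(e4.1 i).le, by linarith [e2.1 i]⟩, h3.trans e1, by linarith [e2.2]⟩,
    fun i => ⟨by linarith [e5.1 i], by linarith [e3.1 i]⟩, h4.trans e5.2, by linarith [e3.2]⟩

/-- The fluxes of the strong solution are bounded by its gradients; dividing by densities and total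
concentration that are bounded below turns this into a multiple of the majorant q. -/
theorem exists_velocity_bound (S : IsComparable D Ω T U0 Ub0 U Ub G Gb u ub δ M q)
    {τ : ℝ} (hτ : τ ∈ Ioo 0 T) {b₀ R : ℝ} (hb₀ : 0 < b₀)
    (hβ : ∀ s ∈ Mixture.stateBox n R, ∀ i j, b₀ ≤ D.friction b₀ s i j)
    (hR : ∀ᵐ z ∂cylMeasure Ω τ, Ub z ∈ Mixture.stateBox n R) :
    ∃ C, 0 ≤ C ∧ ∀ᵐ z ∂cylMeasure Ω τ, ∀ i, ‖ub z i‖ ≤ C * q z.1 ∧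
      ‖((Ub z).1 i / D.m i)⁻¹ • (D.m i)⁻¹ • (Gb z).1 i
        - (∑ j, (Ub z).1 j / D.m j)⁻¹ • ∑ j, (D.m j)⁻¹ • (Gb z).1 j‖ ≤ C * q z.1 := by
  have hδ := S.δ_pos
  have hnδ := S.card_mul_pos
  have hm := D.massSum_pos S.card_pos
  have hε := D.ε_pos
  set k := ∑ i, (D.m i)⁻¹ with hk
  have hk0 : 0 ≤ k := Finset.sum_nonneg fun i _ => (inv_pos.2 (D.m_pos i)).le
  set C₁ := 2 * D.ε / (b₀ * (n * δ)) * k / δ with hC₁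
  set C₂ := δ⁻¹ + (n * δ / D.massSum)⁻¹ * k with hC₂
  have hC₁0 : 0 ≤ C₁ := by positivity
  have hC₂0 : 0 ≤ C₂ := by positivity
  refine ⟨C₁ + C₂, by positivity, ?_⟩
  filter_upwards [hR, cyl_mono S.strong.pos hτ, cyl_mono S.le_strong hτ,
    cyl_mono S.le_totalMass_strong hτ, cyl_mono S.strong.momentum hτ,
    cyl_mono S.strong.relations hτ, cyl_mono S.grad_le hτ, cyl_mono S.le_concentration_strong hτ]
    with z e1 e2 e3 e4 e5 e6 e7 e8 i
  have hq : 0 ≤ q z.1 := (norm_nonneg _).trans e7.2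
  have hG : ∑ j, ‖(D.m j)⁻¹ • (Gb z).1 j‖ ≤ k * q z.1 := by
    rw [hk, Finset.sum_mul]
    refine Finset.sum_le_sum fun j _ => ?_
    rw [norm_smul, Real.norm_of_nonneg (inv_pos.2 (D.m_pos j)).le]
    exact mul_le_mul_of_nonneg_left (e7.1 j) (inv_pos.2 (D.m_pos j)).le
  constructor
  · have h1 := D.sum_norm_massFlux_le hb₀ hnδ e2 e4 (hβ _ e1) e5 e6
    have h2 : ‖massFlux i (Ub z) (ub z)‖ ≤ 2 * D.ε / (b₀ * (n * δ)) * (k * q z.1) :=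
      ((Finset.single_le_sum (f := fun i => ‖massFlux i (Ub z) (ub z)‖)
        (fun j _ => norm_nonneg _) (Finset.mem_univ i)).trans h1).trans
        (mul_le_mul_of_nonneg_left hG (by positivity))
    rw [massFlux, norm_smul, Real.norm_of_nonneg (e2.1 i).le] at h2
    have h3 : δ * ‖ub z i‖ ≤ 2 * D.ε / (b₀ * (n * δ)) * (k * q z.1) :=
      (mul_le_mul_of_nonneg_right (e3.1 i) (norm_nonneg _)).trans h2
    have h4 : ‖ub z i‖ ≤ C₁ * q z.1 := by
      rw [hC₁, div_mul_eq_mul_div, le_div_iff₀' hδ]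
      linarith
    have h5 := mul_nonneg hC₂0 hq
    linarith
  · have h1 : ‖((Ub z).1 i / D.m i)⁻¹ • (D.m i)⁻¹ • (Gb z).1 i‖ ≤ δ⁻¹ * q z.1 := by
      rw [smul_smul, inv_div, div_mul_eq_mul_div, mul_inv_cancel₀ (D.m_pos i).ne', one_div,
        norm_smul, Real.norm_of_nonneg (inv_pos.2 (e2.1 i)).le]
      exact mul_le_mul (inv_anti₀ hδ (e3.1 i)) (e7.1 i) (norm_nonneg _) (inv_pos.2 hδ).le
    have h2 : ‖(∑ j, (Ub z).1 j / D.m j)⁻¹ • ∑ j, (D.m j)⁻¹ • (Gb z).1 j‖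
        ≤ (n * δ / D.massSum)⁻¹ * (k * q z.1) := by
      have h3 : 0 < n * δ / D.massSum := div_pos hnδ hm
      rw [Mixture.concentration] at e8
      rw [norm_smul, Real.norm_of_nonneg (inv_pos.2 (h3.trans_le e8)).le]
      exact mul_le_mul (inv_anti₀ h3 e8) ((norm_sum_le _ _).trans hG) (norm_nonneg _)
        (inv_pos.2 h3).le
    have h5 := mul_nonneg hC₁0 hq
    refine (norm_sub_le _ _).trans ((add_le_add h1 h2).trans ?_)
    rw [hC₂]
    linarith

/-- The initial values of the concentrations lie within the bounds, up to a null set. -/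
theorem exists_initial_concentration (S : IsComparable D Ω T U0 Ub0 U Ub G Gb u ub δ M q) :
    ∃ f₀ : Fin n → Space → ℝ, (∀ i, Measurable (f₀ i)) ∧
      (∀ i x, f₀ i x ∈ Icc (δ / D.massSum) (D.concentrationBound M)) ∧
      ∀ i, (fun x => (D.m i)⁻¹ * (volume.real Ω * (Ub0 x).1 i)) =ᵐ[volume.restrict Ω] f₀ i := by
  have hb := S.domain.isBounded
  have ho := S.domain.isOpen
  have hδ := S.δ_pos
  -- The factor |Ω| is the one produced by `WeakBalance.of_test`. The bounds hold for the scaled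
  -- value because it is the weak limit of the concentrations as time tends to zero.
  set f : Fin n → Space → ℝ := fun i x => (D.m i)⁻¹ * (volume.real Ω * (Ub0 x).1 i) with hf
  have hfi : ∀ i, IntegrableOn (f i) Ω := fun i =>
    ((S.strong.integrableOn_init hb i).const_mul _).const_mul _
  have hB : ∀ i, WeakBalance Ω T (f i) (fun z => (D.m i)⁻¹ * (Ub z).1 i)
      (fun z => (D.m i)⁻¹ • massFlux i (Ub z) (ub z)) := fun i =>
    (S.strong.weakBalance_density S.domain i).const_mul _
  have hlow : ∀ i, ∀ᵐ x ∂volume.restrict Ω, δ / D.massSum ≤ f i x := fun i =>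
    (hB i).le_init ho hb S.time_pos (hfi i) <| S.le_strong.mono fun z hz => by
      rw [div_eq_inv_mul]
      exact mul_le_mul (inv_anti₀ (D.m_pos i) (D.m_le_massSum i)) (hz.1 i) hδ.le
        (inv_pos.2 (D.m_pos i)).le
  have hup : ∀ i, ∀ᵐ x ∂volume.restrict Ω, f i x ≤ D.concentrationBound M := fun i => by
    have := ((hB i).const_mul (-1)).le_init ho hb S.time_pos ((hfi i).const_mul (-1))
      (d := -D.concentrationBound M) <| S.strong_le.mono fun z hz => by
        have := D.div_le_concentrationBound i S.M_pos (hz.1 i)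
        rw [div_eq_inv_mul] at this
        linarith
    exact this.mono fun x hx => by linarith
  have hle : δ / D.massSum ≤ D.concentrationBound M := by
    have : (ae (volume.restrict Ω)).NeBot := by
      rw [ae_restrict_neBot]
      exact (S.domain.isOpen.measure_pos volume S.domain.isConnected.nonempty).ne'
    obtain ⟨x, hx1, hx2⟩ := ((hlow ⟨0, S.card_pos⟩).and (hup ⟨0, S.card_pos⟩)).exists
    exact hx1.trans hx2
  -- Truncating a measurable representative makes the bounds hold at every point without changing it
  -- outside a null set.
  refine ⟨fun i x => max (δ / D.massSum) (min ((hfi i).1.mk _ x) (D.concentrationBound M)),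
    fun i => measurable_const.max ((hfi i).1.stronglyMeasurable_mk.measurable.min measurable_const),
    fun i x => ⟨le_max_left _ _, max_le hle (min_le_right _ _)⟩, fun i => ?_⟩
  filter_upwards [hlow i, hup i, (hfi i).1.ae_eq_mk] with x e1 e2 e3
  rw [← e3, min_eq_left e2, max_eq_right e1]

end IsComparable

end AlongSolutions

theorem SmoothApprox.const_mul {Ω : Set Space} {τ : ℝ} {w : ℝ × Space → ℝ}
    {W : ℝ × Space → Space} (h : SmoothApprox Ω τ w W) (r : ℝ) :
    SmoothApprox Ω τ (fun z => r * w z) (fun z => r • W z) := by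
  obtain ⟨m1, m2, φ, hφ, c1, c2⟩ := h
  refine ⟨m1.const_mul r, m2.const_smul r, fun k z => r * φ k z, fun k => contDiff_const.mul (hφ k),
    ?_, ?_⟩
  · have h1 : ∀ k, eLpNorm ((fun z => r * φ k z) - fun z => r * w z) 2 (cylMeasure Ω τ)
        = ‖r‖ₑ * eLpNorm (φ k - w) 2 (cylMeasure Ω τ) := fun k => by
      rw [← eLpNorm_const_smul]
      congr 1
      ext z
      simp only [Pi.sub_apply, Pi.smul_apply, smul_eq_mul]
      ring
    simp only [h1]
    simpa using ENNReal.Tendsto.const_mul c1 (Or.inr enorm_ne_top)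
  · have h1 : ∀ k, eLpNorm (spaceGrad (fun z => r * φ k z) - fun z => r • W z) 2 (cylMeasure Ω τ)
        = ‖r‖ₑ * eLpNorm (spaceGrad (φ k) - W) 2 (cylMeasure Ω τ) := fun k => by
      rw [← eLpNorm_const_smul]
      congr 1
      ext1 z
      have : spaceGrad (fun z => r * φ k z) z = r • spaceGrad (φ k) z := by
        rw [spaceGrad, fderiv_const_mul ((hφ k).differentiable (by simp) z),
          ContinuousLinearMap.smul_comp, map_smul]
        rfl
      simp only [Pi.sub_apply, Pi.smul_apply, this, smul_sub]
    simp only [h1]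
    simpa using ENNReal.Tendsto.const_mul c2 (Or.inr enorm_ne_top)

/-! ### Entropy production along the two solutions. -/

section AlongSolutions

variable {n : ℕ} {D : Mixture n} {Ω : Set Space} {T : ℝ} {U0 Ub0 : Space → State n}
  {U Ub : ℝ × Space → State n} {G Gb : ℝ × Space → StateGrad n} {u ub : ℝ × Space → Fin n → Space}
  {δ M : ℝ} {q : ℝ → ℝ}

/-- The sum of the distances of the components of two states. -/
def stateDist {n : ℕ} (s s' : State n) : ℝ := ∑ k, |s.1 k - s'.1 k| + |s.2 - s'.2|

namespace IsComparable

/-- The total mass densities agree almost everywhere, and weak gradients are unique. -/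
theorem sum_grad_eq (S : IsComparable D Ω T U0 Ub0 U Ub G Gb u ub δ M q) {τ : ℝ}
    (hτ : τ ∈ Ioo 0 T) :
    ∀ᵐ z ∂cylMeasure Ω τ, ∑ i, (G z).1 i = ∑ i, (Gb z).1 i := by
  have ho := S.domain.isOpen
  have hb := S.domain.isBounded
  exact HasWeakGrad.ae_eq ho
    (SmoothApprox.hasWeakGrad ho hb (SmoothApprox.sum Finset.univ fun i _ =>
      (S.weak.density_L2H1 i).smoothApprox S.domain hτ))
    (SmoothApprox.hasWeakGrad ho hb (SmoothApprox.sum Finset.univ fun i _ =>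
      (S.strong.density_L2H1 i).smoothApprox S.domain hτ))
    (cyl_mono S.totalMass_eq_cyl hτ)

/-- The relative entropy production is controlled by the distance of the states. -/
theorem exists_production_bound (S : IsComparable D Ω T U0 Ub0 U Ub G Gb u ub δ M q) {τ : ℝ}
    (hτ : τ ∈ Ioo 0 T) {b₀ b₁ L R : ℝ} (hb₀ : 0 < b₀) (hb₁ : b₀ ≤ b₁) (hL : 0 ≤ L)
    (hβ : ∀ s ∈ Mixture.stateBox n R, ∀ i j,
      b₀ ≤ D.friction b₀ s i j ∧ D.friction b₀ s i j ≤ b₁ ∧ ∀ s' ∈ Mixture.stateBox n R,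
        |D.friction b₀ s i j - D.friction b₀ s' i j| ≤ L * stateDist s s')
    (hR : ∀ᵐ z ∂cylMeasure Ω τ, U z ∈ Mixture.stateBox n R ∧ Ub z ∈ Mixture.stateBox n R) :
    ∃ K, 0 ≤ K ∧ ∀ᵐ z ∂cylMeasure Ω τ,
      (∑ i, ((U z).1 i / D.m i)⁻¹
        * inner ℝ (((U z).1 i / D.m i) • u z i) ((D.m i)⁻¹ • (G z).1 i))
      + regularProduction (Sum.elim (fun i => (U z).1 i / D.m i) fun i => (Ub z).1 i / D.m i)
          (Sum.elim (fun i => ((U z).1 i / D.m i) • u z i) fun i => ((Ub z).1 i / D.m i) • ub z i)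
          (Sum.elim (fun i => (D.m i)⁻¹ • (G z).1 i) fun i => (D.m i)⁻¹ • (Gb z).1 i)
        ≤ K * (q z.1 * stateDist (U z) (Ub z)) ^ 2 := by
  have hnδ := S.card_mul_pos
  have hn : (Finset.univ : Finset (Fin n)).Nonempty := ⟨⟨0, S.card_pos⟩, Finset.mem_univ _⟩
  obtain ⟨i₀, -, hi₀⟩ := Finset.exists_min_image Finset.univ D.m hn
  obtain ⟨C, hC0, hC⟩ := S.exists_velocity_bound hτ hb₀ (fun s hs i j => (hβ s hs i j).1)
    (hR.mono fun z hz => hz.2)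
  obtain ⟨K, hK0, hK⟩ := exists_relative_flux_bound (Fin n) Space (b₀ := b₀) (b₁ := b₁) (m₁ := D.massSum)
    D.ε_pos hb₀ hL S.M_pos.le (D.m_pos i₀) hnδ (hb₀.le.trans hb₁)
  refine ⟨K * C ^ 2, by positivity, ?_⟩
  filter_upwards [hR, hC, cyl_mono S.weak.pos hτ, cyl_mono S.strong.pos hτ, cyl_mono S.weak_le hτ,
    cyl_mono S.totalMass_eq_cyl hτ, cyl_mono S.le_totalMass_weak hτ, S.sum_grad_eq hτ,
    cyl_mono S.weak.momentum hτ, cyl_mono S.strong.momentum hτ,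
    cyl_mono S.weak.relations hτ, cyl_mono S.strong.relations hτ]
    with z e1 e2 e3 e4 e5 e6 e7 e8 e9 e10 e11 e12
  have hmc : ∀ (r : ℝ) i, D.m i * (r / D.m i) = r := fun r i => mul_div_cancel₀ _ (D.m_pos i).ne'
  have hc : ∀ i, 0 < (U z).1 i / D.m i := fun i => div_pos (e3.1 i) (D.m_pos i)
  have hW : 0 ≤ stateDist (U z) (Ub z) :=
    add_nonneg (Finset.sum_nonneg fun k _ => abs_nonneg _) (abs_nonneg _)
  have key := hK D.m (fun i => (U z).1 i / D.m i) (fun i => (Ub z).1 i / D.m i)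
    (D.friction b₀ (U z)) (D.friction b₀ (Ub z)) (fun i => (D.m i)⁻¹ • (G z).1 i)
    (fun i => (D.m i)⁻¹ • (Gb z).1 i) (u z) (ub z) (C * q z.1) (stateDist (U z) (Ub z))
    (fun i => hi₀ i (Finset.mem_univ i)) D.m_le_massSum hc
    (fun i => by simpa only [hmc] using e5.1 i) (fun i => div_pos (e4.1 i) (D.m_pos i))
    (by simpa only [hmc, totalMass] using e6) (by simpa only [hmc, totalMass] using e7)
    (by simpa only [smul_inv_smul₀ (D.m_pos _).ne'] using e8)
    (D.friction_symm b₀ e3) (fun i j => (hβ _ e1.1 i j).1) (fun i j => (hβ _ e1.1 i j).2.1)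
    (fun i j => by
      rw [abs_of_nonneg (hb₀.le.trans (hβ _ e1.2 i j).1)]
      exact (hβ _ e1.2 i j).2.1)
    (fun i j => (hβ _ e1.1 i j).2.2 _ e1.2)
    (D.friction_relations e3 e9 e11) (D.friction_relations e4 e10 e12)
    (by simpa only [hmc] using e11.2) (by simpa only [hmc] using e12.2)
    (fun i => (e2 i).1) (fun i => (e2 i).2) hW
    (by simpa only [hmc, stateDist] using le_add_of_nonneg_right (abs_nonneg _))
  refine (le_of_eq ?_).trans (key.trans (le_of_eq (by ring)))
  simp only [regularProduction, Sum.elim_inl, Sum.elim_inr]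
  rw [← add_assoc, ← Finset.sum_add_distrib]
  congr 1
  refine Finset.sum_congr rfl fun i _ => ?_
  rw [← real_inner_smul_right, ← inner_add_right]
  congr 1
  abel

/-- The singular part of the relative entropy production is integrably bounded from above. -/
theorem inv_add_mul_inner_le (S : IsComparable D Ω T U0 Ub0 U Ub G Gb u ub δ M q) {τ : ℝ}
    (hτ : τ ∈ Ioo 0 T) {b₀ b₁ R : ℝ} (hb₀ : 0 < b₀)
    (hβ : ∀ s ∈ Mixture.stateBox n R, ∀ i j,
      b₀ ≤ D.friction b₀ s i j ∧ D.friction b₀ s i j ≤ b₁)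
    (hR : ∀ᵐ z ∂cylMeasure Ω τ, U z ∈ Mixture.stateBox n R) :
    ∃ H : ℝ × Space → ℝ, Integrable H (cylMeasure Ω τ) ∧
      ∀ᵐ z ∂cylMeasure Ω τ, ∀ i, ∀ η : ℝ, 0 < η → ((U z).1 i / D.m i + η)⁻¹
        * inner ℝ (((U z).1 i / D.m i) • u z i) ((D.m i)⁻¹ • (G z).1 i) ≤ H z := by
  have hnδ := S.card_mul_pos
  have hc₀ : 0 < n * δ / D.massSum := div_pos hnδ (D.massSum_pos S.card_pos)
  have hF : ∀ i, MemLp (fun z => ((U z).1 i / D.m i) • u z i) 2 (cylMeasure Ω τ) := fun i => by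
    have := (S.weak.memLp_massFlux hτ hb₀ hnδ (fun s hs i j => (hβ s hs i j).1) hR
      S.le_totalMass_weak i).const_smul (D.m i)⁻¹
    refine (memLp_congr_ae (Eventually.of_forall fun z => ?_)).1 this
    simp only [Pi.smul_apply, massFlux, smul_smul, div_eq_inv_mul]
  have hG : ∀ i, MemLp (fun z => (D.m i)⁻¹ • (G z).1 i) 2 (cylMeasure Ω τ) := fun i =>
    ((S.weak.density_L2H1 i).2 τ hτ).2.const_smul (D.m i)⁻¹
  have h1 : MemLp (fun z => ∑ j, ‖((U z).1 j / D.m j) • u z j‖) 2 (cylMeasure Ω τ) :=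
    memLp_finsetSum _ fun j _ => (hF j).norm
  have h2 : MemLp (fun z => ∑ j, ‖(D.m j)⁻¹ • (G z).1 j‖) 2 (cylMeasure Ω τ) :=
    memLp_finsetSum _ fun j _ => (hG j).norm
  refine ⟨_, h1.integrable_mul ((h2.const_mul (n * δ / D.massSum)⁻¹).add
    (h1.const_mul (D.ε⁻¹ * (b₁ * D.massSum ^ 2)))), ?_⟩
  filter_upwards [hR, cyl_mono S.weak.pos hτ, cyl_mono S.le_concentration_weak hτ,
    cyl_mono S.weak.momentum hτ, cyl_mono S.weak.relations hτ] with z e1 e3 e4 e5 e6 i η hη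
  exact inv_add_mul_inner_flux_le D.ε_pos hc₀ hη D.m_pos D.m_le_massSum
    (fun i => div_pos (e3.1 i) (D.m_pos i)) e4 (fun i j => hb₀.le.trans (hβ _ e1 i j).1)
    (fun i j => (hβ _ e1 i j).2) (D.friction_relations e3 e5 e6) i

end IsComparable

end AlongSolutions

/-! ### The relative entropy estimate -/

theorem integrable_relEntropy_slice {ι : Type*} [Fintype ι] [DecidableEq ι] {Ω : Set Space}
    (hb : Bornology.IsBounded Ω) {d M c₀ : ℝ} (hd : 0 < d) (hc₀ : 0 < c₀)
    {f : ι ⊕ ι → ℝ × Space → ℝ} (hfm : ∀ b, Measurable (f b))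
    (hf : ∀ z, (fun b => f b z) ∈ concentrationBox ι d M c₀) (t : ℝ) :
    IntegrableOn (fun x => relEntropy 0 fun b => f b (t, x)) Ω := by
  have hcomp : IsCompact (concentrationBox ι d M c₀) := isCompact_concentrationBox
  have hcont : ContinuousOn (relEntropy (ι := ι) 0) (concentrationBox ι d M c₀) :=
    (continuousOn_relEntropy (ι := ι) (M := M) hd hc₀).comp
      (f := fun y : ι ⊕ ι → ℝ => ((0 : ℝ), y)) (by fun_prop) fun y hy => ⟨mem_univ _, hy⟩
  obtain ⟨C, hC⟩ := hcomp.exists_bound_of_continuousOn hcont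
  have hm : Measurable fun z => relEntropy 0 fun b => f b z := by
    unfold relEntropy
    fun_prop
  exact integrable_slice hb hm (fun z => hC _ (hf z)) t

section AlongSolutions

variable {n : ℕ} {D : Mixture n} {Ω : Set Space} {T : ℝ} {U0 Ub0 : Space → State n}
  {U Ub : ℝ × Space → State n} {G Gb : ℝ × Space → StateGrad n} {u ub : ℝ × Space → Fin n → Space}
  {δ M : ℝ} {q : ℝ → ℝ}

theorem stateDist_nonneg (s s' : State n) : 0 ≤ stateDist s s' :=
  add_nonneg (Finset.sum_nonneg fun _ _ => abs_nonneg _) (abs_nonneg _)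

namespace IsComparable

theorem stateDist_le (S : IsComparable D Ω T U0 Ub0 U Ub G Gb u ub δ M q) :
    ∀ᵐ z ∂cylMeasure Ω T, stateDist (U z) (Ub z) ≤ (n + 1) * M := by
  filter_upwards [S.weak.pos, S.strong.pos, S.weak_le, S.strong_le] with z e1 e2 e3 e4
  have h1 : ∑ k, |(U z).1 k - (Ub z).1 k| ≤ n * M := by
    have := Finset.sum_le_card_nsmul Finset.univ (fun k => |(U z).1 k - (Ub z).1 k|) M fun k _ => by
      rw [abs_le]
      constructor <;> linarith [e1.1 k, e2.1 k, e3.1 k, e4.1 k]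
    simpa using this
  have h2 : |(U z).2 - (Ub z).2| ≤ M := by
    rw [abs_le]
    constructor <;> linarith [e1.2, e2.2, e3.2, e4.2]
  rw [stateDist]
  linarith

theorem aestronglyMeasurable_stateDist (S : IsComparable D Ω T U0 Ub0 U Ub G Gb u ub δ M q) {τ : ℝ}
    (hτ : τ ∈ Ioo 0 T) :
    AEStronglyMeasurable (fun z => stateDist (U z) (Ub z)) (cylMeasure Ω τ) :=
  (Finset.aestronglyMeasurable_fun_sum _ fun i _ =>
    ((S.weak.density_bounded i τ hτ).1.sub (S.strong.density_bounded i τ hτ).1).norm).add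
    ((S.weak.temperature_L2H1.2 τ hτ).1.1.sub (S.strong.temperature_L2H1.2 τ hτ).1.1).norm

theorem integrable_majorant_mul_stateDist_sq
    (S : IsComparable D Ω T U0 Ub0 U Ub G Gb u ub δ M q) {τ : ℝ} (hτ : τ ∈ Ioo 0 T) :
    Integrable (fun z => (q z.1 * stateDist (U z) (Ub z)) ^ 2) (cylMeasure Ω τ) := by
  have hfin := S.isFiniteMeasure
  have hq : MemLp (fun z : ℝ × Space => q z.1) 2 (cylMeasure Ω τ) := by
    rw [cylMeasure_eq_prod]
    exact (S.memLp_majorant τ hτ).comp_fst _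
  refine MemLp.integrable_sq ?_
  refine (hq.norm.const_mul ((n + 1) * M)).mono (hq.1.mul (S.aestronglyMeasurable_stateDist hτ)) ?_
  filter_upwards [cyl_mono S.stateDist_le hτ] with z hz
  rw [norm_mul, Real.norm_of_nonneg (stateDist_nonneg _ _), mul_comm]
  exact (mul_le_mul_of_nonneg_right hz (norm_nonneg _)).trans (le_abs_self _)

/-- Coercivity bounds the distance of the densities by the relative entropy; the entropy inequality
with the production bound then bounds it by the accumulated distance of the states. Concentrations
and fluxes are first replaced by representatives with values in the entropy's compact box. -/
theorem exists_distance_bound (S : IsComparable D Ω T U0 Ub0 U Ub G Gb u ub δ M q)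
    (hb : ∀ i j, i ≠ j → ∀ R : ℝ, 0 < R → ∃ L : ℝ≥0,
      LipschitzOnWith L (fun y : ℝ × ℝ × ℝ => D.b i j y.1 y.2.1 y.2.2)
        (Set.Icc 0 R ×ˢ Set.Icc 0 R ×ˢ Set.Icc R⁻¹ R)) {τ : ℝ} (hτ : τ ∈ Ioo 0 T) :
    ∃ K, 0 ≤ K ∧ ∀ᵐ t : ℝ, t ∈ Ioo 0 τ →
      ∫ x in Ω, (∑ i, |(U (t, x)).1 i - (Ub (t, x)).1 i|) ^ 2
        ≤ K * ∫ z in cyl Ω t, (q z.1 * stateDist (U z) (Ub z)) ^ 2 := by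
  have ho := S.domain.isOpen
  have hbd := S.domain.isBounded
  have hnδ := S.card_mul_pos
  have hms := D.massSum_pos S.card_pos
  have hC := D.concentrationBound_pos S.card_pos S.M_pos
  set d := δ / D.massSum with hd
  set M' := D.concentrationBound M with hM'
  set c₀ := n * δ / D.massSum with hc₀
  have hd0 : 0 < d := div_pos S.δ_pos hms
  have hc₀0 : 0 < c₀ := div_pos hnδ hms
  obtain ⟨R, hR1, hR⟩ := S.exists_stateBox hτ
  obtain ⟨b₀, b₁, L, hb₀, hb₁, hL, hβ⟩ := D.exists_friction_bounds hb hR1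
  obtain ⟨K₁, hK₁0, hK₁⟩ := S.exists_production_bound hτ hb₀ hb₁ hL hβ hR
  obtain ⟨H, hHi, hH⟩ := S.inv_add_mul_inner_le hτ hb₀
    (fun s hs i j => ⟨(hβ s hs i j).1, (hβ s hs i j).2.1⟩) (hR.mono fun z hz => hz.1)
  obtain ⟨K₂, hK₂0, hK₂⟩ := exists_coercivity (ι := Fin n) (m₁ := D.massSum) hd0 hc₀0 hC.le hnδ
  obtain ⟨f₀, hf₀m, hf₀b, hf₀⟩ := S.exists_initial_concentration
  have hf₀s : ∀ x, c₀ ≤ ∑ i, f₀ i x := fun x => by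
    have := Finset.card_nsmul_le_sum Finset.univ (fun i => f₀ i x) d fun i _ => (hf₀b i x).1
    simp only [Finset.card_univ, Fintype.card_fin, nsmul_eq_mul] at this
    rwa [hc₀, mul_div_assoc]
  have hBU : ∀ i, WeakBalance Ω T (fun x => (D.m i)⁻¹ * (volume.real Ω * (U0 x).1 i))
      (fun z => (D.m i)⁻¹ * (U z).1 i) (fun z => (D.m i)⁻¹ • massFlux i (U z) (u z)) := fun i =>
    (S.weak.weakBalance_density S.domain i).const_mul _
  have hBV : ∀ i, WeakBalance Ω T (fun x => (D.m i)⁻¹ * (volume.real Ω * (Ub0 x).1 i))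
      (fun z => (D.m i)⁻¹ * (Ub z).1 i) (fun z => (D.m i)⁻¹ • massFlux i (Ub z) (ub z)) := fun i =>
    (S.strong.weakBalance_density S.domain i).const_mul _
  have hSmeas : ∀ a : ℝ, MeasurableSet
      {y : Fin n → ℝ | (∀ i, y i ∈ Icc a M') ∧ c₀ ≤ ∑ i, y i} := fun a => by
    have h1 : IsClosed {y : Fin n → ℝ | ∀ i, y i ∈ Icc a M'} := by
      simp only [ofPred_forall]
      exact isClosed_iInter fun i => isClosed_Icc.preimage (continuous_apply i)
    have h2 : IsClosed {y : Fin n → ℝ | c₀ ≤ ∑ i, y i} := isClosed_le (by fun_prop) (by fun_prop)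
    exact (h1.inter h2).measurableSet
  have hSb : ∀ a : ℝ, 0 ≤ a → ∃ C, ∀ y ∈ {y : Fin n → ℝ | (∀ i, y i ∈ Icc a M') ∧ c₀ ≤ ∑ i, y i},
      ∀ i, |y i| ≤ C := fun a ha => ⟨M', fun y hy i => by
    rw [abs_of_nonneg (ha.trans (hy.1 i).1)]
    exact (hy.1 i).2⟩
  obtain ⟨f1, F1, hT1, hf1S, hf1, hF1⟩ := WeakBalance.exists_timeBalance ho hbd hτ hBU hf₀m
    (fun i => EventuallyEq.trans (S.init.mono fun x hx => by simp only [hx]) (hf₀ i))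
    (hSmeas 0) (hSb 0 le_rfl) (fun x => ⟨fun i => ⟨hd0.le.trans (hf₀b i x).1, (hf₀b i x).2⟩, hf₀s x⟩)
    (fun i => (S.weak.density_bounded i τ hτ).1.const_mul _)
    (by
      filter_upwards [cyl_mono S.weak.pos hτ, cyl_mono S.weak_le hτ,
        cyl_mono S.le_concentration_weak hτ] with z e1 e2 e3
      simp only [← div_eq_inv_mul]
      exact ⟨fun i => ⟨(div_pos (e1.1 i) (D.m_pos i)).le,
        D.div_le_concentrationBound i S.M_pos (e2.1 i)⟩, e3⟩)
    (fun i => (S.weak.memLp_massFlux hτ hb₀ hnδ (fun s hs i j => (hβ s hs i j).1)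
      (hR.mono fun z hz => hz.1) S.le_totalMass_weak i).const_smul (D.m i)⁻¹)
  obtain ⟨f2, F2, hT2, hf2S, hf2, hF2⟩ := WeakBalance.exists_timeBalance ho hbd hτ hBV hf₀m hf₀
    (hSmeas d) (hSb d hd0.le) (fun x => ⟨fun i => hf₀b i x, hf₀s x⟩)
    (fun i => (S.strong.density_bounded i τ hτ).1.const_mul _)
    (by
      filter_upwards [cyl_mono S.le_strong hτ, cyl_mono S.strong_le hτ,
        cyl_mono S.le_concentration_strong hτ] with z e1 e2 e3
      simp only [← div_eq_inv_mul]
      exact ⟨fun i => ⟨div_le_div₀ (S.δ_pos.le.trans (e1.1 i)) (e1.1 i) (D.m_pos i)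
        (D.m_le_massSum i), D.div_le_concentrationBound i S.M_pos (e2.1 i)⟩, e3⟩)
    (fun i => (S.strong.memLp_massFlux hτ hb₀ hnδ (fun s hs i j => (hβ s hs i j).1)
      (hR.mono fun z hz => hz.2) S.le_totalMass_strong i).const_smul (D.m i)⁻¹)
  set f : Fin n ⊕ Fin n → ℝ × Space → ℝ := Sum.elim f1 f2 with hf
  have hfe : ∀ᵐ z ∂cylMeasure Ω τ, (fun b => f b z)
      = Sum.elim (fun i => (U z).1 i / D.m i) fun i => (Ub z).1 i / D.m i := by
    filter_upwards [ae_all_iff.2 hf1, ae_all_iff.2 hf2] with z e1 e2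
    funext b
    rcases b with i | i
    · simp only [hf, Sum.elim_inl, e1, div_eq_inv_mul]
    · simp only [hf, Sum.elim_inr, e2, div_eq_inv_mul]
  have hFe : ∀ᵐ z ∂cylMeasure Ω τ, (fun b => (Sum.elim F1 F2 : _ → ℝ × Space → Space) b z)
      = Sum.elim (fun i => ((U z).1 i / D.m i) • u z i) fun i => ((Ub z).1 i / D.m i) • ub z i := by
    filter_upwards [ae_all_iff.2 hF1, ae_all_iff.2 hF2] with z e1 e2
    funext b
    rcases b with i | i
    · simp only [Sum.elim_inl, e1, div_eq_inv_mul, massFlux, smul_smul]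
    · simp only [Sum.elim_inr, e2, div_eq_inv_mul, massFlux, smul_smul]
  set Gs : Fin n ⊕ Fin n → ℝ × Space → Space := Sum.elim (fun i z => (D.m i)⁻¹ • (G z).1 i)
    fun i z => (D.m i)⁻¹ • (Gb z).1 i with hGs
  have hGe : ∀ z, (fun b => Gs b z)
      = Sum.elim (fun i => (D.m i)⁻¹ • (G z).1 i) fun i => (D.m i)⁻¹ • (Gb z).1 i := fun z => by
    funext b
    rcases b with i | i <;> rfl
  have hbox : ∀ z, (fun b => f b z) ∈ concentrationBox (Fin n) d M' c₀ := fun z =>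
    ⟨(hf1S z).1, (hf2S z).1, (hf1S z).2, (hf2S z).2⟩
  have hfm : ∀ b, Measurable (f b) := by
    rintro (i | i)
    · exact (hT1 i).measurable
    · exact (hT2 i).measurable
  have main := integral_relEntropy_le (f₀ := Sum.elim f₀ f₀) (f := f) (F := Sum.elim F1 F2)
    (G := Gs) (H := H) (B := fun z => K₁ * (q z.1 * stateDist (U z) (Ub z)) ^ 2) ho hbd hτ.1
    (by
      rintro (i | i)
      · exact hT1 i
      · exact hT2 i)
    (by
      rintro (i | i)
      · exact (((S.weak.density_L2H1 i).smoothApprox S.domain hτ).const_mul (D.m i)⁻¹).congr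
          (hf1 i).symm EventuallyEq.rfl
      · exact (((S.strong.density_L2H1 i).smoothApprox S.domain hτ).const_mul (D.m i)⁻¹).congr
          (hf2 i).symm EventuallyEq.rfl)
    (fun i => rfl) hd0 hc₀0 hbox
    (by
      filter_upwards [hfe, cyl_mono S.weak.pos hτ] with z e1 e2 i
      rw [congrFun e1 (Sum.inl i)]
      exact div_pos (e2.1 i) (D.m_pos i))
    hHi
    (by
      filter_upwards [hfe, hFe, hH] with z e1 e2 e3 i η hη
      rw [congrFun e1 (Sum.inl i), congrFun e2 (Sum.inl i)]
      exact e3 i η hη)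
    ((S.integrable_majorant_mul_stateDist_sq hτ).const_mul K₁)
    (by
      filter_upwards [hfe, hFe, hK₁] with z e1 e2 e3
      rw [e1, e2, hGe]
      refine le_trans (le_of_eq ?_) e3
      congr 1
      refine Finset.sum_congr rfl fun i _ => ?_
      rw [congrFun e1 (Sum.inl i), congrFun e2 (Sum.inl i)]
      rfl)
  refine ⟨K₂ * K₁, mul_nonneg hK₂0 hK₁0, ?_⟩
  filter_upwards [main, ae_slices hfe, ae_slices (cyl_mono S.totalMass_eq_cyl hτ),
    ae_slices (cyl_mono S.le_totalMass_strong hτ)] with t h1 h2 h3 h4 ht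
  have h5 := integral_mono_of_nonneg (μ := volume.restrict Ω)
    (f := fun x => (∑ i, |(U (t, x)).1 i - (Ub (t, x)).1 i|) ^ 2)
    (g := fun x => K₂ * relEntropy 0 fun b => f b (t, x))
    (Eventually.of_forall fun x => sq_nonneg _)
    ((integrable_relEntropy_slice hbd hd0 hc₀0 hfm hbox t).const_mul K₂)
    (by
      filter_upwards [h2 ht, h3 ht, h4 ht] with x e1 e2 e3
      have hmc : ∀ (r : ℝ) i, D.m i * (r / D.m i) = r := fun r i => mul_div_cancel₀ _ (D.m_pos i).ne'
      have h7 := hK₂ D.m _ (fun i => (D.m_pos i).le) D.m_le_massSum (e1 ▸ hbox (t, x))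
      simp only [Sum.elim_inl, Sum.elim_inr, hmc] at h7
      have h8 := h7 e2 e3
      rwa [← e1] at h8)
  rw [integral_const_mul] at h5
  have h6 := h1 ht
  rw [integral_const_mul] at h6
  rw [mul_assoc]
  exact h5.trans (mul_le_mul_of_nonneg_left h6 hK₂0)

end IsComparable

end AlongSolutions

/-! ### Uniqueness -/

section Uniqueness

variable {n : ℕ} {D : Mixture n} {Ω : Set Space} {T : ℝ} {U0 Ub0 : Space → State n}
  {U Ub : ℝ × Space → State n} {G Gb : ℝ × Space → StateGrad n} {u ub : ℝ × Space → Fin n → Space}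
  {δ M : ℝ} {q : ℝ → ℝ}

theorem stateDist_sq_le (s s' : State n) :
    stateDist s s' ^ 2 ≤ 2 * (∑ i, |s.1 i - s'.1 i|) ^ 2 + 2 * (s.2 - s'.2) ^ 2 := by
  rw [stateDist, ← sq_abs (s.2 - s'.2)]
  linarith [sq_nonneg ((∑ i, |s.1 i - s'.1 i|) - |s.2 - s'.2|)]

namespace IsComparable

theorem ae_slice_integrable {Ω : Set Space} {τ : ℝ} {f : ℝ × Space → ℝ}
    (hf : Integrable f (cylMeasure Ω τ)) :
    ∀ᵐ t : ℝ, t ∈ Ioo 0 τ → IntegrableOn (fun x => f (t, x)) Ω := by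
  rw [cylMeasure_eq_prod] at hf
  exact (ae_restrict_iff' measurableSet_Ioo).1 hf.prod_right_ae

/-- The densities and the temperatures coincide up to each time `τ < T`. -/
theorem ae_eq_cyl (S : IsComparable D Ω T U0 Ub0 U Ub G Gb u ub δ M q)
    (hb : ∀ i j, i ≠ j → ∀ R : ℝ, 0 < R → ∃ L : ℝ≥0,
      LipschitzOnWith L (fun y : ℝ × ℝ × ℝ => D.b i j y.1 y.2.1 y.2.2)
        (Set.Icc 0 R ×ˢ Set.Icc 0 R ×ˢ Set.Icc R⁻¹ R)) {τ : ℝ} (hτ : τ ∈ Ioo 0 T) :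
    ∀ᵐ z ∂cylMeasure Ω τ, U z = Ub z := by
  have hfin := S.isFiniteMeasure
  have hM := S.M_pos
  obtain ⟨K, hK0, hK⟩ := S.exists_distance_bound hb hτ
  obtain ⟨Kθ, hKθ0, hKθ⟩ := S.exists_temperature_sub_le hτ
  set w : ℝ × Space → ℝ := fun z => (∑ i, |(U z).1 i - (Ub z).1 i|) ^ 2 with hw
  have hw0 : ∀ z, 0 ≤ w z := fun z => sq_nonneg _
  have hwm : AEStronglyMeasurable w (cylMeasure Ω τ) :=
    (Finset.aestronglyMeasurable_fun_sum _ fun i _ =>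
      ((S.weak.density_bounded i τ hτ).1.sub (S.strong.density_bounded i τ hτ).1).norm).pow 2
  set C : ℝ := ((n + 1) * M) ^ 2 with hC
  have hC0 : 0 ≤ C := sq_nonneg _
  have hdist : ∀ z, w z ≤ stateDist (U z) (Ub z) ^ 2 := fun z =>
    pow_le_pow_left₀ (Finset.sum_nonneg fun k _ => abs_nonneg _)
      (le_add_of_nonneg_right (abs_nonneg _)) 2
  have hwC : ∀ᵐ z ∂cylMeasure Ω τ, w z ≤ C := (cyl_mono S.stateDist_le hτ).mono fun z hz =>
    (hdist z).trans (pow_le_pow_left₀ (stateDist_nonneg _ _) hz 2)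
  -- A representative that is measurable and bounded everywhere, so that its spatial integral Y is
  -- measurable and bounded as Gronwall's lemma requires.
  set w' : ℝ × Space → ℝ := fun z => max 0 (min (hwm.mk w z) C) with hw'
  have hw'm : Measurable w' :=
    measurable_const.max (hwm.stronglyMeasurable_mk.measurable.min measurable_const)
  have hw'C : ∀ z, |w' z| ≤ C := fun z => by
    rw [abs_of_nonneg (le_max_left _ _)]
    exact max_le hC0 (min_le_right _ _)
  have hww' : ∀ᵐ z ∂cylMeasure Ω τ, w z = w' z := by
    filter_upwards [hwm.ae_eq_mk, hwC] with z e1 e2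
    rw [hw']
    simp only
    rw [← e1, min_eq_left e2, max_eq_right (hw0 z)]
  set Y : ℝ → ℝ := fun t => ∫ x in Ω, w' (t, x) with hY
  have hYm : Measurable Y := measurable_integral_slice hw'm
  have hY0 : ∀ t, 0 ≤ Y t := fun t => integral_nonneg fun x => le_max_left _ _
  have hYC : ∀ t, Y t ≤ C * volume.real Ω := fun t => by
    have := integral_mono (μ := volume.restrict Ω) (integrable_slice S.domain.isBounded hw'm hw'C t)
      (integrable_const C) fun x => (le_abs_self _).trans (hw'C (t, x))
    rwa [integral_const, measureReal_restrict_apply_univ, smul_eq_mul, mul_comm] at this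
  have hYw : ∀ᵐ t : ℝ, t ∈ Ioo 0 τ → ∫ x in Ω, w (t, x) = Y t :=
    (ae_slices hww').mono fun t ht htI => integral_congr_ae (ht htI)
  have hθi : Integrable (fun z => ((U z).2 - (Ub z).2) ^ 2) (cylMeasure Ω τ) :=
    ((S.weak.temperature_L2H1.2 τ hτ).1.sub (S.strong.temperature_L2H1.2 τ hτ).1).integrable_sq
  -- The squared state distance is at most 2w plus twice the squared temperature difference, whose
  -- integral is at most Kθ Y. This explains 2 + 2 Kθ; the coefficient is integrable since q is in
  -- L².
  set a : ℝ → ℝ := fun t => K * (2 + 2 * Kθ) * q t ^ 2 with ha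
  have hai : IntegrableOn a (Ioo 0 τ) := (S.memLp_majorant τ hτ).integrable_sq.const_mul _
  have hinner : ∀ᵐ t : ℝ, t ∈ Ioo 0 τ →
      K * ∫ x in Ω, (q t * stateDist (U (t, x)) (Ub (t, x))) ^ 2 ≤ a t * Y t := by
    filter_upwards [ae_slices hww', hYw, hKθ, ae_slice_integrable hθi] with t h1 h2 h3 h4 ht
    have hwi : IntegrableOn (fun x => w (t, x)) Ω :=
      (integrable_congr (h1 ht)).2 (integrable_slice S.domain.isBounded hw'm hw'C t)
    have h5 : ∫ x in Ω, stateDist (U (t, x)) (Ub (t, x)) ^ 2 ≤ (2 + 2 * Kθ) * Y t := by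
      have h6 := integral_mono_of_nonneg (μ := volume.restrict Ω)
        (f := fun x => stateDist (U (t, x)) (Ub (t, x)) ^ 2)
        (g := fun x => 2 * w (t, x) + 2 * ((U (t, x)).2 - (Ub (t, x)).2) ^ 2)
        (Eventually.of_forall fun x => sq_nonneg _)
        ((hwi.const_mul 2).add ((h4 ht).const_mul 2))
        (Eventually.of_forall fun x => stateDist_sq_le _ _)
      rw [integral_add (hwi.const_mul 2) ((h4 ht).const_mul 2), integral_const_mul,
        integral_const_mul, h2 ht] at h6
      have h7 : ∫ x in Ω, ((U (t, x)).2 - (Ub (t, x)).2) ^ 2 ≤ Kθ * Y t := by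
        rw [← h2 ht]
        exact h3 ht
      linarith
    simp only [mul_pow]
    rw [integral_const_mul, ha]
    have h8 := mul_le_mul_of_nonneg_left (mul_le_mul_of_nonneg_left h5 (sq_nonneg (q t))) hK0
    linarith
  have hYzero := ae_eq_zero_of_le_integral hτ.1 hai (fun t => by positivity) hYm hY0 hYC (by
    filter_upwards [hK, hYw] with r h1 h2 hr
    rw [← h2 hr]
    refine (h1 hr).trans ?_
    have hBi : IntegrableOn (fun z : ℝ × Space => (q z.1 * stateDist (U z) (Ub z)) ^ 2) (cyl Ω r) :=
      (S.integrable_majorant_mul_stateDist_sq hτ).mono_measure (cylMeasure_mono hr.2.le)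
    rw [setIntegral_cyl hr.1.le hBi, ← intervalIntegral.integral_const_mul]
    rw [intervalIntegral.integral_of_le hr.1.le, intervalIntegral.integral_of_le hr.1.le,
      integral_Ioc_eq_integral_Ioo, integral_Ioc_eq_integral_Ioo]
    refine integral_mono_of_nonneg (Eventually.of_forall fun t =>
      mul_nonneg hK0 (integral_nonneg fun x => sq_nonneg _)) ?_ ?_
    · exact (hai.mono_set (Ioo_subset_Ioo_right hr.2.le)).mul_bdd (c := C * volume.real Ω)
        hYm.aestronglyMeasurable (Eventually.of_forall fun t => by
          rw [Real.norm_of_nonneg (hY0 t)]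
          exact hYC t)
    · refine (ae_restrict_iff' measurableSet_Ioo).2 ?_
      filter_upwards [hinner] with t h3 ht
      exact h3 ⟨ht.1, ht.2.trans hr.2⟩)
  have hall : ∀ᵐ t : ℝ, t ∈ Ioo 0 τ → ∀ᵐ x ∂volume.restrict Ω, U (t, x) = Ub (t, x) := by
    filter_upwards [hYzero, ae_slices hww', hYw, hKθ, ae_slice_integrable hθi] with t h0 h1 h2 h3 h4 ht
    have hwi : IntegrableOn (fun x => w (t, x)) Ω :=
      (integrable_congr (h1 ht)).2 (integrable_slice S.domain.isBounded hw'm hw'C t)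
    have e1 : ∫ x in Ω, w (t, x) = 0 := (h2 ht).trans (h0 ht)
    have e2 : ∫ x in Ω, ((U (t, x)).2 - (Ub (t, x)).2) ^ 2 = 0 :=
      le_antisymm ((h3 ht).trans (by
        change Kθ * ∫ x in Ω, w (t, x) ≤ 0
        rw [e1, mul_zero])) (integral_nonneg fun x => sq_nonneg _)
    filter_upwards [(integral_eq_zero_iff_of_nonneg (fun x => hw0 (t, x)) hwi).1 e1,
      (integral_eq_zero_iff_of_nonneg (fun x => sq_nonneg _) (h4 ht)).1 e2] with x e3 e4
    have e5 : ∑ i, |(U (t, x)).1 i - (Ub (t, x)).1 i| = 0 := pow_eq_zero_iff two_ne_zero |>.1 e3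
    have e6 := (Finset.sum_eq_zero_iff_of_nonneg fun i _ => abs_nonneg _).1 e5
    refine Prod.ext (funext fun i => ?_) ?_
    · exact sub_eq_zero.1 (abs_eq_zero.1 (e6 i (Finset.mem_univ i)))
    · exact sub_eq_zero.1 (pow_eq_zero_iff two_ne_zero |>.1 e4)
  have hρ : ∀ i, (fun z => (U z).1 i) =ᵐ[cylMeasure Ω τ] fun z => (Ub z).1 i := fun i =>
    ae_cyl_eq_of_slices (S.weak.density_bounded i τ hτ).1 (S.strong.density_bounded i τ hτ).1
      (hall.mono fun t ht htI => (ht htI).mono fun x hx => by rw [hx])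
  have hθ : (fun z => (U z).2) =ᵐ[cylMeasure Ω τ] fun z => (Ub z).2 :=
    ae_cyl_eq_of_slices (S.weak.temperature_L2H1.2 τ hτ).1.1 (S.strong.temperature_L2H1.2 τ hτ).1.1
      (hall.mono fun t ht htI => (ht htI).mono fun x hx => by rw [hx])
  filter_upwards [ae_all_iff.2 hρ, hθ] with z e1 e2
  exact Prod.ext (funext e1) e2

/-- Weak–strong uniqueness at every time. -/
theorem ae_eq_slice (S : IsComparable D Ω T U0 Ub0 U Ub G Gb u ub δ M q)
    (hb : ∀ i j, i ≠ j → ∀ R : ℝ, 0 < R → ∃ L : ℝ≥0,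
      LipschitzOnWith L (fun y : ℝ × ℝ × ℝ => D.b i j y.1 y.2.1 y.2.2)
        (Set.Icc 0 R ×ˢ Set.Icc 0 R ×ˢ Set.Icc R⁻¹ R)) {t : ℝ} (ht : t ∈ Ico 0 T) :
    ∀ᵐ x ∂volume.restrict Ω, U (t, x) = Ub (t, x) := by
  have ho := S.domain.isOpen
  have hbd := S.domain.isBounded
  have hcyl : ∀ᵐ z ∂cylMeasure Ω T, U z = Ub z :=
    ae_cyl_of_forall_lt ho fun τ hτ => S.ae_eq_cyl hb hτ
  have hρ : ∀ i, ∀ᵐ x ∂volume.restrict Ω, (U (t, x)).1 i = (Ub (t, x)).1 i := fun i =>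
    (S.weak.weakBalance_density S.domain i).ae_eq_of_ae_eq_cyl ho hbd
      (S.strong.weakBalance_density S.domain i) (S.init.mono fun x hx => by simp only [hx])
      (hcyl.mono fun z hz => by simp only [hz]) ht
  -- Weak continuity is available for the densities and the energy, not for the temperature itself.
  -- The latter is recovered at each time from the energy, since the total mass is positive there.
  have he : ∀ᵐ x ∂volume.restrict Ω, D.totalEnergy (U (t, x)) = D.totalEnergy (Ub (t, x)) :=
    (S.weak.weakBalance_energy S.domain).ae_eq_of_ae_eq_cyl ho hbd
      (S.strong.weakBalance_energy S.domain) (S.init.mono fun x hx => by simp only [hx])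
      (hcyl.mono fun z hz => by simp only [hz]) ht
  filter_upwards [ae_all_iff.2 hρ, he, S.weak.le_totalMass S.domain S.time_pos S.le_totalMass_weak ht]
    with x e1 e2 e3
  have e4 : (U (t, x)).1 = (Ub (t, x)).1 := funext e1
  refine Prod.ext e4 ?_
  have e5 : totalMass (Ub (t, x)) = totalMass (U (t, x)) := by rw [totalMass, totalMass, e4]
  rw [D.totalEnergy_eq, D.totalEnergy_eq, e5] at e2
  exact mul_left_cancel₀ (S.card_mul_pos.trans_le e3).ne' (mul_left_cancel₀ D.cw_pos.ne' e2)

end IsComparable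

end Uniqueness

end MaxwellStefan

end

/-! ### The weak–strong uniqueness theorem. -/

open MaxwellStefan in
theorem theorem4 {n : ℕ} (hn : 1 ≤ n) (D : Mixture n)
    (Ω : Set Space) (hΩ : IsLipschitzDomain Ω) (T : ℝ) (hT : 0 < T)
    -- the friction coefficients are Lipschitz on compact sets of densities and temperatures
    (hb : ∀ i j, i ≠ j → ∀ R : ℝ, 0 < R → ∃ L : ℝ≥0,
      LipschitzOnWith L (fun y : ℝ × ℝ × ℝ => D.b i j y.1 y.2.1 y.2.2)
        (Set.Icc 0 R ×ˢ Set.Icc 0 R ×ˢ Set.Icc R⁻¹ R))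
    -- the conductivity is continuous, satisfies the quadratic bounds, and is Lipschitz in the
    -- temperature on bounded sets
    (hκ_cont : ContinuousOn D.κ (positiveCone n))
    (cκ Cκ : ℝ) (hcκ : 0 < cκ) (hCκ : 0 < Cκ)
    (hκ_bounds : ∀ s ∈ positiveCone n,
      cκ * (1 + s.2 ^ 2) ≤ D.κ s ∧ D.κ s ≤ Cκ * (1 + s.2 ^ 2))
    (hκ_lip : ∀ R : ℝ, 0 < R → ∃ L : ℝ≥0, ∀ r : Fin n → ℝ, (∀ i, r i ∈ Set.Ioc 0 R) →
      LipschitzOnWith L (fun ϑ : ℝ => D.κ (r, ϑ)) (Set.Ioc 0 R))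
    (U0 Ubar0 : Space → State n) (U Ubar : ℝ × Space → State n)
    (hU : IsWeakSolution D Ω T U0 U) (hUbar : IsStrongSolution D Ω T Ubar0 Ubar)
    (δ M : ℝ) (hδ : 0 < δ) (hM : 0 < M)
    (hU_bounds : ∀ᵐ z ∂(cylMeasure Ω T),
      (∀ i, 0 < (U z).1 i ∧ (U z).1 i ≤ M) ∧ 0 < (U z).2 ∧ (U z).2 ≤ M)
    (hUbar_bounds : ∀ᵐ z ∂(cylMeasure Ω T),
      (∀ i, δ ≤ (Ubar z).1 i ∧ (Ubar z).1 i ≤ M) ∧ δ ≤ (Ubar z).2 ∧ (Ubar z).2 ≤ M)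
    (h_sqrt : ∀ i, HasLocBoundedGrad Ω T (fun z => Real.sqrt ((Ubar z).1 i)))
    (h_log : HasLocBoundedGrad Ω T (fun z => Real.log (Ubar z).2))
    (h_init : ∀ᵐ x ∂(volume.restrict Ω), U0 x = Ubar0 x) :
    ∀ t ∈ Set.Ico 0 T, ∀ᵐ x ∂(volume.restrict Ω), U (t, x) = Ubar (t, x) := by
  obtain ⟨G, u, hw⟩ := hU
  obtain ⟨Gb, ub, hs, -, -, q, hq, hGq⟩ := hUbar
  have S : IsComparable D Ω T U0 Ubar0 U Ubar G Gb u ub δ M q :=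
    { card_pos := hn
      domain := hΩ
      time_pos := hT
      δ_pos := hδ
      M_pos := hM
      weak := hw
      strong := hs
      init := h_init
      weak_le := hU_bounds.mono fun z hz => ⟨fun i => (hz.1 i).2, hz.2.2⟩
      strong_le := hUbar_bounds.mono fun z hz => ⟨fun i => (hz.1 i).2, hz.2.2⟩
      le_strong := hUbar_bounds.mono fun z hz => ⟨fun i => (hz.1 i).1, hz.2.1⟩
      memLp_majorant := hq
      grad_le := hGq }
  exact fun t ht => S.ae_eq_slice hb ht
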